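/- **Setting.** Let $\mathbb R^3_+=\{(x,y,z): z>0\}$, let $\Omega\subset\mathbb R^2=\partial\mathbb R^3_+$ be a bounded open set, $U\ge 0$ with $U\neq 1$, and $\mu>0$. All spaces are real; $H_0^2(\Omega)$ is the closure of $C_0^\infty(\Omega)$ in $H^2(\Omega)$, and $$Y=\big(H^1(\mathbb R^3_+)\times L_2(\mathbb R^3_+)\big)\times\big(H^2_0(\Omega)\times L_2(\Omega)\big),\qquad y=(\phi,\psi;u,v).$$ Let $\gamma[\cdot]$ be the trace on $z=0$, $A=-\Delta+\mu$ with homogeneous Neumann condition, extended to $H^1(\mathbb R^3_+)\to H^1(\mathbb R^3_+)'$ by $\langle A\phi,w\rangle=a_\mu(\phi,w):=(\nabla\phi,\nabla w)+\mu(\phi,w)$. For $f\in L_2(\Omega)$ let $Nf\in H^1(\mathbb R^3_+)$ be the solution of $a_\mu(Nf,w)=\int_\Omega f\,\gamma[w]$ for all $w\in H^1(\mathbb R^3_+)$, i.e. $(-\Delta+\mu)Nf=0$ in $\mathbb R^3_+$ and $\partial_\nu Nf=f_{ext}$ (extension by zero) on $z=0$, with $\nu$ the outward normal. Put $$(\mathbb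 A+\mathbb P)y=\big(-U\partial_x\phi+\psi,\;-U\partial_x\psi-A(\phi+N(v+U\partial_xu));\;v,\;-\Delta^2u+\gamma[\psi]\big),$$ where $\mathscr D(\mathbb A+\mathbb P)$ is the set of $y\in Y$ for which the four components lie in $H^1(\mathbb R^3_+)$, $L_2(\mathbb R^3_+)$, $H_0^2(\Omega)$, $L_2(\Omega)$, respectively. Here the second component is understood in $H^1(\mathbb R^3_+)'$, with $\langle -U\partial_x\psi,w\rangle=U(\psi,\partial_xw)$; the fourth one in $H_0^2(\Omega)'$, with $\langle\Delta^2u,w\rangle=(\Delta u,\Delta w)_\Omega$ and $\langle\gamma[\psi],w\rangle=-U\int_\Omega\gamma[\phi]\,\partial_xw+\int_\Omega\gamma[h]\,w$ for $h=\psi-U\partial_x\phi\in H^1(\mathbb R^3_+)$. Let $\mathscr F(y)=(0,F_1(\phi);0,F_2(u))$ with $F_1:H^1(\mathbb R^3_+)\to L_2(\mathbb R^3_+)$ and $F_2:H_0^2(\Omega)\to L_2(\Omega)$ locally Lipschitz: for every $R>0$ there is $c_R>0$ such that $\|F_1(\phi)-F_1(\phi^*)\|\le c_R\|\phi-\phi^*\|_{H^1}$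 and $\|F_2(u)-F_2(u^*)\|\le c_R\|u-u^*\|_{H^2}$ whenever $\phi,\phi^*,u,u^*$ have norms at most $R$ in $H^1(\mathbb R^3_+)$ and $H^2_0(\Omega)$, respectively. Consider $$y_t=(\mathbb A+\mathbb P)y+\mathscr F(y),\qquad y(0)=y_0\in Y. \tag{1}$$ **Solutions on $[0,T]$, $T>0$.** All solutions $y=(\phi,\psi;u,v)$ are required to be in $C([0,T];Y)$, with $\phi,u$ in $C^1([0,T];L_2)$, $\phi_t+U\partial_x\phi=\psi$ and $u_t=v$. * $y$ is *strong* if $y(t)\in\mathscr D(\mathbb A+\mathbb P)$ for all $t\in(0,T)$ and, for every $[a,b]\subset(0,T)$, $y$ is absolutely continuous on $[a,b]$ with $y_t\in L^1(a,b;Y)$, the equation in (1) holding in $Y$ for almost all $t$. * $y$ is *generalized* if there are strong solutions $y_n$ on $[0,T]$ (with some initial data) such that $\max_{[0,T]}\|y_n(t)-y(t)\|_Y\to0$. * $y$ is *weak* if, for all $t\in[0,T]$, $w\in H^1(\mathbb R^3_+)$ and $\omega\in H_0^2(\Omega)$, $$(\psi(s),w)\Big|_{s=0}^{s=t}=\int_0^t\Big[U(\psi,\partial_xw)-a_\mu(\phi,w)-\int_\Omega(v+U\partial_xu)\gamma[w]+(F_1(\phi),w)\Big]ds,$$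 $$\Big[(v(s),\omega)_\Omega-\int_\Omega\gamma[\phi(s)]\,\omega\Big]_{s=0}^{s=t}=\int_0^t\Big[-(\Delta u,\Delta\omega)_\Omega-U\int_\Omega\gamma[\phi]\,\partial_x\omega+(F_2(u),\omega)_\Omega\Big]ds.$$ **Theorem 3.8.** For every $y_0\in Y$ there are $t_{\max}=t_{\max}(y_0)\in(0,\infty]$ and $y:[0,t_{\max})\to Y$ with $y(0)=y_0$ such that: 1. for every $0<T<t_{\max}$, $y$ is a generalized solution of (1) on $[0,T]$, and it is also a weak solution on $[0,T]$; 2. (uniqueness and maximality) if $T>0$ and $\tilde y$ is a generalized solution on $[0,T]$ with $\tilde y(0)=y_0$, then $T<t_{\max}$ and $\tilde y=y$ on $[0,T]$; 3. if $y_0\in\mathscr D(\mathbb A+\mathbb P)$, then $y$ is a strong solution on $[0,T]$ for every $0<T<t_{\max}$; 4. if $t_{\max}<\infty$, then $\|y(t)\|_Y\to\infty$ as $t\nearrow t_{\max}$. -/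

import Mathlib

noncomputable section

namespace FlowPlate

open MeasureTheory Set Filter Topology
open scoped ContDiff

/-- `ℝ²`, with coordinates `x = p 0`, `y = p 1`. -/
abbrev R2 := EuclideanSpace ℝ (Fin 2)

/-- `ℝ³`, with coordinates `x = q 0`, `y = q 1`, `z = q 2`. -/
abbrev R3 := EuclideanSpace ℝ (Fin 3)

/-- The (open) half-space `ℝ³₊ = {z > 0}`. -/
def halfSpace : Set R3 := {q | 0 < q 2}

/-- The real Hilbert space `L₂(S)`, with respect to Lebesgue measure on `S`. -/
abbrev L2 {n : ℕ} (S : Set (EuclideanSpace ℝ (Fin n))) :=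
  Lp ℝ 2 ((volume : Measure (EuclideanSpace ℝ (Fin n))).restrict S)

/-- The classical partial derivative `∂ᵢ η`. -/
def pd {n : ℕ} (i : Fin n) (η : EuclideanSpace ℝ (Fin n) → ℝ) :
    EuclideanSpace ℝ (Fin n) → ℝ :=
  fun x => fderiv ℝ η x (EuclideanSpace.single i 1)

/-- `η ∈ C₀^∞(S)`. -/
structure IsTest {n : ℕ} (S : Set (EuclideanSpace ℝ (Fin n)))
    (η : EuclideanSpace ℝ (Fin n) → ℝ) : Prop where
  smooth : ContDiff ℝ ∞ η
  compact : HasCompactSupport η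
  supp : tsupport η ⊆ S

/-- `g ∈ L₂(S)` is the weak (distributional) partial derivative `∂ᵢ f` of `f ∈ L₂(S)`. -/
def HasWeakPartial {n : ℕ} (S : Set (EuclideanSpace ℝ (Fin n))) (i : Fin n) (f g : L2 S) : Prop :=
  ∀ η : EuclideanSpace ℝ (Fin n) → ℝ, IsTest S η →
    ∫ x in S, f x * pd i η x = -∫ x in S, g x * η x

theorem IsTest.memLp {n : ℕ} {S : Set (EuclideanSpace ℝ (Fin n))}
    {η : EuclideanSpace ℝ (Fin n) → ℝ} (h : IsTest S η) :
    MemLp η 2 ((volume : Measure (EuclideanSpace ℝ (Fin n))).restrict S) :=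
  (h.smooth.continuous.memLp_of_hasCompactSupport h.compact).restrict S

theorem IsTest.memLp_pd {n : ℕ} {S : Set (EuclideanSpace ℝ (Fin n))}
    {η : EuclideanSpace ℝ (Fin n) → ℝ} (h : IsTest S η) (i : Fin n) :
    MemLp (pd i η) 2 ((volume : Measure (EuclideanSpace ℝ (Fin n))).restrict S) := by
  have h1 : Continuous (fderiv ℝ η) := h.smooth.continuous_fderiv (by simp)
  have h2 : Continuous (pd i η) := h1.clm_apply continuous_const
  have h3 : HasCompactSupport (pd i η) :=
    (h.compact.fderiv (𝕜 := ℝ)).comp_left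
      (g := fun L : EuclideanSpace ℝ (Fin n) →L[ℝ] ℝ => L (EuclideanSpace.single i 1)) rfl
  exact (h2.memLp_of_hasCompactSupport h3).restrict S

theorem integral_add_mul_of_memLp {n : ℕ} {S : Set (EuclideanSpace ℝ (Fin n))} (f g : L2 S)
    {ζ : EuclideanSpace ℝ (Fin n) → ℝ}
    (hζ : MemLp ζ 2 ((volume : Measure (EuclideanSpace ℝ (Fin n))).restrict S)) :
    ∫ x in S, (f + g : L2 S) x * ζ x = (∫ x in S, f x * ζ x) + ∫ x in S, g x * ζ x := by
  have hf : Integrable (fun x => f x * ζ x) (volume.restrict S) := (Lp.memLp f).integrable_mul hζ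
  have hg : Integrable (fun x => g x * ζ x) (volume.restrict S) := (Lp.memLp g).integrable_mul hζ
  rw [← integral_add hf hg]
  refine integral_congr_ae ?_
  filter_upwards [Lp.coeFn_add f g] with x hx
  simp only [hx, Pi.add_apply, add_mul]

theorem integral_smul_mul {n : ℕ} {S : Set (EuclideanSpace ℝ (Fin n))} (c : ℝ) (f : L2 S)
    (ζ : EuclideanSpace ℝ (Fin n) → ℝ) :
    ∫ x in S, (c • f : L2 S) x * ζ x = c * ∫ x in S, f x * ζ x := by
  rw [← integral_const_mul]
  refine integral_congr_ae ?_
  filter_upwards [Lp.coeFn_smul c f] with x hx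
  simp only [hx, Pi.smul_apply, smul_eq_mul, mul_assoc]

theorem integral_zero_mul {n : ℕ} {S : Set (EuclideanSpace ℝ (Fin n))}
    (ζ : EuclideanSpace ℝ (Fin n) → ℝ) :
    ∫ x in S, (0 : L2 S) x * ζ x = 0 := by
  rw [← zero_smul ℝ (0 : L2 S), integral_smul_mul, zero_mul]

/-- The Sobolev space `H¹(S)`. An element is recorded together with its weak first derivatives,
`φ = (φ, ∂₀φ, …, ∂ₙ₋₁φ)`, so that the norm inherited from the `ℓ²`-product of the `L₂(S)` is
`‖φ‖² = ‖φ‖²_{L₂} + ∑ᵢ ‖∂ᵢφ‖²_{L₂}`. -/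
def H1 {n : ℕ} (S : Set (EuclideanSpace ℝ (Fin n))) :
    Submodule ℝ (PiLp 2 (fun _ : Option (Fin n) => L2 S)) where
  carrier := {F | ∀ i, HasWeakPartial S i (F none) (F (some i))}
  add_mem' {F G} hF hG i η hη := by
    have e := hF i η hη
    have e2 := hG i η hη
    rw [PiLp.add_apply, PiLp.add_apply, integral_add_mul_of_memLp _ _ (hη.memLp_pd i),
      integral_add_mul_of_memLp _ _ hη.memLp, e, e2]
    ring
  zero_mem' i η hη := by
    rw [PiLp.zero_apply, PiLp.zero_apply, integral_zero_mul, integral_zero_mul, neg_zero]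
  smul_mem' c F hF i η hη := by
    have e := hF i η hη
    rw [PiLp.smul_apply, PiLp.smul_apply, integral_smul_mul, integral_smul_mul, e]
    ring

/-- The element `φ` of `L₂(S)` underlying `φ ∈ H¹(S)`. -/
def val1 {n : ℕ} {S : Set (EuclideanSpace ℝ (Fin n))} (φ : H1 S) : L2 S := φ.1 none

/-- The weak derivative `∂ᵢφ` of `φ ∈ H¹(S)`. -/
def d1 {n : ℕ} {S : Set (EuclideanSpace ℝ (Fin n))} (i : Fin n) (φ : H1 S) : L2 S :=
  φ.1 (some i)

/-- The index set of the derivatives of order at most two. -/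
abbrev Idx2 (n : ℕ) := Option (Fin n ⊕ Fin n × Fin n)

/-- `F` is the family `(η, (∂ᵢη)ᵢ, (∂ᵢ∂ⱼη)ᵢⱼ)` of the derivatives of order at most two
of the smooth function `η`, as elements of `L₂(S)`. -/
structure IsJet2 {n : ℕ} (S : Set (EuclideanSpace ℝ (Fin n)))
    (η : EuclideanSpace ℝ (Fin n) → ℝ) (F : PiLp 2 (fun _ : Idx2 n => L2 S)) : Prop where
  fn : (F none : EuclideanSpace ℝ (Fin n) → ℝ) =ᵐ[volume.restrict S] η
  d : ∀ i, (F (some (Sum.inl i)) : EuclideanSpace ℝ (Fin n) → ℝ) =ᵐ[volume.restrict S] pd i η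
  dd : ∀ i j, (F (some (Sum.inr (i, j))) : EuclideanSpace ℝ (Fin n) → ℝ)
    =ᵐ[volume.restrict S] pd i (pd j η)

/-- `H²₀(S)`, the closure of `C₀^∞(S)` in the `H²(S)` norm. As for `H¹`, an element is recorded
together with its weak derivatives of order one and two, and
`‖u‖² = ‖u‖² + ∑ᵢ ‖∂ᵢu‖² + ∑ᵢⱼ ‖∂ᵢ∂ⱼu‖²` (norms of `L₂(S)` on the right). -/
def H20 {n : ℕ} (S : Set (EuclideanSpace ℝ (Fin n))) :
    Submodule ℝ (PiLp 2 (fun _ : Idx2 n => L2 S)) :=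
  (Submodule.span ℝ {F | ∃ η, IsTest S η ∧ IsJet2 S η F}).topologicalClosure

/-- The element `u` of `L₂(S)` underlying `u ∈ H²₀(S)`. -/
def val2 {n : ℕ} {S : Set (EuclideanSpace ℝ (Fin n))} (u : H20 S) : L2 S := u.1 none

/-- The weak derivative `∂ᵢu`. -/
def d2 {n : ℕ} {S : Set (EuclideanSpace ℝ (Fin n))} (i : Fin n) (u : H20 S) : L2 S :=
  u.1 (some (Sum.inl i))

/-- The Laplacian `Δu = ∑ᵢ ∂ᵢ∂ᵢu`. -/
def lap {n : ℕ} {S : Set (EuclideanSpace ℝ (Fin n))} (u : H20 S) : L2 S :=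
  ∑ i, u.1 (some (Sum.inr (i, i)))

/-- `g ∈ L₂(ℝ²)` is the trace `γ[φ] = φ|_{z=0}` of `φ ∈ H¹(ℝ³₊)`, characterized by Green's formula
`∫_{z>0} (φ_z η + φ η_z) = -∫_{ℝ²} g η(·,0)` for `η ∈ C₀^∞(ℝ³)`. -/
def IsTrace (φ : H1 halfSpace) (g : Lp ℝ 2 (volume : Measure R2)) : Prop :=
  ∀ η : R3 → ℝ, ContDiff ℝ ∞ η → HasCompactSupport η →
    ∫ q in halfSpace, (d1 2 φ q * η q + val1 φ q * pd 2 η q) =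
      -∫ p : R2, g p * η !₂[p 0, p 1, 0]

open Classical in
/-- The trace `γ[φ] ∈ L₂(ℝ²)` of `φ ∈ H¹(ℝ³₊)` (it exists and is unique by the trace theorem). -/
def trace (φ : H1 halfSpace) : Lp ℝ 2 (volume : Measure R2) :=
  if h : ∃ g, IsTrace φ g then h.choose else 0

/-- `⟨f_ext, g⟩_{L₂(ℝ²)}`, where `f_ext` is the extension by zero of `f ∈ L₂(Ω)`. -/
def bdryPair {Ω : Set R2} (f : L2 Ω) (g : Lp ℝ 2 (volume : Measure R2)) : ℝ :=
  ∫ p in Ω, f p * g p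

/-- The form `⟨Aφ, w⟩ = ∫ ∇φ·∇w + μ ∫ φ w` on `H¹(ℝ³₊) = D(A^{1/2})` of the operator
`A = -Δ + μ` with homogeneous Neumann condition; it extends `A` to `H¹(ℝ³₊) → H¹(ℝ³₊)'`. -/
def formA (μ : ℝ) (φ w : H1 halfSpace) : ℝ :=
  (∑ i, inner ℝ (d1 i φ) (d1 i w)) + μ * inner ℝ (val1 φ) (val1 w)

/-- `g = N f_ext`: `g ∈ H¹(ℝ³₊)` is the (variational) solution of `(-Δ + μ) g = 0` in `ℝ³₊`,
`∂_ν g = f_ext` on `z = 0`, where `ν` is the outward normal. -/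
def IsNeumannLift (μ : ℝ) {Ω : Set R2} (f : L2 Ω) (g : H1 halfSpace) : Prop :=
  ∀ w : H1 halfSpace, formA μ g w = bdryPair f (trace w)

open Classical in
/-- The Neumann map, `f ↦ N f_ext` (well defined for `μ > 0` by the Riesz theorem). -/
def neumann (μ : ℝ) {Ω : Set R2} (f : L2 Ω) : H1 halfSpace :=
  if h : ∃ g, IsNeumannLift μ f g then h.choose else 0

/-- The state space `Y = (H¹(ℝ³₊) × L₂(ℝ³₊)) × (H²₀(Ω) × L₂(Ω))` with its product
Hilbert norm. -/
abbrev Y (Ω : Set R2) :=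
  WithLp 2 (WithLp 2 (H1 halfSpace × L2 halfSpace) × WithLp 2 (H20 Ω × L2 Ω))

section Components

variable {Ω : Set R2}

/-- The component `φ` of `y = (φ, ψ; u, v)`. -/
def Y.phi (y : Y Ω) : H1 halfSpace := y.fst.fst

/-- The component `ψ` of `y = (φ, ψ; u, v)`. -/
def Y.psi (y : Y Ω) : L2 halfSpace := y.fst.snd

/-- The component `u` of `y = (φ, ψ; u, v)`. -/
def Y.u (y : Y Ω) : H20 Ω := y.snd.fst

/-- The component `v` of `y = (φ, ψ; u, v)`. -/
def Y.v (y : Y Ω) : L2 Ω := y.snd.snd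

/-- The element `(φ, ψ; u, v)` of `Y`. -/
def Y.mk (φ : H1 halfSpace) (ψ : L2 halfSpace) (u : H20 Ω) (v : L2 Ω) : Y Ω :=
  WithLp.toLp 2 (WithLp.toLp 2 (φ, ψ), WithLp.toLp 2 (u, v))

end Components

/-- `y = (φ, ψ; u, v) ∈ D(𝔸 + ℙ)` and `z = (𝔸 + ℙ) y`, where
`(𝔸 + ℙ) y = (-U∂ₓφ + ψ, -U∂ₓψ - A(φ + N(v + U∂ₓu)); v, -Δ²u + N*Aψ)`,
and `D(𝔸 + ℙ)` consists of the `y ∈ Y` for which the four components lie in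
`H¹(ℝ³₊)`, `L₂(ℝ³₊)`, `H²₀(Ω)` and `L₂(Ω)`.

* `-U∂ₓψ - A(·)` is taken in `H¹(ℝ³₊)'`; since `∂ₓ` is tangential, `⟨-U∂ₓψ, w⟩ = U(ψ, ∂ₓw)`.
* `-Δ²u + N*Aψ` is taken in `H²₀(Ω)' = H⁻²(Ω)`. Here `N*Aψ = γ[ψ]`, and `ψ = U∂ₓφ + h` with
  `h ∈ H¹(ℝ³₊)` the first component of `z`, so that `γ[ψ] = U∂ₓγ[φ] + γ[h] ∈ H^{-1/2}(ℝ²)` and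
  `⟨γ[ψ], w⟩ = -U⟨γ[φ], ∂ₓw⟩ + ⟨γ[h], w⟩`. -/
structure IsGen {Ω : Set R2} (U μ : ℝ) (y z : Y Ω) : Prop where
  eq_phi : val1 z.phi = y.psi - U • d1 0 y.phi
  eq_psi : ∀ w : H1 halfSpace,
    U * inner ℝ y.psi (d1 0 w) - formA μ (y.phi + neumann μ (y.v + U • d2 0 y.u)) w
      = inner ℝ z.psi (val1 w)
  eq_u : val2 z.u = y.v
  eq_v : ∀ w : H20 Ω,
    -inner ℝ (lap y.u) (lap w)
      + (-U * bdryPair (d2 0 w) (trace y.phi) + bdryPair (val2 w) (trace z.phi))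
      = inner ℝ z.v (val2 w)

/-- The domain `D(𝔸 + ℙ)`. -/
def domGen {Ω : Set R2} (U μ : ℝ) : Set (Y Ω) := {y | ∃ z, IsGen U μ y z}

/-- The nonlinearity `𝓕(y) = (0, F₁(φ); 0, F₂(u))`. -/
def nonlin {Ω : Set R2} (F₁ : H1 halfSpace → L2 halfSpace) (F₂ : H20 Ω → L2 Ω) (y : Y Ω) : Y Ω :=
  Y.mk 0 (F₁ y.phi) 0 (F₂ y.u)

/-- A map between normed spaces that is Lipschitz on every ball around the origin. -/
def LocLip {E G : Type*} [NormedAddCommGroup E] [NormedAddCommGroup G] (F : E → G) : Prop :=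
  ∀ R : ℝ, 0 < R → ∃ c : ℝ, 0 < c ∧ ∀ a b : E, ‖a‖ ≤ R → ‖b‖ ≤ R → ‖F a - F b‖ ≤ c * ‖a - b‖

/-- The finite energy class on `[0, T]`: `y = (φ, ψ; u, v) ∈ C([0,T]; Y)`, and, as functions with
values in `L₂`, `φ` and `u` are continuously differentiable with `φ_t + U∂ₓφ = ψ` and `u_t = v`.
Equivalently, `φ ∈ C([0,T]; H¹) ∩ C¹([0,T]; L₂)`, `u ∈ C([0,T]; H²₀) ∩ C¹([0,T]; L₂)` and
`y = (φ, φ_t + U∂ₓφ; u, u_t)`. -/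
structure FiniteEnergy {Ω : Set R2} (U T : ℝ) (y : ℝ → Y Ω) : Prop where
  cont : ContinuousOn y (Icc 0 T)
  phi_t : ∀ t ∈ Icc 0 T,
    HasDerivWithinAt (fun s => val1 (y s).phi) ((y t).psi - U • d1 0 (y t).phi) (Icc 0 T) t
  u_t : ∀ t ∈ Icc 0 T, HasDerivWithinAt (fun s => val2 (y s).u) (y t).v (Icc 0 T) t

/-- Strong solutions of `y_t = (𝔸 + ℙ) y + 𝓕(y)` on `[0, T]`: finite energy, `y(t) ∈ D(𝔸 + ℙ)`
for all `t ∈ (0, T)`, `y_t ∈ L¹(a, b; Y)` for every `[a, b] ⊂ (0, T)`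
(that is, `φ_t ∈ L¹(a,b;H¹)`, `u_t ∈ L¹(a,b;H²₀)`, and `φ_tt`, `u_tt ∈ L¹(a,b;L₂)`), and the
equation holds in `Y` almost everywhere. -/
structure IsStrongSolution {Ω : Set R2} (U μ : ℝ) (F₁ : H1 halfSpace → L2 halfSpace)
    (F₂ : H20 Ω → L2 Ω) (T : ℝ) (y : ℝ → Y Ω) : Prop where
  energy : FiniteEnergy U T y
  eqn : ∃ z : ℝ → Y Ω, (∀ t ∈ Ioo 0 T, IsGen U μ (y t) (z t)) ∧
    ∀ a b : ℝ, 0 < a → a ≤ b → b < T →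
      IntervalIntegrable (fun t => z t + nonlin F₁ F₂ (y t)) volume a b ∧
        y b - y a = ∫ t in a..b, (z t + nonlin F₁ F₂ (y t))

/-- Generalized solutions on `[0, T]`: limits in `C([0,T]; Y)` of strong solutions on `[0, T]`
(with arbitrary initial data). -/
structure IsGeneralizedSolution {Ω : Set R2} (U μ : ℝ) (F₁ : H1 halfSpace → L2 halfSpace)
    (F₂ : H20 Ω → L2 Ω) (T : ℝ) (y : ℝ → Y Ω) : Prop where
  energy : FiniteEnergy U T y
  approx : ∃ yn : ℕ → ℝ → Y Ω, (∀ n, IsStrongSolution U μ F₁ F₂ T (yn n)) ∧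
    TendstoUniformlyOn yn y atTop (Icc 0 T)

/-- Weak (variational) solutions on `[0, T]` of
`φ_t + Uφ_x = ψ`, `ψ_t + Uψ_x = Δφ - μφ + F₁(φ)` in `ℝ³₊`, `∂_ν φ = -(u_t + U u_x)_ext` on `z = 0`,
`u_tt + Δ²u = (∂_t + U∂ₓ)γ[φ] + F₂(u)` in `Ω`, `u = ∂_ν u = 0` on `∂Ω`,
tested with `w ∈ H¹(ℝ³₊)` and `w ∈ H²₀(Ω)`, respectively, and integrated in time. -/
structure IsWeakSolution {Ω : Set R2} (U μ : ℝ) (F₁ : H1 halfSpace → L2 halfSpace)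
    (F₂ : H20 Ω → L2 Ω) (T : ℝ) (y : ℝ → Y Ω) : Prop where
  energy : FiniteEnergy U T y
  flow : ∀ w : H1 halfSpace, ∀ t ∈ Icc 0 T,
    inner ℝ (y t).psi (val1 w) - inner ℝ (y 0).psi (val1 w) =
      ∫ s in (0 : ℝ)..t,
        (U * inner ℝ (y s).psi (d1 0 w) - formA μ (y s).phi w
          - bdryPair ((y s).v + U • d2 0 (y s).u) (trace w) + inner ℝ (F₁ (y s).phi) (val1 w))
  plate : ∀ w : H20 Ω, ∀ t ∈ Icc 0 T,
    (inner ℝ (y t).v (val2 w) - bdryPair (val2 w) (trace (y t).phi))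
        - (inner ℝ (y 0).v (val2 w) - bdryPair (val2 w) (trace (y 0).phi)) =
      ∫ s in (0 : ℝ)..t,
        (-inner ℝ (lap (y s).u) (lap w) - U * bdryPair (d2 0 w) (trace (y s).phi)
          + inner ℝ (F₂ (y s).u) (val2 w))

end FlowPlate

end

/-!
# Well-posedness of a flow–plate system with free plate velocity coupling

The generator couples a wave equation in the half-space, convected with speed `U ∂ₓ`, to a plate on
its boundary. Up to lower-order terms, the natural energy is conserved except for the boundary term
`-U ⟨∂ₓu, γψ⟩`, which it does not control: `ψ` is merely in `L₂` and has no trace. What saves the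
estimate is the hidden regularity of the trace. Let `B = ∑ₙ 8⁻ⁿ Jₙ` (`Rep.smooth`), with `Jₙ` the
mollification in the tangential variables at the scale `4⁻ⁿ`. It is a nonnegative operator of order
`-3/2` which commutes with tangential translations, with traces and with `∂_z`. Adding to the energy
a small multiple of the bounded form `⟨ψ, B φ_z⟩` produces, by an integration by parts in `z`
(`System.inner_smooth_dz_self`, `System.flow_identity`), the dissipation `⟨γψ, B γψ⟩`. Extended by
zero, `∂ₓu` lies in `H¹(ℝ²)`, and `|⟨e, g⟩| ≤ C (‖e‖ + ‖∇e‖) ⟨g, B g⟩^{1/2}`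
(`Rep.inner_le_smooth`), as `B` has order above `-2`; thus the dissipation absorbs the boundary
term. Consequently the generator is quasi-dissipative in an inner product equivalent to the original
one, for every `U ≥ 0` (`System.exists_dissipative`).

For the range condition, `∂ₓ` in the flow equations is replaced by the bounded skew-adjoint operator
`J ∂ₓ`, `J` a mollification. The regularized resolvent equation is solvable for large parameters by
Lax–Milgram (`System.exists_isRegular`), hence for all admissible ones by dissipativity
(`IsInner.fullRange_of_le`). The energy estimate does not depend on the regularization, so a weak
limit solves the original equation (`System.fullRange_graph`), and the generator is
quasi-m-dissipative (`System.exists_mDissipative`).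

The evolution equation is treated in the integrated form `IsMild`: the time integral of `y` lies in
the domain and is mapped by the generator to `y(t) - y(0) - ∫ F(y)`. Applying resolvents turns this
into differential equations with bounded operators and gives the energy estimate
`MDissipative.linear_le`, whence uniqueness and continuous dependence. Existence for a Lipschitz
nonlinearity is by Yosida approximation (`MDissipative.exists_mild`). A locally Lipschitz one is
composed with the radial retraction onto a ball, and the solutions are concatenated up to the
blow-up time (`MDissipative.exists_maximal`). A mild solution that starts in the domain is Lipschitz
in time, so it stays in the domain and is strong (`MDissipative.exists_image`,
`MDissipative.exists_strong`). Since strong solutions are mild (`MDissipative.isMild_of_strong`) and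
initial data in the domain are dense, the generalized solutions are exactly the mild ones
(`isGeneralizedSolution_iff`), and the weak formulation is the integrated equation read in
components (`isWeakSolution_of_isMild`).

Tangential derivatives are encoded as generators of groups of translations (`Flow.Gen`), which
supplies mollifiers and difference quotients in any Hilbert space. The trace is obtained by duality
from a lifting of boundary data (`traceL`) and satisfies Green's formula (`HasWeakPartial.green`).
-/

set_option linter.unusedSectionVars false

noncomputable section

namespace FlowPlate

open MeasureTheory Set Filter Topology
open scoped ContDiff

/-! ### One-parameter groups of isometries -/

/-- A strongly continuous one-parameter group of linear isometries of a Hilbert space. -/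
structure Flow (H : Type*) [NormedAddCommGroup H] [InnerProductSpace ℝ H] where
  /-- the group itself -/
  T : ℝ → H →L[ℝ] H
  zero : ∀ x, T 0 x = x
  add : ∀ s t x, T (s + t) x = T s (T t x)
  norm_map : ∀ s x, ‖T s x‖ = ‖x‖
  cont : ∀ x, Continuous fun s => T s x

namespace Flow

variable {H H' : Type*} [NormedAddCommGroup H] [InnerProductSpace ℝ H] [CompleteSpace H]
  [NormedAddCommGroup H'] [InnerProductSpace ℝ H'] [CompleteSpace H']

theorem inner_T (τ : Flow H) (s : ℝ) (x y : H) :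
    inner ℝ (τ.T s x) y = inner ℝ x (τ.T (-s) y) := by
  have h1 : y = τ.T s (τ.T (-s) y) := by rw [← τ.add, add_neg_cancel, τ.zero]
  let l : H →ₗᵢ[ℝ] H := ⟨(τ.T s).toLinearMap, τ.norm_map s⟩
  have h2 := l.inner_map_map x (τ.T (-s) y)
  conv_lhs => rw [h1]
  exact h2

theorem cont_scale (τ : Flow H) (r : ℝ) (x : H) : Continuous fun s => τ.T (r * s) x :=
  (τ.cont x).comp (continuous_const.mul continuous_id)

/-- The mean `∫₀¹ T(rs) ds` of the group over the interval from `0` to `r`. -/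
def avg (τ : Flow H) (r : ℝ) : H →L[ℝ] H :=
  LinearMap.mkContinuous
    { toFun := fun x => ∫ s in (0 : ℝ)..1, τ.T (r * s) x
      map_add' := fun x y => by
        simp only [map_add]
        exact intervalIntegral.integral_add ((τ.cont_scale r x).intervalIntegrable _ _)
          ((τ.cont_scale r y).intervalIntegrable _ _)
      map_smul' := fun c x => by
        simp only [map_smul, RingHom.id_apply]
        exact intervalIntegral.integral_smul c _ } 1 (fun x => by
      have := intervalIntegral.norm_integral_le_of_norm_le_const (a := (0 : ℝ)) (b := 1)
        (f := fun s => τ.T (r * s) x) (C := ‖x‖) (fun s _ => (τ.norm_map _ _).le)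
      simpa using this)

theorem avg_apply (τ : Flow H) (r : ℝ) (x : H) :
    τ.avg r x = ∫ s in (0 : ℝ)..1, τ.T (r * s) x := rfl

theorem norm_avg_le (τ : Flow H) (r : ℝ) (x : H) : ‖τ.avg r x‖ ≤ ‖x‖ := by
  have := intervalIntegral.norm_integral_le_of_norm_le_const (a := (0 : ℝ)) (b := 1)
        (f := fun s => τ.T (r * s) x) (C := ‖x‖) (fun s _ => (τ.norm_map _ _).le)
  simpa [avg_apply] using this

theorem avg_zero (τ : Flow H) (x : H) : τ.avg 0 x = x := by
  simp [avg_apply, τ.zero]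

theorem continuous_avg (τ : Flow H) (x : H) : Continuous fun r => τ.avg r x := by
  simp only [avg_apply]
  refine intervalIntegral.continuous_parametric_intervalIntegral_of_continuous' ?_ 0 1
  exact (τ.cont x).comp (continuous_fst.mul continuous_snd)

theorem map_avg {τ : Flow H} {τ' : Flow H'} {P : H →L[ℝ] H'}
    (hP : ∀ s x, P (τ.T s x) = τ'.T s (P x)) (r : ℝ) (x : H) :
    P (τ.avg r x) = τ'.avg r (P x) := by
  simp only [avg_apply, ← hP]
  exact (P.intervalIntegral_comp_comm ((τ.cont_scale r x).intervalIntegrable _ _)).symm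

theorem inner_avg (τ : Flow H) (r : ℝ) (x y : H) :
    inner ℝ (τ.avg r x) y = inner ℝ x (τ.avg (-r) y) := by
  have h1 := (innerSL ℝ y).intervalIntegral_comp_comm
    ((τ.cont_scale r x).intervalIntegrable (μ := volume) 0 1)
  have h2 := (innerSL ℝ x).intervalIntegral_comp_comm
    ((τ.cont_scale (-r) y).intervalIntegrable (μ := volume) 0 1)
  simp only [innerSL_apply_apply] at h1 h2
  rw [real_inner_comm, avg_apply, avg_apply, ← h1, ← h2]
  congr 1
  ext s
  rw [real_inner_comm, inner_T, neg_mul]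

theorem T_comm (τ : Flow H) (s t : ℝ) (x : H) : τ.T s (τ.T t x) = τ.T t (τ.T s x) := by
  rw [← τ.add, ← τ.add, add_comm]

theorem T_avg (τ : Flow H) (s r : ℝ) (x : H) : τ.T s (τ.avg r x) = τ.avg r (τ.T s x) :=
  map_avg (fun t y => τ.T_comm s t y) r x

theorem avg_comm (τ : Flow H) (s r : ℝ) (x : H) : τ.avg s (τ.avg r x) = τ.avg r (τ.avg s x) :=
  map_avg (fun t y => (τ.T_avg t s y).symm) r x

theorem avg_neg_T (τ : Flow H) (r : ℝ) (x : H) : τ.avg (-r) (τ.T r x) = τ.avg r x := by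
  simp only [avg_apply]
  have := intervalIntegral.integral_comp_sub_left (fun s => τ.T (r * s) x) (1 : ℝ) (a := 0) (b := 1)
  simp only [sub_self, sub_zero] at this
  rw [← this]
  congr 1
  ext s
  rw [← τ.add]
  congr 2
  ring

theorem smul_avg (τ : Flow H) (s : ℝ) (x : H) :
    s • τ.avg s x = ∫ t in (0 : ℝ)..s, τ.T t x := by
  rw [avg_apply]
  have := intervalIntegral.smul_integral_comp_mul_left (a := (0 : ℝ)) (b := 1)
    (fun t => τ.T t x) s
  simpa using this

/-- `f` lies in the domain of the infinitesimal generator of the group, which maps it to `f'`. The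
relation is stated in integrated form, `T(s)f - f = ∫₀ˢ T(t)f' dt`. -/
def Gen (τ : Flow H) (f f' : H) : Prop := ∀ s : ℝ, τ.T s f - f = s • τ.avg s f'

theorem Gen.map {τ : Flow H} {τ' : Flow H'} {P : H →L[ℝ] H'}
    (hP : ∀ s x, P (τ.T s x) = τ'.T s (P x)) {f f' : H} (h : τ.Gen f f') :
    τ'.Gen (P f) (P f') := fun s => by
  rw [← hP, ← map_sub, h s, map_smul, map_avg hP]

theorem isClosed_gen (τ : Flow H) : IsClosed {p : H × H | τ.Gen p.1 p.2} := by
  have : {p : H × H | τ.Gen p.1 p.2} =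
      ⋂ s : ℝ, {p : H × H | τ.T s p.1 - p.1 = s • τ.avg s p.2} := by
    ext p
    simp [Gen]
  rw [this]
  refine isClosed_iInter fun s => isClosed_eq ?_ ?_
  · exact ((τ.T s).continuous.comp continuous_fst).sub continuous_fst
  · exact ((τ.avg s).continuous.comp continuous_snd).const_smul s

theorem Gen.norm_avg_sub_le {τ : Flow H} {f f' : H} (h : τ.Gen f f') (r : ℝ) :
    ‖τ.avg r f - f‖ ≤ |r| * ‖f'‖ := by
  have h1 : τ.avg r f - f = ∫ s in (0 : ℝ)..1, (τ.T (r * s) f - f) := by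
    rw [intervalIntegral.integral_sub ((τ.cont_scale r f).intervalIntegrable _ _)
      (by simp), avg_apply]
    simp
  rw [h1]
  have := intervalIntegral.norm_integral_le_of_norm_le_const (a := (0 : ℝ)) (b := 1)
    (f := fun s => τ.T (r * s) f - f) (C := |r| * ‖f'‖) (fun s hs => ?_)
  · simpa using this
  · rw [uIoc_of_le zero_le_one] at hs
    rw [h (r * s), norm_smul, Real.norm_eq_abs, abs_mul, abs_of_pos hs.1]
    have h3 : |r| * s ≤ |r| := mul_le_of_le_one_right (abs_nonneg r) hs.2
    exact mul_le_mul h3 (τ.norm_avg_le _ _) (norm_nonneg _) (abs_nonneg r)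

/-- Means over intervals lie in the domain of the generator. -/
theorem gen_avg (τ : Flow H) {r : ℝ} (hr : r ≠ 0) (f : H) :
    τ.Gen (τ.avg r f) (r⁻¹ • (τ.T r f - f)) := fun s => by
  have key : ∀ r s : ℝ, r • τ.avg r (τ.T s f - f) =
      (∫ t in (0 : ℝ)..(r + s), τ.T t f) - (∫ t in (0 : ℝ)..s, τ.T t f)
        - ∫ t in (0 : ℝ)..r, τ.T t f := by
    intro r s
    have hi : ∀ a b : ℝ, IntervalIntegrable (fun t => τ.T t f) volume a b :=
      fun a b => (τ.cont f).intervalIntegrable a b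
    rw [map_sub, smul_sub, smul_avg, smul_avg]
    congr 1
    have h1 := intervalIntegral.integral_comp_add_right (fun t => τ.T t f) s (a := 0) (b := r)
    simp only [τ.add, zero_add] at h1
    rw [h1, intervalIntegral.integral_interval_sub_left (hi _ _) (hi _ _)]
  have h1 := key r s
  have h2 := key s r
  rw [T_avg, ← map_sub, map_smul, smul_comm, h2]
  rw [eq_inv_smul_iff₀ hr, h1, add_comm r s]
  abel

/-- The generator of a group of isometries is skew-symmetric. -/
theorem Gen.inner_skew {τ : Flow H} {f f' g g' : H} (hf : τ.Gen f f') (hg : τ.Gen g g') :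
    inner ℝ f' g = -inner ℝ f g' := by
  have h1 : Tendsto (fun s : ℝ => inner ℝ (τ.avg s f') g) (𝓝[≠] 0) (𝓝 (inner ℝ f' g)) := by
    have := (Continuous.inner (𝕜 := ℝ) (τ.continuous_avg f')
      (continuous_const (y := g))).tendsto (0 : ℝ)
    rw [avg_zero] at this
    exact this.mono_left nhdsWithin_le_nhds
  have h2 : Tendsto (fun s : ℝ => -inner ℝ f (τ.avg (-s) g')) (𝓝[≠] 0) (𝓝 (-inner ℝ f g')) := by
    have hc : Continuous fun s : ℝ => -inner ℝ f (τ.avg (-s) g') :=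
      (Continuous.inner (𝕜 := ℝ) continuous_const
        ((τ.continuous_avg g').comp continuous_neg)).neg
    have := hc.tendsto 0
    simp only [neg_zero, avg_zero] at this
    exact this.mono_left nhdsWithin_le_nhds
  refine tendsto_nhds_unique h1 (h2.congr' ?_)
  filter_upwards [self_mem_nhdsWithin] with s hs
  have hs : s ≠ 0 := hs
  have e1 := congrArg (fun x => inner ℝ x g) (hf s)
  have e2 := congrArg (fun x => inner ℝ f x) (hg (-s))
  simp only [inner_sub_left, inner_sub_right, inner_smul_left, inner_smul_right, inner_T,
    RCLike.conj_to_real] at e1 e2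
  have : s * (-inner ℝ f (τ.avg (-s) g')) = s * inner ℝ (τ.avg s f') g := by linarith
  exact mul_left_cancel₀ hs this

/-- The mollifier `J = A A*`, where `A` is the mean over the interval from `0` to `r`. -/
def moll (τ : Flow H) (r : ℝ) : H →L[ℝ] H := (τ.avg r).comp (τ.avg (-r))

/-- The bounded skew-symmetric operator `J ∂`, where `∂` is the infinitesimal generator and `J` is
the mollifier `Flow.moll`. With `A` as there, `A ∂ = r⁻¹ (T(r) - 1)` and `A* T(r) = A`, whence the
formula. -/
def dmoll (τ : Flow H) (r : ℝ) : H →L[ℝ] H := r⁻¹ • (τ.avg r - τ.avg (-r))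

theorem moll_apply (τ : Flow H) (r : ℝ) (x : H) : τ.moll r x = τ.avg r (τ.avg (-r) x) := rfl

theorem dmoll_apply (τ : Flow H) (r : ℝ) (x : H) :
    τ.dmoll r x = r⁻¹ • (τ.avg r x - τ.avg (-r) x) := rfl

theorem norm_moll_le (τ : Flow H) (r : ℝ) (x : H) : ‖τ.moll r x‖ ≤ ‖x‖ :=
  (τ.norm_avg_le _ _).trans (τ.norm_avg_le _ _)

theorem map_moll {τ : Flow H} {τ' : Flow H'} {P : H →L[ℝ] H'}
    (hP : ∀ s x, P (τ.T s x) = τ'.T s (P x)) (r : ℝ) (x : H) :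
    P (τ.moll r x) = τ'.moll r (P x) := by
  rw [moll_apply, moll_apply, map_avg hP, map_avg hP]

theorem map_dmoll {τ : Flow H} {τ' : Flow H'} {P : H →L[ℝ] H'}
    (hP : ∀ s x, P (τ.T s x) = τ'.T s (P x)) (r : ℝ) (x : H) :
    P (τ.dmoll r x) = τ'.dmoll r (P x) := by
  rw [dmoll_apply, dmoll_apply, map_smul, map_sub, map_avg hP, map_avg hP]

theorem inner_moll (τ : Flow H) (r : ℝ) (x y : H) :
    inner ℝ (τ.moll r x) y = inner ℝ x (τ.moll r y) := by
  rw [moll_apply, moll_apply, inner_avg, inner_avg, neg_neg]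

theorem inner_dmoll (τ : Flow H) (r : ℝ) (x y : H) :
    inner ℝ (τ.dmoll r x) y = -inner ℝ x (τ.dmoll r y) := by
  rw [dmoll_apply, dmoll_apply, inner_smul_left, inner_smul_right, inner_sub_left, inner_sub_right,
    inner_avg, inner_avg, neg_neg, RCLike.conj_to_real]
  ring

theorem gen_moll (τ : Flow H) {r : ℝ} (hr : r ≠ 0) (f : H) :
    τ.Gen (τ.moll r f) (τ.dmoll r f) := by
  have h := τ.gen_avg hr (τ.avg (-r) f)
  rw [T_avg, avg_neg_T] at h
  exact h

/-- On the domain of the generator, `Flow.dmoll` is the mollifier applied to the derivative. -/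
theorem Gen.dmoll_eq {τ : Flow H} {f f' : H} (h : τ.Gen f f') {r : ℝ} (hr : r ≠ 0) :
    τ.dmoll r f = τ.moll r f' := by
  have h1 := congrArg (τ.avg (-r)) (h r)
  rw [map_sub, avg_neg_T, map_smul] at h1
  rw [dmoll_apply, h1, inv_smul_smul₀ hr, moll_apply, avg_comm]

theorem tendsto_moll (τ : Flow H) (x : H) : Tendsto (fun r => τ.moll r x) (𝓝 0) (𝓝 x) := by
  rw [tendsto_iff_norm_sub_tendsto_zero]
  have h1 : Tendsto (fun r => ‖τ.avg (-r) x - x‖ + ‖τ.avg r x - x‖) (𝓝 0) (𝓝 0) := by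
    have hc : Continuous fun r : ℝ => ‖τ.avg (-r) x - x‖ + ‖τ.avg r x - x‖ :=
      (((τ.continuous_avg x).comp continuous_neg).sub continuous_const).norm.add
        ((τ.continuous_avg x).sub continuous_const).norm
    simpa [avg_zero] using hc.tendsto 0
  refine squeeze_zero (fun _ => norm_nonneg _) (fun r => ?_) h1
  have : τ.moll r x - x = τ.avg r (τ.avg (-r) x - x) + (τ.avg r x - x) := by
    rw [moll_apply, map_sub]; abel
  rw [this]
  exact (norm_add_le _ _).trans (by gcongr; exact τ.norm_avg_le _ _)

end Flow

/-! ### Unitary representations of the plane -/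

/-- A strongly continuous unitary representation of `ℝ²` on a Hilbert space, given by the two
commuting one-parameter groups of its coordinate directions. -/
structure Rep (H : Type*) [NormedAddCommGroup H] [InnerProductSpace ℝ H] where
  /-- the group of the coordinate direction `i` -/
  flow : Fin 2 → Flow H
  comm : ∀ i j s t x, (flow i).T s ((flow j).T t x) = (flow j).T t ((flow i).T s x)

/-- The operator `P` commutes with the representations `ρ` and `ρ'`. -/
def Intertwines {H H' : Type*} [NormedAddCommGroup H] [InnerProductSpace ℝ H]
    [NormedAddCommGroup H'] [InnerProductSpace ℝ H'] (ρ : Rep H) (ρ' : Rep H')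
    (P : H →L[ℝ] H') : Prop :=
  ∀ i s x, P ((ρ.flow i).T s x) = (ρ'.flow i).T s (P x)

/-- The dyadic scales `4⁻ⁿ`. -/
def scale (n : ℕ) : ℝ := (1 / 4) ^ n

theorem scale_pos (n : ℕ) : 0 < scale n := by unfold scale; positivity

theorem tendsto_scale : Tendsto scale atTop (𝓝 0) :=
  tendsto_pow_atTop_nhds_zero_of_lt_one (by norm_num) (by norm_num)

namespace Rep

variable {H H' : Type*} [NormedAddCommGroup H] [InnerProductSpace ℝ H] [CompleteSpace H]
  [NormedAddCommGroup H'] [InnerProductSpace ℝ H'] [CompleteSpace H']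

theorem T_avg_comm (ρ : Rep H) (i j : Fin 2) (s r : ℝ) (x : H) :
    (ρ.flow i).T s ((ρ.flow j).avg r x) = (ρ.flow j).avg r ((ρ.flow i).T s x) :=
  Flow.map_avg (P := (ρ.flow i).T s) (fun t y => ρ.comm i j s t y) r x

theorem avg_avg_comm (ρ : Rep H) (i j : Fin 2) (s r : ℝ) (x : H) :
    (ρ.flow i).avg s ((ρ.flow j).avg r x) = (ρ.flow j).avg r ((ρ.flow i).avg s x) :=
  Flow.map_avg (P := (ρ.flow i).avg s) (fun t y => (ρ.T_avg_comm j i t s y).symm) r x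

theorem moll_comm (ρ : Rep H) (i j : Fin 2) (r : ℝ) (x : H) :
    (ρ.flow i).moll r ((ρ.flow j).moll r x) = (ρ.flow j).moll r ((ρ.flow i).moll r x) :=
  Flow.map_moll (P := (ρ.flow i).moll r) (fun s z => by
    simp only [Flow.moll_apply, T_avg_comm]) _ _

/-- Mollification in both directions at the scale `4⁻ⁿ`. -/
def moll2 (ρ : Rep H) (n : ℕ) : H →L[ℝ] H :=
  ((ρ.flow 0).moll (scale n)).comp ((ρ.flow 1).moll (scale n))

/-- The scale-`n` contribution to `Rep.smoothD`, namely `2⁻ⁿ 4⁻ⁿ J_n ∂ᵢ`, where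
`J_n` is `Rep.moll2`; it is of norm `O(2⁻ⁿ)`. -/
def dmoll2 (ρ : Rep H) (i : Fin 2) (n : ℕ) : H →L[ℝ] H :=
  ((ρ.flow (1 - i)).moll (scale n)).comp
    ((ρ.flow i).avg (scale n) - (ρ.flow i).avg (-scale n))

/-- The smoothing operator `B = ∑ₙ 8⁻ⁿ J_n`, where `J_n` mollifies at the scale `4⁻ⁿ`. It is
nonnegative and behaves like the Fourier multiplier `(1 + |ξ|)^{-3/2}`. -/
def smooth (ρ : Rep H) : H →L[ℝ] H := ∑' n : ℕ, ((1 / 8 : ℝ) ^ n) • ρ.moll2 n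

/-- The bounded operator `B ∂ᵢ`, where `B` is the smoothing operator `Rep.smooth`. -/
def smoothD (ρ : Rep H) (i : Fin 2) : H →L[ℝ] H := ∑' n : ℕ, ((1 / 2 : ℝ) ^ n) • ρ.dmoll2 i n

theorem norm_moll2_le (ρ : Rep H) (n : ℕ) : ‖ρ.moll2 n‖ ≤ 1 :=
  ContinuousLinearMap.opNorm_le_bound _ zero_le_one fun x => by
    rw [one_mul]
    exact ((ρ.flow 0).norm_moll_le _ _).trans ((ρ.flow 1).norm_moll_le _ _)

theorem norm_dmoll2_le (ρ : Rep H) (i : Fin 2) (n : ℕ) : ‖ρ.dmoll2 i n‖ ≤ 2 :=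
  ContinuousLinearMap.opNorm_le_bound _ zero_le_two fun x => by
    refine ((ρ.flow (1 - i)).norm_moll_le _ _).trans ?_
    refine (norm_sub_le _ _).trans ?_
    have h1 := (ρ.flow i).norm_avg_le (scale n) x
    have h2 := (ρ.flow i).norm_avg_le (-scale n) x
    exact (add_le_add h1 h2).trans (two_mul _).ge

theorem summable_smooth (ρ : Rep H) : Summable fun n : ℕ => ((1 / 8 : ℝ) ^ n) • ρ.moll2 n := by
  refine Summable.of_norm_bounded (summable_geometric_of_lt_one (r := 1 / 8) (by norm_num)
    (by norm_num)) fun n => ?_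
  rw [norm_smul, Real.norm_of_nonneg (by positivity)]
  exact mul_le_of_le_one_right (by positivity) (ρ.norm_moll2_le n)

theorem summable_smoothD (ρ : Rep H) (i : Fin 2) :
    Summable fun n : ℕ => ((1 / 2 : ℝ) ^ n) • ρ.dmoll2 i n := by
  refine Summable.of_norm_bounded ((summable_geometric_of_lt_one (r := 1 / 2) (by norm_num)
    (by norm_num)).mul_right 2) fun n => ?_
  rw [norm_smul, Real.norm_of_nonneg (by positivity)]
  gcongr
  exact ρ.norm_dmoll2_le i n

theorem hasSum_smooth (ρ : Rep H) (x : H) :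
    HasSum (fun n : ℕ => ((1 / 8 : ℝ) ^ n) • ρ.moll2 n x) (ρ.smooth x) := by
  have h := (ContinuousLinearMap.apply ℝ H x).hasSum ρ.summable_smooth.hasSum
  simp only [ContinuousLinearMap.apply_apply, smul_apply] at h
  rw [smooth]
  exact h

theorem hasSum_smoothD (ρ : Rep H) (i : Fin 2) (x : H) :
    HasSum (fun n : ℕ => ((1 / 2 : ℝ) ^ n) • ρ.dmoll2 i n x) (ρ.smoothD i x) := by
  have h := (ContinuousLinearMap.apply ℝ H x).hasSum (ρ.summable_smoothD i).hasSum
  simp only [ContinuousLinearMap.apply_apply, smul_apply] at h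
  rw [smoothD]
  exact h

theorem map_moll2 {ρ : Rep H} {ρ' : Rep H'} {P : H →L[ℝ] H'} (hP : Intertwines ρ ρ' P) (n : ℕ)
    (x : H) : P (ρ.moll2 n x) = ρ'.moll2 n (P x) := by
  simp only [moll2, ContinuousLinearMap.comp_apply]
  rw [Flow.map_moll (hP 0), Flow.map_moll (hP 1)]

theorem map_smooth {ρ : Rep H} {ρ' : Rep H'} {P : H →L[ℝ] H'} (hP : Intertwines ρ ρ' P) (x : H) :
    P (ρ.smooth x) = ρ'.smooth (P x) := by
  have h1 := P.hasSum (ρ.hasSum_smooth x)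
  simp only [map_smul, map_moll2 hP] at h1
  exact h1.unique (ρ'.hasSum_smooth (P x))

theorem inner_moll2 (ρ : Rep H) (n : ℕ) (x y : H) :
    inner ℝ (ρ.moll2 n x) y = inner ℝ x (ρ.moll2 n y) := by
  simp only [moll2, ContinuousLinearMap.comp_apply]
  rw [Flow.inner_moll, Flow.inner_moll]
  rw [ρ.moll_comm 1 0]

theorem inner_dmoll2 (ρ : Rep H) (i : Fin 2) (n : ℕ) (x y : H) :
    inner ℝ (ρ.dmoll2 i n x) y = -inner ℝ x (ρ.dmoll2 i n y) := by
  simp only [dmoll2, ContinuousLinearMap.comp_apply, sub_apply]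
  rw [Flow.inner_moll, inner_sub_left, Flow.inner_avg, Flow.inner_avg, neg_neg, ← inner_sub_right,
    ← inner_neg_right, ← map_neg, neg_sub]
  simp only [Flow.moll_apply, map_sub, ρ.avg_avg_comm i (1 - i)]

theorem inner_smooth (ρ : Rep H) (x y : H) :
    inner ℝ (ρ.smooth x) y = inner ℝ x (ρ.smooth y) := by
  have h1 := (innerSL ℝ y).hasSum (ρ.hasSum_smooth x)
  have h2 := (innerSL ℝ x).hasSum (ρ.hasSum_smooth y)
  simp only [innerSL_apply_apply, inner_smul_right] at h1 h2
  rw [real_inner_comm]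
  refine h1.unique ?_
  convert! h2 using 3 with n
  rw [real_inner_comm, inner_moll2]

theorem inner_smoothD (ρ : Rep H) (i : Fin 2) (x y : H) :
    inner ℝ (ρ.smoothD i x) y = -inner ℝ x (ρ.smoothD i y) := by
  have h1 := (innerSL ℝ y).hasSum (ρ.hasSum_smoothD i x)
  have h2 := ((innerSL ℝ x).hasSum (ρ.hasSum_smoothD i y)).neg
  simp only [innerSL_apply_apply, inner_smul_right] at h1 h2
  rw [real_inner_comm]
  refine h1.unique ?_
  convert! h2 using 2 with n
  rw [real_inner_comm, inner_dmoll2]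
  ring

/-- The operator `Rep.smoothD i` is the bounded extension of `B ∂ᵢ`. -/
theorem smoothD_of_gen (ρ : Rep H) {i : Fin 2} {f f' : H} (h : (ρ.flow i).Gen f f') :
    ρ.smoothD i f = ρ.smooth f' := by
  refine (ρ.hasSum_smoothD i f).unique ?_
  convert! ρ.hasSum_smooth f' using 2 with n
  have hr := (scale_pos n).ne'
  have h1 := h.dmoll_eq hr
  rw [Flow.dmoll_apply, inv_smul_eq_iff₀ hr] at h1
  have h2 : (1 / 2 : ℝ) ^ n * scale n = (1 / 8) ^ n := by
    rw [scale, ← mul_pow]; norm_num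
  simp only [dmoll2, moll2, ContinuousLinearMap.comp_apply, sub_apply]
  rw [h1, map_smul, smul_smul, h2]
  congr 1
  fin_cases i
  · exact ρ.moll_comm 1 0 _ _
  · rfl

theorem smooth_gen (ρ : Rep H) {i : Fin 2} {f f' : H} (h : (ρ.flow i).Gen f f') :
    (ρ.flow i).Gen (ρ.smooth f) (ρ.smooth f') :=
  Flow.Gen.map (P := ρ.smooth) (fun s x => (map_smooth (P := (ρ.flow i).T s)
    (fun j t y => ρ.comm i j s t y) x).symm) h

/-- The mean over a square of side `r`, so that `Rep.moll2` is `A A*` for `A` this mean at the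
scale `4⁻ⁿ`. -/
def avg2 (ρ : Rep H) (r : ℝ) : H →L[ℝ] H := ((ρ.flow 0).avg r).comp ((ρ.flow 1).avg r)

theorem avg2_apply (ρ : Rep H) (r : ℝ) (x : H) :
    ρ.avg2 r x = (ρ.flow 0).avg r ((ρ.flow 1).avg r x) := rfl

theorem inner_avg2 (ρ : Rep H) (r : ℝ) (x y : H) :
    inner ℝ (ρ.avg2 r x) y = inner ℝ x (ρ.avg2 (-r) y) := by
  rw [avg2_apply, avg2_apply, Flow.inner_avg, Flow.inner_avg, avg_avg_comm]

theorem avg2_comm (ρ : Rep H) (r s : ℝ) (x : H) :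
    ρ.avg2 r (ρ.avg2 s x) = ρ.avg2 s (ρ.avg2 r x) := by
  simp only [avg2_apply]
  rw [ρ.avg_avg_comm 1 0 r s, ρ.avg_avg_comm 0 0 r s, ρ.avg_avg_comm 1 1 r s,
    ρ.avg_avg_comm 0 1 r s]

theorem norm_avg2_neg (ρ : Rep H) (r : ℝ) (x : H) : ‖ρ.avg2 (-r) x‖ = ‖ρ.avg2 r x‖ := by
  have h : ‖ρ.avg2 (-r) x‖ ^ 2 = ‖ρ.avg2 r x‖ ^ 2 := by
    rw [← real_inner_self_eq_norm_sq, ← real_inner_self_eq_norm_sq, inner_avg2, inner_avg2,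
      neg_neg, avg2_comm]
  exact (sq_eq_sq₀ (norm_nonneg _) (norm_nonneg _)).mp h

theorem inner_moll2_self (ρ : Rep H) (n : ℕ) (x : H) :
    inner ℝ x (ρ.moll2 n x) = ‖ρ.avg2 (scale n) x‖ ^ 2 := by
  rw [← real_inner_self_eq_norm_sq, inner_avg2]
  simp only [moll2, Flow.moll_apply, ContinuousLinearMap.comp_apply, avg2_apply]
  rw [ρ.avg_avg_comm 0 0, ρ.avg_avg_comm 1 1 (scale n) (-scale n),
    ρ.avg_avg_comm 0 1 (scale n) (-scale n)]

/-- A single term of the series of nonnegative terms `⟨x, B x⟩ = ∑ₙ 8⁻ⁿ ‖Aₙ x‖²`, where `Aₙ` is the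
mean `Rep.avg2` at the scale `4⁻ⁿ`. -/
theorem norm_avg2_sq_le (ρ : Rep H) (n : ℕ) (x : H) :
    ‖ρ.avg2 (scale n) x‖ ^ 2 ≤ 8 ^ n * inner ℝ x (ρ.smooth x) := by
  have h1 := (innerSL ℝ x).hasSum (ρ.hasSum_smooth x)
  simp only [innerSL_apply_apply, inner_smul_right, inner_moll2_self] at h1
  have h2 := le_hasSum h1 n (fun j _ => by positivity)
  calc ‖ρ.avg2 (scale n) x‖ ^ 2 = 8 ^ n * ((1 / 8) ^ n * ‖ρ.avg2 (scale n) x‖ ^ 2) := by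
        rw [← mul_assoc, ← mul_pow]; norm_num
    _ ≤ _ := by gcongr

theorem inner_smooth_nonneg (ρ : Rep H) (x : H) : 0 ≤ inner ℝ x (ρ.smooth x) := by
  have := ρ.norm_avg2_sq_le 0 x
  simp only [pow_zero, one_mul] at this
  exact (sq_nonneg _).trans this

theorem tendsto_avg2 (ρ : Rep H) (x : H) :
    Tendsto (fun n => ρ.avg2 (scale n) x) atTop (𝓝 x) := by
  rw [tendsto_iff_norm_sub_tendsto_zero]
  have hc : Continuous fun r : ℝ => ‖(ρ.flow 1).avg r x - x‖ + ‖(ρ.flow 0).avg r x - x‖ :=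
    (((ρ.flow 1).continuous_avg x).sub continuous_const).norm.add
      (((ρ.flow 0).continuous_avg x).sub continuous_const).norm
  have h1 := (hc.tendsto 0).comp tendsto_scale
  simp only [Flow.avg_zero, sub_self, norm_zero, add_zero] at h1
  refine squeeze_zero (fun _ => norm_nonneg _) (fun n => ?_) h1
  have : ρ.avg2 (scale n) x - x = (ρ.flow 0).avg (scale n) ((ρ.flow 1).avg (scale n) x - x)
      + ((ρ.flow 0).avg (scale n) x - x) := by
    rw [avg2_apply, map_sub]; abel
  rw [this]
  refine (norm_add_le _ _).trans ?_
  simp only [Function.comp]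
  gcongr
  exact (ρ.flow 0).norm_avg_le _ _

theorem norm_avg2_sub_le (ρ : Rep H) {f f₀ f₁ : H} (h₀ : (ρ.flow 0).Gen f f₀)
    (h₁ : (ρ.flow 1).Gen f f₁) (r : ℝ) : ‖ρ.avg2 r f - f‖ ≤ |r| * (‖f₀‖ + ‖f₁‖) := by
  have : ρ.avg2 r f - f = (ρ.flow 0).avg r ((ρ.flow 1).avg r f - f)
      + ((ρ.flow 0).avg r f - f) := by
    rw [avg2_apply, map_sub]; abel
  rw [this]
  refine (norm_add_le _ _).trans ?_
  have h2 := ((ρ.flow 0).norm_avg_le r ((ρ.flow 1).avg r f - f)).trans (h₁.norm_avg_sub_le r)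
  have h3 := h₀.norm_avg_sub_le r
  linarith

/-- The quadratic form of the smoothing operator controls a pairing with an element in the common
domain of the two generators: `⟨g, Bg⟩^{1/2}` dominates the norm dual to the graph norm. The
pairing is telescoped over the scales; since `B` is of order larger than `-2`, the resulting
series is geometric. -/
theorem inner_le_smooth (ρ : Rep H) {e e₀ e₁ : H} (h₀ : (ρ.flow 0).Gen e e₀)
    (h₁ : (ρ.flow 1).Gen e e₁) (g : H) :
    |inner ℝ e g| ≤ (‖e‖ + 48 * (‖e₀‖ + ‖e₁‖)) * √(inner ℝ g (ρ.smooth g)) := by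
  set N := ‖e₀‖ + ‖e₁‖ with hN
  set s := √(inner ℝ g (ρ.smooth g)) with hs
  have hN0 : 0 ≤ N := by positivity
  have hs0 : 0 ≤ s := Real.sqrt_nonneg _
  -- `8ⁿ ≤ 9ⁿ` avoids square roots of `8`.
  have hA : ∀ n, ‖ρ.avg2 (scale n) g‖ ≤ 3 ^ n * s := by
    intro n
    refine abs_le_of_sq_le_sq' ?_ (by positivity) |>.2
    rw [mul_pow, hs, Real.sq_sqrt (ρ.inner_smooth_nonneg g)]
    refine (ρ.norm_avg2_sq_le n g).trans ?_
    refine mul_le_mul_of_nonneg_right ?_ (ρ.inner_smooth_nonneg g)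
    rw [← pow_mul, mul_comm, pow_mul]
    exact pow_le_pow_left₀ (by norm_num) (by norm_num) n
  set S : ℕ → ℝ := fun n => inner ℝ (ρ.avg2 (scale n) e) (ρ.avg2 (scale n) g) with hS
  have hlim : Tendsto S atTop (𝓝 (inner ℝ e g)) := (ρ.tendsto_avg2 e).inner (ρ.tendsto_avg2 g)
  -- The increments of `e` are `O(4⁻ⁿ)` while the means of `g` are `O(3ⁿ)`.
  have hstep : ∀ n, |S (n + 1) - S n| ≤ 12 * N * s * (3 / 4) ^ n := by
    intro n
    have hd : ∀ σ : ℝ, (σ = 1 ∨ σ = -1) →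
        ‖ρ.avg2 (σ * scale (n + 1)) e - ρ.avg2 (σ * scale n) e‖ ≤ 2 * (1 / 4) ^ n * N := by
      intro σ hσ
      have habs : ∀ m, |σ * scale m| = scale m := fun m => by
        rw [abs_mul, abs_of_pos (scale_pos m)]; rcases hσ with rfl | rfl <;> simp
      have a1 := ρ.norm_avg2_sub_le h₀ h₁ (σ * scale (n + 1))
      have a2 := ρ.norm_avg2_sub_le h₀ h₁ (σ * scale n)
      rw [habs] at a1 a2
      have a3 : scale (n + 1) ≤ scale n := by
        unfold scale
        exact pow_le_pow_of_le_one (by norm_num) (by norm_num) (Nat.le_succ n)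
      have a4 : ρ.avg2 (σ * scale (n + 1)) e - ρ.avg2 (σ * scale n) e
          = (ρ.avg2 (σ * scale (n + 1)) e - e) - (ρ.avg2 (σ * scale n) e - e) := by abel
      rw [a4]
      refine (norm_sub_le _ _).trans ?_
      have : scale (n + 1) * N ≤ scale n * N := by gcongr
      have e5 : (1 / 4 : ℝ) ^ n = scale n := rfl
      rw [e5]
      linarith
    have hd1 := hd 1 (Or.inl rfl)
    have hd2 := hd (-1) (Or.inr rfl)
    simp only [one_mul, neg_mul] at hd1 hd2
    -- Since the means commute, `⟨A₍ᵣ₎ e, A₍ₛ₎ g⟩ = ⟨A₍₋ₛ₎ e, A₍₋ᵣ₎ g⟩`; so only `e` is differenced.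
    have e1 : S (n + 1) - S n =
        inner ℝ (ρ.avg2 (scale (n + 1)) e - ρ.avg2 (scale n) e) (ρ.avg2 (scale (n + 1)) g)
        + inner ℝ (ρ.avg2 (-scale (n + 1)) e - ρ.avg2 (-scale n) e) (ρ.avg2 (-scale n) g) := by
      simp only [hS, inner_sub_left]
      have b1 : inner ℝ (ρ.avg2 (-scale (n + 1)) e) (ρ.avg2 (-scale n) g)
          = inner ℝ (ρ.avg2 (scale n) e) (ρ.avg2 (scale (n + 1)) g) := by
        rw [inner_avg2, inner_avg2, neg_neg, avg2_comm]
      have b2 : inner ℝ (ρ.avg2 (-scale n) e) (ρ.avg2 (-scale n) g)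
          = inner ℝ (ρ.avg2 (scale n) e) (ρ.avg2 (scale n) g) := by
        rw [inner_avg2, inner_avg2, neg_neg, avg2_comm]
      rw [b1, b2]
      ring
    have c1 := abs_real_inner_le_norm (ρ.avg2 (scale (n + 1)) e - ρ.avg2 (scale n) e)
      (ρ.avg2 (scale (n + 1)) g)
    have c2 := abs_real_inner_le_norm (ρ.avg2 (-scale (n + 1)) e - ρ.avg2 (-scale n) e)
      (ρ.avg2 (-scale n) g)
    rw [norm_avg2_neg] at c2
    have c3 := mul_le_mul hd1 (hA (n + 1)) (norm_nonneg _) (by positivity)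
    have c4 := mul_le_mul hd2 (hA n) (norm_nonneg _) (by positivity)
    rw [e1]
    refine (abs_add_le _ _).trans ((add_le_add (c1.trans c3) (c2.trans c4)).trans ?_)
    have e6 : (3 / 4 : ℝ) ^ n = (1 / 4) ^ n * 3 ^ n := by rw [← mul_pow]; norm_num
    rw [e6, pow_succ]
    have : 0 ≤ (1 / 4 : ℝ) ^ n * N * (3 ^ n * s) := by positivity
    nlinarith
  have hS0 : |S 0| ≤ ‖e‖ * s := by
    have h3 := hA 0
    rw [pow_zero, one_mul] at h3
    refine (abs_real_inner_le_norm _ _).trans ?_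
    have : ‖ρ.avg2 (scale 0) e‖ ≤ ‖e‖ :=
      ((ρ.flow 0).norm_avg_le _ _).trans ((ρ.flow 1).norm_avg_le _ _)
    exact mul_le_mul this h3 (norm_nonneg _) (norm_nonneg _)
  have hSn : ∀ n, |S n| ≤ ‖e‖ * s + 48 * N * s * (1 - (3 / 4) ^ n) := by
    intro n
    induction n with
    | zero => simpa using hS0
    | succ n ih =>
      have h4 : S (n + 1) = (S (n + 1) - S n) + S n := by ring
      rw [h4]
      refine (abs_add_le _ _).trans ((add_le_add (hstep n) ih).trans (le_of_eq ?_))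
      rw [pow_succ]; ring
  refine le_of_tendsto hlim.abs (Eventually.of_forall fun n => (hSn n).trans ?_)
  have h5 : 0 ≤ 48 * N * s * (3 / 4) ^ n := by positivity
  nlinarith

end Rep

/-! ### Translations in L₂ and test functions -/

section Translations

variable {n : ℕ} {ν : Measure (EuclideanSpace ℝ (Fin n))}

theorem inner_eq_integral (f g : Lp ℝ 2 ν) : inner ℝ f g = ∫ x, f x * g x ∂ν := by
  rw [L2.inner_def]
  refine integral_congr_ae (Eventually.of_forall fun x => ?_)
  simp [mul_comm]

theorem inner_toLp (f : Lp ℝ 2 ν) {η : EuclideanSpace ℝ (Fin n) → ℝ} (hη : MemLp η 2 ν) :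
    inner ℝ f (hη.toLp η) = ∫ x, f x * η x ∂ν := by
  rw [inner_eq_integral]
  refine integral_congr_ae ?_
  filter_upwards [hη.coeFn_toLp] with x hx
  rw [hx]

/-- Translation by `c`, `f ↦ f(· + c)`. -/
def trans (c : EuclideanSpace ℝ (Fin n)) (hc : MeasurePreserving (fun x => x + c) ν ν) :
    Lp ℝ 2 ν →L[ℝ] Lp ℝ 2 ν :=
  (Lp.compMeasurePreservingₗᵢ ℝ (fun x => x + c) hc).toContinuousLinearMap

theorem trans_ae (c : EuclideanSpace ℝ (Fin n)) (hc : MeasurePreserving (fun x => x + c) ν ν)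
    (f : Lp ℝ 2 ν) : trans c hc f =ᵐ[ν] fun x => f (x + c) :=
  Lp.coeFn_compMeasurePreserving f hc

theorem norm_trans (c : EuclideanSpace ℝ (Fin n)) (hc : MeasurePreserving (fun x => x + c) ν ν)
    (f : Lp ℝ 2 ν) : ‖trans c hc f‖ = ‖f‖ :=
  Lp.norm_compMeasurePreserving f hc

theorem trans_trans (c d e : EuclideanSpace ℝ (Fin n))
    (hc : MeasurePreserving (fun x => x + c) ν ν) (hd : MeasurePreserving (fun x => x + d) ν ν)
    (he : MeasurePreserving (fun x => x + e) ν ν) (h : c + d = e) (f : Lp ℝ 2 ν) :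
    trans c hc (trans d hd f) = trans e he f := by
  refine Lp.ext ?_
  have h1 := hc.quasiMeasurePreserving.ae_eq_comp (trans_ae d hd f)
  filter_upwards [trans_ae c hc (trans d hd f), trans_ae e he f, h1] with x h2 h3 h4
  simp only [Function.comp] at h4
  rw [h2, h3, h4, add_assoc, h]

theorem trans_toLp (c : EuclideanSpace ℝ (Fin n)) (hc : MeasurePreserving (fun x => x + c) ν ν)
    {η : EuclideanSpace ℝ (Fin n) → ℝ} (hη : MemLp η 2 ν) (hη' : MemLp (fun x => η (x + c)) 2 ν) :
    trans c hc (hη.toLp η) = hη'.toLp _ := by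
  refine Lp.ext ?_
  have h1 := hc.quasiMeasurePreserving.ae_eq_comp hη.coeFn_toLp
  filter_upwards [trans_ae c hc (hη.toLp η), hη'.coeFn_toLp, h1] with x h2 h3 h4
  rw [h2, h3]
  exact h4

variable [IsLocallyFiniteMeasure ν] [ν.InnerRegularCompactLTTop]

/-- The group of translations in the direction `xᵢ`, `f ↦ f(· + s eᵢ)`, on `L²` of a measure that
is invariant under it. -/
def transFlow (i : Fin n)
    (hν : ∀ s : ℝ, MeasurePreserving (fun x => x + EuclideanSpace.single i s) ν ν) :
    Flow (Lp ℝ 2 ν) where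
  T s := trans (EuclideanSpace.single i s) (hν s)
  zero x := by
    refine Lp.ext ?_
    filter_upwards [trans_ae _ (hν 0) x] with y hy
    rw [hy]
    congr 1
    ext j
    simp
  add s t x := by
    rw [trans_trans (EuclideanSpace.single i s) (EuclideanSpace.single i t) _ (hν s) (hν t)
      (hν (s + t))]
    ext j
    by_cases h : j = i <;> simp [h]
  norm_map s x := norm_trans _ _ x
  cont x := by
    let g : ℝ → C(EuclideanSpace ℝ (Fin n), EuclideanSpace ℝ (Fin n)) := fun s =>
      ⟨fun y => y + EuclideanSpace.single i s, by fun_prop⟩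
    have hg : Continuous g := by
      refine ContinuousMap.continuous_of_continuous_uncurry _ ?_
      change Continuous fun p : ℝ × EuclideanSpace ℝ (Fin n) => p.2 + EuclideanSpace.single i p.1
      have h1 : ∀ s : ℝ, (EuclideanSpace.single i s : EuclideanSpace ℝ (Fin n))
          = s • EuclideanSpace.single i 1 := fun s => by
        ext j
        by_cases hj : j = i <;> simp [hj]
      have h2 : Continuous fun s : ℝ =>
          (EuclideanSpace.single i s : EuclideanSpace ℝ (Fin n)) := by
        rw [funext h1]
        fun_prop
      exact continuous_snd.add (h2.comp continuous_fst)
    exact Continuous.compMeasurePreservingLp (f := fun _ => x) continuous_const hg hν (by simp)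

end Translations

section Tests

variable {n : ℕ}

theorem IsTest.mono {S S' : Set (EuclideanSpace ℝ (Fin n))} (hS : S ⊆ S')
    {η : EuclideanSpace ℝ (Fin n) → ℝ} (h : IsTest S η) : IsTest S' η :=
  ⟨h.smooth, h.compact, h.supp.trans hS⟩

theorem IsTest.toUniv {S : Set (EuclideanSpace ℝ (Fin n))} {η : EuclideanSpace ℝ (Fin n) → ℝ}
    (h : IsTest S η) : IsTest Set.univ η := h.mono (subset_univ S)

theorem tsupport_pd_subset (i : Fin n) (η : EuclideanSpace ℝ (Fin n) → ℝ) :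
    tsupport (pd i η) ⊆ tsupport η := by
  refine (closure_mono fun x hx => ?_).trans (tsupport_fderiv_subset ℝ (f := η))
  rw [Function.mem_support] at hx ⊢
  intro h0
  exact hx (by simp [pd, h0])

theorem IsTest.pd {S : Set (EuclideanSpace ℝ (Fin n))} {η : EuclideanSpace ℝ (Fin n) → ℝ}
    (h : IsTest S η) (i : Fin n) : IsTest S (pd i η) where
  smooth := (h.smooth.fderiv_right (m := ∞) (by simp)).clm_apply contDiff_const
  compact := h.compact.mono' ((subset_tsupport _).trans (tsupport_pd_subset i η))
  supp := (tsupport_pd_subset i η).trans h.supp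

theorem IsTest.shift {S S' : Set (EuclideanSpace ℝ (Fin n))} {η : EuclideanSpace ℝ (Fin n) → ℝ}
    (h : IsTest S η) (c : EuclideanSpace ℝ (Fin n)) (hS : ∀ x, x + c ∈ S → x ∈ S') :
    IsTest S' (fun x => η (x + c)) where
  smooth := h.smooth.comp (contDiff_id.add contDiff_const)
  compact := h.compact.comp_homeomorph (Homeomorph.addRight c)
  supp := by
    have : tsupport (fun x => η (x + c)) = (Homeomorph.addRight c) ⁻¹' tsupport η :=
      tsupport_comp_eq_preimage η (Homeomorph.addRight c)
    rw [this]
    exact fun x hx => hS x (h.supp hx)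

theorem pd_shift (η : EuclideanSpace ℝ (Fin n) → ℝ) (i : Fin n) (c x : EuclideanSpace ℝ (Fin n)) :
    pd i (fun y => η (y + c)) x = pd i η (x + c) := by
  unfold pd
  rw [fderiv_comp_add_right]

theorem IsTest.memLp' {S : Set (EuclideanSpace ℝ (Fin n))} {η : EuclideanSpace ℝ (Fin n) → ℝ}
    (h : IsTest S η) (ν : Measure (EuclideanSpace ℝ (Fin n))) [IsLocallyFiniteMeasure ν] :
    MemLp η 2 ν :=
  h.smooth.continuous.memLp_of_hasCompactSupport h.compact

/-- The element of `L²(ν)` given by a test function. -/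
def IsTest.lp {S : Set (EuclideanSpace ℝ (Fin n))} {η : EuclideanSpace ℝ (Fin n) → ℝ}
    (h : IsTest S η) (ν : Measure (EuclideanSpace ℝ (Fin n))) [IsLocallyFiniteMeasure ν] :
    Lp ℝ 2 ν := (h.memLp' ν).toLp η

theorem IsTest.lp_ae {S : Set (EuclideanSpace ℝ (Fin n))} {η : EuclideanSpace ℝ (Fin n) → ℝ}
    (h : IsTest S η) (ν : Measure (EuclideanSpace ℝ (Fin n))) [IsLocallyFiniteMeasure ν] :
    h.lp ν =ᵐ[ν] η := (h.memLp' ν).coeFn_toLp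

theorem IsTest.inner_lp {S : Set (EuclideanSpace ℝ (Fin n))} {η : EuclideanSpace ℝ (Fin n) → ℝ}
    (h : IsTest S η) {ν : Measure (EuclideanSpace ℝ (Fin n))} [IsLocallyFiniteMeasure ν]
    (f : Lp ℝ 2 ν) : inner ℝ f (h.lp ν) = ∫ x, f x * η x ∂ν :=
  inner_toLp f _

theorem eq_zero_of_test {S : Set (EuclideanSpace ℝ (Fin n))} (hS : IsOpen S) {f : L2 S}
    (hf : ∀ η, IsTest S η → ∫ x in S, f x * η x = 0) : f = 0 := by
  refine Lp.ext ?_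
  have h1 : LocallyIntegrable f ((volume : Measure (EuclideanSpace ℝ (Fin n))).restrict S) :=
    (Lp.memLp f).locallyIntegrable one_le_two
  have h2 := hS.ae_eq_zero_of_integral_contDiff_smul_eq_zero
    (μ := (volume : Measure (EuclideanSpace ℝ (Fin n))).restrict S)
    (h1.locallyIntegrableOn S) (fun g g1 g2 g3 => by
      simp only [smul_eq_mul, mul_comm (g _)]
      exact hf g ⟨g1, g2, g3⟩)
  have h3 : ∀ᵐ x ∂((volume : Measure (EuclideanSpace ℝ (Fin n))).restrict S), x ∈ S :=
    ae_restrict_mem hS.measurableSet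
  filter_upwards [h2, h3, Lp.coeFn_zero ℝ 2
    ((volume : Measure (EuclideanSpace ℝ (Fin n))).restrict S)] with x hx hx' h0
  rw [hx hx', h0, Pi.zero_apply]

theorem eq_zero_of_test_univ {f : Lp ℝ 2 (volume : Measure (EuclideanSpace ℝ (Fin n)))}
    (hf : ∀ η, IsTest Set.univ η → ∫ x, f x * η x = 0) : f = 0 := by
  refine Lp.ext ?_
  have h1 : LocallyIntegrable f (volume : Measure (EuclideanSpace ℝ (Fin n))) :=
    (Lp.memLp f).locallyIntegrable one_le_two
  have h2 := ae_eq_zero_of_integral_contDiff_smul_eq_zero h1 (fun g g1 g2 => by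
      simp only [smul_eq_mul, mul_comm (g _)]
      exact hf g ⟨g1, g2, subset_univ _⟩)
  filter_upwards [h2, Lp.coeFn_zero ℝ 2
    (volume : Measure (EuclideanSpace ℝ (Fin n)))] with x hx h0
  rw [hx, h0, Pi.zero_apply]

variable {ν : Measure (EuclideanSpace ℝ (Fin n))} [IsLocallyFiniteMeasure ν]
  [ν.InnerRegularCompactLTTop]

theorem hasDerivAt_line {η : EuclideanSpace ℝ (Fin n) → ℝ} (h : ContDiff ℝ ∞ η) (i : Fin n)
    (x : EuclideanSpace ℝ (Fin n)) (r : ℝ) :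
    HasDerivAt (fun r : ℝ => η (x + EuclideanSpace.single i r))
      (pd i η (x + EuclideanSpace.single i r)) r := by
  have h1 : HasFDerivAt η (fderiv ℝ η (x + EuclideanSpace.single i r))
      (x + EuclideanSpace.single i r) :=
    (h.differentiable (by simp) _).hasFDerivAt
  have h2 : HasDerivAt (fun r : ℝ => x + (EuclideanSpace.single i r : EuclideanSpace ℝ (Fin n)))
      (EuclideanSpace.single i 1) r := by
    have h3 : HasDerivAt (fun r : ℝ => x + r • (EuclideanSpace.single i 1 :
        EuclideanSpace ℝ (Fin n))) ((1 : ℝ) • EuclideanSpace.single i 1) r :=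
      ((hasDerivAt_id r).smul_const _).const_add x
    rw [one_smul] at h3
    refine h3.congr_of_eventuallyEq (Eventually.of_forall fun s => ?_)
    simp only
    congr 1
    ext j
    by_cases hj : j = i <;> simp [hj]
  exact h1.comp_hasDerivAt r h2

/-- The pairing of an `L²` function with a translated test function is differentiable. -/
theorem hasDerivAt_pairing (f : Lp ℝ 2 ν) {η : EuclideanSpace ℝ (Fin n) → ℝ}
    (hη : IsTest Set.univ η) (i : Fin n) :
    HasDerivAt (fun r : ℝ => ∫ x, f x * η (x + EuclideanSpace.single i r) ∂ν)
      (∫ x, f x * pd i η x ∂ν) 0 := by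
  set K := Metric.cthickening 1 (tsupport η) with hK
  have hKc : IsCompact K := hη.compact.isCompact.cthickening
  have hpd := hη.pd i
  obtain ⟨C, hC⟩ := hpd.compact.exists_bound_of_continuous hpd.smooth.continuous
  have hind : MemLp (K.indicator fun _ => C) 2 ν :=
    memLp_indicator_const 2 hKc.isClosed.measurableSet C (Or.inr hKc.measure_lt_top.ne)
  have hs0 : (EuclideanSpace.single i (0 : ℝ) : EuclideanSpace ℝ (Fin n)) = 0 := by
    ext j; simp
  have key := hasDerivAt_integral_of_dominated_loc_of_deriv_le (μ := ν) (𝕜 := ℝ)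
    (F := fun r x => f x * η (x + EuclideanSpace.single i r))
    (F' := fun r x => f x * pd i η (x + EuclideanSpace.single i r)) (x₀ := (0 : ℝ))
    (s := Metric.ball 0 1) (bound := fun x => |f x| * K.indicator (fun _ => C) x)
    (Metric.ball_mem_nhds 0 one_pos) ?_ ?_ ?_ ?_ ?_ ?_
  · simpa [hs0] using key.2
  · refine Eventually.of_forall fun r => ?_
    refine (Lp.aestronglyMeasurable f).mul ?_
    exact (hη.smooth.continuous.comp (continuous_id.add continuous_const)).aestronglyMeasurable
  · simp only [hs0, add_zero]
    exact (Lp.memLp f).integrable_mul (hη.memLp' ν)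
  · refine (Lp.aestronglyMeasurable f).mul ?_
    exact (hpd.smooth.continuous.comp (continuous_id.add continuous_const)).aestronglyMeasurable
  · refine Eventually.of_forall fun x r hr => ?_
    rw [norm_mul, Real.norm_eq_abs]
    refine mul_le_mul_of_nonneg_left ?_ (abs_nonneg _)
    by_cases hx : x ∈ K
    · rw [indicator_of_mem hx]
      exact hC _
    · rw [indicator_of_notMem hx]
      have : pd i η (x + EuclideanSpace.single i r) = 0 := by
        by_contra h0
        apply hx
        have h1 : x + EuclideanSpace.single i r ∈ tsupport η :=
          tsupport_pd_subset i η (subset_tsupport _ h0)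
        refine Metric.mem_cthickening_of_dist_le x _ 1 _ h1 ?_
        rw [dist_self_add_right, PiLp.norm_single]
        exact (mem_ball_zero_iff.mp hr).le
      rw [this, norm_zero]
  · exact (Lp.memLp f).abs.integrable_mul hind
  · refine Eventually.of_forall fun x r _ => ?_
    exact (hasDerivAt_line hη.smooth i x r).const_mul (f x)

variable {i : Fin n} {hν : ∀ s : ℝ, MeasurePreserving (fun x => x + EuclideanSpace.single i s) ν ν}

/-- On test functions, the generator of the translations is the classical partial derivative. -/
theorem gen_test {η : EuclideanSpace ℝ (Fin n) → ℝ} (hη : IsTest Set.univ η) :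
    (transFlow i hν).Gen (hη.lp ν) ((hη.pd i).lp ν) := fun s => by
  set τ := transFlow i hν with hτ
  have hT : ∀ r, τ.T r (hη.lp ν) = (hη.shift (EuclideanSpace.single i r)
      (fun _ _ => mem_univ _)).lp ν := fun r => trans_toLp _ _ _ _
  refine ext_inner_left ℝ fun f => ?_
  have hd : ∀ r, HasDerivAt (fun r => inner ℝ f (τ.T r (hη.lp ν)))
      (inner ℝ f (τ.T r ((hη.pd i).lp ν))) r := by
    intro r
    have h1 := hasDerivAt_pairing (τ.T (-r) f) hη i
    have h2 : ∀ t : ℝ, ∫ x, τ.T (-r) f x * η (x + EuclideanSpace.single i t) ∂ν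
        = inner ℝ f (τ.T (r + t) (hη.lp ν)) := by
      intro t
      rw [τ.add, ← neg_neg r, ← τ.inner_T, neg_neg, hT t, IsTest.inner_lp]
    have h3 : ∫ x, τ.T (-r) f x * pd i η x ∂ν = inner ℝ f (τ.T r ((hη.pd i).lp ν)) := by
      rw [← neg_neg r, ← τ.inner_T, neg_neg, IsTest.inner_lp]
    simp only [h2, h3] at h1
    rw [← sub_self r] at h1
    simpa using h1.comp_sub_const r r
  have h6 := intervalIntegral.integral_eq_sub_of_hasDerivAt (a := 0) (b := s) (fun r _ => hd r)
    ((Continuous.inner (𝕜 := ℝ) continuous_const (τ.cont _)).intervalIntegrable _ _)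
  rw [τ.zero] at h6
  rw [inner_sub_right, ← h6, τ.smul_avg]
  have h7 := (innerSL ℝ f).intervalIntegral_comp_comm
    ((τ.cont ((hη.pd i).lp ν)).intervalIntegrable (μ := volume) 0 s)
  simpa only [innerSL_apply_apply] using h7

/-- Weak derivatives are the generators of translations: this is the form of the statement in
which both sides are tested with a test function `η` all of whose relevant translates are
admissible in the definition of the weak derivative. -/
theorem inner_gen_test (f f' : Lp ℝ 2 ν) {η : EuclideanSpace ℝ (Fin n) → ℝ}
    (hη : IsTest Set.univ η) (s : ℝ)
    (h : ∀ t ∈ Icc (0 : ℝ) 1, ∫ x, f x * pd i η (x + EuclideanSpace.single i (-s * t)) ∂ν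
      = -∫ x, f' x * η (x + EuclideanSpace.single i (-s * t)) ∂ν) :
    inner ℝ ((transFlow i hν).T s f - f) (hη.lp ν)
      = inner ℝ (s • (transFlow i hν).avg s f') (hη.lp ν) := by
  set τ := transFlow i hν with hτ
  have hT : ∀ r, τ.T r (hη.lp ν) = (hη.shift (EuclideanSpace.single i r)
      (fun _ _ => mem_univ _)).lp ν := fun r => trans_toLp _ _ _ _
  have hT' : ∀ r, τ.T r ((hη.pd i).lp ν) = ((hη.pd i).shift (EuclideanSpace.single i r)
      (fun _ _ => mem_univ _)).lp ν := fun r => trans_toLp _ _ _ _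
  rw [inner_sub_left, τ.inner_T, ← inner_sub_right, gen_test (hν := hν) hη (-s), inner_smul_right,
    inner_smul_left, τ.inner_avg, τ.avg_apply, τ.avg_apply]
  have h1 := (innerSL ℝ f).intervalIntegral_comp_comm
    ((τ.cont_scale (-s) ((hη.pd i).lp ν)).intervalIntegrable (μ := volume) 0 1)
  have h2 := (innerSL ℝ f').intervalIntegral_comp_comm
    ((τ.cont_scale (-s) (hη.lp ν)).intervalIntegrable (μ := volume) 0 1)
  simp only [innerSL_apply_apply] at h1 h2
  rw [← h1, ← h2, RCLike.conj_to_real, neg_mul, ← mul_neg, ← intervalIntegral.integral_neg]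
  congr 1
  refine intervalIntegral.integral_congr fun t ht => ?_
  rw [uIcc_of_le zero_le_one] at ht
  rw [hT, hT', IsTest.inner_lp, IsTest.inner_lp, h t ht, neg_neg]

end Tests

/-! ### Tensor test functions and the lifting of boundary data -/

theorem isOpen_halfSpace : IsOpen halfSpace :=
  isOpen_lt continuous_const (by fun_prop)

theorem measurableSet_halfSpace : MeasurableSet halfSpace := isOpen_halfSpace.measurableSet

section Coordinates

/-- The splitting `q ↦ (z, (x, y))` of the coordinates of `ℝ³`. -/
def coord : R3 ≃ᵐ ℝ × R2 :=
  ((MeasurableEquiv.toLp 2 (Fin 3 → ℝ)).symm.trans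
    (MeasurableEquiv.piFinSuccAbove (fun _ => ℝ) 2)).trans
      (MeasurableEquiv.prodCongr (MeasurableEquiv.refl ℝ) (MeasurableEquiv.toLp 2 (Fin 2 → ℝ)))

theorem coord_apply (q : R3) : coord q = (q 2, !₂[q 0, q 1]) := by
  refine Prod.ext rfl ?_
  ext j
  fin_cases j <;> rfl

theorem coord_symm_apply (z : ℝ) (p : R2) : coord.symm (z, p) = !₂[p 0, p 1, z] := by
  rw [MeasurableEquiv.symm_apply_eq, coord_apply]
  refine Prod.ext rfl ?_
  ext j
  fin_cases j <;> rfl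

theorem measurePreserving_coord :
    MeasurePreserving coord (volume : Measure R3) ((volume : Measure ℝ).prod volume) := by
  have h1 : MeasurePreserving (MeasurableEquiv.toLp 2 (Fin 3 → ℝ)).symm volume volume :=
    PiLp.volume_preserving_ofLp (Fin 3)
  have h2 := volume_preserving_piFinSuccAbove (fun _ : Fin 3 => ℝ) 2
  have h3 : MeasurePreserving (MeasurableEquiv.prodCongr (MeasurableEquiv.refl ℝ)
      (MeasurableEquiv.toLp 2 (Fin 2 → ℝ))) ((volume : Measure ℝ).prod volume)
      ((volume : Measure ℝ).prod volume) :=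
    (MeasurePreserving.id volume).prod (PiLp.volume_preserving_toLp (Fin 2))
  exact h3.comp (h2.comp h1)

theorem measurePreserving_coord_half :
    MeasurePreserving coord ((volume : Measure R3).restrict halfSpace)
      (((volume : Measure ℝ).restrict (Ioi 0)).prod volume) := by
  have h1 := measurePreserving_coord.restrict_preimage_emb coord.measurableEmbedding
    (Ioi (0 : ℝ) ×ˢ (univ : Set R2))
  rw [← Measure.prod_restrict, Measure.restrict_univ] at h1
  have h2 : coord ⁻¹' (Ioi (0 : ℝ) ×ˢ (univ : Set R2)) = halfSpace := by
    ext q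
    simp [coord_apply, halfSpace]
  rwa [h2] at h1

/-- Projection of `ℝ³` to the boundary coordinates. -/
def toBd (q : R3) : R2 := !₂[q 0, q 1]

theorem quasiMeasurePreserving_toBd :
    Measure.QuasiMeasurePreserving toBd ((volume : Measure R3).restrict halfSpace) volume := by
  have h1 := (Measure.quasiMeasurePreserving_snd (μ := (volume : Measure ℝ).restrict (Ioi 0))
    (ν := (volume : Measure R2))).comp measurePreserving_coord_half.quasiMeasurePreserving
  have h2 : Prod.snd ∘ coord = toBd := by
    ext1 q
    simp [coord_apply, toBd]
  rwa [h2] at h1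

/-- The linear inclusion of `ℝ²` as the boundary plane of the half-space. -/
def bdIncl : R2 →L[ℝ] R3 :=
  LinearMap.toContinuousLinearMap
    { toFun := fun p => !₂[p 0, p 1, 0]
      map_add' := fun p q => by ext j; fin_cases j <;> simp
      map_smul' := fun c p => by ext j; fin_cases j <;> simp }

theorem bdIncl_apply (p : R2) : bdIncl p = !₂[p 0, p 1, 0] := rfl

theorem isClosedEmbedding_bdIncl : IsClosedEmbedding bdIncl := by
  have : Function.Injective bdIncl := by
    intro p q h
    have h0 := congrArg (fun x : R3 => x 0) h
    have h1 := congrArg (fun x : R3 => x 1) h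
    ext j
    fin_cases j
    · exact h0
    · exact h1
  exact bdIncl.toLinearMap.isClosedEmbedding_of_injective (LinearMap.ker_eq_bot.mpr this)

/-- The boundary values of a test function. -/
theorem IsTest.bd {η : R3 → ℝ} (h : IsTest univ η) :
    IsTest univ (fun p : R2 => η !₂[p 0, p 1, 0]) where
  smooth := h.smooth.comp bdIncl.contDiff
  compact := h.compact.comp_isClosedEmbedding isClosedEmbedding_bdIncl
  supp := subset_univ _

/-- The divergence theorem on the half-space, for test functions: integration along vertical lines. -/
theorem integral_pd_half {F : R3 → ℝ} (hF : IsTest univ F) :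
    ∫ q in halfSpace, pd 2 F q = -∫ p : R2, F !₂[p 0, p 1, 0] := by
  have hint : Integrable (pd 2 F) ((volume : Measure R3).restrict halfSpace) :=
    ((hF.pd 2).smooth.continuous.integrable_of_hasCompactSupport (hF.pd 2).compact).restrict
  have h0 : pd 2 F = (fun w => pd 2 F (coord.symm w)) ∘ coord := by
    ext q; simp
  have h1 := measurePreserving_coord_half.integral_comp coord.measurableEmbedding
    (fun w => pd 2 F (coord.symm w))
  rw [h0] at hint
  have hint2 := (measurePreserving_coord_half.integrable_comp_emb
    coord.measurableEmbedding).mp hint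
  simp only [MeasurableEquiv.symm_apply_apply] at h1
  rw [h1, integral_prod_symm _ hint2, ← integral_neg]
  congr 1
  ext p
  simp only [coord_symm_apply]
  set c : ℝ → R3 := fun z => !₂[p 0, p 1, z] with hc
  have hcs : ∀ z, c z = c 0 + EuclideanSpace.single 2 z := by
    intro z
    ext j
    fin_cases j <;> simp [hc]
  have hd : ∀ z, HasDerivAt (fun z => F (c z)) (pd 2 F (c z)) z := by
    intro z
    have := hasDerivAt_line hF.smooth 2 (c 0) z
    simpa only [← hcs] using this
  have hcd : ContDiff ℝ ∞ c := by
    have : c = fun z => c 0 + z • EuclideanSpace.single 2 (1 : ℝ) := by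
      ext z j
      fin_cases j <;> simp [hc]
    rw [this]
    fun_prop
  have hce : IsClosedEmbedding c := by
    refine Isometry.isClosedEmbedding ?_
    refine Isometry.of_dist_eq fun z w => ?_
    rw [hcs z, hcs w, dist_add_left, dist_eq_norm, ← PiLp.single_sub, PiLp.norm_single,
      Real.dist_eq, Real.norm_eq_abs]
  have hcomp : HasCompactSupport (fun z => F (c z)) :=
    hF.compact.comp_isClosedEmbedding hce
  have h2 := hcomp.integral_Ioi_deriv_eq ((hF.smooth.comp hcd).of_le (by simp)) 0
  refine Eq.trans ?_ h2
  refine integral_congr_ae (Eventually.of_forall fun z => ?_)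
  exact (hd z).deriv.symm

end Coordinates

section Lift

theorem memLp_lift (g : Lp ℝ 2 (volume : Measure R2)) :
    MemLp (fun w : ℝ × R2 => Real.exp (-w.1) * g w.2) 2
      (((volume : Measure ℝ).restrict (Ioi 0)).prod volume) := by
  have hm : AEStronglyMeasurable (fun w : ℝ × R2 => Real.exp (-w.1) * g w.2)
      (((volume : Measure ℝ).restrict (Ioi 0)).prod volume) := by
    have h1 : AEStronglyMeasurable (fun w : ℝ × R2 => g w.2)
        (((volume : Measure ℝ).restrict (Ioi 0)).prod volume) :=
      (Lp.aestronglyMeasurable g).comp_snd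
    have h2 : Continuous fun w : ℝ × R2 => Real.exp (-w.1) := by fun_prop
    exact h2.aestronglyMeasurable.mul h1
  rw [memLp_two_iff_integrable_sq hm]
  simp only [mul_pow, ← Real.exp_nat_mul]
  have h3 : Integrable (fun z : ℝ => Real.exp (((2 : ℕ) : ℝ) * -z))
      ((volume : Measure ℝ).restrict (Ioi 0)) := by
    have := integrableOn_exp_mul_Ioi (a := (-2 : ℝ)) (by norm_num) 0
    refine IntegrableOn.congr_fun this (fun z _ => ?_) measurableSet_Ioi
    congr 1
    push_cast
    ring
  exact h3.mul_prod (Lp.memLp g).integrable_sq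

theorem memLp_lift' (g : Lp ℝ 2 (volume : Measure R2)) :
    MemLp (fun q : R3 => Real.exp (-q 2) * g (toBd q)) 2
      ((volume : Measure R3).restrict halfSpace) := by
  have := (memLp_lift g).comp_measurePreserving measurePreserving_coord_half
  convert! this using 1
  ext q
  simp [coord_apply, toBd]

theorem norm_lift_le (g : Lp ℝ 2 (volume : Measure R2)) : ‖(memLp_lift' g).toLp _‖ ≤ 1 * ‖g‖ := by
  rw [one_mul]
  refine abs_le_of_sq_le_sq' ?_ (norm_nonneg g) |>.2
  rw [← real_inner_self_eq_norm_sq, ← real_inner_self_eq_norm_sq, inner_toLp, inner_eq_integral]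
  have h1 : ∫ q in halfSpace, (memLp_lift' g).toLp _ q * (Real.exp (-q 2) * g (toBd q))
      = ∫ q in halfSpace, (fun w : ℝ × R2 => Real.exp (-w.1) ^ 2 * (g w.2 * g w.2)) (coord q) := by
    refine integral_congr_ae ?_
    filter_upwards [(memLp_lift' g).coeFn_toLp] with q hq
    rw [hq, coord_apply]
    simp only [toBd]
    ring
  have h1' := measurePreserving_coord_half.integral_comp coord.measurableEmbedding
    (fun w : ℝ × R2 => Real.exp (-w.1) ^ 2 * (g w.2 * g w.2))
  rw [h1, h1']
  have h2 := integral_prod_mul (μ := (volume : Measure ℝ).restrict (Ioi 0))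
    (ν := (volume : Measure R2)) (fun z => Real.exp (-z) ^ 2) (fun p => g p * g p)
  rw [h2]
  have h3 : ∫ z in Ioi (0 : ℝ), Real.exp (-z) ^ 2 ≤ 1 := by
    have h4 := integral_exp_mul_Ioi (a := (-2 : ℝ)) (by norm_num) 0
    have h5 : ∀ z : ℝ, Real.exp (-z) ^ 2 = Real.exp (-2 * z) := fun z => by
      rw [← Real.exp_nat_mul]; push_cast; ring_nf
    simp only [h5, h4]
    norm_num
  have h4 : 0 ≤ ∫ p, g p * g p := integral_nonneg fun p => mul_self_nonneg _
  nlinarith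

/-- The bounded lifting `(Λg)(x, y, z) = e^{-z} g(x, y)` of boundary functions. -/
def lift : Lp ℝ 2 (volume : Measure R2) →L[ℝ] L2 halfSpace :=
  LinearMap.mkContinuous
    { toFun := fun g => (memLp_lift' g).toLp _
      map_add' := fun g g' => by
        refine Lp.ext ?_
        have h1 := quasiMeasurePreserving_toBd.ae_eq_comp (Lp.coeFn_add g g')
        filter_upwards [(memLp_lift' (g + g')).coeFn_toLp, (memLp_lift' g).coeFn_toLp,
          (memLp_lift' g').coeFn_toLp, h1,
          Lp.coeFn_add ((memLp_lift' g).toLp _) ((memLp_lift' g').toLp _)] with q e1 e2 e3 e4 e5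
        simp only [Function.comp, Pi.add_apply] at e4
        rw [e1, e5, Pi.add_apply, e2, e3, e4]
        ring
      map_smul' := fun c g => by
        refine Lp.ext ?_
        have h1 := quasiMeasurePreserving_toBd.ae_eq_comp (Lp.coeFn_smul c g)
        filter_upwards [(memLp_lift' (c • g)).coeFn_toLp, (memLp_lift' g).coeFn_toLp, h1,
          Lp.coeFn_smul c ((memLp_lift' g).toLp _)] with q e1 e2 e4 e5
        simp only [Function.comp, Pi.smul_apply, smul_eq_mul] at e4
        simp only [RingHom.id_apply]
        rw [e1, e5, Pi.smul_apply, e2, e4, smul_eq_mul]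
        ring } 1 norm_lift_le

theorem lift_ae (g : Lp ℝ 2 (volume : Measure R2)) :
    lift g =ᵐ[(volume : Measure R3).restrict halfSpace]
      fun q => Real.exp (-q 2) * g (toBd q) := (memLp_lift' g).coeFn_toLp

/-- The product of a test function on the boundary plane with a cut-off `χ` in the transversal
variable; if `χ(0) = 1`, it extends the test function to `ℝ³`. -/
theorem isTest_tensor {ζ : R2 → ℝ} (hζ : IsTest univ ζ) {χ : ℝ → ℝ} (h1 : ContDiff ℝ ∞ χ)
    (h2 : HasCompactSupport χ) : IsTest univ (fun q : R3 => χ (q 2) * ζ (toBd q)) where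
  smooth := by
    have h3 : ContDiff ℝ ∞ toBd := by
      unfold toBd
      rw [contDiff_piLp]
      intro j
      fin_cases j <;> simp <;> fun_prop
    have h4 : ContDiff ℝ ∞ fun q : R3 => q 2 := by fun_prop
    exact (h1.comp h4).mul (hζ.smooth.comp h3)
  compact := by
    have hK : IsCompact ((fun w : ℝ × R2 => bdIncl w.2 + EuclideanSpace.single 2 w.1) ''
        (tsupport χ ×ˢ tsupport ζ)) := by
      refine (h2.isCompact.prod hζ.compact.isCompact).image ?_
      have h5 : ∀ z : ℝ, (EuclideanSpace.single 2 z : R3) = z • EuclideanSpace.single 2 1 :=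
        fun z => by ext j; fin_cases j <;> simp
      have h6 : Continuous fun w : ℝ × R2 =>
          bdIncl w.2 + w.1 • (EuclideanSpace.single 2 1 : R3) := by fun_prop
      refine h6.congr fun w => ?_
      rw [h5 w.1]
    refine HasCompactSupport.intro hK fun q hq => ?_
    by_contra h0
    refine hq ⟨(q 2, toBd q), ⟨?_, ?_⟩, ?_⟩
    · exact subset_tsupport _ fun h => h0 (by simp only [h, zero_mul])
    · exact subset_tsupport _ fun h => h0 (by simp only [h, mul_zero])
    · ext j
      fin_cases j <;> simp [bdIncl_apply, toBd]
  supp := subset_univ _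

end Lift

/-! ### Extension by zero, tangential translations and Green's formula -/

section Extension

variable {n : ℕ} (S : Set (EuclideanSpace ℝ (Fin n)))

/-- Restriction of `L²(ℝⁿ)` functions to `S`. -/
def rest : Lp ℝ 2 (volume : Measure (EuclideanSpace ℝ (Fin n))) →L[ℝ] L2 S :=
  LpToLpRestrictCLM _ ℝ ℝ volume 2 S

/-- Extension of `L²(S)` functions by zero, defined as the adjoint of the restriction. -/
def ext : L2 S →L[ℝ] Lp ℝ 2 (volume : Measure (EuclideanSpace ℝ (Fin n))) :=
  ContinuousLinearMap.adjoint (rest S)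

variable {S}

theorem rest_ae (f : Lp ℝ 2 (volume : Measure (EuclideanSpace ℝ (Fin n)))) :
    rest S f =ᵐ[(volume : Measure (EuclideanSpace ℝ (Fin n))).restrict S] f :=
  LpToLpRestrictCLM_coeFn ℝ S f

theorem inner_ext (f : L2 S) (g : Lp ℝ 2 (volume : Measure (EuclideanSpace ℝ (Fin n)))) :
    inner ℝ (ext S f) g = inner ℝ f (rest S g) :=
  ContinuousLinearMap.adjoint_inner_left _ _ _

theorem inner_ext' (f : L2 S) (g : Lp ℝ 2 (volume : Measure (EuclideanSpace ℝ (Fin n)))) :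
    inner ℝ (ext S f) g = ∫ x in S, f x * g x := by
  rw [inner_ext, inner_eq_integral]
  refine integral_congr_ae ?_
  filter_upwards [rest_ae (S := S) g] with x hx
  rw [hx]

theorem rest_ext (hS : MeasurableSet S) (f : L2 S) : rest S (ext S f) = f := by
  have hm : MemLp (S.indicator f) 2 (volume : Measure (EuclideanSpace ℝ (Fin n))) :=
    (memLp_indicator_iff_restrict hS).mpr (Lp.memLp f)
  have h1 : ext S f = hm.toLp _ := by
    refine ext_inner_right ℝ fun g => ?_
    rw [inner_ext', real_inner_comm, inner_toLp, ← integral_indicator hS]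
    congr 1
    ext x
    by_cases hx : x ∈ S <;> simp [hx, mul_comm]
  refine Lp.ext ?_
  filter_upwards [rest_ae (S := S) (ext S f), ae_restrict_of_ae (s := S) (hm.coeFn_toLp),
    ae_restrict_mem hS] with x h2 h3 h4
  rw [h2, h1, h3, indicator_of_mem h4]

theorem rest_lp {S' : Set (EuclideanSpace ℝ (Fin n))} {η : EuclideanSpace ℝ (Fin n) → ℝ}
    (h : IsTest S' η) : rest S (h.lp volume) = h.lp (volume.restrict S) := by
  refine Lp.ext ?_
  filter_upwards [rest_ae (S := S) (h.lp volume), h.lp_ae (volume.restrict S),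
    ae_restrict_of_ae (s := S) (h.lp_ae volume)] with x h1 h2 h3
  rw [h1, h2, h3]

theorem inner_ext_test (f : L2 S) {S' : Set (EuclideanSpace ℝ (Fin n))}
    {η : EuclideanSpace ℝ (Fin n) → ℝ} (h : IsTest S' η) :
    inner ℝ (ext S f) (h.lp volume) = ∫ x in S, f x * η x := by
  rw [inner_ext, rest_lp, IsTest.inner_lp]

theorem ext_lp {η : EuclideanSpace ℝ (Fin n) → ℝ} (h : IsTest S η) :
    ext S (h.lp (volume.restrict S)) = h.lp volume := by
  refine ext_inner_right ℝ fun g => ?_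
  rw [inner_ext', real_inner_comm, IsTest.inner_lp]
  have h1 : ∫ x in S, h.lp (volume.restrict S) x * g x = ∫ x in S, g x * η x := by
    refine integral_congr_ae ?_
    filter_upwards [h.lp_ae (volume.restrict S)] with x hx
    rw [hx, mul_comm]
  rw [h1]
  refine setIntegral_eq_integral_of_forall_compl_eq_zero fun x hx => ?_
  rw [image_eq_zero_of_notMem_tsupport fun h' => hx (h.supp h'), mul_zero]

end Extension

section Representations

theorem measurePreserving_add {n : ℕ} (c : EuclideanSpace ℝ (Fin n)) :
    MeasurePreserving (fun x => x + c) (volume : Measure (EuclideanSpace ℝ (Fin n))) volume :=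
  measurePreserving_add_right volume c

theorem measurePreserving_half (i : Fin 2) (s : ℝ) :
    MeasurePreserving (fun x => x + EuclideanSpace.single i.castSucc s)
      ((volume : Measure R3).restrict halfSpace) ((volume : Measure R3).restrict halfSpace) := by
  have h := (measurePreserving_add (EuclideanSpace.single i.castSucc s : R3)).restrict_preimage
    measurableSet_halfSpace
  have h2 : (fun x : R3 => x + EuclideanSpace.single i.castSucc s) ⁻¹' halfSpace = halfSpace := by
    ext q
    fin_cases i <;> simp [halfSpace]
  rwa [h2] at h

theorem trans_comm {n : ℕ} {ν : Measure (EuclideanSpace ℝ (Fin n))}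
    (c d : EuclideanSpace ℝ (Fin n)) (hc : MeasurePreserving (fun x => x + c) ν ν)
    (hd : MeasurePreserving (fun x => x + d) ν ν) (f : Lp ℝ 2 ν) :
    trans c hc (trans d hd f) = trans d hd (trans c hc f) := by
  have h : MeasurePreserving (fun x => x + (c + d)) ν ν := by
    have h1 := hd.comp hc
    have h2 : (fun x => x + d) ∘ (fun x => x + c) = fun x => x + (c + d) := by
      ext1 x
      simp [add_assoc]
    rwa [h2] at h1
  rw [trans_trans c d _ hc hd h rfl, trans_trans d c _ hd hc h (add_comm d c)]

/-- Tangential translations on `L²` of the half-space. -/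
def halfRep : Rep (L2 halfSpace) where
  flow i := transFlow i.castSucc (measurePreserving_half i)
  comm _ _ _ _ x := trans_comm _ _ _ _ x

/-- Translations on `L²(ℝ²)`. -/
def bdRep : Rep (Lp ℝ 2 (volume : Measure R2)) where
  flow i := transFlow i fun _ => measurePreserving_add _
  comm _ _ _ _ x := trans_comm _ _ _ _ x

/-- Transversal translations on `L²(ℝ³)`. -/
def zFlow : Flow (Lp ℝ 2 (volume : Measure R3)) :=
  transFlow 2 fun _ => measurePreserving_add _

theorem mem_half_add (i : Fin 2) (s : ℝ) (q : R3) :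
    q + EuclideanSpace.single i.castSucc s ∈ halfSpace ↔ q ∈ halfSpace := by
  fin_cases i <;> simp [halfSpace]

/-- Weak tangential derivatives are the generators of the tangential translations, as these map
`C₀^∞` of the half-space into itself. -/
theorem HasWeakPartial.gen_half {i : Fin 2} {f f' : L2 halfSpace}
    (h : HasWeakPartial halfSpace i.castSucc f f') : (halfRep.flow i).Gen f f' := fun s => by
  rw [← sub_eq_zero]
  refine eq_zero_of_test isOpen_halfSpace fun η hη => ?_
  rw [← hη.toUniv.inner_lp, inner_sub_left, sub_eq_zero]
  refine inner_gen_test f f' hη.toUniv s fun t _ => ?_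
  have h1 := h _ (hη.shift (EuclideanSpace.single i.castSucc (-s * t))
    fun x hx => (mem_half_add i _ x).mp hx)
  simp only [pd_shift] at h1
  exact h1

end Representations

section Trace

/-- `f'` is the weak transversal derivative of `f` also across the boundary, once both are
extended by zero; that is, `f` has zero trace. -/
def ZeroTrace (f f' : L2 halfSpace) : Prop :=
  ∀ η : R3 → ℝ, ∀ h : IsTest univ η,
    inner ℝ f' (h.lp (volume.restrict halfSpace))
      + inner ℝ f ((h.pd 2).lp (volume.restrict halfSpace)) = 0

/-- For functions with zero trace, the transversal derivative of the extension by zero is the extension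
of the derivative. -/
theorem ZeroTrace.gen {f f' : L2 halfSpace} (h : ZeroTrace f f') :
    zFlow.Gen (ext halfSpace f) (ext halfSpace f') := fun s => by
  rw [← sub_eq_zero]
  refine eq_zero_of_test_univ fun η hη => ?_
  rw [← hη.inner_lp, inner_sub_left, sub_eq_zero]
  refine inner_gen_test _ _ hη s fun t _ => ?_
  set ζ := hη.shift (EuclideanSpace.single 2 (-s * t)) (fun x _ => mem_univ x) with hζ
  have h1 := h _ ζ
  have h2 : ∫ x, ext halfSpace f x * pd 2 η (x + EuclideanSpace.single 2 (-s * t))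
      = inner ℝ f ((ζ.pd 2).lp (volume.restrict halfSpace)) := by
    rw [← rest_lp, ← inner_ext, IsTest.inner_lp]
    simp only [pd_shift]
  have h3 : ∫ x, ext halfSpace f' x * η (x + EuclideanSpace.single 2 (-s * t))
      = inner ℝ f' (ζ.lp (volume.restrict halfSpace)) := by
    rw [← rest_lp, ← inner_ext, IsTest.inner_lp]
  rw [h2, h3]
  linarith

/-- A function with a weak transversal derivative may be shifted into the half-space. -/
theorem HasWeakPartial.rest_shift {f f' : L2 halfSpace} (h : HasWeakPartial halfSpace 2 f f')
    {s : ℝ} (hs : 0 ≤ s) :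
    rest halfSpace (zFlow.T s (ext halfSpace f) - ext halfSpace f)
      = rest halfSpace (s • zFlow.avg s (ext halfSpace f')) := by
  rw [← sub_eq_zero, ← map_sub]
  refine eq_zero_of_test isOpen_halfSpace fun η hη => ?_
  rw [← hη.inner_lp, real_inner_comm, ← inner_ext, ext_lp, real_inner_comm, inner_sub_left,
    sub_eq_zero]
  refine inner_gen_test _ _ hη.toUniv s fun t ht => ?_
  have ζ := hη.shift (S' := halfSpace) (EuclideanSpace.single 2 (-s * t)) (fun x hx => by
    have h2 : 0 < x 2 + -s * t := by simpa [halfSpace] using hx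
    have h3 : 0 ≤ s * t := mul_nonneg hs ht.1
    have h4 : 0 < x 2 := by linarith
    exact h4)
  have h1 := h _ ζ
  have h2 : ∫ x, ext halfSpace f x * pd 2 η (x + EuclideanSpace.single 2 (-s * t))
      = ∫ x in halfSpace, f x * pd 2 (fun y => η (y + EuclideanSpace.single 2 (-s * t))) x := by
    rw [← inner_ext_test f (ζ.pd 2), IsTest.inner_lp]
    simp only [pd_shift]
  have h3 : ∫ x, ext halfSpace f' x * η (x + EuclideanSpace.single 2 (-s * t))
      = ∫ x in halfSpace, f' x * η (x + EuclideanSpace.single 2 (-s * t)) := by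
    rw [← inner_ext_test f' ζ, IsTest.inner_lp]
  rw [h2, h3]
  exact h1

/-- Green's formula without boundary term, when one of the two functions has zero trace: both
sides are the derivative at `0+` of the pairing of one function with the shift of the other. -/
theorem ZeroTrace.green {f f' g g' : L2 halfSpace} (h : ZeroTrace f f')
    (hg : HasWeakPartial halfSpace 2 g g') : inner ℝ f g' + inner ℝ f' g = 0 := by
  set F := ext halfSpace f
  set F' := ext halfSpace f'
  set G := ext halfSpace g
  set G' := ext halfSpace g'
  have hF : zFlow.Gen F F' := h.gen
  have e1 : inner ℝ F G' = inner ℝ f g' := by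
    rw [inner_ext, rest_ext measurableSet_halfSpace]
  have e2 : inner ℝ F' G = inner ℝ f' g := by
    rw [inner_ext, rest_ext measurableSet_halfSpace]
  rw [← e1, ← e2]
  have h1 : Tendsto (fun s : ℝ => inner ℝ F (zFlow.avg s G')) (𝓝[>] 0) (𝓝 (inner ℝ F G')) := by
    have hc : Continuous fun s : ℝ => inner ℝ F (zFlow.avg s G') :=
      Continuous.inner (𝕜 := ℝ) continuous_const (zFlow.continuous_avg G')
    have := hc.tendsto 0
    rw [Flow.avg_zero] at this
    exact this.mono_left nhdsWithin_le_nhds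
  have h2 : Tendsto (fun s : ℝ => -inner ℝ (zFlow.avg (-s) F') G) (𝓝[>] 0)
      (𝓝 (-inner ℝ F' G)) := by
    have hc : Continuous fun s : ℝ => -inner ℝ (zFlow.avg (-s) F') G :=
      (Continuous.inner (𝕜 := ℝ) ((zFlow.continuous_avg F').comp continuous_neg)
        continuous_const).neg
    have := hc.tendsto 0
    simp only [neg_zero, Flow.avg_zero] at this
    exact this.mono_left nhdsWithin_le_nhds
  have h3 : inner ℝ F G' = -inner ℝ F' G := by
    refine tendsto_nhds_unique h1 (h2.congr' ?_)
    filter_upwards [self_mem_nhdsWithin] with s hs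
    have hs : 0 < s := hs
    have a1 : inner ℝ F (zFlow.T s G - G) = inner ℝ F (s • zFlow.avg s G') := by
      rw [inner_ext, inner_ext, hg.rest_shift hs.le]
    have a2 := congrArg (fun x => inner ℝ x G) (hF (-s))
    simp only [inner_sub_left, inner_sub_right, inner_smul_left, inner_smul_right, Flow.inner_T,
      RCLike.conj_to_real, neg_neg] at a1 a2
    have : s * (-inner ℝ (zFlow.avg (-s) F') G) = s * inner ℝ F (zFlow.avg s G') := by linarith
    exact mul_left_cancel₀ hs.ne' this
  linarith

/-- The adjoint `Λ*` of the lifting `Λ = lift`. -/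
def liftAdj : L2 halfSpace →L[ℝ] Lp ℝ 2 (volume : Measure R2) := ContinuousLinearMap.adjoint lift

theorem inner_liftAdj (f : L2 halfSpace) (g : Lp ℝ 2 (volume : Measure R2)) :
    inner ℝ (liftAdj f) g = inner ℝ f (lift g) := ContinuousLinearMap.adjoint_inner_left _ _ _

theorem pd_mul {n : ℕ} {F G : EuclideanSpace ℝ (Fin n) → ℝ} (hF : ContDiff ℝ ∞ F)
    (hG : ContDiff ℝ ∞ G) (i : Fin n) (x : EuclideanSpace ℝ (Fin n)) :
    pd i (fun x => F x * G x) x = pd i F x * G x + F x * pd i G x := by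
  unfold pd
  have h1 := (hF.differentiable (by simp) x)
  have h2 := (hG.differentiable (by simp) x)
  have : fderiv ℝ (fun x => F x * G x) x = F x • fderiv ℝ G x + G x • fderiv ℝ F x :=
    fderiv_mul h1 h2
  rw [this]
  simp only [add_apply, smul_apply, smul_eq_mul]
  ring

theorem IsTest.mul_smooth {n : ℕ} {S : Set (EuclideanSpace ℝ (Fin n))}
    {F G : EuclideanSpace ℝ (Fin n) → ℝ} (hF : IsTest S F) (hG : ContDiff ℝ ∞ G) :
    IsTest S (fun x => F x * G x) where
  smooth := hF.smooth.mul hG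
  compact := hF.compact.mul_right
  supp := (tsupport_mul_subset_left).trans hF.supp

theorem green_test {η ζ : R3 → ℝ} (hη : IsTest univ η) (hζ : IsTest univ ζ) :
    inner ℝ (hη.lp (volume.restrict halfSpace)) ((hζ.pd 2).lp (volume.restrict halfSpace))
      + inner ℝ ((hη.pd 2).lp (volume.restrict halfSpace)) (hζ.lp (volume.restrict halfSpace))
    = -inner ℝ (hη.bd.lp volume) (hζ.bd.lp volume) := by
  have h1 := integral_pd_half (hη.mul_smooth hζ.smooth)
  rw [IsTest.inner_lp, IsTest.inner_lp, IsTest.inner_lp, ← integral_add]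
  · refine Eq.trans ?_ (h1.trans ?_)
    · refine integral_congr_ae ?_
      filter_upwards [hη.lp_ae (volume.restrict halfSpace),
        (hη.pd 2).lp_ae (volume.restrict halfSpace)] with x e1 e2
      rw [e1, e2, pd_mul hη.smooth hζ.smooth, add_comm]
    · congr 1
      refine integral_congr_ae ?_
      filter_upwards [hη.bd.lp_ae volume] with x e1
      rw [e1]
  · exact (Lp.memLp _).integrable_mul ((hζ.pd 2).memLp' _)
  · exact (Lp.memLp _).integrable_mul (hζ.memLp' _)

/-- On test functions, `Λ* (η - η_z)` is the boundary value of `η`, since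
`∂_z (e^{-z} η) = -e^{-z} (η - η_z)`. -/
theorem liftAdj_test {η : R3 → ℝ} (hη : IsTest univ η) :
    liftAdj (hη.lp (volume.restrict halfSpace) - (hη.pd 2).lp (volume.restrict halfSpace))
      = hη.bd.lp volume := by
  rw [← sub_eq_zero]
  refine eq_zero_of_test_univ fun ζ hζ => ?_
  rw [← hζ.inner_lp, inner_sub_left, inner_liftAdj, sub_eq_zero, IsTest.inner_lp]
  have hE : ContDiff ℝ ∞ fun q : R3 => Real.exp (-q 2) := by fun_prop
  have hB : ContDiff ℝ ∞ toBd := by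
    unfold toBd
    rw [contDiff_piLp]
    intro j
    fin_cases j <;> simp <;> fun_prop
  have hG : ContDiff ℝ ∞ fun q : R3 => Real.exp (-q 2) * ζ (toBd q) :=
    hE.mul (hζ.smooth.comp hB)
  have h1 := integral_pd_half (hη.mul_smooth hG)
  have hpd : ∀ q, pd 2 (fun q : R3 => Real.exp (-q 2) * ζ (toBd q)) q
      = -(Real.exp (-q 2) * ζ (toBd q)) := by
    intro q
    have a1 := hasDerivAt_line hG 2 q 0
    have a2 : HasDerivAt (fun r : ℝ => Real.exp (-(q 2 + r)) * ζ (toBd q))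
        (-(Real.exp (-q 2) * ζ (toBd q))) 0 := by
      have b : HasDerivAt (fun r : ℝ => Real.exp (-(q 2 + r))) (-Real.exp (-q 2)) 0 := by
        have c : HasDerivAt (fun r : ℝ => -(q 2 + r)) (-1) 0 :=
          ((hasDerivAt_id (0 : ℝ)).const_add (q 2)).neg
        have := c.exp
        simpa using this
      have := b.mul_const (ζ (toBd q))
      rwa [neg_mul] at this
    have hz : (EuclideanSpace.single 2 (0 : ℝ) : R3) = 0 := by ext j; simp
    rw [hz, add_zero] at a1
    refine a1.unique (a2.congr_of_eventuallyEq (Eventually.of_forall fun r => ?_))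
    have h3 : toBd (q + EuclideanSpace.single 2 r) = toBd q := by
      ext j
      fin_cases j <;> simp [toBd]
    simp [h3]
  have h2 : inner ℝ (hη.lp (volume.restrict halfSpace) - (hη.pd 2).lp (volume.restrict halfSpace))
      (lift (hζ.lp volume)) = -∫ q in halfSpace,
        pd 2 (fun q => η q * (Real.exp (-q 2) * ζ (toBd q))) q := by
    rw [inner_eq_integral, ← integral_neg]
    refine integral_congr_ae ?_
    have e0 := quasiMeasurePreserving_toBd.ae_eq_comp (hζ.lp_ae volume)
    filter_upwards [hη.lp_ae (volume.restrict halfSpace),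
      (hη.pd 2).lp_ae (volume.restrict halfSpace), lift_ae (hζ.lp volume), e0,
      Lp.coeFn_sub (hη.lp (volume.restrict halfSpace))
        ((hη.pd 2).lp (volume.restrict halfSpace))] with q e1 e2 e3 e4 e5
    simp only [Function.comp] at e4
    rw [e5, Pi.sub_apply, e1, e2, e3, e4, pd_mul hη.smooth hG, hpd]
    ring
  rw [h2, h1, neg_neg]
  refine integral_congr_ae ?_
  filter_upwards [hη.bd.lp_ae volume] with p e1
  rw [e1]
  have : toBd (!₂[p 0, p 1, 0] : R3) = p := by
    ext j
    fin_cases j <;> simp [toBd]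
  rw [this]
  simp

/-- Subtraction of the lifting of the boundary values, whose transversal derivative is `-Λg`, leaves a
function with zero trace. -/
theorem zeroTrace_test {η : R3 → ℝ} (hη : IsTest univ η) :
    ZeroTrace (hη.lp (volume.restrict halfSpace) - lift (hη.bd.lp volume))
      ((hη.pd 2).lp (volume.restrict halfSpace) + lift (hη.bd.lp volume)) := by
  intro ζ hζ
  have h1 := green_test hη hζ
  have h2 := congrArg (fun x => inner ℝ x (hη.bd.lp volume)) (liftAdj_test hζ)
  simp only [inner_liftAdj, inner_sub_left] at h2
  rw [inner_add_left, inner_sub_left, real_inner_comm _ (lift _), real_inner_comm _ (lift _)]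
  rw [real_inner_comm] at h1
  rw [real_inner_comm (hζ.bd.lp volume)] at h1
  rw [real_inner_comm _ ((hζ.pd 2).lp (volume.restrict halfSpace)),
    real_inner_comm (hη.bd.lp volume) (hζ.bd.lp volume)] at *
  linarith

/-- The trace of a function with a weak transversal derivative, tested with `C₀^∞(ℝ³)`. -/
theorem HasWeakPartial.trace_test {f f' : L2 halfSpace} (h : HasWeakPartial halfSpace 2 f f')
    {η : R3 → ℝ} (hη : IsTest univ η) :
    inner ℝ f' (hη.lp (volume.restrict halfSpace))
      + inner ℝ f ((hη.pd 2).lp (volume.restrict halfSpace))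
      = -inner ℝ (liftAdj (f - f')) (hη.bd.lp volume) := by
  have h1 := (zeroTrace_test hη).green h
  rw [inner_liftAdj]
  simp only [inner_sub_left, inner_add_left] at h1 ⊢
  have c1 := real_inner_comm f' (hη.lp (volume.restrict halfSpace))
  have c2 := real_inner_comm f ((hη.pd 2).lp (volume.restrict halfSpace))
  have c3 := real_inner_comm f (lift (hη.bd.lp volume))
  have c4 := real_inner_comm f' (lift (hη.bd.lp volume))
  linarith

/-- The trace of `f` is `Λ* (f - f_z)`: when its lifting is subtracted, a function with zero trace
remains. -/
theorem HasWeakPartial.zeroTrace {f f' : L2 halfSpace} (h : HasWeakPartial halfSpace 2 f f') :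
    ZeroTrace (f - lift (liftAdj (f - f'))) (f' + lift (liftAdj (f - f'))) := by
  intro ζ hζ
  have h1 := h.trace_test hζ
  have h2 := congrArg (fun x => inner ℝ x (liftAdj (f - f'))) (liftAdj_test hζ)
  simp only [inner_liftAdj _ (liftAdj _), inner_sub_left] at h2
  rw [real_inner_comm (hζ.bd.lp volume)] at h1
  rw [inner_add_left, inner_sub_left, real_inner_comm _ (lift _), real_inner_comm _ (lift _)]
  linarith

/-- Green's formula in the transversal variable. -/
theorem HasWeakPartial.green {f f' g g' : L2 halfSpace} (h : HasWeakPartial halfSpace 2 f f')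
    (hg : HasWeakPartial halfSpace 2 g g') :
    inner ℝ f g' + inner ℝ f' g = -inner ℝ (liftAdj (f - f')) (liftAdj (g - g')) := by
  have h1 := h.zeroTrace.green hg
  rw [real_inner_comm (liftAdj (g - g')), inner_liftAdj]
  simp only [inner_sub_left, inner_add_left] at h1 ⊢
  have c1 := real_inner_comm g (lift (liftAdj (f - f')))
  have c2 := real_inner_comm g' (lift (liftAdj (f - f')))
  linarith

theorem intertwines_liftAdj : Intertwines halfRep bdRep liftAdj := by
  have h1 : ∀ i s g, lift ((bdRep.flow i).T s g) = (halfRep.flow i).T s (lift g) := by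
    intro i s g
    refine Lp.ext ?_
    have e2 := quasiMeasurePreserving_toBd.ae_eq_comp
      (trans_ae (EuclideanSpace.single i s) (measurePreserving_add _) g)
    have e4 := (measurePreserving_half i s).quasiMeasurePreserving.ae_eq_comp (lift_ae g)
    filter_upwards [lift_ae ((bdRep.flow i).T s g), e2,
      trans_ae _ (measurePreserving_half i s) (lift g), e4] with q a1 a2 a3 a4
    simp only [Function.comp] at a2 a4
    refine a1.trans (Eq.trans ?_ a3.symm)
    refine Eq.trans ?_ a4.symm
    refine (congrArg (fun x => Real.exp (-q 2) * x) a2).trans ?_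
    congr 2
    · fin_cases i <;> simp
    · ext j
      fin_cases i <;> fin_cases j <;> simp [toBd]
  intro i s f
  refine ext_inner_right ℝ fun g => ?_
  rw [inner_liftAdj, Flow.inner_T, Flow.inner_T, inner_liftAdj, h1]

end Trace

/-! ### The space H¹ of the half-space -/

section H1

variable {n : ℕ} {S : Set (EuclideanSpace ℝ (Fin n))}

theorem hasWeakPartial_iff {i : Fin n} {f g : L2 S} :
    HasWeakPartial S i f g ↔ ∀ η : EuclideanSpace ℝ (Fin n) → ℝ, ∀ h : IsTest S η,
      inner ℝ f ((h.pd i).lp (volume.restrict S)) = -inner ℝ g (h.lp (volume.restrict S)) := by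
  constructor
  · intro h η hη
    rw [IsTest.inner_lp, IsTest.inner_lp]
    exact h η hη
  · intro h η hη
    have := h η hη
    rwa [IsTest.inner_lp, IsTest.inner_lp] at this

theorem isClosed_H1 : IsClosed (H1 S : Set (PiLp 2 (fun _ : Option (Fin n) => L2 S))) := by
  have : (H1 S : Set (PiLp 2 (fun _ : Option (Fin n) => L2 S))) =
      ⋂ (i : Fin n) (η : EuclideanSpace ℝ (Fin n) → ℝ) (h : IsTest S η),
        {F | inner ℝ (F none) ((h.pd i).lp (volume.restrict S))
          = -inner ℝ (F (some i)) (h.lp (volume.restrict S))} := by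
    ext F
    simp only [mem_iInter, mem_ofPred_eq]
    exact forall_congr' fun i => hasWeakPartial_iff
  rw [this]
  refine isClosed_iInter fun i => isClosed_iInter fun η => isClosed_iInter fun h =>
    isClosed_eq ?_ ?_
  · exact Continuous.inner (𝕜 := ℝ) (PiLp.continuous_apply 2 _ _) continuous_const
  · exact (Continuous.inner (𝕜 := ℝ) (PiLp.continuous_apply 2 _ _) continuous_const).neg

instance : CompleteSpace (H1 S) := isClosed_H1.completeSpace_coe

instance : CompleteSpace (H20 S) := (Submodule.isClosed_topologicalClosure _).completeSpace_coe

/-- `val1` as a continuous linear map. -/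
def val1L (S : Set (EuclideanSpace ℝ (Fin n))) : H1 S →L[ℝ] L2 S :=
  (PiLp.proj 2 (𝕜 := ℝ) (fun _ : Option (Fin n) => L2 S) none).comp (H1 S).subtypeL

/-- `d1` as a continuous linear map. -/
def d1L (S : Set (EuclideanSpace ℝ (Fin n))) (i : Fin n) : H1 S →L[ℝ] L2 S :=
  (PiLp.proj 2 (𝕜 := ℝ) (fun _ : Option (Fin n) => L2 S) (some i)).comp (H1 S).subtypeL

theorem val1L_apply (φ : H1 S) : val1L S φ = val1 φ := rfl

theorem d1L_apply (i : Fin n) (φ : H1 S) : d1L S i φ = d1 i φ := rfl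

theorem d1_weak (φ : H1 S) (i : Fin n) : HasWeakPartial S i (val1 φ) (d1 i φ) := φ.2 i

theorem norm_sq_H1 (φ : H1 S) : ‖φ‖ ^ 2 = ‖val1 φ‖ ^ 2 + ∑ i, ‖d1 i φ‖ ^ 2 := by
  rw [Submodule.coe_norm, PiLp.norm_sq_eq_of_L2, Fintype.sum_option]
  rfl

/-- The element of `H¹(S)` with prescribed components. -/
def mkH1 (f : L2 S) (g : Fin n → L2 S) (h : ∀ i, HasWeakPartial S i f (g i)) : H1 S :=
  ⟨WithLp.toLp 2 fun o => o.elim f g, h⟩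

theorem H1_ext_of_val (hS : IsOpen S) {φ : H1 S} (h : val1 φ = 0) : φ = 0 := by
  have hd : ∀ i, d1 i φ = 0 := fun i => eq_zero_of_test hS fun η hη => by
    have h1 := d1_weak φ i η hη
    rw [h, integral_zero_mul] at h1
    linarith
  refine Subtype.ext (PiLp.ext fun o => ?_)
  cases o with
  | none => exact h
  | some i => exact hd i

end H1

section SolutionSpace

/-- A flow from its action on vectors. -/
def Flow.ofFun {H : Type*} [NormedAddCommGroup H] [InnerProductSpace ℝ H] (f : ℝ → H → H)
    (hadd : ∀ s x y, f s (x + y) = f s x + f s y) (hsmul : ∀ (s c : ℝ) (x : H), f s (c • x) = c • f s x)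
    (h0 : ∀ x, f 0 x = x) (hst : ∀ s t x, f (s + t) x = f s (f t x))
    (hn : ∀ s x, ‖f s x‖ = ‖x‖) (hc : ∀ x, Continuous fun s => f s x) : Flow H where
  T s := LinearMap.mkContinuous { toFun := f s, map_add' := hadd s, map_smul' := hsmul s } 1
    fun x => ((hn s x).trans (one_mul _).symm).le
  zero := h0
  add := hst
  norm_map := hn
  cont := hc

theorem Flow.ofFun_T {H : Type*} [NormedAddCommGroup H] [InnerProductSpace ℝ H] (f : ℝ → H → H)
    (hadd : ∀ s x y, f s (x + y) = f s x + f s y) (hsmul : ∀ (s c : ℝ) (x : H), f s (c • x) = c • f s x)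
    (h0 : ∀ x, f 0 x = x) (hst : ∀ s t x, f (s + t) x = f s (f t x))
    (hn : ∀ s x, ‖f s x‖ = ‖x‖) (hc : ∀ x, Continuous fun s => f s x) (s : ℝ) (x : H) :
    (Flow.ofFun f hadd hsmul h0 hst hn hc).T s x = f s x := rfl

theorem halfRep_T_lp (i : Fin 2) (s : ℝ) {S : Set R3} {η : R3 → ℝ} (h : IsTest S η) {S' : Set R3}
    (h' : IsTest S' fun q => η (q + EuclideanSpace.single i.castSucc s)) :
    (halfRep.flow i).T s (h.lp (volume.restrict halfSpace))
      = h'.lp (volume.restrict halfSpace) := trans_toLp _ _ _ _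

theorem IsTest.lp_congr {n : ℕ} {S S' : Set (EuclideanSpace ℝ (Fin n))}
    {η η' : EuclideanSpace ℝ (Fin n) → ℝ} (h : IsTest S η) (h' : IsTest S' η') (e : η = η')
    (ν : Measure (EuclideanSpace ℝ (Fin n))) [IsLocallyFiniteMeasure ν] : h.lp ν = h'.lp ν := by
  subst e
  rfl

theorem HasWeakPartial.halfRep_T {j : Fin 3} {f g : L2 halfSpace}
    (h : HasWeakPartial halfSpace j f g) (i : Fin 2) (s : ℝ) :
    HasWeakPartial halfSpace j ((halfRep.flow i).T s f) ((halfRep.flow i).T s g) := by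
  rw [hasWeakPartial_iff] at h ⊢
  intro η hη
  have h' := hη.shift (S' := halfSpace) (EuclideanSpace.single i.castSucc (-s))
    fun x hx => (mem_half_add i _ x).mp hx
  rw [Flow.inner_T, Flow.inner_T, halfRep_T_lp i (-s) hη h',
    halfRep_T_lp i (-s) (hη.pd j) ((hη.pd j).shift (S' := halfSpace)
      (EuclideanSpace.single i.castSucc (-s)) fun x hx => (mem_half_add i _ x).mp hx),
    ← h _ h']
  congr 1
  exact IsTest.lp_congr _ _ (funext fun x => (pd_shift η j _ x).symm) _

theorem H1_ext {n : ℕ} {S : Set (EuclideanSpace ℝ (Fin n))} {φ w : H1 S} (h : val1 φ = val1 w)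
    (h' : ∀ j, d1 j φ = d1 j w) : φ = w := by
  refine Subtype.ext (PiLp.ext fun o => ?_)
  cases o with
  | none => exact h
  | some i => exact h' i

theorem val1_add {n : ℕ} {S : Set (EuclideanSpace ℝ (Fin n))} (φ w : H1 S) :
    val1 (φ + w) = val1 φ + val1 w := map_add (val1L S) φ w

theorem d1_add {n : ℕ} {S : Set (EuclideanSpace ℝ (Fin n))} (j : Fin n) (φ w : H1 S) :
    d1 j (φ + w) = d1 j φ + d1 j w := map_add (d1L S j) φ w

theorem val1_smul {n : ℕ} {S : Set (EuclideanSpace ℝ (Fin n))} (c : ℝ) (φ : H1 S) :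
    val1 (c • φ) = c • val1 φ := map_smul (val1L S) c φ

theorem d1_smul {n : ℕ} {S : Set (EuclideanSpace ℝ (Fin n))} (j : Fin n) (c : ℝ) (φ : H1 S) :
    d1 j (c • φ) = c • d1 j φ := map_smul (d1L S j) c φ

/-- Tangential translation of an element of `H¹` of the half-space, applied to all components. -/
def solShift (i : Fin 2) (s : ℝ) (φ : H1 halfSpace) : H1 halfSpace :=
  mkH1 ((halfRep.flow i).T s (val1 φ)) (fun j => (halfRep.flow i).T s (d1 j φ))
    fun j => (d1_weak φ j).halfRep_T i s

theorem val1_solShift (i : Fin 2) (s : ℝ) (φ : H1 halfSpace) :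
    val1 (solShift i s φ) = (halfRep.flow i).T s (val1 φ) := rfl

theorem d1_solShift (i : Fin 2) (s : ℝ) (φ : H1 halfSpace) (j : Fin 3) :
    d1 j (solShift i s φ) = (halfRep.flow i).T s (d1 j φ) := rfl

theorem solShift_add (i : Fin 2) (s : ℝ) (φ w : H1 halfSpace) :
    solShift i s (φ + w) = solShift i s φ + solShift i s w := by
  refine H1_ext ?_ fun j => ?_
  · rw [val1_add, val1_solShift, val1_solShift, val1_solShift, val1_add, map_add]
  · rw [d1_add, d1_solShift, d1_solShift, d1_solShift, d1_add, map_add]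

theorem solShift_smul (i : Fin 2) (s c : ℝ) (φ : H1 halfSpace) :
    solShift i s (c • φ) = c • solShift i s φ := by
  refine H1_ext ?_ fun j => ?_
  · rw [val1_smul, val1_solShift, val1_solShift, val1_smul, map_smul]
  · rw [d1_smul, d1_solShift, d1_solShift, d1_smul, map_smul]

theorem norm_solShift (i : Fin 2) (s : ℝ) (φ : H1 halfSpace) : ‖solShift i s φ‖ = ‖φ‖ := by
  refine (sq_eq_sq₀ (norm_nonneg _) (norm_nonneg _)).mp ?_
  rw [norm_sq_H1, norm_sq_H1]
  simp only [val1_solShift, d1_solShift, Flow.norm_map]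

theorem continuous_solShift (i : Fin 2) (φ : H1 halfSpace) :
    Continuous fun s => solShift i s φ := by
  refine Continuous.subtype_mk ((PiLp.continuous_toLp 2 _).comp (continuous_pi fun o => ?_)) _
  cases o with
  | none => exact (halfRep.flow i).cont (val1 φ)
  | some j => exact (halfRep.flow i).cont (d1 j φ)

/-- Tangential translations on `H¹` of the half-space. -/
def solRep : Rep (H1 halfSpace) where
  flow i := Flow.ofFun (solShift i) (solShift_add i) (solShift_smul i)
    (fun φ => H1_ext ((halfRep.flow i).zero _) fun j => (halfRep.flow i).zero _)
    (fun s t φ => H1_ext ((halfRep.flow i).add s t _) fun j => (halfRep.flow i).add s t _)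
    (norm_solShift i) (continuous_solShift i)
  comm i j s t φ := by
    simp only [Flow.ofFun_T]
    exact H1_ext (halfRep.comm i j s t _) fun _ => halfRep.comm i j s t _

theorem solRep_T (i : Fin 2) (s : ℝ) (φ : H1 halfSpace) :
    (solRep.flow i).T s φ = solShift i s φ := Flow.ofFun_T ..

theorem intertwines_val1 : Intertwines solRep halfRep (val1L halfSpace) := fun i s φ => by
  rw [solRep_T]
  rfl

theorem intertwines_d1 (j : Fin 3) : Intertwines solRep halfRep (d1L halfSpace j) := fun i s φ => by
  rw [solRep_T]
  rfl

/-- The trace as a continuous linear map, `φ ↦ Λ* (φ - φ_z)`. -/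
def traceL : H1 halfSpace →L[ℝ] Lp ℝ 2 (volume : Measure R2) :=
  liftAdj.comp (val1L halfSpace - d1L halfSpace 2)

theorem Intertwines.comp {H H' H'' : Type*} [NormedAddCommGroup H] [InnerProductSpace ℝ H]
    [NormedAddCommGroup H'] [InnerProductSpace ℝ H'] [NormedAddCommGroup H'']
    [InnerProductSpace ℝ H''] {ρ : Rep H} {ρ' : Rep H'} {ρ'' : Rep H''} {P : H →L[ℝ] H'}
    {Q : H' →L[ℝ] H''} (hQ : Intertwines ρ' ρ'' Q) (hP : Intertwines ρ ρ' P) :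
    Intertwines ρ ρ'' (Q.comp P) := fun i s x => by
  rw [ContinuousLinearMap.comp_apply, hP, hQ, ContinuousLinearMap.comp_apply]

theorem Intertwines.sub {H H' : Type*} [NormedAddCommGroup H] [InnerProductSpace ℝ H]
    [NormedAddCommGroup H'] [InnerProductSpace ℝ H'] {ρ : Rep H} {ρ' : Rep H'}
    {P Q : H →L[ℝ] H'} (hP : Intertwines ρ ρ' P) (hQ : Intertwines ρ ρ' Q) :
    Intertwines ρ ρ' (P - Q) := fun i s x => by
  rw [sub_apply, sub_apply, hP, hQ, map_sub]

theorem intertwines_traceL : Intertwines solRep bdRep traceL :=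
  Intertwines.comp (fun i s x => intertwines_liftAdj i s x)
    (intertwines_val1.sub (intertwines_d1 2))

theorem isTrace_traceL (φ : H1 halfSpace) : IsTrace φ (traceL φ) := by
  intro η h1 h2
  have hη : IsTest univ η := ⟨h1, h2, subset_univ _⟩
  have h3 := (d1_weak φ 2).trace_test hη
  rw [IsTest.inner_lp, IsTest.inner_lp, ← integral_add] at h3
  · rw [h3, IsTest.inner_lp]
    rfl
  · exact (Lp.memLp _).integrable_mul (hη.memLp' _)
  · exact (Lp.memLp _).integrable_mul ((hη.pd 2).memLp' _)

theorem isTrace_unique {φ : H1 halfSpace} {g g' : Lp ℝ 2 (volume : Measure R2)}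
    (h : IsTrace φ g) (h' : IsTrace φ g') : g = g' := by
  rw [← sub_eq_zero]
  refine eq_zero_of_test_univ fun ζ hζ => ?_
  let b : ContDiffBump (0 : ℝ) := ⟨1, 2, one_pos, one_lt_two⟩
  have hη := isTest_tensor hζ b.contDiff b.hasCompactSupport
  have h1 := h _ hη.smooth hη.compact
  have h2 := h' _ hη.smooth hη.compact
  have hb : b 0 = 1 := b.one_of_mem_closedBall (by simp [b])
  have h3 : ∀ p : R2, toBd (!₂[p 0, p 1, 0] : R3) = p := fun p => by
    ext j
    fin_cases j <;> simp [toBd]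
  have h4 : ∀ p : R2, b ((!₂[p 0, p 1, 0] : R3) 2) = 1 := fun p => hb
  simp only [h3, h4, one_mul] at h1 h2
  rw [← hζ.inner_lp, inner_sub_left, IsTest.inner_lp, IsTest.inner_lp]
  linarith

/-- The function `trace`, which is chosen among the solutions of Green's formula, is `traceL`. -/
theorem trace_eq (φ : H1 halfSpace) : trace φ = traceL φ := by
  have h : ∃ g, IsTrace φ g := ⟨_, isTrace_traceL φ⟩
  unfold trace
  rw [dif_pos h]
  exact isTrace_unique h.choose_spec (isTrace_traceL φ)

/-- Green's formula in `H¹` of the half-space. -/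
theorem green_H1 (φ w : H1 halfSpace) :
    inner ℝ (val1 φ) (d1 2 w) + inner ℝ (d1 2 φ) (val1 w) = -inner ℝ (traceL φ) (traceL w) :=
  (d1_weak φ 2).green (d1_weak w 2)

theorem inner_lp_of_supp {n : ℕ} {S : Set (EuclideanSpace ℝ (Fin n))}
    {η ζ : EuclideanSpace ℝ (Fin n) → ℝ} (hη : IsTest univ η) (hζ : IsTest S ζ) :
    inner ℝ (hη.lp (volume.restrict S)) (hζ.lp (volume.restrict S))
      = inner ℝ (hη.lp volume) (hζ.toUniv.lp volume) := by
  rw [← rest_lp, real_inner_comm, ← inner_ext, ext_lp, real_inner_comm]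
  rfl

/-- The element of `H¹` of the half-space given by a function in `C₀^∞(ℝ³)`. -/
def testH1 {η : R3 → ℝ} (hη : IsTest univ η) : H1 halfSpace :=
  mkH1 (hη.lp (volume.restrict halfSpace)) (fun j => (hη.pd j).lp (volume.restrict halfSpace))
    fun j => by
      rw [hasWeakPartial_iff]
      intro ζ hζ
      rw [inner_lp_of_supp hη (hζ.pd j), inner_lp_of_supp (hη.pd j) hζ]
      have hν : ∀ s : ℝ, MeasurePreserving (fun x => x + EuclideanSpace.single j s)
        (volume : Measure R3) volume := fun s => measurePreserving_add _
      have := (gen_test (hν := hν) hη).inner_skew (gen_test (hν := hν) hζ.toUniv)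
      rw [this, neg_neg]

theorem val1_test {η : R3 → ℝ} (hη : IsTest univ η) :
    val1 (testH1 hη) = hη.lp (volume.restrict halfSpace) := rfl

theorem d1_test {η : R3 → ℝ} (hη : IsTest univ η) (j : Fin 3) :
    d1 j (testH1 hη) = (hη.pd j).lp (volume.restrict halfSpace) := rfl

theorem traceL_test {η : R3 → ℝ} (hη : IsTest univ η) : traceL (testH1 hη) = hη.bd.lp volume :=
  liftAdj_test hη

theorem traceL_test_half {η : R3 → ℝ} (hη : IsTest halfSpace η) :
    traceL (testH1 hη.toUniv) = 0 := by
  rw [traceL_test]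
  refine Lp.ext ?_
  filter_upwards [hη.toUniv.bd.lp_ae volume,
    Lp.coeFn_zero ℝ 2 (volume : Measure R2)] with p h1 h2
  rw [h1, h2]
  refine image_eq_zero_of_notMem_tsupport fun h => ?_
  have h3 : (0 : ℝ) < 0 := hη.supp h
  exact lt_irrefl _ h3

theorem eq_zero_of_inner_val1 {k : L2 halfSpace}
    (h : ∀ w : H1 halfSpace, inner ℝ k (val1 w) = 0) : k = 0 :=
  eq_zero_of_test isOpen_halfSpace fun η hη => by
    rw [← hη.toUniv.inner_lp]
    exact h (testH1 hη.toUniv)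

theorem gen_d1 (φ : H1 halfSpace) (i : Fin 2) :
    (halfRep.flow i).Gen (val1 φ) (d1 i.castSucc φ) :=
  HasWeakPartial.gen_half (d1_weak φ i.castSucc)

end SolutionSpace

section Forms

/-- The bounded bilinear form `(x, w) ↦ ⟨P x, Q w⟩`. -/
def bil {X E : Type*} [NormedAddCommGroup X] [NormedSpace ℝ X] [NormedAddCommGroup E]
    [InnerProductSpace ℝ E] (P Q : X →L[ℝ] E) : X →L[ℝ] X →L[ℝ] ℝ :=
  (innerSL ℝ).bilinearComp P Q

theorem bil_apply {X E : Type*} [NormedAddCommGroup X] [NormedSpace ℝ X] [NormedAddCommGroup E]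
    [InnerProductSpace ℝ E] (P Q : X →L[ℝ] E) (x w : X) : bil P Q x w = inner ℝ (P x) (Q w) := rfl

/-- `formA` as a bounded bilinear form. -/
def formAL (μ : ℝ) : H1 halfSpace →L[ℝ] H1 halfSpace →L[ℝ] ℝ :=
  (∑ i, bil (d1L halfSpace i) (d1L halfSpace i)) + μ • bil (val1L halfSpace) (val1L halfSpace)

theorem formAL_apply (μ : ℝ) (φ w : H1 halfSpace) : formAL μ φ w = formA μ φ w := by
  simp [formAL, formA, bil_apply, val1L_apply, d1L_apply, Fin.sum_univ_three]

theorem formA_self (μ : ℝ) (φ : H1 halfSpace) :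
    formA μ φ φ = (∑ i, ‖d1 i φ‖ ^ 2) + μ * ‖val1 φ‖ ^ 2 := by
  simp only [formA, real_inner_self_eq_norm_sq]

theorem formA_coercive {μ : ℝ} (φ : H1 halfSpace) :
    min 1 μ * ‖φ‖ ^ 2 ≤ formA μ φ φ := by
  rw [formA_self, norm_sq_H1]
  have h1 : 0 ≤ ∑ i, ‖d1 i φ‖ ^ 2 := by positivity
  have h2 : min 1 μ ≤ 1 := min_le_left _ _
  have h3 : min 1 μ ≤ μ := min_le_right _ _
  nlinarith [sq_nonneg ‖val1 φ‖]

theorem bdryPair_eq {Ω : Set R2} (f : L2 Ω) (g : Lp ℝ 2 (volume : Measure R2)) :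
    bdryPair f g = inner ℝ (ext Ω f) g := (inner_ext' f g).symm

/-- The Lax–Milgram theorem. -/
theorem exists_of_coercive {H : Type*} [NormedAddCommGroup H] [InnerProductSpace ℝ H]
    [CompleteSpace H] (β : H →L[ℝ] H →L[ℝ] ℝ) {c : ℝ} (hc : 0 < c)
    (h : ∀ x, c * ‖x‖ ^ 2 ≤ β x x) (ℓ : H →L[ℝ] ℝ) : ∃ x, ∀ w, β x w = ℓ w := by
  have hβ : IsCoercive β := ⟨c, hc, fun x => by
    rw [mul_assoc, ← sq]
    exact h x⟩
  obtain ⟨x, hx⟩ : ∃ x, hβ.continuousLinearEquivOfBilin x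
      = (InnerProductSpace.toDual ℝ H).symm ℓ := hβ.continuousLinearEquivOfBilin.surjective _
  refine ⟨x, fun w => ?_⟩
  rw [← hβ.continuousLinearEquivOfBilin_apply x w, hx, InnerProductSpace.toDual_symm_apply]

/-- The Neumann problem is solvable, so that `neumann` is a solution and not the default value. -/
theorem formA_neumann {μ : ℝ} (hμ : 0 < μ) {Ω : Set R2} (f : L2 Ω) (w : H1 halfSpace) :
    formA μ (neumann μ f) w = inner ℝ (ext Ω f) (traceL w) := by
  have h : ∃ g, IsNeumannLift μ f g := by
    obtain ⟨g, hg⟩ := exists_of_coercive (formAL μ) (lt_min one_pos hμ)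
      (fun φ => (formA_coercive φ).trans_eq (formAL_apply μ φ φ).symm)
      ((innerSL ℝ (ext Ω f)).comp traceL)
    refine ⟨g, fun w => ?_⟩
    rw [trace_eq, bdryPair_eq, ← formAL_apply, hg w]
    rfl
  unfold neumann
  rw [dif_pos h, h.choose_spec w, trace_eq, bdryPair_eq]

theorem formA_add_left (μ : ℝ) (φ φ' w : H1 halfSpace) :
    formA μ (φ + φ') w = formA μ φ w + formA μ φ' w := by
  simp only [← formAL_apply, map_add, add_apply]

end Forms

/-! ### The space H²₀ -/

section H20

variable {n : ℕ} {S : Set (EuclideanSpace ℝ (Fin n))}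

/-- The ambient space of the families of derivatives of order at most two. -/
abbrev Jets (S : Set (EuclideanSpace ℝ (Fin n))) := PiLp 2 (fun _ : Idx2 n => L2 S)

/-- The component `o` of a family of derivatives, as a continuous linear map. -/
def jetL (S : Set (EuclideanSpace ℝ (Fin n))) (o : Idx2 n) : Jets S →L[ℝ] L2 S :=
  PiLp.proj 2 (𝕜 := ℝ) (fun _ : Idx2 n => L2 S) o

theorem jetL_apply (o : Idx2 n) (F : Jets S) : jetL S o F = F o := rfl

theorem IsJet2.fn_eq {η : EuclideanSpace ℝ (Fin n) → ℝ} {F : Jets S} (h : IsJet2 S η F)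
    (hη : IsTest S η) : F none = hη.lp (volume.restrict S) :=
  Lp.ext (h.fn.trans (hη.lp_ae _).symm)

theorem IsJet2.d_eq {η : EuclideanSpace ℝ (Fin n) → ℝ} {F : Jets S} (h : IsJet2 S η F)
    (hη : IsTest S η) (i : Fin n) :
    F (some (Sum.inl i)) = (hη.pd i).lp (volume.restrict S) :=
  Lp.ext ((h.d i).trans ((hη.pd i).lp_ae _).symm)

theorem IsJet2.dd_eq {η : EuclideanSpace ℝ (Fin n) → ℝ} {F : Jets S} (h : IsJet2 S η F)
    (hη : IsTest S η) (i j : Fin n) :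
    F (some (Sum.inr (i, j))) = ((hη.pd j).pd i).lp (volume.restrict S) :=
  Lp.ext ((h.dd i j).trans (((hη.pd j).pd i).lp_ae _).symm)

/-- The element of `H²₀(S)` given by a function in `C₀^∞(S)`. -/
def testH20 {η : EuclideanSpace ℝ (Fin n) → ℝ} (hη : IsTest S η) : H20 S :=
  ⟨WithLp.toLp 2 fun o => o.elim (hη.lp (volume.restrict S)) (Sum.elim
    (fun i => (hη.pd i).lp (volume.restrict S))
    fun ij => ((hη.pd ij.2).pd ij.1).lp (volume.restrict S)),
    Submodule.le_topologicalClosure _ (Submodule.subset_span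
      ⟨η, hη, ⟨hη.lp_ae _, fun i => (hη.pd i).lp_ae _, fun i j => ((hη.pd j).pd i).lp_ae _⟩⟩)⟩

/-- Continuous linear maps that agree on `C₀^∞(S)` agree on `H²₀(S)`. -/
theorem H20_eq_of_jet {E : Type*} [NormedAddCommGroup E] [NormedSpace ℝ E] (P Q : Jets S →L[ℝ] E)
    (h : ∀ (η : EuclideanSpace ℝ (Fin n) → ℝ) (F : Jets S), IsTest S η → IsJet2 S η F → P F = Q F)
    (u : H20 S) : P u.1 = Q u.1 := by
  have h1 : H20 S ≤ LinearMap.eqLocus P.toLinearMap Q.toLinearMap := by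
    refine Submodule.topologicalClosure_minimal _ (Submodule.span_le.mpr ?_) ?_
    · rintro F ⟨η, hη, hF⟩
      exact h η F hη hF
    · exact isClosed_eq P.continuous Q.continuous
  exact h1 u.2

theorem pd_comm {η : EuclideanSpace ℝ (Fin n) → ℝ} (hη : ContDiff ℝ ∞ η) (i j : Fin n) :
    pd i (pd j η) = pd j (pd i η) := by
  funext x
  have h1 : ∀ k l, pd k (pd l η) x = fderiv ℝ (fderiv ℝ η) x (EuclideanSpace.single k 1)
      (EuclideanSpace.single l 1) := fun k l => by
    have hd : DifferentiableAt ℝ (fderiv ℝ η) x :=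
      ((hη.fderiv_right (m := ∞) (by simp)).differentiable (by simp)) x
    have : pd l η = fun y => fderiv ℝ η y (EuclideanSpace.single l 1) := rfl
    rw [this, pd, fderiv_clm_apply hd (differentiableAt_const _)]
    simp
  rw [h1, h1]
  exact (hη.contDiffAt.isSymmSndFDerivAt (n := ∞) (by simpa using WithTop.coe_le_coe.mpr (le_top (a := (2 : ℕ∞))))) _ _

/-- Double integration by parts: `(∂ᵢ∂ⱼη, ∂ᵢ∂ⱼζ) = (∂ⱼ∂ⱼη, ∂ᵢ∂ᵢζ)`. -/
theorem inner_dd_test {ν : Measure (EuclideanSpace ℝ (Fin n))} [IsLocallyFiniteMeasure ν]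
    (hν : ∀ (i : Fin n) (s : ℝ), MeasurePreserving (fun x => x + EuclideanSpace.single i s) ν ν)
    {η ζ : EuclideanSpace ℝ (Fin n) → ℝ} (hη : IsTest univ η) (hζ : IsTest univ ζ) (i j : Fin n) :
    inner ℝ (((hη.pd j).pd i).lp ν) (((hζ.pd j).pd i).lp ν)
      = inner ℝ (((hη.pd j).pd j).lp ν) (((hζ.pd i).pd i).lp ν) := by
  have h1 := (gen_test (hν := hν i) (hη.pd j)).inner_skew
    (gen_test (hν := hν i) ((hζ.pd j).pd i))
  have h2 := (gen_test (hν := hν j) (hη.pd j)).inner_skew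
    (gen_test (hν := hν j) ((hζ.pd i).pd i))
  have h3 : (((hζ.pd j).pd i).pd i).lp ν = (((hζ.pd i).pd i).pd j).lp ν :=
    IsTest.lp_congr _ _ (by
      rw [pd_comm hζ.smooth i j, pd_comm (hζ.pd i).smooth i j]) _
  rw [h1, h2, h3]

end H20

section Plate

variable {Ω : Set R2}

theorem inner_ext_ext (hΩ : MeasurableSet Ω) (f g : L2 Ω) :
    inner ℝ (ext Ω f) (ext Ω g) = inner ℝ f g := by
  rw [inner_ext, rest_ext hΩ]

/-- `val2` as a continuous linear map. -/
def val2L (Ω : Set R2) : H20 Ω →L[ℝ] L2 Ω := (jetL Ω none).comp (H20 Ω).subtypeL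

/-- `d2` as a continuous linear map. -/
def d2L (Ω : Set R2) (i : Fin 2) : H20 Ω →L[ℝ] L2 Ω :=
  (jetL Ω (some (Sum.inl i))).comp (H20 Ω).subtypeL

/-- The second derivative `u ↦ ∂ᵢ∂ⱼu` as a continuous linear map. -/
def ddL (Ω : Set R2) (i j : Fin 2) : H20 Ω →L[ℝ] L2 Ω :=
  (jetL Ω (some (Sum.inr (i, j)))).comp (H20 Ω).subtypeL

/-- `lap` as a continuous linear map. -/
def lapL (Ω : Set R2) : H20 Ω →L[ℝ] L2 Ω := ddL Ω 0 0 + ddL Ω 1 1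

theorem lapL_apply (u : H20 Ω) : lapL Ω u = lap u := by
  unfold lap
  rw [Fin.sum_univ_two]
  rfl

theorem gen_of_jet {A B : Jets Ω →L[ℝ] L2 Ω} {i : Fin 2}
    (h : ∀ (η : R2 → ℝ) (F : Jets Ω), IsTest Ω η → IsJet2 Ω η F →
      (bdRep.flow i).Gen (ext Ω (A F)) (ext Ω (B F))) (u : H20 Ω) :
    (bdRep.flow i).Gen (ext Ω (A u.1)) (ext Ω (B u.1)) := fun s =>
  H20_eq_of_jet (((bdRep.flow i).T s).comp ((ext Ω).comp A) - (ext Ω).comp A)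
    (s • ((bdRep.flow i).avg s).comp ((ext Ω).comp B)) (fun η F hη hF => h η F hη hF s) u

theorem gen_val2 (u : H20 Ω) (i : Fin 2) :
    (bdRep.flow i).Gen (ext Ω (val2 u)) (ext Ω (d2 i u)) := by
  refine gen_of_jet (A := jetL Ω none) (B := jetL Ω (some (Sum.inl i)))
    (fun η F hη hF => ?_) u
  rw [jetL_apply, jetL_apply, hF.fn_eq hη, hF.d_eq hη, ext_lp, ext_lp]
  exact gen_test (hν := fun _ => measurePreserving_add _) hη.toUniv

theorem gen_d2 (u : H20 Ω) (i j : Fin 2) :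
    (bdRep.flow i).Gen (ext Ω (d2 j u)) (ext Ω (ddL Ω i j u)) := by
  refine gen_of_jet (A := jetL Ω (some (Sum.inl j))) (B := jetL Ω (some (Sum.inr (i, j))))
    (fun η F hη hF => ?_) u
  rw [jetL_apply, jetL_apply, hF.d_eq hη, hF.dd_eq hη, ext_lp, ext_lp]
  exact gen_test (hν := fun _ => measurePreserving_add _) (hη.pd j).toUniv

theorem inner_dd (hΩ : MeasurableSet Ω) (u w : H20 Ω) (i j : Fin 2) :
    inner ℝ (ddL Ω i j u) (ddL Ω i j w) = inner ℝ (ddL Ω j j u) (ddL Ω i i w) := by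
  have key : ∀ (η ζ : R2 → ℝ) (F G : Jets Ω), IsTest Ω η → IsJet2 Ω η F → IsTest Ω ζ →
      IsJet2 Ω ζ G → inner ℝ (jetL Ω (some (Sum.inr (i, j))) F) (jetL Ω (some (Sum.inr (i, j))) G)
        = inner ℝ (jetL Ω (some (Sum.inr (j, j))) F) (jetL Ω (some (Sum.inr (i, i))) G) := by
    intro η ζ F G hη hF hζ hG
    simp only [jetL_apply]
    rw [hF.dd_eq hη, hF.dd_eq hη, hG.dd_eq hζ, hG.dd_eq hζ, ← inner_ext_ext hΩ,
      ← inner_ext_ext hΩ, ext_lp, ext_lp, ext_lp, ext_lp]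
    exact inner_dd_test (fun _ _ => measurePreserving_add _) hη.toUniv hζ.toUniv i j
  have h1 : ∀ (ζ : R2 → ℝ) (G : Jets Ω), IsTest Ω ζ → IsJet2 Ω ζ G →
      inner ℝ (ddL Ω i j u) (jetL Ω (some (Sum.inr (i, j))) G)
        = inner ℝ (ddL Ω j j u) (jetL Ω (some (Sum.inr (i, i))) G) := fun ζ G hζ hG =>
    H20_eq_of_jet ((bil (jetL Ω (some (Sum.inr (i, j)))) (jetL Ω (some (Sum.inr (i, j))))).flip G)
      ((bil (jetL Ω (some (Sum.inr (j, j)))) (jetL Ω (some (Sum.inr (i, i))))).flip G)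
      (fun η F hη hF => key η ζ F G hη hF hζ hG) u
  exact H20_eq_of_jet ((innerSL ℝ (ddL Ω i j u)).comp (jetL Ω (some (Sum.inr (i, j)))))
    ((innerSL ℝ (ddL Ω j j u)).comp (jetL Ω (some (Sum.inr (i, i)))))
    (fun ζ G hζ hG => h1 ζ G hζ hG) w

theorem norm_sq_d2 (hΩ : MeasurableSet Ω) (u : H20 Ω) (i : Fin 2) :
    ‖d2 i u‖ ^ 2 = -inner ℝ (val2 u) (ddL Ω i i u) := by
  have h := (gen_val2 u i).inner_skew (gen_d2 u i i)
  rw [inner_ext_ext hΩ, inner_ext_ext hΩ, real_inner_self_eq_norm_sq] at h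
  exact h

theorem sum_norm_sq_d2 (hΩ : MeasurableSet Ω) (u : H20 Ω) :
    ‖d2 0 u‖ ^ 2 + ‖d2 1 u‖ ^ 2 = -inner ℝ (val2 u) (lapL Ω u) := by
  have h1 := norm_sq_d2 hΩ u 0
  have h2 := norm_sq_d2 hΩ u 1
  have h3 : inner ℝ (val2 u) (lapL Ω u)
      = inner ℝ (val2 u) (ddL Ω 0 0 u) + inner ℝ (val2 u) (ddL Ω 1 1 u) := inner_add_right _ _ _
  linarith

theorem sum_norm_sq_dd (hΩ : MeasurableSet Ω) (u : H20 Ω) :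
    ‖ddL Ω 0 0 u‖ ^ 2 + ‖ddL Ω 0 1 u‖ ^ 2 + ‖ddL Ω 1 0 u‖ ^ 2 + ‖ddL Ω 1 1 u‖ ^ 2
      = ‖lapL Ω u‖ ^ 2 := by
  have key : ∀ a b c d : L2 Ω, inner ℝ b b = inner ℝ d a → inner ℝ c c = inner ℝ a d →
      ‖a‖ ^ 2 + ‖b‖ ^ 2 + ‖c‖ ^ 2 + ‖d‖ ^ 2 = ‖a + d‖ ^ 2 := by
    intro a b c d h1 h2
    rw [norm_add_sq_real, ← real_inner_self_eq_norm_sq b, ← real_inner_self_eq_norm_sq c, h1, h2,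
      real_inner_comm]
    ring
  exact key _ _ _ _ (inner_dd hΩ u u 0 1) (inner_dd hΩ u u 1 0)

theorem sum_idx2 (f : Idx2 2 → ℝ) : ∑ o, f o = f none
    + (f (some (Sum.inl 0)) + f (some (Sum.inl 1)))
    + (f (some (Sum.inr (0, 0))) + f (some (Sum.inr (0, 1))) + f (some (Sum.inr (1, 0)))
      + f (some (Sum.inr (1, 1)))) := by
  rw [Fintype.sum_option, Fintype.sum_sum_type, Fintype.sum_prod_type, Fin.sum_univ_two,
    Fin.sum_univ_two, Fin.sum_univ_two, Fin.sum_univ_two]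
  ring

theorem norm_sq_H20 (u : H20 Ω) : ‖u‖ ^ 2 = ‖val2 u‖ ^ 2 + (‖d2 0 u‖ ^ 2 + ‖d2 1 u‖ ^ 2)
    + (‖ddL Ω 0 0 u‖ ^ 2 + ‖ddL Ω 0 1 u‖ ^ 2 + ‖ddL Ω 1 0 u‖ ^ 2 + ‖ddL Ω 1 1 u‖ ^ 2) :=
  (PiLp.norm_sq_eq_of_L2 (fun _ : Idx2 2 => L2 Ω) u.1).trans (sum_idx2 fun o => ‖u.1 o‖ ^ 2)

/-- The second derivatives are controlled by the Laplacian, and the first ones by interpolation. -/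
theorem norm_sq_H20_le (hΩ : MeasurableSet Ω) (u : H20 Ω) :
    ‖u‖ ^ 2 ≤ 2 * (‖val2 u‖ ^ 2 + ‖lapL Ω u‖ ^ 2) := by
  have h1 := norm_sq_H20 u
  have h2 := sum_norm_sq_d2 hΩ u
  have h3 := sum_norm_sq_dd hΩ u
  have := abs_le.mp (abs_real_inner_le_norm (val2 u) (lapL Ω u))
  nlinarith [sq_nonneg (‖val2 u‖ - ‖lapL Ω u‖), this.1]

theorem norm_sq_d2_le (hΩ : MeasurableSet Ω) (u : H20 Ω) :
    ‖d2 0 u‖ ^ 2 ≤ ‖val2 u‖ * ‖lapL Ω u‖ := by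
  have h1 := sum_norm_sq_d2 hΩ u
  have h2 := abs_le.mp (abs_real_inner_le_norm (val2 u) (lapL Ω u))
  nlinarith [sq_nonneg ‖d2 1 u‖, h2.1]

theorem eq_zero_of_inner_val2 (hΩ : IsOpen Ω) {f : L2 Ω}
    (h : ∀ w : H20 Ω, inner ℝ f (val2 w) = 0) : f = 0 :=
  eq_zero_of_test hΩ fun η hη => by
    rw [← hη.inner_lp]
    exact h (testH20 hη)

theorem Flow.gen_zero {H : Type*} [NormedAddCommGroup H] [InnerProductSpace ℝ H]
    [CompleteSpace H] {τ : Flow H} {f : H} (h : τ.Gen 0 f) : f = 0 := by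
  have h1 : ∀ s : ℝ, s ≠ 0 → τ.avg s f = 0 := fun s hs => by
    have := h s
    rw [map_zero, sub_zero] at this
    exact (smul_eq_zero.mp this.symm).resolve_left hs
  have h2 : Tendsto (fun s => τ.avg s f) (𝓝[≠] 0) (𝓝 (τ.avg 0 f)) :=
    (τ.continuous_avg f).continuousAt.tendsto.mono_left nhdsWithin_le_nhds
  have h3 : Tendsto (fun s => τ.avg s f) (𝓝[≠] 0) (𝓝 0) :=
    tendsto_const_nhds.congr' (eventually_nhdsWithin_of_forall fun s hs => (h1 s hs).symm)
  rw [← τ.avg_zero f]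
  exact tendsto_nhds_unique h2 h3

/-- The derivatives are determined by the function, as generators of translations of its extension. -/
theorem val2_injective (hΩ : MeasurableSet Ω) {u : H20 Ω} (h : val2 u = 0) : u = 0 := by
  have hd : ∀ i, d2 i u = 0 := fun i => by
    have h1 := gen_val2 u i
    rw [h, map_zero] at h1
    rw [← rest_ext hΩ (d2 i u), Flow.gen_zero h1, map_zero]
  have hdd : ∀ i j, ddL Ω i j u = 0 := fun i j => by
    have h1 := gen_d2 u i j
    rw [hd, map_zero] at h1
    rw [← rest_ext hΩ (ddL Ω i j u), Flow.gen_zero h1, map_zero]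
  have h1 := norm_sq_H20 u
  simp only [h, hd, hdd, norm_zero] at h1
  rw [← norm_eq_zero, ← sq_eq_zero_iff, h1]
  norm_num

/-- The range of the trace is dense. -/
theorem eq_zero_of_inner_traceL {g : Lp ℝ 2 (volume : Measure R2)}
    (h : ∀ w : H1 halfSpace, inner ℝ g (traceL w) = 0) : g = 0 := by
  refine eq_zero_of_test_univ fun ζ hζ => ?_
  let b : ContDiffBump (0 : ℝ) := ⟨1, 2, one_pos, one_lt_two⟩
  have hη := isTest_tensor hζ b.contDiff b.hasCompactSupport
  have h1 := h (testH1 hη)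
  have hb : b 0 = 1 := b.one_of_mem_closedBall (by simp [b])
  have h3 : ∀ p : R2, toBd (bdIncl p) = p := fun p => by
    ext j
    fin_cases j <;> simp [toBd, bdIncl]
  have h4 : ∀ p : R2, b ((bdIncl p) 2) = 1 := fun p => hb
  rw [traceL_test, IsTest.inner_lp] at h1
  rw [← h1]
  refine integral_congr_ae (Eventually.of_forall fun p => ?_)
  change g p * ζ p = g p * (b ((bdIncl p) 2) * ζ (toBd (bdIncl p)))
  rw [h3, h4, one_mul]

end Plate

/-! ### The abstract flow–plate system -/

theorem Rep.smooth_dmoll {H : Type*} [NormedAddCommGroup H] [InnerProductSpace ℝ H]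
    [CompleteSpace H] (ρ : Rep H) (i : Fin 2) {r : ℝ} (hr : r ≠ 0) (f : H) :
    ρ.smooth ((ρ.flow i).dmoll r f) = ρ.smoothD i ((ρ.flow i).moll r f) :=
  (ρ.smoothD_of_gen ((ρ.flow i).gen_moll hr f)).symm

theorem Rep.gen_smoothD {H : Type*} [NormedAddCommGroup H] [InnerProductSpace ℝ H]
    [CompleteSpace H] (ρ : Rep H) (i : Fin 2) (f : H) :
    (ρ.flow i).Gen (ρ.smooth f) (ρ.smoothD i f) := by
  have h1 : Tendsto (fun r => (ρ.flow i).moll r f) (𝓝[≠] 0) (𝓝 f) :=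
    ((ρ.flow i).tendsto_moll f).mono_left nhdsWithin_le_nhds
  have h2 := ((ρ.smooth.continuous.tendsto f).comp h1).prodMk_nhds
    (((ρ.smoothD i).continuous.tendsto f).comp h1)
  refine (ρ.flow i).isClosed_gen.mem_of_tendsto h2 (eventually_nhdsWithin_of_forall fun r hr => ?_)
  have h3 := ρ.smooth_gen ((ρ.flow i).gen_moll hr f)
  rw [ρ.smooth_dmoll i hr] at h3
  exact h3

/-- The functional analytic data of the flow–plate interaction: the Hilbert spaces `V = H¹(ℝ³₊)`,
`L = L₂(ℝ³₊)`, `X = L₂(ℝ²)`, `K = H²₀(Ω)` and `M = L₂(Ω)`, the differential operators and the trace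
between them, extension by zero `M → X`, and tangential translations on `V`, `L` and `X`. -/
structure System (V L X K M : Type*)
    [NormedAddCommGroup V] [InnerProductSpace ℝ V] [NormedAddCommGroup L] [InnerProductSpace ℝ L]
    [NormedAddCommGroup X] [InnerProductSpace ℝ X] [NormedAddCommGroup K] [InnerProductSpace ℝ K]
    [NormedAddCommGroup M] [InnerProductSpace ℝ M] [CompleteSpace V] [CompleteSpace L]
    [CompleteSpace X] [CompleteSpace K] [CompleteSpace M] where
  /-- translations on `V` -/
  ρV : Rep V
  /-- translations on `L` -/
  ρL : Rep L
  /-- translations on `X` -/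
  ρX : Rep X
  /-- the inclusion of `V` in `L` -/
  val : V →L[ℝ] L
  /-- the tangential derivatives on `V` -/
  dx : Fin 2 → V →L[ℝ] L
  /-- the transversal derivative on `V` -/
  dz : V →L[ℝ] L
  /-- the trace -/
  tr : V →L[ℝ] X
  /-- extension by zero -/
  e : M →L[ℝ] X
  /-- the inclusion of `K` in `M` -/
  pos : K →L[ℝ] M
  /-- the derivative `∂ₓ` on `K` -/
  ux : K →L[ℝ] M
  /-- the derivatives `∂ᵢ∂ₓ` on `K` -/
  uxx : Fin 2 → K →L[ℝ] M
  /-- the Laplacian on `K` -/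
  lap : K →L[ℝ] M
  int_val : Intertwines ρV ρL val
  int_dx : ∀ i, Intertwines ρV ρL (dx i)
  int_dz : Intertwines ρV ρL dz
  int_tr : Intertwines ρV ρX tr
  norm_sq : ∀ φ, ‖φ‖ ^ 2 = ‖val φ‖ ^ 2 + ‖dx 0 φ‖ ^ 2 + ‖dx 1 φ‖ ^ 2 + ‖dz φ‖ ^ 2
  val_inj : ∀ φ, val φ = 0 → φ = 0
  val_dense : ∀ f, (∀ w, inner ℝ f (val w) = 0) → f = 0
  gen_dx : ∀ φ i, (ρL.flow i).Gen (val φ) (dx i φ)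
  green : ∀ φ w, inner ℝ (val φ) (dz w) + inner ℝ (dz φ) (val w) = -inner ℝ (tr φ) (tr w)
  tr_dense : ∀ g, (∀ w, inner ℝ g (tr w) = 0) → g = 0
  exists_mk : ∀ f f₀ f₁ f', (ρL.flow 0).Gen f f₀ → (ρL.flow 1).Gen f f₁ →
    (∀ w, tr w = 0 → inner ℝ f (dz w) = -inner ℝ f' (val w)) →
    ∃ W, val W = f ∧ dx 0 W = f₀ ∧ dx 1 W = f₁ ∧ dz W = f'
  norm_sq_plate : ∀ u, ‖u‖ ^ 2 ≤ 2 * (‖pos u‖ ^ 2 + ‖lap u‖ ^ 2)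
  norm_sq_ux : ∀ u, ‖ux u‖ ^ 2 ≤ ‖pos u‖ * ‖lap u‖
  pos_inj : ∀ u, pos u = 0 → u = 0
  pos_dense : ∀ f, (∀ w, inner ℝ f (pos w) = 0) → f = 0
  gen_pos : ∀ u, (ρX.flow 0).Gen (e (pos u)) (e (ux u))
  gen_ux : ∀ u i, (ρX.flow i).Gen (e (ux u)) (e (uxx i u))

namespace System

variable {V L X K M : Type*}
    [NormedAddCommGroup V] [InnerProductSpace ℝ V] [NormedAddCommGroup L] [InnerProductSpace ℝ L]
    [NormedAddCommGroup X] [InnerProductSpace ℝ X] [NormedAddCommGroup K] [InnerProductSpace ℝ K]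
    [NormedAddCommGroup M] [InnerProductSpace ℝ M] [CompleteSpace V] [CompleteSpace L]
    [CompleteSpace X] [CompleteSpace K] [CompleteSpace M] (S : System V L X K M)

/-- The form `(∇φ, ∇w) + μ(φ, w)`. -/
def form (μ : ℝ) : V →L[ℝ] V →L[ℝ] ℝ :=
  bil (S.dx 0) (S.dx 0) + bil (S.dx 1) (S.dx 1) + bil S.dz S.dz + μ • bil S.val S.val

theorem form_apply (μ : ℝ) (φ w : V) : S.form μ φ w = inner ℝ (S.dx 0 φ) (S.dx 0 w)
    + inner ℝ (S.dx 1 φ) (S.dx 1 w) + inner ℝ (S.dz φ) (S.dz w)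
    + μ * inner ℝ (S.val φ) (S.val w) := rfl

theorem form_comm (μ : ℝ) (φ w : V) : S.form μ φ w = S.form μ w φ := by
  simp only [form_apply, real_inner_comm]

theorem norm_val_le (φ : V) : ‖S.val φ‖ ≤ ‖φ‖ := by
  refine (abs_le_of_sq_le_sq' ?_ (norm_nonneg φ)).2
  rw [S.norm_sq φ]
  nlinarith [sq_nonneg ‖S.dx 0 φ‖, sq_nonneg ‖S.dx 1 φ‖, sq_nonneg ‖S.dz φ‖]

theorem norm_dx_le (i : Fin 2) (φ : V) : ‖S.dx i φ‖ ≤ ‖φ‖ := by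
  refine (abs_le_of_sq_le_sq' ?_ (norm_nonneg φ)).2
  rw [S.norm_sq φ]
  fin_cases i
  · simp only [Fin.zero_eta]
    nlinarith [sq_nonneg ‖S.val φ‖, sq_nonneg ‖S.dx 1 φ‖, sq_nonneg ‖S.dz φ‖]
  · simp only [Fin.mk_one]
    nlinarith [sq_nonneg ‖S.val φ‖, sq_nonneg ‖S.dx 0 φ‖, sq_nonneg ‖S.dz φ‖]

theorem norm_dz_le (φ : V) : ‖S.dz φ‖ ≤ ‖φ‖ := by
  refine (abs_le_of_sq_le_sq' ?_ (norm_nonneg φ)).2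
  rw [S.norm_sq φ]
  nlinarith [sq_nonneg ‖S.dx 0 φ‖, sq_nonneg ‖S.dx 1 φ‖, sq_nonneg ‖S.val φ‖]

theorem form_coercive {μ : ℝ} (φ : V) : min 1 μ * ‖φ‖ ^ 2 ≤ S.form μ φ φ := by
  rw [form_apply, S.norm_sq φ]
  simp only [real_inner_self_eq_norm_sq]
  have h2 : min 1 μ ≤ 1 := min_le_left _ _
  have h3 : min 1 μ ≤ μ := min_le_right _ _
  nlinarith [sq_nonneg ‖S.val φ‖, sq_nonneg ‖S.dx 0 φ‖, sq_nonneg ‖S.dx 1 φ‖, sq_nonneg ‖S.dz φ‖]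

/-- If `-Δφ + μφ = -k` weakly, with `∂_ν φ = -g` on the boundary, and `B = Rep.smooth`, then `B φ_z` has one more
transversal derivative than `φ_z`, and its trace is `B g`. -/
theorem exists_smooth_dz {μ : ℝ} {φ : V} {k : L} {g : X}
    (hE : ∀ w, -S.form μ φ w - inner ℝ g (S.tr w) = inner ℝ k (S.val w)) :
    ∃ W, S.val W = S.ρL.smooth (S.dz φ) ∧ (∀ i, S.dx i W = S.ρL.smoothD i (S.dz φ)) ∧
      S.dz W = S.ρL.smooth (k + μ • S.val φ) - S.ρL.smoothD 0 (S.dx 0 φ)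
        - S.ρL.smoothD 1 (S.dx 1 φ) ∧ S.tr W = S.ρX.smooth g := by
  -- Testing with `B w` moves `B` onto `φ`; the tangential derivatives become bounded operators.
  have key : ∀ w, inner ℝ (S.ρL.smooth (S.dz φ)) (S.dz w)
      + inner ℝ (S.ρL.smooth (k + μ • S.val φ) - S.ρL.smoothD 0 (S.dx 0 φ)
        - S.ρL.smoothD 1 (S.dx 1 φ)) (S.val w) = -inner ℝ (S.ρX.smooth g) (S.tr w) := by
    intro w
    have h1 := hE (S.ρV.smooth w)
    rw [form_apply, Rep.map_smooth S.int_tr, Rep.map_smooth (S.int_dx 0),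
      Rep.map_smooth (S.int_dx 1), Rep.map_smooth S.int_dz, Rep.map_smooth S.int_val,
      ← Rep.smoothD_of_gen _ (S.gen_dx w 0), ← Rep.smoothD_of_gen _ (S.gen_dx w 1)] at h1
    rw [inner_sub_left, inner_sub_left, Rep.inner_smooth, Rep.inner_smooth, Rep.inner_smooth,
      Rep.inner_smoothD, Rep.inner_smoothD, inner_add_left, inner_smul_left, RCLike.conj_to_real]
    linarith
  -- Tests with zero trace identify the transversal derivative, and the others then give the trace.
  obtain ⟨W, hW, hW0, hW1, hWz⟩ := S.exists_mk (S.ρL.smooth (S.dz φ))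
    (S.ρL.smoothD 0 (S.dz φ)) (S.ρL.smoothD 1 (S.dz φ)) _ (S.ρL.gen_smoothD 0 _)
    (S.ρL.gen_smoothD 1 _) (fun w hw => by
      have := key w
      rw [hw, inner_zero_right, neg_zero] at this
      exact eq_neg_of_add_eq_zero_left this)
  refine ⟨W, hW, fun i => ?_, hWz, ?_⟩
  · fin_cases i
    · exact hW0
    · exact hW1
  · rw [← sub_eq_zero]
    refine S.tr_dense _ fun w => ?_
    have h1 := S.green W w
    have h2 := key w
    rw [hW, hWz] at h1
    rw [inner_sub_left]
    linarith

/-- The identity behind the hidden boundary regularity: `2 (k, B φ_z)` equals `-(g, B g)` up to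
terms bounded by `‖φ‖²`. -/
theorem inner_smooth_dz {μ : ℝ} {φ : V} {k : L} {g : X}
    (hE : ∀ w, -S.form μ φ w - inner ℝ g (S.tr w) = inner ℝ k (S.val w)) :
    2 * inner ℝ k (S.ρL.smooth (S.dz φ)) =
      2 * (inner ℝ (S.dz φ) (S.ρL.smoothD 0 (S.dx 0 φ))
        + inner ℝ (S.dz φ) (S.ρL.smoothD 1 (S.dx 1 φ)))
      - 2 * μ * inner ℝ (S.val φ) (S.ρL.smooth (S.dz φ)) - inner ℝ g (S.ρX.smooth g) := by
  obtain ⟨W, hW, hWi, hWz, hWt⟩ := S.exists_smooth_dz hE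
  have h1 := hE W
  rw [form_apply, hW, hWi, hWi, hWz, hWt, inner_sub_right, inner_sub_right,
    ← Rep.inner_smooth _ (S.dz φ), inner_add_right, inner_smul_right,
    real_inner_comm k, real_inner_comm (S.val φ)] at h1
  have h2 := S.ρL.inner_smoothD 0 (S.dx 0 φ) (S.dz φ)
  have h3 := S.ρL.inner_smoothD 1 (S.dx 1 φ) (S.dz φ)
  rw [real_inner_comm] at h2 h3
  linarith

/-- Green's formula for `ψ` and `B ψ`. -/
theorem inner_smooth_dz_self (ψ : V) : inner ℝ (S.val ψ) (S.ρL.smooth (S.dz ψ))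
    = -(1 / 2) * inner ℝ (S.tr ψ) (S.ρX.smooth (S.tr ψ)) := by
  have h1 := S.green ψ (S.ρV.smooth ψ)
  rw [Rep.map_smooth S.int_tr, Rep.map_smooth S.int_dz, Rep.map_smooth S.int_val] at h1
  have h2 := S.ρL.inner_smooth (S.val ψ) (S.dz ψ)
  rw [real_inner_comm] at h2
  linarith

/-- The energy identity of the flow for regular data, with the symmetrizer `2ε (ψ, B φ_z)` added
to the energy. Here `φ'` and `ψ'` stand for `∂ₓφ` and `∂ₓψ`, or for approximations of them. -/
theorem flow_identity {U μ ε : ℝ} {φ φ' ψ h : V} {ψ' k : L} {g : X} (hh : h = ψ - U • φ')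
    (hE : ∀ w, -U * inner ℝ ψ' (S.val w) - S.form μ φ w - inner ℝ g (S.tr w)
      = inner ℝ k (S.val w))
    (hφ : S.form μ φ' φ = 0) (hψ : inner ℝ ψ' (S.val ψ) = 0) :
    S.form μ h φ + inner ℝ k (S.val ψ) + ε * (inner ℝ k (S.ρL.smooth (S.dz φ))
        + inner ℝ (S.val ψ) (S.ρL.smooth (S.dz h)))
      = -inner ℝ g (S.tr ψ) - ε / 2 * (inner ℝ g (S.ρX.smooth g)
        + inner ℝ (S.tr ψ) (S.ρX.smooth (S.tr ψ)))
        + ε * (inner ℝ (S.dz φ) (S.ρL.smoothD 0 (S.dx 0 φ))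
          + inner ℝ (S.dz φ) (S.ρL.smoothD 1 (S.dx 1 φ))
          - μ * inner ℝ (S.val φ) (S.ρL.smooth (S.dz φ))
          - U * inner ℝ (S.ρL.smooth ψ') (S.dz φ)
          - U * inner ℝ (S.val ψ) (S.ρL.smooth (S.dz φ'))) := by
  have h1 := S.inner_smooth_dz (μ := μ) (φ := φ) (k := k + U • ψ') (g := g) fun w => by
    rw [inner_add_left, inner_smul_left, RCLike.conj_to_real]
    linarith [hE w]
  rw [inner_add_left, inner_smul_left, RCLike.conj_to_real, ← S.ρL.inner_smooth ψ'] at h1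
  have h2 := S.inner_smooth_dz_self ψ
  have h3 := hE ψ
  rw [hψ, S.form_comm] at h3
  have h4 : S.form μ h φ = S.form μ ψ φ := by
    rw [hh, map_sub, map_smul, sub_apply, smul_apply, hφ, smul_zero, sub_zero]
  rw [h4, hh, map_sub, map_smul, map_sub, map_smul, inner_sub_right, inner_smul_right, h2]
  linear_combination (ε / 2) * h1 - h3

end System

/-! ### Energy estimates for the generator and its regularization -/

/-- The state space of a flow–plate system. -/
abbrev State (V L K M : Type*) := WithLp 2 (WithLp 2 (V × L) × WithLp 2 (K × M))

theorem Flow.inner_dmoll_moll {H : Type*} [NormedAddCommGroup H] [InnerProductSpace ℝ H]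
    [CompleteSpace H] (τ : Flow H) {r : ℝ} (hr : r ≠ 0) (f : H) :
    inner ℝ (τ.dmoll r f) (τ.moll r f) = 0 := by
  have h1 := (τ.gen_moll hr f).inner_skew (τ.gen_moll hr f)
  have h2 := real_inner_comm (τ.dmoll r f) (τ.moll r f)
  linarith

theorem Flow.inner_dmoll_self {H : Type*} [NormedAddCommGroup H] [InnerProductSpace ℝ H]
    [CompleteSpace H] (τ : Flow H) (r : ℝ) (f : H) : inner ℝ (τ.dmoll r f) f = 0 := by
  have h1 := τ.inner_dmoll r f f
  have h2 := real_inner_comm (τ.dmoll r f) f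
  linarith

namespace System

variable {V L X K M : Type*}
    [NormedAddCommGroup V] [InnerProductSpace ℝ V] [NormedAddCommGroup L] [InnerProductSpace ℝ L]
    [NormedAddCommGroup X] [InnerProductSpace ℝ X] [NormedAddCommGroup K] [InnerProductSpace ℝ K]
    [NormedAddCommGroup M] [InnerProductSpace ℝ M] [CompleteSpace V] [CompleteSpace L]
    [CompleteSpace X] [CompleteSpace K] [CompleteSpace M] (S : System V L X K M)

/-- The graph of the generator, in terms of components: `z = (h, p; q, r)` is the image of
`y = (φ, ψ; u, v)`. -/
structure IsGenerator (U μ : ℝ) (φ : V) (ψ : L) (u : K) (v : M) (h : V) (p : L) (q : K) (r : M) :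
    Prop where
  eq_phi : S.val h = ψ - U • S.dx 0 φ
  eq_psi : ∀ w, U * inner ℝ ψ (S.dx 0 w) - S.form μ φ w - inner ℝ (S.e (v + U • S.ux u)) (S.tr w)
    = inner ℝ p (S.val w)
  eq_u : S.pos q = v
  eq_v : ∀ w, -inner ℝ (S.lap u) (S.lap w) - U * inner ℝ (S.e (S.ux w)) (S.tr φ)
    + inner ℝ (S.e (S.pos w)) (S.tr h) = inner ℝ r (S.pos w)

/-- The graph of the regularized generator, in which the derivative `∂ₓ` of the flow variables is
replaced by the bounded skew-symmetric operator `Flow.dmoll s = J ∂ₓ`. -/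
structure IsRegular (s U μ : ℝ) (φ : V) (ψ : L) (u : K) (v : M) (h : V) (p : L) (q : K) (r : M) :
    Prop where
  eq_phi : S.val h = ψ - U • (S.ρL.flow 0).dmoll s (S.val φ)
  eq_psi : ∀ w, -U * inner ℝ ((S.ρL.flow 0).dmoll s ψ) (S.val w) - S.form μ φ w
    - inner ℝ (S.e (v + U • S.ux u)) (S.tr w) = inner ℝ p (S.val w)
  eq_u : S.pos q = v
  eq_v : ∀ w, -inner ℝ (S.lap u) (S.lap w)
    + U * inner ℝ (S.e (S.pos w)) ((S.ρX.flow 0).dmoll s (S.tr φ))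
    + inner ℝ (S.e (S.pos w)) (S.tr h) = inner ℝ r (S.pos w)

/-- A common bound of the smoothing operators. -/
def kap : ℝ := ‖S.ρL.smooth‖ + ‖S.ρL.smoothD 0‖ + ‖S.ρL.smoothD 1‖ + 1

theorem kap_pos : 0 < S.kap := by unfold kap; positivity

theorem norm_smooth_le (f : L) : ‖S.ρL.smooth f‖ ≤ S.kap * ‖f‖ := by
  refine (S.ρL.smooth.le_opNorm f).trans (mul_le_mul_of_nonneg_right ?_ (norm_nonneg f))
  unfold kap
  linarith [norm_nonneg (S.ρL.smoothD 0), norm_nonneg (S.ρL.smoothD 1)]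

theorem norm_smoothD_le (i : Fin 2) (f : L) : ‖S.ρL.smoothD i f‖ ≤ S.kap * ‖f‖ := by
  refine ((S.ρL.smoothD i).le_opNorm f).trans (mul_le_mul_of_nonneg_right ?_ (norm_nonneg f))
  unfold kap
  fin_cases i
  · simp only [Fin.zero_eta]
    linarith [norm_nonneg (S.ρL.smooth), norm_nonneg (S.ρL.smoothD 1)]
  · simp only [Fin.mk_one]
    linarith [norm_nonneg (S.ρL.smooth), norm_nonneg (S.ρL.smoothD 0)]

theorem abs_inner_le_mul {H : Type*} [NormedAddCommGroup H] [InnerProductSpace ℝ H] {a b : H}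
    {x y : ℝ} (ha : ‖a‖ ≤ x) (hb : ‖b‖ ≤ y) : |inner ℝ a b| ≤ x * y :=
  (abs_real_inner_le_norm a b).trans
    (mul_le_mul ha hb (norm_nonneg b) ((norm_nonneg a).trans ha))

/-- The energy estimate of the flow for regular data. The part `c` of the boundary flux is
absorbed by the hidden boundary regularity. -/
theorem flow_estimate {U μ ε α : ℝ} (hU : 0 ≤ U) (hμ : 0 < μ) (hε : 0 < ε) {φ φ' ψ h : V}
    {ψ' k : L} {b c : X} (hh : h = ψ - U • φ')
    (hE : ∀ w, -U * inner ℝ ψ' (S.val w) - S.form μ φ w - inner ℝ (b + c) (S.tr w)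
      = inner ℝ k (S.val w))
    (hφ : S.form μ φ' φ = 0) (hψ : inner ℝ ψ' (S.val ψ) = 0)
    (hψ' : ‖S.ρL.smooth ψ'‖ ≤ S.kap * ‖S.val ψ‖) (hφ' : ‖S.ρL.smooth (S.dz φ')‖ ≤ S.kap * ‖φ‖)
    (hc : |inner ℝ c (S.tr ψ)| ≤ α * √(inner ℝ (S.tr ψ) (S.ρX.smooth (S.tr ψ)))) :
    S.form μ h φ + inner ℝ k (S.val ψ) + ε * (inner ℝ k (S.ρL.smooth (S.dz φ))
        + inner ℝ (S.val ψ) (S.ρL.smooth (S.dz h)))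
      ≤ -inner ℝ b (S.tr ψ) + α ^ 2 / (2 * ε)
        + ε * ((2 + μ + U) * S.kap) * (‖φ‖ ^ 2 + ‖S.val ψ‖ ^ 2) := by
  rw [S.flow_identity hh hE hφ hψ, inner_add_left]
  set s := √(inner ℝ (S.tr ψ) (S.ρX.smooth (S.tr ψ))) with hs
  have hs2 : s ^ 2 = inner ℝ (S.tr ψ) (S.ρX.smooth (S.tr ψ)) :=
    Real.sq_sqrt (S.ρX.inner_smooth_nonneg _)
  have hg := S.ρX.inner_smooth_nonneg (b + c)
  have h1 := (abs_le.mp hc).1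
  -- The pairing of `c` with the trace is absorbed by the term `-ε/2 ⟨γψ, B γψ⟩`.
  have h2 : α * s ≤ α ^ 2 / (2 * ε) + ε / 2 * s ^ 2 := by
    have : α ^ 2 / (2 * ε) + ε / 2 * s ^ 2 - α * s = (α - ε * s) ^ 2 / (2 * ε) := by
      field_simp
      ring
    have : 0 ≤ (α - ε * s) ^ 2 / (2 * ε) := by positivity
    linarith
  have k1 := (abs_le.mp (abs_inner_le_mul (S.norm_dz_le φ) ((S.norm_smoothD_le 0 _).trans
    (mul_le_mul_of_nonneg_left (S.norm_dx_le 0 φ) S.kap_pos.le)))).2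
  have k2 := (abs_le.mp (abs_inner_le_mul (S.norm_dz_le φ) ((S.norm_smoothD_le 1 _).trans
    (mul_le_mul_of_nonneg_left (S.norm_dx_le 1 φ) S.kap_pos.le)))).2
  have k3 := (abs_le.mp (abs_inner_le_mul (S.norm_val_le φ) ((S.norm_smooth_le _).trans
    (mul_le_mul_of_nonneg_left (S.norm_dz_le φ) S.kap_pos.le)))).1
  have k4 := (abs_le.mp (abs_inner_le_mul hψ' (S.norm_dz_le φ))).1
  have k5 := (abs_le.mp (abs_inner_le_mul le_rfl hφ' (a := S.val ψ))).1
  have k6 : S.kap * ‖S.val ψ‖ * ‖φ‖ ≤ S.kap * ((‖φ‖ ^ 2 + ‖S.val ψ‖ ^ 2) / 2) := by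
    rw [mul_assoc]
    exact mul_le_mul_of_nonneg_left (by nlinarith [sq_nonneg (‖φ‖ - ‖S.val ψ‖)]) S.kap_pos.le
  have k7 : 0 ≤ S.kap * ‖S.val ψ‖ ^ 2 := mul_nonneg S.kap_pos.le (sq_nonneg _)
  have k8 := mul_nonneg hμ.le k7
  have key : inner ℝ (S.dz φ) (S.ρL.smoothD 0 (S.dx 0 φ))
          + inner ℝ (S.dz φ) (S.ρL.smoothD 1 (S.dx 1 φ))
          - μ * inner ℝ (S.val φ) (S.ρL.smooth (S.dz φ))
          - U * inner ℝ (S.ρL.smooth ψ') (S.dz φ)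
          - U * inner ℝ (S.val ψ) (S.ρL.smooth (S.dz φ'))
      ≤ (2 + μ + U) * S.kap * (‖φ‖ ^ 2 + ‖S.val ψ‖ ^ 2) := by
    have e3 := mul_le_mul_of_nonneg_left k3 hμ.le
    have e4 := mul_le_mul_of_nonneg_left k4 hU
    have e5 := mul_le_mul_of_nonneg_left k5 hU
    have e6 := mul_le_mul_of_nonneg_left k6 hU
    nlinarith
  have key' := mul_le_mul_of_nonneg_left key hε.le
  have h3 := mul_nonneg (half_pos hε).le hg
  rw [← hs2]
  nlinarith

/-- The constant bounding `e (u_x)` as a functional on traces. -/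
def plateConst : ℝ := ‖S.e‖ * (‖S.ux‖ + 48 * (‖S.uxx 0‖ + ‖S.uxx 1‖))

theorem norm_e_le {P : K →L[ℝ] M} (u : K) : ‖S.e (P u)‖ ≤ ‖S.e‖ * ‖P‖ * ‖u‖ := by
  rw [mul_assoc]
  exact (S.e.le_opNorm _).trans (mul_le_mul_of_nonneg_left (P.le_opNorm u) (norm_nonneg _))

/-- The pairing of `U ∂ₓu` with a trace is controlled by the quadratic form of the smoothing operator.
The operator `P` stands for a tangential mollifier or for the identity. -/
theorem inner_ux_le {U : ℝ} (hU : 0 ≤ U) (u : K) {P : X →L[ℝ] X} (hP : ∀ x, ‖P x‖ ≤ ‖x‖)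
    (hP' : ∀ i s x, P ((S.ρX.flow i).T s x) = (S.ρX.flow i).T s (P x)) (g : X) :
    |inner ℝ (U • P (S.e (S.ux u))) g|
      ≤ U * (S.plateConst * ‖u‖) * √(inner ℝ g (S.ρX.smooth g)) := by
  have h1 := S.ρX.inner_le_smooth ((S.gen_ux u 0).map (hP' 0)) ((S.gen_ux u 1).map (hP' 1)) g
  rw [inner_smul_left, RCLike.conj_to_real, abs_mul, abs_of_nonneg hU, mul_assoc]
  refine mul_le_mul_of_nonneg_left (h1.trans ?_) hU
  refine mul_le_mul_of_nonneg_right ?_ (Real.sqrt_nonneg _)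
  have a0 := (hP _).trans (S.norm_e_le (P := S.ux) u)
  have a1 := (hP _).trans (S.norm_e_le (P := S.uxx 0) u)
  have a2 := (hP _).trans (S.norm_e_le (P := S.uxx 1) u)
  unfold plateConst
  linarith

/-- The flow and plate energies together, for the regularized generator. -/
theorem IsRegular.estimate {s U μ ε : ℝ} (hs : s ≠ 0) (hU : 0 ≤ U) (hμ : 0 < μ) (hε : 0 < ε)
    {φ : V} {ψ : L} {u : K} {v : M} {h : V} {p : L} {q : K} {r : M}
    (H : S.IsRegular s U μ φ ψ u v h p q r) :
    S.form μ h φ + inner ℝ p ψ + inner ℝ (S.lap q) (S.lap u) + inner ℝ r v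
      + ε * (inner ℝ p (S.ρL.smooth (S.dz φ)) + inner ℝ ψ (S.ρL.smooth (S.dz h)))
      ≤ (U * (S.plateConst * ‖u‖)) ^ 2 / (2 * ε)
        + ε * ((2 + μ + U) * S.kap) * (‖φ‖ ^ 2 + ‖ψ‖ ^ 2) := by
  -- `ψ` has a trace, since it is the sum of two elements of `V`.
  set ψ₁ : V := h + U • (S.ρV.flow 0).dmoll s φ with hψ₁
  have e1 : S.val ψ₁ = ψ := by
    rw [hψ₁, map_add, map_smul, Flow.map_dmoll (S.int_val 0), H.eq_phi, sub_add_cancel]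
  have h1 := S.flow_estimate (b := S.e v) (c := U • S.e (S.ux u)) hU hμ hε (φ := φ)
    (φ' := (S.ρV.flow 0).dmoll s φ) (ψ := ψ₁) (h := h) (ψ' := (S.ρL.flow 0).dmoll s ψ) (k := p)
    (by rw [hψ₁, add_sub_cancel_right])
    (fun w => by rw [← map_smul, ← map_add]; exact H.eq_psi w)
    (by
      rw [form_apply, Flow.map_dmoll (S.int_val 0), Flow.map_dmoll (S.int_dx 0 0),
        Flow.map_dmoll (S.int_dx 1 0), Flow.map_dmoll (S.int_dz 0)]
      simp only [Flow.inner_dmoll_self]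
      ring)
    (by rw [e1]; exact Flow.inner_dmoll_self _ _ _)
    (by
      rw [e1, S.ρL.smooth_dmoll 0 hs]
      exact (S.norm_smoothD_le 0 _).trans
        (mul_le_mul_of_nonneg_left (Flow.norm_moll_le _ _ _) S.kap_pos.le))
    (by
      rw [Flow.map_dmoll (S.int_dz 0), S.ρL.smooth_dmoll 0 hs]
      exact (S.norm_smoothD_le 0 _).trans (mul_le_mul_of_nonneg_left
        ((Flow.norm_moll_le _ _ _).trans (S.norm_dz_le φ)) S.kap_pos.le))
    (S.inner_ux_le hU u (P := ContinuousLinearMap.id ℝ X) (fun _ => le_rfl)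
      (fun _ _ _ => rfl) (S.tr ψ₁))
  -- The plate equation, tested with `q`, cancels the boundary term `⟨v, γψ⟩`.
  have h2 := H.eq_v q
  rw [H.eq_u] at h2
  have h3 : S.tr ψ₁ = S.tr h + U • (S.ρX.flow 0).dmoll s (S.tr φ) := by
    rw [hψ₁, map_add, map_smul, Flow.map_dmoll (S.int_tr 0)]
  rw [e1, h3, inner_add_right, inner_smul_right] at h1
  have h4 := real_inner_comm (S.lap q) (S.lap u)
  linarith

/-- The flow equation for the tangentially mollified data. -/
theorem IsGenerator.eq_psi_moll {U μ s : ℝ} (hs : s ≠ 0)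
    {φ : V} {ψ : L} {u : K} {v : M} {h : V} {p : L} {q : K} {r : M}
    (H : S.IsGenerator U μ φ ψ u v h p q r) (w : V) :
    -U * inner ℝ ((S.ρL.flow 0).dmoll s ψ) (S.val w) - S.form μ ((S.ρV.flow 0).moll s φ) w
      - inner ℝ ((S.ρX.flow 0).moll s (S.e (v + U • S.ux u))) (S.tr w)
      = inner ℝ ((S.ρL.flow 0).moll s p) (S.val w) := by
  have h2 := H.eq_psi ((S.ρV.flow 0).moll s w)
  rw [form_apply, Flow.map_moll (S.int_val 0), Flow.map_moll (S.int_dx 0 0),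
    Flow.map_moll (S.int_dx 1 0), Flow.map_moll (S.int_dz 0), Flow.map_moll (S.int_tr 0)] at h2
  rw [form_apply, Flow.map_moll (S.int_val 0), Flow.map_moll (S.int_dx 0 0),
    Flow.map_moll (S.int_dx 1 0), Flow.map_moll (S.int_dz 0), Flow.inner_dmoll,
    (S.gen_dx w 0).dmoll_eq hs]
  simp only [Flow.inner_moll]
  linarith

/-- The energy estimate for the tangentially mollified data. The first two terms on the right are
those of the plate equation, up to mollification. -/
theorem IsGenerator.estimate_moll {U μ ε s : ℝ} (hs : s ≠ 0) (hU : 0 ≤ U) (hμ : 0 < μ) (hε : 0 < ε)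
    {φ : V} {ψ : L} {u : K} {v : M} {h : V} {p : L} {q : K} {r : M}
    (H : S.IsGenerator U μ φ ψ u v h p q r) :
    S.form μ ((S.ρV.flow 0).moll s h) ((S.ρV.flow 0).moll s φ)
      + inner ℝ ((S.ρL.flow 0).moll s p) ((S.ρL.flow 0).moll s ψ)
      + ε * (inner ℝ ((S.ρL.flow 0).moll s p) (S.ρL.smooth (S.dz ((S.ρV.flow 0).moll s φ)))
        + inner ℝ ((S.ρL.flow 0).moll s ψ) (S.ρL.smooth (S.dz ((S.ρV.flow 0).moll s h))))
    ≤ -inner ℝ ((S.ρX.flow 0).moll s (S.e v)) ((S.ρX.flow 0).moll s (S.tr h))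
      + U * inner ℝ ((S.ρX.flow 0).moll s (S.e (S.ux q))) ((S.ρX.flow 0).moll s (S.tr φ))
      + (U * (S.plateConst * ‖u‖)) ^ 2 / (2 * ε)
      + ε * ((2 + μ + U) * S.kap) * (‖φ‖ ^ 2 + ‖ψ‖ ^ 2) := by
  set ψ₁ : V := (S.ρV.flow 0).moll s h + U • (S.ρV.flow 0).dmoll s φ with hψ₁
  have e1 : S.val ψ₁ = (S.ρL.flow 0).moll s ψ := by
    rw [hψ₁, map_add, map_smul, Flow.map_dmoll (S.int_val 0), Flow.map_moll (S.int_val 0),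
      H.eq_phi, (S.gen_dx φ 0).dmoll_eq hs, map_sub, map_smul, sub_add_cancel]
  have h1 := S.flow_estimate (b := (S.ρX.flow 0).moll s (S.e v))
    (c := U • (S.ρX.flow 0).moll s (S.e (S.ux u))) hU hμ hε
    (φ := (S.ρV.flow 0).moll s φ)
    (φ' := (S.ρV.flow 0).dmoll s φ) (ψ := ψ₁) (h := (S.ρV.flow 0).moll s h)
    (ψ' := (S.ρL.flow 0).dmoll s ψ) (k := (S.ρL.flow 0).moll s p)
    (by rw [hψ₁, add_sub_cancel_right])
    (fun w => by rw [← map_smul, ← map_smul, ← map_add, ← map_add]; exact H.eq_psi_moll S hs w)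
    (by
      rw [form_apply, Flow.map_dmoll (S.int_val 0), Flow.map_dmoll (S.int_dx 0 0),
        Flow.map_dmoll (S.int_dx 1 0), Flow.map_dmoll (S.int_dz 0), Flow.map_moll (S.int_val 0),
        Flow.map_moll (S.int_dx 0 0), Flow.map_moll (S.int_dx 1 0), Flow.map_moll (S.int_dz 0)]
      simp only [Flow.inner_dmoll_moll _ hs]
      ring)
    (by rw [e1]; exact Flow.inner_dmoll_moll _ hs _)
    (by
      rw [e1, S.ρL.smooth_dmoll 0 hs]
      exact S.norm_smoothD_le 0 _)
    (by
      rw [Flow.map_dmoll (S.int_dz 0), S.ρL.smooth_dmoll 0 hs, ← Flow.map_moll (S.int_dz 0)]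
      exact (S.norm_smoothD_le 0 _).trans
        (mul_le_mul_of_nonneg_left (S.norm_dz_le _) S.kap_pos.le))
    (S.inner_ux_le hU u (P := (S.ρX.flow 0).moll s) (Flow.norm_moll_le _ _)
      (fun i t x => Flow.map_moll (P := (S.ρX.flow i).T t)
        (fun t' y => S.ρX.comm i 0 t t' y) s x |>.symm) (S.tr ψ₁))
  have h3 : S.tr ψ₁ = (S.ρX.flow 0).moll s (S.tr h) + U • (S.ρX.flow 0).dmoll s (S.tr φ) := by
    rw [hψ₁, map_add, map_smul, Flow.map_dmoll (S.int_tr 0), Flow.map_moll (S.int_tr 0)]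
  -- As `v` is the image of `q ∈ K`, it has a derivative `∂ₓv`, onto which `∂ₓγφ` is shifted.
  have h4 : inner ℝ ((S.ρX.flow 0).moll s (S.e v)) ((S.ρX.flow 0).dmoll s (S.tr φ))
      = -inner ℝ ((S.ρX.flow 0).moll s (S.e (S.ux q))) ((S.ρX.flow 0).moll s (S.tr φ)) := by
    have h5 := S.gen_pos q
    rw [H.eq_u] at h5
    have h6 := (S.ρX.flow 0).inner_dmoll s ((S.ρX.flow 0).moll s (S.e v)) (S.tr φ)
    have h7 := h5.map (P := (S.ρX.flow 0).moll s) (τ' := S.ρX.flow 0) fun t x =>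
      (Flow.map_moll (P := (S.ρX.flow 0).T t) (fun t' y => Flow.T_comm _ t t' y) s x).symm
    rw [h7.dmoll_eq hs, Flow.inner_moll] at h6
    linarith
  rw [e1, h3, inner_add_right, inner_smul_right, h4] at h1
  have h7 : ‖(S.ρV.flow 0).moll s φ‖ ^ 2 + ‖(S.ρL.flow 0).moll s ψ‖ ^ 2
      ≤ ‖φ‖ ^ 2 + ‖ψ‖ ^ 2 :=
    add_le_add (pow_le_pow_left₀ (norm_nonneg _) (Flow.norm_moll_le _ _ _) 2)
      (pow_le_pow_left₀ (norm_nonneg _) (Flow.norm_moll_le _ _ _) 2)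
  have h8 : 0 ≤ ε * ((2 + μ + U) * S.kap) :=
    mul_nonneg hε.le (mul_nonneg (by linarith) S.kap_pos.le)
  have h9 := mul_le_mul_of_nonneg_left h7 h8
  linarith

/-- The flow and plate energies together, for the generator: the flow variables are mollified
tangentially, which does not affect the terms that are not bounded by the energy. -/
theorem IsGenerator.estimate {U μ ε : ℝ} (hU : 0 ≤ U) (hμ : 0 < μ) (hε : 0 < ε)
    {φ : V} {ψ : L} {u : K} {v : M} {h : V} {p : L} {q : K} {r : M}
    (H : S.IsGenerator U μ φ ψ u v h p q r) :
    S.form μ h φ + inner ℝ p ψ + inner ℝ (S.lap q) (S.lap u) + inner ℝ r v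
      + ε * (inner ℝ p (S.ρL.smooth (S.dz φ)) + inner ℝ ψ (S.ρL.smooth (S.dz h)))
      ≤ (U * (S.plateConst * ‖u‖)) ^ 2 / (2 * ε)
        + ε * ((2 + μ + U) * S.kap) * (‖φ‖ ^ 2 + ‖ψ‖ ^ 2) := by
  have key := fun (s : ℝ) (hs : s ≠ 0) => H.estimate_moll S hs hU hμ hε
  have tV : ∀ x, Tendsto (fun s => (S.ρV.flow 0).moll s x) (𝓝[≠] 0) (𝓝 x) := fun x =>
    ((S.ρV.flow 0).tendsto_moll x).mono_left nhdsWithin_le_nhds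
  have tL : ∀ x, Tendsto (fun s => (S.ρL.flow 0).moll s x) (𝓝[≠] 0) (𝓝 x) := fun x =>
    ((S.ρL.flow 0).tendsto_moll x).mono_left nhdsWithin_le_nhds
  have tX : ∀ x, Tendsto (fun s => (S.ρX.flow 0).moll s x) (𝓝[≠] 0) (𝓝 x) := fun x =>
    ((S.ρX.flow 0).tendsto_moll x).mono_left nhdsWithin_le_nhds
  have tB : ∀ x, Tendsto (fun s => S.ρL.smooth (S.dz ((S.ρV.flow 0).moll s x))) (𝓝[≠] 0)
      (𝓝 (S.ρL.smooth (S.dz x))) := fun x =>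
    ((S.ρL.smooth.continuous.comp S.dz.continuous).tendsto x).comp (tV x)
  have tF : Tendsto (fun s => S.form μ ((S.ρV.flow 0).moll s h) ((S.ρV.flow 0).moll s φ))
      (𝓝[≠] 0) (𝓝 (S.form μ h φ)) := by
    simp only [form_apply]
    have t0 := fun x => ((S.dx 0).continuous.tendsto x).comp (tV x)
    have t1 := fun x => ((S.dx 1).continuous.tendsto x).comp (tV x)
    have t2 := fun x => (S.dz.continuous.tendsto x).comp (tV x)
    have t3 := fun x => (S.val.continuous.tendsto x).comp (tV x)
    exact ((((t0 h).inner (𝕜 := ℝ) (t0 φ)).add ((t1 h).inner (𝕜 := ℝ) (t1 φ))).add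
      ((t2 h).inner (𝕜 := ℝ) (t2 φ))).add (((t3 h).inner (𝕜 := ℝ) (t3 φ)).const_mul μ)
  have l1 := (tF.add ((tL p).inner (𝕜 := ℝ) (tL ψ))).add
    ((((tL p).inner (𝕜 := ℝ) (tB φ)).add ((tL ψ).inner (𝕜 := ℝ) (tB h))).const_mul ε)
  have l2 := (((((tX (S.e v)).inner (𝕜 := ℝ) (tX (S.tr h))).neg).add
    (((tX (S.e (S.ux q))).inner (𝕜 := ℝ) (tX (S.tr φ))).const_mul U)).add_const
    ((U * (S.plateConst * ‖u‖)) ^ 2 / (2 * ε))).add_const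
    (ε * ((2 + μ + U) * S.kap) * (‖φ‖ ^ 2 + ‖ψ‖ ^ 2))
  -- In the limit `s → 0` no trace of `ψ` is left.
  have h1 := le_of_tendsto_of_tendsto l1 l2
    (eventually_nhdsWithin_of_forall fun s hs => key s hs)
  have h2 := H.eq_v q
  rw [H.eq_u] at h2
  have h4 := real_inner_comm (S.lap q) (S.lap u)
  linarith

end System

/-! ### Quasi-dissipative linear relations -/

/-- Bounded sequences have weak limits along an ultrafilter. -/
theorem exists_weak_limit {E : Type*} [NormedAddCommGroup E] [InnerProductSpace ℝ E]
    [CompleteSpace E] {y : ℕ → E} {C : ℝ} (h : ∀ n, ‖y n‖ ≤ C) :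
    ∃ x, ∀ w, Tendsto (fun n => inner ℝ (y n) w) (hyperfilter ℕ) (𝓝 (inner ℝ x w)) := by
  have h1 : ∀ w, ∃ l ∈ Icc (-(C * ‖w‖)) (C * ‖w‖),
      Tendsto (fun n => inner ℝ (y n) w) (hyperfilter ℕ) (𝓝 l) := fun w =>
    isCompact_Icc.ultrafilter_le_nhds ((hyperfilter ℕ).map fun n => inner ℝ (y n) w) (by
      rw [Ultrafilter.coe_map, le_principal_iff]
      refine Filter.mem_map.mpr (Filter.univ_mem' fun n => abs_le.mp ?_)
      exact (abs_real_inner_le_norm _ _).trans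
        (mul_le_mul_of_nonneg_right (h n) (norm_nonneg w)))
  choose l hl hl' using h1
  let ℓ : E →L[ℝ] ℝ := LinearMap.mkContinuous
    { toFun := l
      map_add' := fun a b => tendsto_nhds_unique (hl' (a + b)) (by
        simp only [inner_add_right]
        exact (hl' a).add (hl' b))
      map_smul' := fun c a => tendsto_nhds_unique (hl' (c • a)) (by
        simp only [inner_smul_right]
        exact (hl' a).const_mul c) } C fun w => abs_le.mpr (hl w)
  refine ⟨(InnerProductSpace.toDual ℝ E).symm ℓ, fun w => ?_⟩
  rw [InnerProductSpace.toDual_symm_apply]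
  exact hl' w

/-- Strong convergence times weak convergence. -/
theorem tendsto_inner_weak {E : Type*} [NormedAddCommGroup E] [InnerProductSpace ℝ E]
    {l : Filter ℕ} {y a : ℕ → E} {x b : E} {C : ℝ} (h : ∀ n, ‖y n‖ ≤ C)
    (hx : ∀ w, Tendsto (fun n => inner ℝ (y n) w) l (𝓝 (inner ℝ x w))) (ha : Tendsto a l (𝓝 b)) :
    Tendsto (fun n => inner ℝ (y n) (a n)) l (𝓝 (inner ℝ x b)) := by
  have h1 : Tendsto (fun n => inner ℝ (y n) (a n - b)) l (𝓝 0) := by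
    refine squeeze_zero_norm (a := fun n => C * ‖a n - b‖) (fun n => ?_) ?_
    · exact (abs_real_inner_le_norm _ _).trans
        (mul_le_mul_of_nonneg_right (h n) (norm_nonneg _))
    · simpa using (tendsto_iff_norm_sub_tendsto_zero.mp ha).const_mul C
  have h2 := h1.add (hx b)
  simp only [inner_sub_right, sub_add_cancel, zero_add] at h2
  exact h2

section Relation

variable {E : Type*} [NormedAddCommGroup E] [InnerProductSpace ℝ E] [CompleteSpace E]

/-- `m` is a bounded symmetric coercive form, that is, an equivalent inner product. -/
structure IsInner (m : E →L[ℝ] E →L[ℝ] ℝ) (c : ℝ) : Prop where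
  pos : 0 < c
  symm : ∀ x y, m x y = m y x
  coercive : ∀ x, c * ‖x‖ ^ 2 ≤ m x x

/-- The linear relation `G` is quasi-dissipative for the inner product `m`. -/
def Dissipative (m : E →L[ℝ] E →L[ℝ] ℝ) (κ : ℝ) (G : Submodule ℝ (E × E)) : Prop :=
  ∀ y z, (y, z) ∈ G → m z y ≤ κ * m y y

/-- The range of `l - G` is the whole space. -/
def FullRange (l : ℝ) (G : Submodule ℝ (E × E)) : Prop :=
  ∀ f, ∃ y, (y, l • y - f) ∈ G

namespace IsInner

variable {m : E →L[ℝ] E →L[ℝ] ℝ} {c : ℝ}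

theorem nonneg (hm : IsInner m c) (x : E) : 0 ≤ m x x :=
  (mul_nonneg hm.pos.le (sq_nonneg _)).trans (hm.coercive x)

theorem eq_zero (hm : IsInner m c) {x : E} (h : m x x ≤ 0) : x = 0 := by
  have h1 := (hm.coercive x).trans h
  have h2 : ‖x‖ ^ 2 ≤ 0 := by
    by_contra h3
    exact absurd h1 (not_le.mpr (mul_pos hm.pos (not_le.mp h3)))
  exact norm_eq_zero.mp (pow_eq_zero_iff two_ne_zero |>.mp (le_antisymm h2 (sq_nonneg _)))

theorem le_norm (m : E →L[ℝ] E →L[ℝ] ℝ) (x y : E) : m x y ≤ ‖m‖ * ‖x‖ * ‖y‖ :=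
  (le_abs_self _).trans (m.le_opNorm₂ x y)

theorem two_mul_le (hm : IsInner m c) (x y : E) : 2 * m x y ≤ m x x + m y y := by
  have h := hm.nonneg (x - y)
  have h1 := hm.symm x y
  simp only [map_sub, sub_apply] at h
  linarith

/-- The resolvent bound, in the norm of the space. -/
theorem norm_le (hm : IsInner m c) {κ l : ℝ} (hl : κ < l) {G : Submodule ℝ (E × E)}
    (hG : Dissipative m κ G) {y f : E} (h : (y, l • y - f) ∈ G) :
    ‖y‖ ≤ ‖m‖ / ((l - κ) * c) * ‖f‖ := by
  have h1 := hG _ _ h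
  simp only [map_sub, map_smul, sub_apply, smul_apply, smul_eq_mul] at h1
  have h2 := le_norm m f y
  have h3 := mul_le_mul_of_nonneg_left (hm.coercive y) (sub_pos.mpr hl).le
  have h4 : 0 < (l - κ) * c := mul_pos (sub_pos.mpr hl) hm.pos
  rcases (norm_nonneg y).eq_or_lt with h0 | h0
  · rw [← h0]; positivity
  · rw [div_mul_eq_mul_div, le_div_iff₀ h4]
    have h5 : (l - κ) * c * ‖y‖ * ‖y‖ ≤ ‖m‖ * ‖f‖ * ‖y‖ := by nlinarith
    linarith [le_of_mul_le_mul_right h5 h0]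

theorem unique (hm : IsInner m c) {κ l : ℝ} (hl : κ < l) {G : Submodule ℝ (E × E)}
    (hG : Dissipative m κ G) {y y' f : E} (h : (y, l • y - f) ∈ G) (h' : (y', l • y' - f) ∈ G) :
    y = y' := by
  have h1 := G.sub_mem h h'
  have h2 : (y, l • y - f) - (y', l • y' - f) = (y - y', l • (y - y') - (0 : E)) := by
    rw [Prod.mk_sub_mk, smul_sub]
    congr 1
    abel
  rw [h2] at h1
  have h3 := hm.norm_le hl hG h1
  rw [norm_zero, mul_zero] at h3
  exact sub_eq_zero.mp (norm_le_zero_iff.mp h3)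

/-- The resolvent of a quasi-m-dissipative relation. -/
theorem exists_resolvent (hm : IsInner m c) {κ l : ℝ} (hl : κ < l) {G : Submodule ℝ (E × E)}
    (hG : Dissipative m κ G) (hR : FullRange l G) :
    ∃ R : E →L[ℝ] E, ∀ f, (R f, l • R f - f) ∈ G := by
  choose R hR using hR
  refine ⟨LinearMap.mkContinuous { toFun := R, map_add' := fun f g => ?_, map_smul' := fun a f => ?_ }
    (‖m‖ / ((l - κ) * c)) fun f => hm.norm_le hl hG (hR f), hR⟩
  · refine hm.unique hl hG (hR (f + g)) ?_
    have h := G.add_mem (hR f) (hR g)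
    have h2 : (R f, l • R f - f) + (R g, l • R g - g)
        = (R f + R g, l • (R f + R g) - (f + g)) := by
      rw [Prod.mk_add_mk, smul_add]
      congr 1
      abel
    rwa [h2] at h
  · refine hm.unique hl hG (hR (a • f)) ?_
    have h := G.smul_mem a (hR f)
    have h2 : a • (R f, l • R f - f) = (a • R f, l • a • R f - a • f) := by
      rw [Prod.smul_mk, smul_sub, smul_comm l a]
    rwa [h2] at h

/-- If `l₀ - G` is onto for one `l₀ > κ`, then `l - G` is onto for all `l ∈ (κ, l₀]`. -/
theorem fullRange_of_le (hm : IsInner m c) {κ l l₀ : ℝ} (hl : κ < l) (hll : l ≤ l₀)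
    {G : Submodule ℝ (E × E)} (hG : Dissipative m κ G) (hR : FullRange l₀ G) : FullRange l G := by
  obtain ⟨R, hR⟩ := hm.exists_resolvent (hl.trans_le hll) hG hR
  intro f
  set t := l₀ - κ
  set θ := l₀ - l
  have ht : 0 < t := sub_pos.mpr (hl.trans_le hll)
  have hθ : 0 ≤ θ := sub_nonneg.mpr hll
  have hθt : θ < t := by simp only [θ, t]; linarith
  -- With `R = (l₀ - G)⁻¹`, the equation reads `y - θ R y = R f`, and `1 - θ R` is coercive.
  have key : ∀ x, t * m (R x) x ≤ m x x := fun x => by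
    have h1 := hG _ _ (hR x)
    simp only [map_sub, map_smul, sub_apply, smul_apply, smul_eq_mul] at h1
    have h2 := hm.nonneg (x - t • R x)
    simp only [map_sub, map_smul, sub_apply, smul_apply, smul_eq_mul] at h2
    have h3 := hm.symm x (R x)
    have h4 : t * m (R x) (R x) ≤ m (R x) x := by simp only [t]; linarith
    have h5 := mul_le_mul_of_nonneg_left h4 ht.le
    nlinarith
  obtain ⟨y, hy⟩ := exists_of_coercive (m.comp (ContinuousLinearMap.id ℝ E - θ • R))
    (c := (1 - θ / t) * c) (mul_pos (sub_pos.mpr ((div_lt_one ht).mpr hθt)) hm.pos)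
    (fun x => by
      simp only [ContinuousLinearMap.comp_apply, sub_apply, smul_apply, map_sub, map_smul,
        ContinuousLinearMap.id_apply, smul_eq_mul]
      have h1 := mul_le_mul_of_nonneg_left (key x) (div_nonneg hθ ht.le)
      have h2 : θ / t * (t * m (R x) x) = θ * m (R x) x := by field_simp
      have h3 := mul_le_mul_of_nonneg_left (hm.coercive x)
        (sub_nonneg.mpr ((div_le_one ht).mpr hθt.le))
      linarith) (m (R f))
  have h1 : y = R (f + θ • y) := by
    have h2 : m (y - θ • R y - R f) (y - θ • R y - R f) ≤ 0 := by
      have h3 := hy (y - θ • R y - R f)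
      rw [map_sub m (y - θ • R y), sub_apply, ← h3]
      exact (sub_self _).le
    rw [map_add, map_smul]
    have h4 := hm.eq_zero h2
    rw [sub_sub, sub_eq_zero] at h4
    exact h4.trans (add_comm _ _)
  refine ⟨y, ?_⟩
  have h2 := hR (f + θ • y)
  rw [← h1] at h2
  have h3 : l₀ • y - (f + θ • y) = l • y - f := by
    simp only [θ, sub_smul]
    abel
  rwa [h3] at h2

end IsInner

end Relation

/-! ### Solvability of the regularized resolvent equation -/

namespace System

variable {V L X K M : Type*}
    [NormedAddCommGroup V] [InnerProductSpace ℝ V] [NormedAddCommGroup L] [InnerProductSpace ℝ L]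
    [NormedAddCommGroup X] [InnerProductSpace ℝ X] [NormedAddCommGroup K] [InnerProductSpace ℝ K]
    [NormedAddCommGroup M] [InnerProductSpace ℝ M] [CompleteSpace V] [CompleteSpace L]
    [CompleteSpace X] [CompleteSpace K] [CompleteSpace M] (S : System V L X K M)

/-- The operator `l + U J ∂ₓ` on `V`. -/
def transport (s U l : ℝ) : V →L[ℝ] V :=
  l • ContinuousLinearMap.id ℝ V + U • (S.ρV.flow 0).dmoll s

theorem transport_apply (s U l : ℝ) (φ : V) :
    S.transport s U l φ = l • φ + U • (S.ρV.flow 0).dmoll s φ := rfl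

theorem val_transport (s U l : ℝ) (φ : V) : S.val (S.transport s U l φ)
    = l • S.val φ + U • (S.ρL.flow 0).dmoll s (S.val φ) := by
  rw [transport_apply, map_add, map_smul, map_smul, Flow.map_dmoll (S.int_val 0)]

theorem transport_surjective (s U : ℝ) {l : ℝ} (hl : 0 < l) (w : V) :
    ∃ φ, S.transport s U l φ = w := by
  obtain ⟨φ, hφ⟩ := exists_of_coercive ((innerSL ℝ).comp (S.transport s U l)) hl (fun φ => by
    rw [ContinuousLinearMap.comp_apply, innerSL_apply_apply, transport_apply, inner_add_left,
      inner_smul_left, inner_smul_left, Flow.inner_dmoll_self, real_inner_self_eq_norm_sq,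
      RCLike.conj_to_real, mul_zero, add_zero]) (innerSL ℝ w)
  exact ⟨φ, ext_inner_right ℝ hφ⟩

theorem form_dmoll (s μ : ℝ) (φ : V) : S.form μ φ ((S.ρV.flow 0).dmoll s φ) = 0 := by
  rw [form_comm, form_apply, Flow.map_dmoll (S.int_val 0), Flow.map_dmoll (S.int_dx 0 0),
    Flow.map_dmoll (S.int_dx 1 0), Flow.map_dmoll (S.int_dz 0)]
  simp only [Flow.inner_dmoll_self]
  ring

theorem form_transport (s U l μ : ℝ) (φ : V) :
    S.form μ φ (S.transport s U l φ) = l * S.form μ φ φ := by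
  rw [transport_apply, map_add, map_smul, map_smul, form_dmoll, smul_zero, add_zero, smul_eq_mul]

theorem inner_transport (s U l : ℝ) (φ : V) :
    inner ℝ (S.val (S.transport s U l (S.transport s U l φ))) (S.val (S.transport s U l φ))
      = l * ‖S.val (S.transport s U l φ)‖ ^ 2 := by
  rw [S.val_transport s U l (S.transport s U l φ), inner_add_left, inner_smul_left,
    inner_smul_left, Flow.inner_dmoll_self, real_inner_self_eq_norm_sq, RCLike.conj_to_real,
    mul_zero, add_zero]

/-- The form of the stationary problem for the regularized generator. The flow equation is tested
with `(l + U J ∂ₓ) w` and the plate equation with `l ω`, which makes the coupling terms cancel. -/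
def statForm (s U μ l : ℝ) : WithLp 2 (V × K) →L[ℝ] WithLp 2 (V × K) →L[ℝ] ℝ :=
  let Λ := (S.transport s U l).comp (WithLp.fstL 2 ℝ V K)
  let P := S.pos.comp (WithLp.sndL 2 ℝ V K)
  let D := S.lap.comp (WithLp.sndL 2 ℝ V K)
  let Q := S.ux.comp (WithLp.sndL 2 ℝ V K)
  bil (S.val.comp ((S.transport s U l).comp Λ)) (S.val.comp Λ)
    + (S.form μ).bilinearComp (WithLp.fstL 2 ℝ V K) Λ
    + bil (S.e.comp (l • P + U • Q)) (S.tr.comp Λ)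
    + l • (bil D D + l ^ 2 • bil P P - bil (S.tr.comp Λ) (S.e.comp P))

theorem statForm_apply (s U μ l : ℝ) (x y : WithLp 2 (V × K)) :
    S.statForm s U μ l x y
      = inner ℝ (S.val (S.transport s U l (S.transport s U l x.fst)))
          (S.val (S.transport s U l y.fst))
        + S.form μ x.fst (S.transport s U l y.fst)
        + inner ℝ (S.e (l • S.pos x.snd + U • S.ux x.snd)) (S.tr (S.transport s U l y.fst))
        + l * (inner ℝ (S.lap x.snd) (S.lap y.snd) + l ^ 2 * inner ℝ (S.pos x.snd) (S.pos y.snd)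
          - inner ℝ (S.tr (S.transport s U l x.fst)) (S.e (S.pos y.snd))) := rfl

/-- For large `l` the form is coercive: the only term without a sign, `U ⟨u_x, γ(l + U J ∂ₓ)φ⟩`, is of
lower order in `l`. The bound on `l` depends on the regularization `s`. -/
theorem statForm_coercive (s : ℝ) {U μ : ℝ} (hU : 0 ≤ U) (hμ : 0 < μ) :
    ∃ l₀ : ℝ, 0 < l₀ ∧ ∀ l, l₀ ≤ l → ∃ c : ℝ, 0 < c ∧ ∀ x, c * ‖x‖ ^ 2 ≤ S.statForm s U μ l x x := by
  set d := ‖(S.ρV.flow 0).dmoll s‖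
  set a := min 1 μ
  have ha : 0 < a := lt_min one_pos hμ
  set b := U * ‖S.e‖ * ‖S.tr‖
  have hb : 0 ≤ b := by positivity
  refine ⟨1 + U * d + 2 * b ^ 2 / a, by positivity, fun l hl => ?_⟩
  have hd : 0 ≤ U * d := by positivity
  have hba : 0 ≤ 2 * b ^ 2 / a := by positivity
  have hl1 : 1 ≤ l := by linarith
  have hl2 : U * d ≤ l := by linarith
  have hl3 : 2 * b ^ 2 ≤ l * a := (div_le_iff₀ ha).mp (by linarith)
  have hl0 : 0 < l := by linarith
  refine ⟨l * min (a / 2) (1 / 4), mul_pos hl0 (lt_min (half_pos ha) (by norm_num)), fun x => ?_⟩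
  set φ := x.fst
  set u := x.snd
  rw [WithLp.prod_norm_sq_eq_of_L2, statForm_apply, inner_transport, form_transport, map_add,
    map_smul, map_smul, inner_add_left, inner_smul_left, inner_smul_left, RCLike.conj_to_real,
    RCLike.conj_to_real, real_inner_self_eq_norm_sq, real_inner_self_eq_norm_sq]
  have h1 := real_inner_comm (S.e (S.pos u)) (S.tr (S.transport s U l φ))
  have h2 := S.form_coercive (μ := μ) φ
  have h3 := S.norm_sq_plate u
  have h4 := S.norm_sq_ux u
  have h5 : ‖S.transport s U l φ‖ ≤ 2 * l * ‖φ‖ := by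
    rw [transport_apply]
    refine (norm_add_le _ _).trans ?_
    rw [norm_smul, norm_smul, Real.norm_of_nonneg hl0.le, Real.norm_of_nonneg hU]
    have := mul_le_mul_of_nonneg_left (((S.ρV.flow 0).dmoll s).le_opNorm φ) hU
    have := mul_le_mul_of_nonneg_right hl2 (norm_nonneg φ)
    nlinarith
  have h6 : -(b * ‖S.ux u‖ * (2 * l * ‖φ‖)) ≤
      U * inner ℝ (S.e (S.ux u)) (S.tr (S.transport s U l φ)) := by
    have k1 := abs_inner_le_mul (S.e.le_opNorm (S.ux u))
      ((S.tr.le_opNorm _).trans (mul_le_mul_of_nonneg_left h5 (norm_nonneg S.tr)))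
    have k2 := mul_le_mul_of_nonneg_left (abs_le.mp k1).1 hU
    refine le_trans (le_of_eq ?_) k2
    simp only [b]
    ring
  have h7 : ‖S.pos u‖ * ‖S.lap u‖ * (2 * l) ≤ l ^ 2 * ‖S.pos u‖ ^ 2 + ‖S.lap u‖ ^ 2 := by
    nlinarith [sq_nonneg (l * ‖S.pos u‖ - ‖S.lap u‖)]
  set N := l ^ 2 * ‖S.pos u‖ ^ 2 + ‖S.lap u‖ ^ 2 with hN
  -- Young's inequality, with the gain of a factor `l⁻¹` from the interpolation of `u_x`.
  have h8 : b * ‖S.ux u‖ * (2 * ‖φ‖) ≤ a / 2 * ‖φ‖ ^ 2 + N / 2 := by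
    have k1 : 2 * b * ‖S.ux u‖ * ‖φ‖ ≤ a / 2 * ‖φ‖ ^ 2 + 2 * b ^ 2 / a * ‖S.ux u‖ ^ 2 := by
      have : a / 2 * ‖φ‖ ^ 2 + 2 * b ^ 2 / a * ‖S.ux u‖ ^ 2 - 2 * b * ‖S.ux u‖ * ‖φ‖
          = (a * ‖φ‖ - 2 * b * ‖S.ux u‖) ^ 2 / (2 * a) := by
        field_simp
        ring
      have : 0 ≤ (a * ‖φ‖ - 2 * b * ‖S.ux u‖) ^ 2 / (2 * a) := by positivity
      linarith
    have k2 : 2 * b ^ 2 / a * ‖S.ux u‖ ^ 2 ≤ l * ‖S.ux u‖ ^ 2 :=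
      mul_le_mul_of_nonneg_right ((div_le_iff₀ ha).mpr hl3) (sq_nonneg _)
    have k3 := mul_le_mul_of_nonneg_left h4 hl0.le
    linarith
  have h9 := mul_le_mul_of_nonneg_left h8 hl0.le
  have h10 : 0 ≤ l * ‖S.val (S.transport s U l φ)‖ ^ 2 := by positivity
  have h11 := mul_le_mul_of_nonneg_left h2 hl0.le
  have h12 : ‖S.pos u‖ ^ 2 ≤ l ^ 2 * ‖S.pos u‖ ^ 2 := by
    have : 1 ≤ l ^ 2 := one_le_pow₀ hl1
    nlinarith [sq_nonneg ‖S.pos u‖]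
  have h13 : min (a / 2) (1 / 4) * (‖φ‖ ^ 2 + ‖u‖ ^ 2) ≤ a / 2 * ‖φ‖ ^ 2 + N / 2 := by
    have k1 := mul_le_mul_of_nonneg_right (min_le_left (a / 2) (1 / 4)) (sq_nonneg ‖φ‖)
    have k2 := mul_le_mul_of_nonneg_right (min_le_right (a / 2) (1 / 4)) (sq_nonneg ‖u‖)
    linarith
  have h14 := mul_le_mul_of_nonneg_left h13 hl0.le
  nlinarith

/-- Solvability of the stationary problem for the regularized generator, by Lax–Milgram. -/
theorem exists_isRegular (s : ℝ) {U μ : ℝ} (hU : 0 ≤ U) (hμ : 0 < μ) :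
    ∃ l₀ : ℝ, ∀ l, l₀ ≤ l → ∀ (f₁ : V) (f₂ : L) (f₃ : K) (f₄ : M), ∃ φ ψ u v,
      S.IsRegular s U μ φ ψ u v (l • φ - f₁) (l • ψ - f₂) (l • u - f₃) (l • v - f₄) := by
  obtain ⟨l₀, hl₀, h⟩ := S.statForm_coercive s hU hμ
  refine ⟨l₀, fun l hl f₁ f₂ f₃ f₄ => ?_⟩
  obtain ⟨c, hc, hβ⟩ := h l hl
  have hl0 : 0 < l := hl₀.trans_le hl
  -- The unknowns `ψ = Λφ - f₁`, with `Λ = l + U J ∂ₓ`, and `v = l u - f₃` are eliminated.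
  let Λ := S.transport s U l
  let ℓ₁ : V →L[ℝ] ℝ := (innerSL ℝ (f₂ + S.val (Λ f₁))).comp S.val
    + (innerSL ℝ (S.e (S.pos f₃))).comp S.tr
  let ℓ₂ : K →L[ℝ] ℝ := (innerSL ℝ (f₄ + l • S.pos f₃)).comp S.pos
    - (innerSL ℝ (S.tr f₁)).comp (S.e.comp S.pos)
  obtain ⟨x, hx⟩ := exists_of_coercive (S.statForm s U μ l) hc hβ
    (ℓ₁.comp (Λ.comp (WithLp.fstL 2 ℝ V K)) + l • ℓ₂.comp (WithLp.sndL 2 ℝ V K))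
  set φ := x.fst with hφ
  set u := x.snd with hu
  have hx' : ∀ w ξ, inner ℝ (S.val (Λ (Λ φ))) (S.val (Λ w)) + S.form μ φ (Λ w)
      + inner ℝ (S.e (l • S.pos u + U • S.ux u)) (S.tr (Λ w))
      + l * (inner ℝ (S.lap u) (S.lap ξ) + l ^ 2 * inner ℝ (S.pos u) (S.pos ξ)
        - inner ℝ (S.tr (Λ φ)) (S.e (S.pos ξ))) = ℓ₁ (Λ w) + l * ℓ₂ ξ :=
    fun w ξ => hx (WithLp.toLp 2 (w, ξ))
  -- Since `Λ` is onto, its image under `Λ` may be replaced by an arbitrary test function.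
  have e1 : ∀ w, inner ℝ (S.val (Λ (Λ φ))) (S.val w) + S.form μ φ w
      + inner ℝ (S.e (l • S.pos u + U • S.ux u)) (S.tr w) = inner ℝ (f₂ + S.val (Λ f₁)) (S.val w)
        + inner ℝ (S.e (S.pos f₃)) (S.tr w) := fun w => by
    obtain ⟨w', hw'⟩ := S.transport_surjective s U hl0 w
    have h1 := hx' w' 0
    simp only [map_zero, inner_zero_right, mul_zero, add_zero, sub_zero] at h1
    rw [← hw']
    exact h1
  have e2 : ∀ w, inner ℝ (S.lap u) (S.lap w) + l ^ 2 * inner ℝ (S.pos u) (S.pos w)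
      - inner ℝ (S.tr (Λ φ)) (S.e (S.pos w))
      = inner ℝ (f₄ + l • S.pos f₃) (S.pos w) - inner ℝ (S.tr f₁) (S.e (S.pos w)) := fun w => by
    have h1 := hx' 0 w
    simp only [map_zero, inner_zero_right, add_zero, zero_add] at h1
    exact mul_left_cancel₀ hl0.ne' h1
  refine ⟨φ, S.val (Λ φ - f₁), u, S.pos (l • u - f₃), ?_, fun w => ?_, rfl, fun w => ?_⟩
  · rw [map_sub, map_sub, map_smul, S.val_transport]
    abel
  · have h1 := e1 w
    have h2 := S.val_transport s U l (Λ φ - f₁)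
    have h3 : S.val (S.transport s U l (Λ φ - f₁)) = S.val (Λ (Λ φ)) - S.val (Λ f₁) := by
      rw [← map_sub, ← map_sub]
    have h4 : U * inner ℝ ((S.ρL.flow 0).dmoll s (S.val (Λ φ - f₁))) (S.val w)
        = inner ℝ (S.val (Λ (Λ φ))) (S.val w) - inner ℝ (S.val (Λ f₁)) (S.val w)
          - l * inner ℝ (S.val (Λ φ - f₁)) (S.val w) := by
      have h5 := congrArg (fun y => inner ℝ y (S.val w)) (h3.symm.trans h2)
      simp only [inner_sub_left, inner_add_left, inner_smul_left, RCLike.conj_to_real] at h5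
      linarith
    simp only [map_add, map_sub, map_smul, inner_add_left, inner_sub_left, inner_smul_left,
      RCLike.conj_to_real] at h1 h4 ⊢
    linarith
  · have h1 := e2 w
    have h2 : S.tr (Λ φ) = l • S.tr φ + U • (S.ρX.flow 0).dmoll s (S.tr φ) := by
      rw [show Λ φ = l • φ + U • (S.ρV.flow 0).dmoll s φ from rfl, map_add, map_smul, map_smul,
        Flow.map_dmoll (S.int_tr 0)]
    rw [h2] at h1
    have c1 := real_inner_comm (S.tr φ) (S.e (S.pos w))
    have c2 := real_inner_comm ((S.ρX.flow 0).dmoll s (S.tr φ)) (S.e (S.pos w))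
    have c3 := real_inner_comm (S.tr f₁) (S.e (S.pos w))
    simp only [map_sub, map_smul, inner_add_left, inner_sub_left, inner_smul_left,
      inner_sub_right, inner_smul_right, RCLike.conj_to_real] at h1 ⊢
    rw [← c1, ← c2, ← c3] at h1
    linear_combination -h1

end System

/-! ### The generator is quasi-m-dissipative -/

/-- The image of a weakly convergent sequence, paired with a strongly convergent one. -/
theorem tendsto_inner_weak_map {E F : Type*} [NormedAddCommGroup E] [InnerProductSpace ℝ E]
    [CompleteSpace E] [NormedAddCommGroup F] [InnerProductSpace ℝ F] [CompleteSpace F]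
    {l : Filter ℕ} {y : ℕ → E} {x : E} {C : ℝ} (h : ∀ n, ‖y n‖ ≤ C)
    (hx : ∀ w, Tendsto (fun n => inner ℝ (y n) w) l (𝓝 (inner ℝ x w))) (P : E →L[ℝ] F)
    {a : ℕ → F} {b : F} (ha : Tendsto a l (𝓝 b)) :
    Tendsto (fun n => inner ℝ (P (y n)) (a n)) l (𝓝 (inner ℝ (P x) b)) := by
  refine tendsto_inner_weak (fun n => (P.le_opNorm (y n)).trans
    (mul_le_mul_of_nonneg_left (h n) (norm_nonneg P))) (fun w => ?_) ha
  simp only [← ContinuousLinearMap.adjoint_inner_right]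
  exact hx _

namespace System

variable {V L X K M : Type*}
    [NormedAddCommGroup V] [InnerProductSpace ℝ V] [NormedAddCommGroup L] [InnerProductSpace ℝ L]
    [NormedAddCommGroup X] [InnerProductSpace ℝ X] [NormedAddCommGroup K] [InnerProductSpace ℝ K]
    [NormedAddCommGroup M] [InnerProductSpace ℝ M] [CompleteSpace V] [CompleteSpace L]
    [CompleteSpace X] [CompleteSpace K] [CompleteSpace M] (S : System V L X K M)

section Projections

variable (V L K M)

/-- The component `φ` of a state. -/
def phiL : State V L K M →L[ℝ] V :=
  (WithLp.fstL 2 ℝ V L).comp (WithLp.fstL 2 ℝ (WithLp 2 (V × L)) (WithLp 2 (K × M)))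

/-- The component `ψ` of a state. -/
def psiL : State V L K M →L[ℝ] L :=
  (WithLp.sndL 2 ℝ V L).comp (WithLp.fstL 2 ℝ (WithLp 2 (V × L)) (WithLp 2 (K × M)))

/-- The component `u` of a state. -/
def uL : State V L K M →L[ℝ] K :=
  (WithLp.fstL 2 ℝ K M).comp (WithLp.sndL 2 ℝ (WithLp 2 (V × L)) (WithLp 2 (K × M)))

/-- The component `v` of a state. -/
def vL : State V L K M →L[ℝ] M :=
  (WithLp.sndL 2 ℝ K M).comp (WithLp.sndL 2 ℝ (WithLp 2 (V × L)) (WithLp 2 (K × M)))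

end Projections

theorem norm_sq_state (y : State V L K M) : ‖y‖ ^ 2
    = ‖phiL V L K M y‖ ^ 2 + ‖psiL V L K M y‖ ^ 2 + ‖uL V L K M y‖ ^ 2 + ‖vL V L K M y‖ ^ 2 := by
  rw [WithLp.prod_norm_sq_eq_of_L2, WithLp.prod_norm_sq_eq_of_L2, WithLp.prod_norm_sq_eq_of_L2,
    ← add_assoc]
  rfl

theorem state_ext {y y' : State V L K M} (h1 : phiL V L K M y = phiL V L K M y')
    (h2 : psiL V L K M y = psiL V L K M y') (h3 : uL V L K M y = uL V L K M y')
    (h4 : vL V L K M y = vL V L K M y') : y = y' := by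
  have h : ‖y - y'‖ ^ 2 = 0 := by
    rw [norm_sq_state, map_sub, map_sub, map_sub, map_sub, h1, h2, h3, h4]
    simp
  exact sub_eq_zero.mp (norm_eq_zero.mp (pow_eq_zero_iff two_ne_zero |>.mp h))

theorem IsGenerator.add {U μ : ℝ} {φ φ' : V} {ψ ψ' : L} {u u' : K} {v v' : M} {h h' : V} {p p' : L}
    {q q' : K} {r r' : M} (H : S.IsGenerator U μ φ ψ u v h p q r)
    (H' : S.IsGenerator U μ φ' ψ' u' v' h' p' q' r') :
    S.IsGenerator U μ (φ + φ') (ψ + ψ') (u + u') (v + v') (h + h') (p + p') (q + q') (r + r') where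
  eq_phi := by
    rw [map_add, map_add, H.eq_phi, H'.eq_phi, smul_add]
    abel
  eq_psi w := by
    have h1 := H.eq_psi w
    have h2 := H'.eq_psi w
    simp only [map_add, add_apply, inner_add_left, smul_add] at h1 h2 ⊢
    linarith
  eq_u := by rw [map_add, H.eq_u, H'.eq_u]
  eq_v w := by
    have h1 := H.eq_v w
    have h2 := H'.eq_v w
    simp only [map_add, inner_add_left, inner_add_right] at h1 h2 ⊢
    linarith

theorem IsGenerator.smul {U μ : ℝ} {φ : V} {ψ : L} {u : K} {v : M} {h : V} {p : L} {q : K} {r : M}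
    (c : ℝ) (H : S.IsGenerator U μ φ ψ u v h p q r) :
    S.IsGenerator U μ (c • φ) (c • ψ) (c • u) (c • v) (c • h) (c • p) (c • q) (c • r) where
  eq_phi := by rw [map_smul, map_smul, H.eq_phi, smul_sub, smul_comm c U]
  eq_psi w := by
    have h1 := H.eq_psi w
    simp only [map_add, map_smul, smul_apply, inner_add_left, inner_smul_left,
      RCLike.conj_to_real, smul_eq_mul] at h1 ⊢
    linear_combination c * h1
  eq_u := by rw [map_smul, H.eq_u]
  eq_v w := by
    have h1 := H.eq_v w
    simp only [map_smul, inner_smul_left, inner_smul_right, RCLike.conj_to_real] at h1 ⊢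
    linear_combination c * h1

theorem IsRegular.add {s U μ : ℝ} {φ φ' : V} {ψ ψ' : L} {u u' : K} {v v' : M} {h h' : V} {p p' : L}
    {q q' : K} {r r' : M} (H : S.IsRegular s U μ φ ψ u v h p q r)
    (H' : S.IsRegular s U μ φ' ψ' u' v' h' p' q' r') :
    S.IsRegular s U μ (φ + φ') (ψ + ψ') (u + u') (v + v') (h + h') (p + p') (q + q') (r + r') where
  eq_phi := by
    rw [map_add, map_add, H.eq_phi, H'.eq_phi, map_add, smul_add]
    abel
  eq_psi w := by
    have h1 := H.eq_psi w
    have h2 := H'.eq_psi w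
    simp only [map_add, add_apply, inner_add_left, smul_add] at h1 h2 ⊢
    linarith
  eq_u := by rw [map_add, H.eq_u, H'.eq_u]
  eq_v w := by
    have h1 := H.eq_v w
    have h2 := H'.eq_v w
    simp only [map_add, inner_add_left, inner_add_right] at h1 h2 ⊢
    linarith

theorem IsRegular.smul {s U μ : ℝ} {φ : V} {ψ : L} {u : K} {v : M} {h : V} {p : L} {q : K} {r : M}
    (c : ℝ) (H : S.IsRegular s U μ φ ψ u v h p q r) :
    S.IsRegular s U μ (c • φ) (c • ψ) (c • u) (c • v) (c • h) (c • p) (c • q) (c • r) where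
  eq_phi := by rw [map_smul, map_smul, map_smul, H.eq_phi, smul_sub, smul_comm c U]
  eq_psi w := by
    have h1 := H.eq_psi w
    simp only [map_add, map_smul, smul_apply, inner_add_left, inner_smul_left,
      RCLike.conj_to_real, smul_eq_mul] at h1 ⊢
    linear_combination c * h1
  eq_u := by rw [map_smul, H.eq_u]
  eq_v w := by
    have h1 := H.eq_v w
    simp only [map_smul, inner_smul_left, inner_smul_right, RCLike.conj_to_real] at h1 ⊢
    linear_combination c * h1

/-- The graph of the generator, as a linear relation in the state space. -/
def graph (U μ : ℝ) : Submodule ℝ (State V L K M × State V L K M) where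
  carrier := {y | S.IsGenerator U μ (phiL V L K M y.1) (psiL V L K M y.1) (uL V L K M y.1)
    (vL V L K M y.1) (phiL V L K M y.2) (psiL V L K M y.2) (uL V L K M y.2) (vL V L K M y.2)}
  add_mem' H H' := H.add S H'
  zero_mem' := by
    refine ⟨?_, fun w => ?_, ?_, fun w => ?_⟩ <;> simp
  smul_mem' c _ H := H.smul S c

/-- The graph of the regularized generator. -/
def regGraph (s U μ : ℝ) : Submodule ℝ (State V L K M × State V L K M) where
  carrier := {y | S.IsRegular s U μ (phiL V L K M y.1) (psiL V L K M y.1) (uL V L K M y.1)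
    (vL V L K M y.1) (phiL V L K M y.2) (psiL V L K M y.2) (uL V L K M y.2) (vL V L K M y.2)}
  add_mem' H H' := H.add S H'
  zero_mem' := by
    refine ⟨?_, fun w => ?_, ?_, fun w => ?_⟩ <;> simp
  smul_mem' c _ H := H.smul S c

theorem mem_graph {U μ : ℝ} {y z : State V L K M} : (y, z) ∈ S.graph U μ ↔
    S.IsGenerator U μ (phiL V L K M y) (psiL V L K M y) (uL V L K M y) (vL V L K M y)
      (phiL V L K M z) (psiL V L K M z) (uL V L K M z) (vL V L K M z) := Iff.rfl

theorem mem_regGraph {s U μ : ℝ} {y z : State V L K M} : (y, z) ∈ S.regGraph s U μ ↔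
    S.IsRegular s U μ (phiL V L K M y) (psiL V L K M y) (uL V L K M y) (vL V L K M y)
      (phiL V L K M z) (psiL V L K M z) (uL V L K M z) (vL V L K M z) := Iff.rfl

/-- The generator is single valued. -/
theorem graph_zero {U μ : ℝ} {z : State V L K M} (h : ((0 : State V L K M), z) ∈ S.graph U μ) :
    z = 0 := by
  rw [mem_graph] at h
  have h1 := h.eq_phi
  have h3 := h.eq_u
  simp only [map_zero, smul_zero, sub_zero] at h1 h3
  have h1' := S.val_inj _ h1
  refine state_ext ?_ ?_ ?_ ?_
  · rw [map_zero, h1']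
  · rw [map_zero]
    refine S.val_dense _ fun w => ?_
    have h2 := h.eq_psi w
    simp only [map_zero, smul_zero, add_zero, inner_zero_left, mul_zero, zero_apply,
      sub_zero] at h2
    exact h2.symm
  · rw [map_zero]
    exact S.pos_inj _ h3
  · rw [map_zero]
    refine S.pos_dense _ fun w => ?_
    have h2 := h.eq_v w
    simp only [h1', map_zero, inner_zero_left, inner_zero_right, mul_zero, add_zero, sub_zero,
      neg_zero] at h2
    exact h2.symm

/-- The modified energy: the energy of the flow and of the plate, and the symmetrizer
`2ε (ψ, B φ_z)`. -/
def energy (μ ε : ℝ) : State V L K M →L[ℝ] State V L K M →L[ℝ] ℝ :=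
  (S.form μ).bilinearComp (phiL V L K M) (phiL V L K M)
    + bil (psiL V L K M) (psiL V L K M)
    + bil (S.lap.comp (uL V L K M)) (S.lap.comp (uL V L K M))
    + bil (S.pos.comp (uL V L K M)) (S.pos.comp (uL V L K M))
    + bil (vL V L K M) (vL V L K M)
    + ε • (bil (psiL V L K M) (S.ρL.smooth.comp (S.dz.comp (phiL V L K M)))
      + bil (S.ρL.smooth.comp (S.dz.comp (phiL V L K M))) (psiL V L K M))

theorem energy_apply (μ ε : ℝ) (y z : State V L K M) : S.energy μ ε y z =
    S.form μ (phiL V L K M y) (phiL V L K M z) + inner ℝ (psiL V L K M y) (psiL V L K M z)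
    + inner ℝ (S.lap (uL V L K M y)) (S.lap (uL V L K M z))
    + inner ℝ (S.pos (uL V L K M y)) (S.pos (uL V L K M z))
    + inner ℝ (vL V L K M y) (vL V L K M z)
    + ε * (inner ℝ (psiL V L K M y) (S.ρL.smooth (S.dz (phiL V L K M z)))
      + inner ℝ (S.ρL.smooth (S.dz (phiL V L K M y))) (psiL V L K M z)) := rfl

/-- The weight of the symmetrizer, so small that the energy remains coercive. -/
def symWeight (μ : ℝ) : ℝ := min 1 μ / (2 * S.kap)

theorem symWeight_pos {μ : ℝ} (hμ : 0 < μ) : 0 < S.symWeight μ :=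
  div_pos (lt_min one_pos hμ) (mul_pos two_pos S.kap_pos)

theorem isInner_energy {μ : ℝ} (hμ : 0 < μ) :
    IsInner (S.energy μ (S.symWeight μ)) (min 1 μ / 2) where
  pos := half_pos (lt_min one_pos hμ)
  symm y z := by
    rw [energy_apply, energy_apply, S.form_comm, real_inner_comm (psiL V L K M z),
      real_inner_comm (S.lap (uL V L K M z)), real_inner_comm (S.pos (uL V L K M z)),
      real_inner_comm (vL V L K M z), real_inner_comm (S.ρL.smooth (S.dz (phiL V L K M z))),
      real_inner_comm (psiL V L K M z) (S.ρL.smooth (S.dz (phiL V L K M y)))]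
    ring
  coercive y := by
    rw [energy_apply, norm_sq_state]
    simp only [real_inner_self_eq_norm_sq]
    set a := min 1 μ
    have ha : 0 < a := lt_min one_pos hμ
    have ha1 : a ≤ 1 := min_le_left _ _
    have h1 := S.form_coercive (μ := μ) (phiL V L K M y)
    have h2 := S.norm_sq_plate (uL V L K M y)
    have h3 := (abs_le.mp (abs_inner_le_mul (le_refl ‖psiL V L K M y‖)
      ((S.norm_smooth_le _).trans (mul_le_mul_of_nonneg_left (S.norm_dz_le (phiL V L K M y))
        S.kap_pos.le)))).1
    have h4 := real_inner_comm (psiL V L K M y) (S.ρL.smooth (S.dz (phiL V L K M y)))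
    rw [h4, ← two_mul]
    have h5 : S.symWeight μ * S.kap = a / 2 := by
      have := S.kap_pos.ne'
      unfold symWeight
      field_simp
      rfl
    have h6 := mul_le_mul_of_nonneg_left h3 (S.symWeight_pos hμ).le
    have h7 : S.symWeight μ * -(‖psiL V L K M y‖ * (S.kap * ‖phiL V L K M y‖))
        = -(a / 2 * (‖psiL V L K M y‖ * ‖phiL V L K M y‖)) := by
      rw [← h5]
      ring
    rw [h7] at h6
    have h8 : ‖psiL V L K M y‖ * ‖phiL V L K M y‖
        ≤ (‖phiL V L K M y‖ ^ 2 + ‖psiL V L K M y‖ ^ 2) / 2 := by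
      nlinarith [sq_nonneg (‖phiL V L K M y‖ - ‖psiL V L K M y‖)]
    have h9 := mul_le_mul_of_nonneg_left h8 ha.le
    have h10 := mul_le_mul_of_nonneg_right ha1 (sq_nonneg ‖psiL V L K M y‖)
    have h11 := mul_le_mul_of_nonneg_right ha1 (sq_nonneg ‖uL V L K M y‖)
    have h12 := mul_le_mul_of_nonneg_right ha1 (sq_nonneg ‖vL V L K M y‖)
    nlinarith [sq_nonneg ‖vL V L K M y‖]

/-- The energy estimates, in the form of quasi-dissipativity. -/
theorem exists_dissipative {U μ : ℝ} (hU : 0 ≤ U) (hμ : 0 < μ) :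
    ∃ κ : ℝ, 0 ≤ κ ∧ Dissipative (S.energy μ (S.symWeight μ)) κ (S.graph U μ) ∧
      ∀ s, s ≠ 0 → Dissipative (S.energy μ (S.symWeight μ)) κ (S.regGraph s U μ) := by
  set ε := S.symWeight μ with hε
  have hε0 : 0 < ε := S.symWeight_pos hμ
  set A := (U * S.plateConst) ^ 2 / (2 * ε) + ε * ((2 + μ + U) * S.kap) + ‖S.pos‖ with hA
  have hk := S.kap_pos
  have hA1 : 0 ≤ (U * S.plateConst) ^ 2 / (2 * ε) := by positivity
  have hA2 : 0 ≤ ε * ((2 + μ + U) * S.kap) := by positivity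
  have hm := S.isInner_energy hμ
  have key : ∀ (φ : V) (ψ : L) (u : K) (v : M) (h : V) (p : L) (q : K) (r : M), S.pos q = v →
      S.form μ h φ + inner ℝ p ψ + inner ℝ (S.lap q) (S.lap u) + inner ℝ r v
      + ε * (inner ℝ p (S.ρL.smooth (S.dz φ)) + inner ℝ ψ (S.ρL.smooth (S.dz h)))
      ≤ (U * (S.plateConst * ‖u‖)) ^ 2 / (2 * ε)
        + ε * ((2 + μ + U) * S.kap) * (‖φ‖ ^ 2 + ‖ψ‖ ^ 2) →
      S.form μ h φ + inner ℝ p ψ + inner ℝ (S.lap q) (S.lap u) + inner ℝ (S.pos q) (S.pos u)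
      + inner ℝ r v + ε * (inner ℝ p (S.ρL.smooth (S.dz φ)) + inner ℝ (S.ρL.smooth (S.dz h)) ψ)
      ≤ A * (‖φ‖ ^ 2 + ‖ψ‖ ^ 2 + ‖u‖ ^ 2 + ‖v‖ ^ 2) := by
    intro φ ψ u v h p q r hq H
    have c1 := real_inner_comm ψ (S.ρL.smooth (S.dz h))
    rw [hq, c1]
    have h1 := (abs_le.mp (abs_inner_le_mul (le_refl ‖v‖) (S.pos.le_opNorm u))).2
    have h2 : ‖v‖ * (‖S.pos‖ * ‖u‖) ≤ ‖S.pos‖ * (‖u‖ ^ 2 + ‖v‖ ^ 2) := by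
      have : ‖u‖ * ‖v‖ ≤ ‖u‖ ^ 2 + ‖v‖ ^ 2 := by
        nlinarith [sq_nonneg (‖u‖ - ‖v‖), sq_nonneg ‖u‖, sq_nonneg ‖v‖]
      have := mul_le_mul_of_nonneg_left this (norm_nonneg S.pos)
      linarith
    have h3 : (U * (S.plateConst * ‖u‖)) ^ 2 / (2 * ε)
        = (U * S.plateConst) ^ 2 / (2 * ε) * ‖u‖ ^ 2 := by
      field_simp
    rw [h3] at H
    have k1 := mul_nonneg hA1 (add_nonneg (add_nonneg (sq_nonneg ‖φ‖) (sq_nonneg ‖ψ‖))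
      (sq_nonneg ‖v‖))
    have k2 := mul_nonneg hA2 (add_nonneg (sq_nonneg ‖u‖) (sq_nonneg ‖v‖))
    have k3 := mul_nonneg (norm_nonneg S.pos) (add_nonneg (sq_nonneg ‖φ‖) (sq_nonneg ‖ψ‖))
    rw [hA]
    nlinarith
  have hA0 : 0 ≤ A := by positivity
  have fin : ∀ y z : State V L K M, S.energy μ ε z y ≤ A * ‖y‖ ^ 2 →
      S.energy μ ε z y ≤ A / (min 1 μ / 2) * S.energy μ ε y y := fun y z h => by
    refine h.trans ?_
    rw [div_mul_eq_mul_div, le_div_iff₀ hm.pos]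
    have := mul_le_mul_of_nonneg_left (hm.coercive y) hA0
    linarith
  refine ⟨A / (min 1 μ / 2), div_nonneg hA0 hm.pos.le, fun y z h => fin y z ?_,
    fun s hs y z h => fin y z ?_⟩
  · rw [energy_apply, norm_sq_state]
    rw [mem_graph] at h
    exact key _ _ _ _ _ _ _ _ h.eq_u (h.estimate S hU hμ hε0)
  · rw [energy_apply, norm_sq_state]
    rw [mem_regGraph] at h
    exact key _ _ _ _ _ _ _ _ h.eq_u (h.estimate S hs hU hμ hε0)

/-- The range condition for the generator, by passing to the limit in the regularization. -/
theorem fullRange_graph {U μ κ l : ℝ} (hU : 0 ≤ U) (hμ : 0 < μ) (hl : κ < l)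
    (hκ : ∀ s, s ≠ 0 → Dissipative (S.energy μ (S.symWeight μ)) κ (S.regGraph s U μ)) :
    FullRange l (S.graph U μ) := by
  have hm := S.isInner_energy hμ
  -- For the regularized generators, large values of `l` are reached by Lax–Milgram; the bounds for
  -- these depend on `s`, but dissipativity leads back to the given `l`.
  have hreg : ∀ s, s ≠ 0 → FullRange l (S.regGraph s U μ) := fun s hs => by
    obtain ⟨l₀, h₀⟩ := S.exists_isRegular s hU hμ
    refine hm.fullRange_of_le hl (le_max_left l l₀) (hκ s hs) fun f => ?_
    obtain ⟨φ, ψ, u, v, h⟩ := h₀ _ (le_max_right l l₀) (phiL V L K M f) (psiL V L K M f)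
      (uL V L K M f) (vL V L K M f)
    exact ⟨WithLp.toLp 2 (WithLp.toLp 2 (φ, ψ), WithLp.toLp 2 (u, v)), h⟩
  intro f
  have hs : ∀ n, scale n ≠ 0 := fun n => (scale_pos n).ne'
  choose y hy using fun n => hreg (scale n) (hs n) f
  obtain ⟨C, hb⟩ : ∃ C, ∀ n, ‖y n‖ ≤ C := ⟨_, fun n => hm.norm_le hl (hκ _ (hs n)) (hy n)⟩
  obtain ⟨x, hx⟩ := exists_weak_limit hb
  have hl' : ((hyperfilter ℕ : Ultrafilter ℕ) : Filter ℕ) ≤ atTop := by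
    rw [← Nat.cofinite_eq_atTop]
    exact hyperfilter_le_cofinite
  -- In the weak formulation, the mollifiers are put on the test functions, where they converge
  -- strongly.
  have hH : ∀ n, S.IsRegular (scale n) U μ _ _ _ _ _ _ _ _ := fun n => S.mem_regGraph.mp (hy n)
  set ζ := l • x - f with hζ
  have hzb : ∀ n, ‖l • y n - f‖ ≤ ‖l‖ * C + ‖f‖ := fun n => by
    refine (norm_sub_le _ _).trans (add_le_add_left ?_ _)
    rw [norm_smul]
    exact mul_le_mul_of_nonneg_left (hb n) (norm_nonneg l)
  have hz : ∀ w, Tendsto (fun n => inner ℝ (l • y n - f) w) (hyperfilter ℕ)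
      (𝓝 (inner ℝ ζ w)) := fun w => by
    simp only [hζ, inner_sub_left, inner_smul_left]
    exact ((hx w).const_mul _).sub_const _
  have hJL : ∀ a, Tendsto (fun n => (S.ρL.flow 0).moll (scale n) a) (hyperfilter ℕ) (𝓝 a) :=
    fun a => (((S.ρL.flow 0).tendsto_moll a).comp tendsto_scale).mono_left hl'
  have hJX : ∀ a, Tendsto (fun n => (S.ρX.flow 0).moll (scale n) a) (hyperfilter ℕ) (𝓝 a) :=
    fun a => (((S.ρX.flow 0).tendsto_moll a).comp tendsto_scale).mono_left hl'
  refine ⟨x, ⟨?_, fun w => ?_, ?_, fun w => ?_⟩⟩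
  · refine ext_inner_right ℝ fun w => ?_
    have t1 := tendsto_inner_weak_map hzb hz (S.val.comp (phiL V L K M))
      (tendsto_const_nhds (x := w))
    have t2 := (tendsto_inner_weak_map hb hx (psiL V L K M) (tendsto_const_nhds (x := w))).sub
      ((tendsto_inner_weak_map hb hx ((S.dx 0).comp (phiL V L K M)) (hJL w)).const_mul U)
    refine (tendsto_nhds_unique t1 (t2.congr fun n => ?_)).trans ?_
    · rw [ContinuousLinearMap.comp_apply, ContinuousLinearMap.comp_apply, (hH n).eq_phi,
        (S.gen_dx _ 0).dmoll_eq (hs n), inner_sub_left, inner_smul_left, Flow.inner_moll,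
        RCLike.conj_to_real]
    · rw [inner_sub_left, inner_smul_left, RCLike.conj_to_real]
      rfl
  · have t1 := tendsto_inner_weak_map hzb hz (psiL V L K M) (tendsto_const_nhds (x := S.val w))
    have t2 := tendsto_inner_weak_map hb hx (psiL V L K M) (hJL (S.dx 0 w))
    have t3 := tendsto_inner_weak_map hb hx ((S.dx 0).comp (phiL V L K M))
      (tendsto_const_nhds (x := S.dx 0 w))
    have t4 := tendsto_inner_weak_map hb hx ((S.dx 1).comp (phiL V L K M))
      (tendsto_const_nhds (x := S.dx 1 w))
    have t5 := tendsto_inner_weak_map hb hx (S.dz.comp (phiL V L K M))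
      (tendsto_const_nhds (x := S.dz w))
    have t6 := tendsto_inner_weak_map hb hx (S.val.comp (phiL V L K M))
      (tendsto_const_nhds (x := S.val w))
    have t7 := tendsto_inner_weak_map hb hx (S.e.comp (vL V L K M + U • S.ux.comp (uL V L K M)))
      (tendsto_const_nhds (x := S.tr w))
    have t8 := ((t2.const_mul U).sub (((t3.add t4).add t5).add (t6.const_mul μ))).sub t7
    refine tendsto_nhds_unique (t8.congr fun n => ?_) t1
    rw [← (hH n).eq_psi w, Flow.inner_dmoll, (S.gen_dx w 0).dmoll_eq (hs n), neg_mul_neg,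
      form_apply]
    rfl
  · refine ext_inner_right ℝ fun w => ?_
    have t1 := tendsto_inner_weak_map hzb hz (S.pos.comp (uL V L K M))
      (tendsto_const_nhds (x := w))
    have t2 := tendsto_inner_weak_map hb hx (vL V L K M) (tendsto_const_nhds (x := w))
    refine tendsto_nhds_unique t1 (t2.congr fun n => ?_)
    rw [ContinuousLinearMap.comp_apply, (hH n).eq_u]
  · have t1 := tendsto_inner_weak_map hzb hz (vL V L K M) (tendsto_const_nhds (x := S.pos w))
    have t2 := tendsto_inner_weak_map hb hx (S.lap.comp (uL V L K M))
      (tendsto_const_nhds (x := S.lap w))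
    have t3 := tendsto_inner_weak_map hb hx (S.tr.comp (phiL V L K M)) (hJX (S.e (S.ux w)))
    have t4 := tendsto_inner_weak_map hzb hz (S.tr.comp (phiL V L K M))
      (tendsto_const_nhds (x := S.e (S.pos w)))
    have t5 := (t2.neg.sub (t3.const_mul U)).add t4
    rw [← tendsto_nhds_unique (t5.congr fun n => ?_) t1,
      real_inner_comm (S.tr (phiL V L K M x)), real_inner_comm (S.tr (phiL V L K M ζ))]
    · rfl
    · have h1 := (S.ρX.flow 0).inner_dmoll (scale n) (S.e (S.pos w)) (S.tr (phiL V L K M (y n)))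
      rw [(S.gen_pos w).dmoll_eq (hs n)] at h1
      rw [← (hH n).eq_v w, ContinuousLinearMap.comp_apply, ContinuousLinearMap.comp_apply,
        ContinuousLinearMap.comp_apply,
        real_inner_comm ((S.ρX.flow 0).moll (scale n) (S.e (S.ux w))),
        real_inner_comm (S.e (S.pos w)), h1]
      ring

end System

/-! ### Resolvents and the integrated equation -/

section Scalar

/-- Grönwall's inequality with a time-dependent source. -/
theorem gronwall_source {u u' b : ℝ → ℝ} {K T : ℝ} (hK : 0 ≤ K)
    (hu : ∀ t ∈ Icc 0 T, HasDerivAt u (u' t) t) (hb : Continuous b) (hb0 : ∀ t, 0 ≤ b t)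
    (h : ∀ t ∈ Icc 0 T, u' t ≤ K * u t + b t) {t : ℝ} (ht : t ∈ Icc 0 T) :
    u t ≤ Real.exp (K * t) * (u 0 + ∫ s in (0 : ℝ)..t, b s) := by
  let w : ℝ → ℝ := fun t => Real.exp (-K * t) * u t - ∫ s in (0 : ℝ)..t, b s
  have hw : ∀ t ∈ Icc 0 T, HasDerivAt w
      (Real.exp (-K * t) * (-K) * u t + Real.exp (-K * t) * u' t - b t) t := fun t ht => by
    have h1 : HasDerivAt (fun t : ℝ => Real.exp (-K * t)) (Real.exp (-K * t) * (-K)) t := by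
      have := ((hasDerivAt_id t).const_mul (-K)).exp
      simpa using this
    exact (h1.mul (hu t ht)).sub (hb.integral_hasStrictDerivAt 0 t).hasDerivAt
  have hanti : AntitoneOn w (Icc 0 T) := by
    refine antitoneOn_of_deriv_nonpos (convex_Icc 0 T)
      (fun t ht => (hw t ht).continuousAt.continuousWithinAt)
      (fun t ht => (hw t (interior_subset ht)).differentiableAt.differentiableWithinAt)
      (fun t ht => ?_)
    have ht' := interior_subset ht
    rw [(hw t ht').deriv]
    have h1 := h t ht'
    have h2 : 0 < Real.exp (-K * t) := Real.exp_pos _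
    have h3 : Real.exp (-K * t) ≤ 1 := Real.exp_le_one_iff.mpr (by nlinarith [ht'.1])
    have h4 := mul_le_mul_of_nonneg_left h1 h2.le
    have h5 := mul_le_mul_of_nonneg_right h3 (hb0 t)
    nlinarith
  have h1 := hanti ⟨le_rfl, ht.1.trans ht.2⟩ ht ht.1
  simp only [w, mul_zero, Real.exp_zero, one_mul, intervalIntegral.integral_same, sub_zero] at h1
  have h2 : Real.exp (K * t) * (Real.exp (-K * t) * u t) = u t := by
    rw [← mul_assoc, ← Real.exp_add]
    simp
  rw [← h2]
  exact mul_le_mul_of_nonneg_left (by linarith) (Real.exp_pos _).le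

end Scalar

section Relation

variable {E : Type*} [NormedAddCommGroup E] [InnerProductSpace ℝ E] [CompleteSpace E]

/-- `G` is the graph of a (single-valued) quasi-m-dissipative operator, for the inner product `m`. -/
structure MDissipative (m : E →L[ℝ] E →L[ℝ] ℝ) (c κ : ℝ) (G : Submodule ℝ (E × E)) : Prop where
  isInner : IsInner m c
  nonneg : 0 ≤ κ
  diss : Dissipative m κ G
  range : ∀ l, κ < l → FullRange l G
  single : ∀ z, ((0 : E), z) ∈ G → z = 0

namespace MDissipative

variable {m : E →L[ℝ] E →L[ℝ] ℝ} {c κ : ℝ} {G : Submodule ℝ (E × E)}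

open Classical in
/-- The resolvent `(l - G)⁻¹`, defined to be zero for `l ≤ κ`. -/
def res (H : MDissipative m c κ G) (l : ℝ) : E →L[ℝ] E :=
  if hl : κ < l then (H.isInner.exists_resolvent hl H.diss (H.range l hl)).choose else 0

theorem res_mem (H : MDissipative m c κ G) {l : ℝ} (hl : κ < l) (f : E) :
    (H.res l f, l • H.res l f - f) ∈ G := by
  unfold res
  rw [dif_pos hl]
  exact (H.isInner.exists_resolvent hl H.diss (H.range l hl)).choose_spec f

theorem mem_iff (H : MDissipative m c κ G) {l : ℝ} (hl : κ < l) {y z : E} :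
    (y, z) ∈ G ↔ H.res l (l • y - z) = y := by
  constructor
  · intro h
    refine H.isInner.unique hl H.diss (H.res_mem hl _) ?_
    rwa [sub_sub_cancel]
  · intro h
    have h1 := H.res_mem hl (l • y - z)
    rwa [h, sub_sub_cancel] at h1

theorem res_injective (H : MDissipative m c κ G) {l : ℝ} (hl : κ < l) {f : E}
    (h : H.res l f = 0) : f = 0 := by
  have h1 := H.res_mem hl f
  rw [h, smul_zero, zero_sub] at h1
  exact neg_eq_zero.mp (H.single _ h1)

theorem isClosed (H : MDissipative m c κ G) {l : ℝ} (hl : κ < l) : IsClosed (G : Set (E × E)) := by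
  have : (G : Set (E × E)) = {p | H.res l (l • p.1 - p.2) = p.1} :=
    Set.ext fun p => H.mem_iff hl
  rw [this]
  exact isClosed_eq (by fun_prop) continuous_fst

theorem sub_mul_res_le (H : MDissipative m c κ G) {l : ℝ} (hl : κ < l) (f : E) :
    (l - κ) * m (H.res l f) (H.res l f) ≤ m f (H.res l f) := by
  have h1 := H.diss _ _ (H.res_mem hl f)
  simp only [map_sub, map_smul, sub_apply, smul_apply, smul_eq_mul] at h1
  linarith

theorem sq_mul_res_le (H : MDissipative m c κ G) {l : ℝ} (hl : κ < l) (f : E) :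
    (l - κ) ^ 2 * m (H.res l f) (H.res l f) ≤ m f f := by
  have h1 := H.sub_mul_res_le hl f
  have h2 := H.isInner.nonneg (f - (l - κ) • H.res l f)
  have h3 := H.isInner.symm f (H.res l f)
  simp only [map_sub, map_smul, sub_apply, smul_apply, smul_eq_mul] at h2
  have h4 := mul_le_mul_of_nonneg_left h1 (sub_pos.mpr hl).le
  nlinarith

theorem yosida_le (H : MDissipative m c κ G) {l : ℝ} (hl' : 2 * κ < l) (f : E) :
    m (l • H.res l f) (l • H.res l f) ≤ 4 * m f f := by
  have hl : κ < l := by linarith [H.nonneg]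
  have h1 := H.sq_mul_res_le hl f
  have h2 := H.isInner.nonneg (H.res l f)
  have h3 : l ^ 2 ≤ 4 * (l - κ) ^ 2 := by nlinarith [H.nonneg]
  have h4 := mul_le_mul_of_nonneg_right h3 h2
  simp only [map_smul, smul_apply, smul_eq_mul]
  nlinarith

theorem norm_sq_le (H : MDissipative m c κ G) (x : E) : ‖x‖ ^ 2 ≤ m x x / c := by
  rw [le_div_iff₀ H.isInner.pos, mul_comm]
  exact H.isInner.coercive x

theorem form_le (m : E →L[ℝ] E →L[ℝ] ℝ) (x : E) : m x x ≤ ‖m‖ * ‖x‖ ^ 2 := by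
  rw [sq, ← mul_assoc]
  exact IsInner.le_norm m x x

/-- The domain is dense. -/
theorem dense (H : MDissipative m c κ G) :
    ((G.map (LinearMap.fst ℝ E E)).topologicalClosure : Submodule ℝ E) = ⊤ := by
  rw [Submodule.topologicalClosure_eq_top_iff, Submodule.eq_bot_iff]
  intro f hf
  have hl : κ < κ + 1 := by linarith
  -- An `f` orthogonal to the domain is represented with respect to `m`, as dissipativity refers to
  -- that inner product.
  obtain ⟨f', hf'⟩ := exists_of_coercive m H.isInner.pos H.isInner.coercive (innerSL ℝ f)
  have h1 := H.res_mem hl f'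
  set y := H.res (κ + 1) f' with hy
  have h2 : inner ℝ y f = 0 := (Submodule.mem_orthogonal _ f).mp hf y ⟨_, h1, rfl⟩
  have h3 : m f' y = 0 := by
    rw [hf' y, innerSL_apply_apply, real_inner_comm, h2]
  have h4 := H.sub_mul_res_le hl f'
  rw [← hy, h3] at h4
  have h5 : y = 0 := H.isInner.eq_zero (by linarith)
  have h6 : f' = 0 := H.res_injective hl h5
  have h7 := hf' f
  rw [h6, map_zero, zero_apply, innerSL_apply_apply, real_inner_self_eq_norm_sq] at h7
  exact norm_eq_zero.mp (pow_eq_zero_iff two_ne_zero |>.mp h7.symm)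

/-- Every vector is a limit of vectors of the domain. -/
theorem exists_seq (H : MDissipative m c κ G) (x : E) :
    ∃ y z : ℕ → E, (∀ n, (y n, z n) ∈ G) ∧ Tendsto y atTop (𝓝 x) := by
  have h1 : x ∈ closure ((G.map (LinearMap.fst ℝ E E) : Submodule ℝ E) : Set E) := by
    rw [← Submodule.topologicalClosure_coe, H.dense]
    exact mem_univ x
  obtain ⟨y, hy, hy'⟩ := mem_closure_iff_seq_limit.mp h1
  choose p hp hp' using hy
  refine ⟨y, fun n => (p n).2, fun n => ?_, hy'⟩
  have : (p n).1 = y n := hp' n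
  rw [← this]
  exact hp n

theorem norm_yosida_le (H : MDissipative m c κ G) {l : ℝ} (hl' : 2 * κ < l) (f : E) :
    ‖l • H.res l f‖ ^ 2 ≤ 4 * ‖m‖ / c * ‖f‖ ^ 2 := by
  have h1 := H.norm_sq_le (l • H.res l f)
  have h2 := H.yosida_le hl' f
  have h3 := form_le m f
  refine h1.trans ?_
  rw [div_mul_eq_mul_div]
  refine div_le_div_of_nonneg_right ?_ H.isInner.pos.le
  linarith

/-- The Yosida regularizations `l (l - G)⁻¹` converge strongly to the identity. -/
theorem tendsto_yosida (H : MDissipative m c κ G) (x : E) :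
    Tendsto (fun l : ℝ => l • H.res l x) atTop (𝓝 x) := by
  set C := √(4 * ‖m‖ / c) with hC
  have hC0 : 0 ≤ 4 * ‖m‖ / c := div_nonneg (by positivity) H.isInner.pos.le
  have hb : ∀ l : ℝ, 2 * κ < l → ∀ f, ‖l • H.res l f‖ ≤ C * ‖f‖ := fun l hl f => by
    refine (abs_le_of_sq_le_sq' ?_ (by positivity)).2
    rw [mul_pow, hC, Real.sq_sqrt hC0]
    exact H.norm_yosida_le hl f
  have hD : ∀ y z, (y, z) ∈ G → Tendsto (fun l : ℝ => l • H.res l y) atTop (𝓝 y) := by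
    intro y z h
    rw [tendsto_iff_norm_sub_tendsto_zero]
    refine squeeze_zero' (g := fun l : ℝ => C * ‖z‖ * l⁻¹)
      (Eventually.of_forall fun _ => norm_nonneg _) ?_ ?_
    · filter_upwards [eventually_gt_atTop (2 * κ), eventually_gt_atTop 0] with l hl hl0
      have hl' : κ < l := by linarith [H.nonneg]
      have h1 := (H.mem_iff hl').mp h
      rw [map_sub, map_smul, sub_eq_iff_eq_add] at h1
      rw [h1, add_sub_cancel_left]
      have h2 := hb l hl z
      rw [norm_smul, Real.norm_of_nonneg hl0.le] at h2
      rw [← div_eq_mul_inv, le_div_iff₀ hl0]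
      linarith
    · simpa using tendsto_inv_atTop_zero.const_mul (C * ‖z‖)
  obtain ⟨y, z, hyz, hy⟩ := H.exists_seq x
  rw [Metric.tendsto_atTop]
  intro ε hε
  have hC1 : 0 < C + 2 := by positivity
  obtain ⟨n, hn⟩ := (Metric.tendsto_nhds.mp hy (ε / (C + 2)) (by positivity)).exists
  obtain ⟨l₀, h₀⟩ := (Metric.tendsto_atTop.mp (hD _ _ (hyz n))) (ε / (C + 2)) (by positivity)
  refine ⟨max l₀ (2 * κ + 1), fun l hl => ?_⟩
  have hl1 := h₀ l ((le_max_left _ _).trans hl)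
  have hl2 : 2 * κ < l := by linarith [(le_max_right _ _).trans hl]
  have h3 := hb l hl2 (x - y n)
  rw [map_sub, smul_sub] at h3
  rw [dist_eq_norm] at hl1 hn ⊢
  rw [norm_sub_rev] at hn
  have h4 : l • H.res l x - x = (l • H.res l x - l • H.res l (y n)) + (l • H.res l (y n) - y n)
    - (x - y n) := by abel
  rw [h4]
  have h5 := norm_sub_le ((l • H.res l x - l • H.res l (y n)) + (l • H.res l (y n) - y n))
    (x - y n)
  have h6 := norm_add_le (l • H.res l x - l • H.res l (y n)) (l • H.res l (y n) - y n)
  have h7 := mul_le_mul_of_nonneg_left hn.le (Real.sqrt_nonneg (4 * ‖m‖ / c))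
  have h8 : (C + 2) * (ε / (C + 2)) = ε := by field_simp
  linarith

/-- The integral of a curve in `G` is in `G`: the resolvent, being bounded, commutes with it. -/
theorem integral_mem (H : MDissipative m c κ G) {y z : ℝ → E} {a b : ℝ} (hab : a ≤ b)
    (hy : IntervalIntegrable y volume a b) (hz : IntervalIntegrable z volume a b)
    (h : ∀ t ∈ Ioo a b, (y t, z t) ∈ G) : (∫ t in a..b, y t, ∫ t in a..b, z t) ∈ G := by
  have hl : κ < κ + 1 := by linarith
  have hy' : IntervalIntegrable (fun t => (κ + 1) • y t) volume a b := hy.smul (κ + 1)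
  rw [H.mem_iff hl, ← intervalIntegral.integral_smul, ← intervalIntegral.integral_sub
    hy' hz, ← ContinuousLinearMap.intervalIntegral_comp_comm _ (hy'.sub hz)]
  refine intervalIntegral.integral_congr_ae ?_
  have h0 : ∀ᵐ t : ℝ, t ≠ b := by simp [ae_iff]
  filter_upwards [h0] with t ht ht'
  rw [uIoc_of_le hab] at ht'
  exact (H.mem_iff hl).mp (h t ⟨ht'.1, lt_of_le_of_ne ht'.2 ht⟩)

/-- The domain contains the limits of sequences along which the images stay bounded: these have a
weak limit, and the graph is weakly closed. -/
theorem exists_of_bounded (H : MDissipative m c κ G) {y z : ℕ → E} {x : E} {C : ℝ}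
    (h : ∀ n, (y n, z n) ∈ G) (hy : Tendsto y atTop (𝓝 x)) (hz : ∀ n, ‖z n‖ ≤ C) :
    ∃ g, ‖g‖ ≤ C ∧ (x, g) ∈ G := by
  have hl : κ < κ + 1 := by linarith
  obtain ⟨g, hg⟩ := exists_weak_limit hz
  have hl' : ((hyperfilter ℕ : Ultrafilter ℕ) : Filter ℕ) ≤ atTop := by
    rw [← Nat.cofinite_eq_atTop]
    exact hyperfilter_le_cofinite
  refine ⟨g, ?_, (H.mem_iff hl).mpr (ext_inner_right ℝ fun w => ?_)⟩
  · have h1 : inner ℝ g g ≤ C * ‖g‖ := le_of_tendsto (hg g) (Eventually.of_forall fun n =>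
      (real_inner_le_norm _ _).trans (mul_le_mul_of_nonneg_right (hz n) (norm_nonneg g)))
    rw [real_inner_self_eq_norm_sq, sq] at h1
    rcases (norm_nonneg g).eq_or_lt with h0 | h0
    · rw [← h0]
      exact (norm_nonneg _).trans (hz 0)
    · exact le_of_mul_le_mul_right h1 h0
  · have t1 : Tendsto (fun n => inner ℝ (y n) w) (hyperfilter ℕ) (𝓝 (inner ℝ x w)) :=
      (hy.mono_left hl').inner (𝕜 := ℝ) tendsto_const_nhds
    have t2 := tendsto_inner_weak_map hz hg (H.res (κ + 1)) (tendsto_const_nhds (x := w))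
    have t3 : Tendsto (fun n => inner ℝ (H.res (κ + 1) ((κ + 1) • y n)) w) (hyperfilter ℕ)
        (𝓝 (inner ℝ (H.res (κ + 1) ((κ + 1) • x)) w)) := by
      have : Continuous fun p : E => inner ℝ (H.res (κ + 1) ((κ + 1) • p)) w := by fun_prop
      exact (this.tendsto x).comp (hy.mono_left hl')
    refine tendsto_nhds_unique ((t3.sub t2).congr fun n => ?_) t1 |>.symm ▸ ?_
    · rw [← inner_sub_left, ← map_sub, (H.mem_iff hl).mp (h n)]
    · rw [map_sub, inner_sub_left]

end MDissipative

end Relation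

/-! ### The linear energy estimate and ordinary differential equations -/

section Mild

variable {E : Type*} [NormedAddCommGroup E] [InnerProductSpace ℝ E] [CompleteSpace E]
variable {m : E →L[ℝ] E →L[ℝ] ℝ} {c κ : ℝ} {G : Submodule ℝ (E × E)}

theorem IsInner.energy_le (hm : IsInner m c) {w w' : ℝ → E} {b : ℝ → ℝ} {K T : ℝ} (hK : 0 ≤ K)
    (hw : ∀ t ∈ Icc 0 T, HasDerivAt w (w' t) t) (hb : Continuous b) (hb0 : ∀ t, 0 ≤ b t)
    (h : ∀ t ∈ Icc 0 T, 2 * m (w' t) (w t) ≤ K * m (w t) (w t) + b t) {t : ℝ}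
    (ht : t ∈ Icc 0 T) :
    m (w t) (w t) ≤ Real.exp (K * t) * (m (w 0) (w 0) + ∫ s in (0 : ℝ)..t, b s) := by
  refine gronwall_source (u := fun t => m (w t) (w t)) (u' := fun t => 2 * m (w' t) (w t)) hK
    (fun s hs => ?_) hb hb0 h ht
  have h1 := (m.hasFDerivAt.comp_hasDerivAt s (hw s hs)).clm_apply (hw s hs)
  have h2 : 2 * m (w' s) (w s) = m (w' s) (w s) + m (w s) (w' s) := by
    rw [hm.symm (w s) (w' s)]
    ring
  rw [h2]
  exact h1

theorem IsInner.young (hm : IsInner m c) {δ : ℝ} (hδ : 0 < δ) (x y : E) :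
    2 * m x y ≤ δ * m x x + δ⁻¹ * m y y := by
  have h1 := hm.nonneg (δ • x - y)
  have h2 := hm.symm x y
  simp only [map_sub, map_smul, sub_apply, smul_apply, smul_eq_mul] at h1
  have h3 : 0 ≤ δ⁻¹ * (δ * (δ * m x x - m y x) - (δ * m x y - m y y)) :=
    mul_nonneg (inv_pos.mpr hδ).le (by linarith)
  have h4 : δ⁻¹ * (δ * (δ * m x x - m y x) - (δ * m x y - m y y))
      = δ * m x x - m y x - m x y + δ⁻¹ * m y y := by
    field_simp
    ring
  linarith

theorem continuous_self {X : Type*} [TopologicalSpace X] (m : E →L[ℝ] E →L[ℝ] ℝ) {f : X → E}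
    (hf : Continuous f) : Continuous fun t => m (f t) (f t) :=
  (m.continuous.comp hf).clm_apply hf

/-- The energy estimate `MDissipative.linear_le` for curves that are continuous on the whole line. -/
theorem MDissipative.linear_le_of_continuous (H : MDissipative m c κ G) {w f : ℝ → E} {T δ : ℝ}
    (hδ : 0 < δ) (hw : Continuous w) (hf : Continuous f)
    (h : ∀ t ∈ Icc 0 T, (∫ s in (0 : ℝ)..t, w s, w t - w 0 - ∫ s in (0 : ℝ)..t, f s) ∈ G)
    {t : ℝ} (ht : t ∈ Icc 0 T) :
    m (w t) (w t) ≤ 4 * Real.exp ((2 * κ + δ⁻¹) * t) *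
      (m (w 0) (w 0) + δ * ∫ s in (0 : ℝ)..t, m (f s) (f s)) := by
  have hbound : ∀ l : ℝ, 2 * κ < l → m (l • H.res l (w t)) (l • H.res l (w t)) ≤
      4 * Real.exp ((2 * κ + δ⁻¹) * t) *
        (m (w 0) (w 0) + δ * ∫ s in (0 : ℝ)..t, m (f s) (f s)) := by
    intro l hl
    have hl' : κ < l := by linarith [H.nonneg]
    let J : E →L[ℝ] E := l • H.res l
    have hJ : ∀ x, (J x, l • (J x - x)) ∈ G := fun x => by
      exact G.smul_mem l (H.res_mem hl' x)
    let g : ℝ → E := fun s => J (f s) + l • (J (w s) - w s)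
    have hg : Continuous g := by fun_prop
    let x : ℝ → E := fun t => J (w 0) + ∫ s in (0 : ℝ)..t, g s
    -- The regularized curve `l (l - G)⁻¹ w` is differentiable, with derivative `g`, and stays in the
    -- domain; so the differential energy estimate holds for it.
    have hx : ∀ t ∈ Icc 0 T, x t = J (w t) := by
      intro t ht
      have h1 := (H.mem_iff hl').mp (h t ht)
      have i1 : ∀ {k : ℝ → E}, Continuous k → IntervalIntegrable k volume 0 t :=
        fun hk => hk.intervalIntegrable _ _
      have h2 : ∫ s in (0 : ℝ)..t, g s = J (∫ s in (0 : ℝ)..t, f s)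
          + l • (J (∫ s in (0 : ℝ)..t, w s) - ∫ s in (0 : ℝ)..t, w s) := by
        simp only [g]
        rw [intervalIntegral.integral_add (i1 (by fun_prop)) (i1 (by fun_prop)),
          intervalIntegral.integral_smul,
          intervalIntegral.integral_sub (i1 (by fun_prop)) (i1 hw),
          ContinuousLinearMap.intervalIntegral_comp_comm _ (i1 hf),
          ContinuousLinearMap.intervalIntegral_comp_comm _ (i1 hw)]
      have h3 : J (∫ s in (0 : ℝ)..t, w s) - ∫ s in (0 : ℝ)..t, w s
          = H.res l (w t - w 0 - ∫ s in (0 : ℝ)..t, f s) := by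
        rw [map_sub, map_smul, sub_eq_iff_eq_add] at h1
        change l • H.res l _ - _ = _
        rw [h1, add_sub_cancel_left]
      simp only [x]
      rw [h2, h3]
      simp only [J, smul_apply, map_sub, smul_sub]
      abel
    have h4 := H.isInner.energy_le (w := x) (w' := g) (K := 2 * κ + δ⁻¹)
      (b := fun s => δ * m (J (f s)) (J (f s))) (T := T)
      (add_nonneg (by linarith [H.nonneg]) (inv_pos.mpr hδ).le)
      (fun s _ => ((hg.integral_hasStrictDerivAt 0 s).hasDerivAt.const_add _))
      (continuous_const.mul (continuous_self m (J.continuous.comp hf)))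
      (fun s => mul_nonneg hδ.le (H.isInner.nonneg _)) (fun s hs => by
        rw [hx s hs]
        have h5 := H.diss _ _ (hJ (w s))
        have h6 := H.isInner.young hδ (J (f s)) (J (w s))
        simp only [g, map_add, add_apply]
        linarith) ht
    have hx0 : x 0 = J (w 0) := by simp [x]
    rw [hx t ht, hx0] at h4
    refine h4.trans ?_
    rw [intervalIntegral.integral_const_mul]
    have h7 : ∫ s in (0 : ℝ)..t, m (J (f s)) (J (f s)) ≤ 4 * ∫ s in (0 : ℝ)..t, m (f s) (f s) := by
      rw [← intervalIntegral.integral_const_mul]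
      refine intervalIntegral.integral_mono_on ht.1
        ((continuous_self m (J.continuous.comp hf)).intervalIntegrable _ _)
        ((continuous_const.mul (continuous_self m hf)).intervalIntegrable _ _)
        fun s _ => H.yosida_le hl (f s)
    have h8 : m (J (w 0)) (J (w 0)) ≤ 4 * m (w 0) (w 0) := H.yosida_le hl (w 0)
    have h9 := mul_le_mul_of_nonneg_left h7 hδ.le
    have h10 := Real.exp_pos ((2 * κ + δ⁻¹) * t)
    rw [mul_comm 4 (Real.exp _), mul_assoc]
    refine mul_le_mul_of_nonneg_left ?_ h10.le
    linarith
  have h1 : Tendsto (fun l : ℝ => m (l • H.res l (w t)) (l • H.res l (w t))) atTop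
      (𝓝 (m (w t) (w t))) :=
    ((continuous_self m continuous_id).tendsto (w t)).comp (H.tendsto_yosida (w t))
  exact le_of_tendsto h1 ((eventually_gt_atTop (2 * κ)).mono hbound)

theorem integral_congr_Icc {X : Type*} [NormedAddCommGroup X] [NormedSpace ℝ X] {f g : ℝ → X}
    {T t : ℝ} (h : ∀ s ∈ Icc 0 T, f s = g s) (ht : t ∈ Icc 0 T) :
    ∫ s in (0 : ℝ)..t, f s = ∫ s in (0 : ℝ)..t, g s := by
  refine intervalIntegral.integral_congr fun s hs => h s ?_
  rw [uIcc_of_le ht.1] at hs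
  exact ⟨hs.1, hs.2.trans ht.2⟩

/-- A continuous curve on `[0, T]` is the restriction of a continuous curve. -/
theorem exists_continuous_extension {X : Type*} [TopologicalSpace X] {f : ℝ → X} {T : ℝ}
    (hT : 0 ≤ T) (hf : ContinuousOn f (Icc 0 T)) :
    ∃ g : ℝ → X, Continuous g ∧ ∀ s ∈ Icc 0 T, f s = g s :=
  ⟨IccExtend hT ((Icc 0 T).domRestrict f), hf.domRestrict.Icc_extend',
    fun _ hs => (IccExtend_of_mem hT ((Icc 0 T).domRestrict f) hs).symm⟩

/-- The energy estimate for mild solutions of `w' = G w + f`. The inhomogeneity is weighted with a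
free parameter, so that on short intervals it contributes `O(t²)`. -/
theorem MDissipative.linear_le (H : MDissipative m c κ G) {w f : ℝ → E} {T δ : ℝ}
    (hδ : 0 < δ) (hw : ContinuousOn w (Icc 0 T)) (hf : ContinuousOn f (Icc 0 T))
    (h : ∀ t ∈ Icc 0 T, (∫ s in (0 : ℝ)..t, w s, w t - w 0 - ∫ s in (0 : ℝ)..t, f s) ∈ G)
    {t : ℝ} (ht : t ∈ Icc 0 T) :
    m (w t) (w t) ≤ 4 * Real.exp ((2 * κ + δ⁻¹) * t) *
      (m (w 0) (w 0) + δ * ∫ s in (0 : ℝ)..t, m (f s) (f s)) := by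
  have hT : 0 ≤ T := ht.1.trans ht.2
  have h0 : (0 : ℝ) ∈ Icc 0 T := ⟨le_rfl, hT⟩
  obtain ⟨w', hw', e1⟩ := exists_continuous_extension hT hw
  obtain ⟨f', hf', e2⟩ := exists_continuous_extension hT hf
  have h1 := H.linear_le_of_continuous hδ hw' hf' (T := T) (fun s hs => by
    rw [← e1 s hs, ← e1 0 h0, ← integral_congr_Icc e1 hs, ← integral_congr_Icc e2 hs]
    exact h s hs) ht
  rw [← e1 t ht, ← e1 0 h0] at h1
  rw [integral_congr_Icc (g := fun s => m (f' s) (f' s)) (fun s hs => by rw [e2 s hs]) ht]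
  exact h1

end Mild

section Retraction

variable {E : Type*} [NormedAddCommGroup E] [NormedSpace ℝ E]

/-- The radial retraction onto the ball of radius `R`. -/
def retract (R : ℝ) (x : E) : E := (R / max R ‖x‖) • x

theorem retract_of_le {R : ℝ} (hR : 0 < R) {x : E} (h : ‖x‖ ≤ R) : retract R x = x := by
  rw [retract, max_eq_left h, div_self hR.ne', one_smul]

theorem norm_retract_le {R : ℝ} (hR : 0 < R) (x : E) : ‖retract R x‖ ≤ R := by
  have h1 : 0 < max R ‖x‖ := lt_max_of_lt_left hR
  rw [retract, norm_smul, Real.norm_of_nonneg (div_pos hR h1).le, div_mul_eq_mul_div,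
    div_le_iff₀ h1]
  exact mul_le_mul_of_nonneg_left (le_max_right _ _) hR.le

theorem norm_retract_le_norm {R : ℝ} (hR : 0 < R) (x : E) : ‖retract R x‖ ≤ ‖x‖ := by
  have h1 : 0 < max R ‖x‖ := lt_max_of_lt_left hR
  rw [retract, norm_smul, Real.norm_of_nonneg (div_pos hR h1).le]
  exact mul_le_of_le_one_left (norm_nonneg _) ((div_le_one h1).mpr (le_max_left _ _))

theorem norm_retract_sub_le {R : ℝ} (hR : 0 < R) (x y : E) :
    ‖retract R x - retract R y‖ ≤ 2 * ‖x - y‖ := by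
  have h1 : 0 < max R ‖x‖ := lt_max_of_lt_left hR
  have h2 : 0 < max R ‖y‖ := lt_max_of_lt_left hR
  have e : retract R x - retract R y
      = (R / max R ‖y‖) • (x - y) + (R / max R ‖x‖ - R / max R ‖y‖) • x := by
    rw [retract, retract, smul_sub, sub_smul]
    abel
  have h3 : ‖(R / max R ‖y‖) • (x - y)‖ ≤ ‖x - y‖ := by
    rw [norm_smul, Real.norm_of_nonneg (div_pos hR h2).le]
    exact mul_le_of_le_one_left (norm_nonneg _) ((div_le_one h2).mpr (le_max_left _ _))
  have h4 : ‖(R / max R ‖x‖ - R / max R ‖y‖) • x‖ ≤ ‖x - y‖ := by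
    have e2 : R / max R ‖x‖ - R / max R ‖y‖
        = (R / max R ‖y‖) * (max R ‖y‖ - max R ‖x‖) / max R ‖x‖ := by
      field_simp
    have h5 : |max R ‖y‖ - max R ‖x‖| ≤ ‖x - y‖ := by
      have := abs_max_sub_max_le_abs ‖y‖ ‖x‖ R
      rw [norm_sub_rev, max_comm R, max_comm R]
      exact this.trans (abs_norm_sub_norm_le _ _)
    rw [e2, norm_smul, Real.norm_eq_abs, abs_div, abs_mul, abs_of_pos (div_pos hR h2),
      abs_of_pos h1, div_mul_eq_mul_div, div_le_iff₀ h1]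
    have h6 : R / max R ‖y‖ ≤ 1 := (div_le_one h2).mpr (le_max_left _ _)
    have h7 : R / max R ‖y‖ * |max R ‖y‖ - max R ‖x‖| ≤ ‖x - y‖ :=
      (mul_le_of_le_one_left (abs_nonneg _) h6).trans h5
    exact mul_le_mul h7 (le_max_right _ _) (norm_nonneg _) (norm_nonneg _)
  rw [e]
  linarith [norm_add_le ((R / max R ‖y‖) • (x - y)) ((R / max R ‖x‖ - R / max R ‖y‖) • x)]

end Retraction

section ODE

variable {E : Type*} [NormedAddCommGroup E] [NormedSpace ℝ E] [CompleteSpace E]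

/-- Global existence for bounded Lipschitz vector fields, from the Picard–Lindelöf theorem. -/
theorem exists_ode_of_bounded {F : E → E} {k L : NNReal} (hF : LipschitzWith k F)
    (hL : ∀ x, ‖F x‖ ≤ L) (x₀ : E) {T : ℝ} (hT : 0 ≤ T) :
    ∃ y : ℝ → E, y 0 = x₀ ∧ ∀ t ∈ Icc 0 T, HasDerivAt y (F (y t)) t := by
  have h0 : (0 : ℝ) ∈ Icc (-1 : ℝ) (T + 1) := ⟨by norm_num, by linarith⟩
  have hp : IsPicardLindelof (fun _ => F) (⟨0, h0⟩ : Icc (-1 : ℝ) (T + 1)) x₀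
      (L * (T + 1).toNNReal) 0 L k :=
    { lipschitzOnWith := fun _ _ => hF.lipschitzOnWith
      continuousOn := fun _ _ => continuousOn_const
      norm_le := fun _ _ x _ => hL x
      mul_max_le := by
        rw [max_eq_left (by simp; linarith)]
        simp only [sub_zero, NNReal.coe_mul, NNReal.coe_zero]
        rw [Real.coe_toNNReal _ (by linarith)] }
  obtain ⟨y, hy0, hy⟩ := hp.exists_eq_forall_mem_Icc_hasDerivWithinAt₀
  refine ⟨y, hy0, fun t ht => ?_⟩
  exact (hy t ⟨by linarith [ht.1], by linarith [ht.2]⟩).hasDerivAt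
    (Icc_mem_nhds (by linarith [ht.1]) (by linarith [ht.2]))

/-- Global existence for Lipschitz vector fields. -/
theorem exists_ode {F : E → E} {k : NNReal} (hF : LipschitzWith k F) (x₀ : E) {T : ℝ}
    (hT : 0 ≤ T) : ∃ y : ℝ → E, y 0 = x₀ ∧ ∀ t ∈ Icc 0 T, HasDerivAt y (F (y t)) t := by
  -- The field is truncated outside of a ball that the solution does not leave, by Grönwall.
  set R : ℝ := max 1 (gronwallBound ‖x₀‖ k ‖F 0‖ T) with hR
  have hR0 : 0 < R := lt_max_of_lt_left one_pos
  have hgrow : ∀ x, ‖F x‖ ≤ k * ‖x‖ + ‖F 0‖ := fun x => by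
    have := hF.norm_sub_le x 0
    rw [sub_zero] at this
    linarith [norm_sub_norm_le (F x) (F 0)]
  have hL2 : LipschitzWith (k * 2) fun x => F (retract R x) :=
    hF.comp (LipschitzWith.of_dist_le_mul fun x y => by
      rw [dist_eq_norm, dist_eq_norm]
      exact norm_retract_sub_le hR0 x y)
  obtain ⟨y, hy0, hy⟩ := exists_ode_of_bounded (L := k * R.toNNReal + ‖F 0‖₊) hL2 (fun x => by
    refine (hgrow _).trans ?_
    rw [NNReal.coe_add, NNReal.coe_mul, Real.coe_toNNReal _ hR0.le, coe_nnnorm]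
    have := mul_le_mul_of_nonneg_left (norm_retract_le hR0 x) k.2
    linarith!) x₀ hT
  have hb : ∀ t ∈ Icc 0 T, ‖y t‖ ≤ R := by
    intro t ht
    have h1 := norm_le_gronwallBound_of_norm_deriv_right_le (f := y) (δ := ‖x₀‖) (K := k)
      (ε := ‖F 0‖) (a := 0) (b := T) (fun s hs => (hy s hs).continuousAt.continuousWithinAt)
      (fun s hs => (hy s ⟨hs.1, hs.2.le⟩).hasDerivWithinAt) (by rw [hy0])
      (fun s hs => (hgrow _).trans (add_le_add (mul_le_mul_of_nonneg_left
        (norm_retract_le_norm hR0 _) k.2) le_rfl)) t ht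
    refine h1.trans (le_trans ?_ (le_max_right _ _))
    rw [sub_zero]
    exact gronwallBound_mono (norm_nonneg _) (norm_nonneg _) k.2 ht.2
  refine ⟨y, hy0, fun t ht => ?_⟩
  have := hy t ht
  rwa [retract_of_le hR0 (hb t ht)] at this

end ODE

/-! ### Mild solutions and continuous dependence -/

section UniformLimits

variable {E : Type*} [NormedAddCommGroup E] [NormedSpace ℝ E]

theorem LocLip.continuous {X : Type*} [NormedAddCommGroup X] {F : E → X} (hF : LocLip F) :
    Continuous F := by
  refine continuous_iff_continuousAt.mpr fun x => ?_
  obtain ⟨k, hk, h⟩ := hF (‖x‖ + 1) (by positivity)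
  have h1 : LipschitzOnWith k.toNNReal F (Metric.closedBall 0 (‖x‖ + 1)) :=
    LipschitzOnWith.of_dist_le_mul fun a ha b hb => by
      rw [dist_eq_norm, dist_eq_norm, Real.coe_toNNReal _ hk.le]
      exact h a b (by simpa using ha) (by simpa using hb)
  refine h1.continuousOn.continuousAt (Metric.closedBall_mem_nhds_of_mem ?_)
  simp

theorem exists_norm_le {X : Type*} [NormedAddCommGroup X] {y : ℝ → X} {T : ℝ}
    (hy : ContinuousOn y (Icc 0 T)) : ∃ C, 0 < C ∧ ∀ t ∈ Icc 0 T, ‖y t‖ ≤ C := by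
  obtain ⟨C, hC⟩ := isCompact_Icc.exists_bound_of_continuousOn hy
  exact ⟨max C 1, lt_max_of_lt_right one_pos, fun t ht => (hC t ht).trans (le_max_left _ _)⟩

theorem LocLip.tendstoUniformlyOn {F : E → E} (hF : LocLip F) {y : ℕ → ℝ → E} {x : ℝ → E} {T : ℝ}
    (hx : ContinuousOn x (Icc 0 T)) (h : TendstoUniformlyOn y x atTop (Icc 0 T)) :
    TendstoUniformlyOn (fun n t => F (y n t)) (fun t => F (x t)) atTop (Icc 0 T) := by
  obtain ⟨C, hC0, hC⟩ := exists_norm_le hx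
  obtain ⟨k, hk, hl⟩ := hF (C + 1) (by linarith)
  rw [Metric.tendstoUniformlyOn_iff] at h ⊢
  intro ε hε
  filter_upwards [h 1 one_pos, h (ε / k) (div_pos hε hk)] with n h1 h2 t ht
  have h3 := h1 t ht
  have h4 := h2 t ht
  rw [dist_eq_norm] at h3 h4 ⊢
  have h5 : ‖y n t‖ ≤ C + 1 := by
    have := norm_sub_norm_le (y n t) (x t)
    rw [norm_sub_rev] at this
    linarith [hC t ht]
  refine (hl _ _ ((hC t ht).trans (by linarith)) h5).trans_lt ?_
  rwa [lt_div_iff₀ hk, mul_comm] at h4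

theorem intervalIntegrable_of_Icc {X : Type*} [NormedAddCommGroup X] {f : ℝ → X} {T t : ℝ}
    (hf : ContinuousOn f (Icc 0 T)) (ht : t ∈ Icc 0 T) : IntervalIntegrable f volume 0 t := by
  refine ContinuousOn.intervalIntegrable (hf.mono ?_)
  rw [uIcc_of_le ht.1]
  exact Icc_subset_Icc_right ht.2

theorem tendsto_integral_of_uniform {f : ℕ → ℝ → E} {g : ℝ → E} {T t : ℝ} (ht : t ∈ Icc 0 T)
    (hf : ∀ n, ContinuousOn (f n) (Icc 0 T)) (hg : ContinuousOn g (Icc 0 T))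
    (h : TendstoUniformlyOn f g atTop (Icc 0 T)) :
    Tendsto (fun n => ∫ s in (0 : ℝ)..t, f n s) atTop (𝓝 (∫ s in (0 : ℝ)..t, g s)) := by
  rw [Metric.tendsto_atTop']
  intro ε hε
  have hT : 0 ≤ T := ht.1.trans ht.2
  rw [Metric.tendstoUniformlyOn_iff] at h
  obtain ⟨N, hN⟩ := eventually_atTop.mp (h (ε / (T + 1)) (by positivity))
  refine ⟨N, fun n hn => ?_⟩
  rw [dist_eq_norm, ← intervalIntegral.integral_sub (intervalIntegrable_of_Icc (hf n) ht)
    (intervalIntegrable_of_Icc hg ht)]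
  have h1 : ‖∫ s in (0 : ℝ)..t, (f n s - g s)‖ ≤ ε / (T + 1) * |t - 0| := by
    refine intervalIntegral.norm_integral_le_of_norm_le_const fun s hs => ?_
    rw [uIoc_of_le ht.1] at hs
    have := hN n hn.le s ⟨hs.1.le, hs.2.trans ht.2⟩
    rw [dist_comm, dist_eq_norm] at this
    exact this.le
  refine h1.trans_lt ?_
  rw [sub_zero, abs_of_nonneg ht.1, div_mul_eq_mul_div, div_lt_iff₀ (by positivity)]
  have := ht.2
  nlinarith

theorem exists_uniform_limit [CompleteSpace E] {f : ℕ → ℝ → E} {s : Set ℝ} {ε : ℕ → ℝ}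
    (hε : Tendsto ε atTop (𝓝 0)) (h : ∀ n j, ∀ t ∈ s, ‖f n t - f j t‖ ^ 2 ≤ ε n + ε j) :
    ∃ g, TendstoUniformlyOn f g atTop s := by
  have hc : UniformCauchySeqOn f atTop s := by
    rw [Metric.uniformCauchySeqOn_iff]
    intro δ hδ
    obtain ⟨N, hN⟩ := eventually_atTop.mp
      (hε.eventually (gt_mem_nhds (show 0 < δ ^ 2 / 2 by positivity)))
    refine ⟨N, fun n hn j hj t ht => ?_⟩
    rw [dist_eq_norm]
    refine lt_of_pow_lt_pow_left₀ 2 hδ.le ((h n j t ht).trans_lt ?_)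
    linarith [hN n hn, hN j hj]
  have h1 : ∀ t, ∃ x, t ∈ s → Tendsto (fun n => f n t) atTop (𝓝 x) := fun t => by
    by_cases ht : t ∈ s
    · obtain ⟨x, hx⟩ := cauchySeq_tendsto_of_complete (hc.cauchySeq ht)
      exact ⟨x, fun _ => hx⟩
    · exact ⟨0, fun h => absurd h ht⟩
  choose g hg using h1
  exact ⟨g, hc.tendstoUniformlyOn_of_tendsto fun t ht => hg t ht⟩

end UniformLimits

section Mild

variable {E : Type*} [NormedAddCommGroup E] [InnerProductSpace ℝ E] [CompleteSpace E]
variable {m : E →L[ℝ] E →L[ℝ] ℝ} {c κ : ℝ} {G : Submodule ℝ (E × E)}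

/-- Mild solutions of `y' = G y + F(y)` on `[0, T]`: the equation, integrated in time. -/
structure IsMild (G : Submodule ℝ (E × E)) (F : E → E) (T : ℝ) (y : ℝ → E) : Prop where
  cont : ContinuousOn y (Icc 0 T)
  mem : ∀ t ∈ Icc 0 T, (∫ s in (0 : ℝ)..t, y s, y t - y 0 - ∫ s in (0 : ℝ)..t, F (y s)) ∈ G

theorem IsMild.mono {F : E → E} {T S : ℝ} {y : ℝ → E} (h : IsMild G F T y) (hS : S ≤ T) :
    IsMild G F S y :=
  ⟨h.cont.mono (Icc_subset_Icc_right hS), fun t ht => h.mem t ⟨ht.1, ht.2.trans hS⟩⟩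

theorem IsMild.congr {F F' : E → E} {T : ℝ} {y y' : ℝ → E} (h : IsMild G F T y)
    (hF : ∀ t ∈ Icc 0 T, F (y t) = F' (y t)) (hy : ∀ t ∈ Icc 0 T, y t = y' t) :
    IsMild G F' T y' := by
  refine ⟨h.cont.congr fun t ht => (hy t ht).symm, fun t ht => ?_⟩
  have h0 : (0 : ℝ) ∈ Icc 0 T := ⟨le_rfl, ht.1.trans ht.2⟩
  have h1 := h.mem t ht
  have h2 : ∀ s ∈ Icc 0 T, F (y s) = F' (y' s) := fun s hs => by rw [hF s hs, hy s hs]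
  rwa [integral_congr_Icc h2 ht, integral_congr_Icc hy ht, hy t ht, hy 0 h0] at h1

/-- Limits of approximate mild solutions are mild. -/
theorem MDissipative.isMild_of_tendsto (H : MDissipative m c κ G) {F : E → E} (hF : LocLip F)
    {T : ℝ} {x y : ℕ → ℝ → E} {z : ℝ → E} (hx : ∀ n, ContinuousOn (x n) (Icc 0 T))
    (hy : ∀ n, ContinuousOn (y n) (Icc 0 T))
    (h : ∀ n, ∀ t ∈ Icc 0 T,
      (∫ s in (0 : ℝ)..t, x n s, y n t - y n 0 - ∫ s in (0 : ℝ)..t, F (y n s)) ∈ G)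
    (hxz : TendstoUniformlyOn x z atTop (Icc 0 T)) (hyz : TendstoUniformlyOn y z atTop (Icc 0 T)) :
    IsMild G F T z := by
  have hz : ContinuousOn z (Icc 0 T) := hyz.continuousOn (Frequently.of_forall hy)
  refine ⟨hz, fun t ht => ?_⟩
  have h0 : (0 : ℝ) ∈ Icc 0 T := ⟨le_rfl, ht.1.trans ht.2⟩
  have hl : κ < κ + 1 := by linarith
  have t1 := tendsto_integral_of_uniform ht hx hz hxz
  have t2 := tendsto_integral_of_uniform ht (fun n => hF.continuous.comp_continuousOn (hy n))
    (hF.continuous.comp_continuousOn hz) (hF.tendstoUniformlyOn hz hyz)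
  have t3 := ((hyz.tendsto_at ht).sub (hyz.tendsto_at h0)).sub t2
  exact (H.isClosed hl).mem_of_tendsto (t1.prodMk_nhds t3)
    (Eventually.of_forall fun n => h n t ht)

/-- Continuous dependence of mild solutions on the initial value. -/
theorem MDissipative.exists_stability (H : MDissipative m c κ G) (k T : ℝ) :
    ∃ C, 0 ≤ C ∧ ∀ {F : E → E} {S : ℝ} {y z : ℝ → E}, Continuous F → S ≤ T → IsMild G F S y →
      IsMild G F S z → (∀ s ∈ Icc 0 S, ‖F (y s) - F (z s)‖ ≤ k * ‖y s - z s‖) →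
      ∀ t ∈ Icc 0 S, ‖y t - z t‖ ≤ C * ‖y 0 - z 0‖ := by
  set A : ℝ := 4 * Real.exp ((2 * κ + 1⁻¹) * T) with hA
  set B : ℝ := ‖m‖ * k ^ 2 / c with hB
  have hA0 : 0 ≤ A := by positivity
  have hB0 : 0 ≤ B := div_nonneg (by positivity) H.isInner.pos.le
  set D : ℝ := A * Real.exp (A * B * T) * (‖m‖ / c) with hD
  have hD0 : 0 ≤ D := mul_nonneg (by positivity) (div_nonneg (by positivity) H.isInner.pos.le)
  refine ⟨√D, Real.sqrt_nonneg _, fun {F S y z} hF hST hy hz hL t ht => ?_⟩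
  have hS : 0 ≤ S := ht.1.trans ht.2
  have hw : ContinuousOn (fun s => y s - z s) (Icc 0 S) := hy.cont.sub hz.cont
  have hFy : ContinuousOn (fun s => F (y s)) (Icc 0 S) := hF.comp_continuousOn hy.cont
  have hFz : ContinuousOn (fun s => F (z s)) (Icc 0 S) := hF.comp_continuousOn hz.cont
  have hf : ContinuousOn (fun s => F (y s) - F (z s)) (Icc 0 S) := hFy.sub hFz
  have hmem : ∀ t ∈ Icc 0 S, (∫ s in (0 : ℝ)..t, (y s - z s),
      (y t - z t) - (y 0 - z 0) - ∫ s in (0 : ℝ)..t, (F (y s) - F (z s))) ∈ G := by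
    intro t ht
    have h1 := G.sub_mem (hy.mem t ht) (hz.mem t ht)
    rw [Prod.mk_sub_mk] at h1
    rw [intervalIntegral.integral_sub (intervalIntegrable_of_Icc hy.cont ht)
      (intervalIntegrable_of_Icc hz.cont ht), intervalIntegral.integral_sub
      (intervalIntegrable_of_Icc hFy ht) (intervalIntegrable_of_Icc hFz ht)]
    convert h1 using 2
    abel
  have hv : ContinuousOn (fun s => m (y s - z s) (y s - z s)) (Icc 0 S) :=
    (continuous_self m continuous_id).comp_continuousOn hw
  obtain ⟨v, hvc, hve⟩ := exists_continuous_extension hS hv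
  have hN : ∀ x : E, ‖x‖ ^ 2 ≤ m x x / c := H.norm_sq_le
  have h1 : ∀ t ∈ Icc 0 S, v t ≤ A * (v 0 + B * ∫ s in (0 : ℝ)..t, v s) := by
    intro t ht
    have h2 := H.linear_le one_pos hw hf hmem ht
    have h3 : ∫ s in (0 : ℝ)..t, m (F (y s) - F (z s)) (F (y s) - F (z s))
        ≤ ∫ s in (0 : ℝ)..t, B * v s := by
      refine intervalIntegral.integral_mono_on ht.1 (intervalIntegrable_of_Icc
        ((continuous_self m continuous_id).comp_continuousOn hf) ht)
        ((continuous_const.mul hvc).intervalIntegrable _ _) fun s hs => ?_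
      have hs' : s ∈ Icc 0 S := ⟨hs.1, hs.2.trans ht.2⟩
      have h4 := MDissipative.form_le m (F (y s) - F (z s))
      have h5 : ‖F (y s) - F (z s)‖ ^ 2 ≤ (k * ‖y s - z s‖) ^ 2 :=
        pow_le_pow_left₀ (norm_nonneg _) (hL s hs') 2
      have h6 := hN (y s - z s)
      rw [← hve s hs', hB]
      calc m (F (y s) - F (z s)) (F (y s) - F (z s)) ≤ ‖m‖ * (k * ‖y s - z s‖) ^ 2 :=
            h4.trans (mul_le_mul_of_nonneg_left h5 (by positivity))
        _ = ‖m‖ * k ^ 2 * ‖y s - z s‖ ^ 2 := by ring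
        _ ≤ ‖m‖ * k ^ 2 * (m (y s - z s) (y s - z s) / c) :=
            mul_le_mul_of_nonneg_left h6 (by positivity)
        _ = ‖m‖ * k ^ 2 / c * m (y s - z s) (y s - z s) := by ring
    rw [intervalIntegral.integral_const_mul] at h3
    rw [← hve t ht, ← hve 0 ⟨le_rfl, hS⟩]
    refine h2.trans ?_
    rw [hA, one_mul]
    have h7 : Real.exp ((2 * κ + 1⁻¹) * t) ≤ Real.exp ((2 * κ + 1⁻¹) * T) := by
      refine Real.exp_le_exp.mpr (mul_le_mul_of_nonneg_left (ht.2.trans hST) ?_)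
      have := H.nonneg
      norm_num
      linarith
    have h8 : 0 ≤ ∫ s in (0 : ℝ)..t, v s := intervalIntegral.integral_nonneg ht.1 fun s hs => by
      rw [← hve s ⟨hs.1, hs.2.trans ht.2⟩]
      exact H.isInner.nonneg _
    have h9 := H.isInner.nonneg (y 0 - z 0)
    refine mul_le_mul (by linarith) (by linarith) ?_ (by positivity)
    exact add_nonneg h9 (intervalIntegral.integral_nonneg ht.1 fun s _ => H.isInner.nonneg _)
  -- Grönwall for the right-hand side of `h1`.
  have h2 := gronwall_source (u := fun t => v 0 + B * ∫ s in (0 : ℝ)..t, v s)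
    (u' := fun t => B * v t) (b := fun _ => 0) (K := A * B) (T := S) (mul_nonneg hA0 hB0)
    (fun s _ => (((hvc.integral_hasStrictDerivAt 0 s).hasDerivAt.const_mul B).const_add _))
    continuous_const (fun _ => le_rfl) (fun s hs => by
      have := mul_le_mul_of_nonneg_left (h1 s hs) hB0
      linarith) ht
  simp only [intervalIntegral.integral_same, mul_zero, add_zero,
    intervalIntegral.integral_zero] at h2
  have hv0 : 0 ≤ v 0 := by
    rw [← hve 0 ⟨le_rfl, hS⟩]
    exact H.isInner.nonneg _
  have h3 : v t ≤ A * Real.exp (A * B * T) * v 0 := by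
    refine (h1 t ht).trans ?_
    rw [mul_assoc A]
    refine mul_le_mul_of_nonneg_left (h2.trans (mul_le_mul_of_nonneg_right ?_ hv0)) hA0
    exact Real.exp_le_exp.mpr (mul_le_mul_of_nonneg_left (ht.2.trans hST) (mul_nonneg hA0 hB0))
  rw [← hve t ht, ← hve 0 ⟨le_rfl, hS⟩] at h3
  have h4 : ‖y t - z t‖ ^ 2 ≤ D * ‖y 0 - z 0‖ ^ 2 := by
    refine (hN _).trans ((div_le_div_of_nonneg_right (h3.trans (mul_le_mul_of_nonneg_left
      (MDissipative.form_le m (y 0 - z 0)) (by positivity))) H.isInner.pos.le).trans_eq ?_)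
    rw [hD]
    ring
  refine le_of_sq_le_sq ?_ (by positivity)
  rwa [mul_pow, Real.sq_sqrt hD0]

end Mild

/-! ### Yosida approximation -/

section Yosida

variable {E : Type*} [NormedAddCommGroup E] [InnerProductSpace ℝ E] [CompleteSpace E]
variable {m : E →L[ℝ] E →L[ℝ] ℝ} {c κ : ℝ} {G : Submodule ℝ (E × E)}

/-- The Yosida approximation `l (l (l - G)⁻¹ - 1)` of `G`. -/
def MDissipative.yosida (H : MDissipative m c κ G) (l : ℝ) : E →L[ℝ] E :=
  l • (l • H.res l - ContinuousLinearMap.id ℝ E)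

theorem MDissipative.yosida_mem (H : MDissipative m c κ G) {l : ℝ} (hl : κ < l) (x : E) :
    (l • H.res l x, H.yosida l x) ∈ G :=
  G.smul_mem l (H.res_mem hl x)

theorem MDissipative.eq_sub_yosida (H : MDissipative m c κ G) {l : ℝ} (hl : 0 < l) (x : E) :
    l • H.res l x = x + l⁻¹ • H.yosida l x := by
  change _ = x + l⁻¹ • l • (l • H.res l x - x)
  rw [smul_smul, inv_mul_cancel₀ hl.ne', one_smul, add_sub_cancel]

theorem MDissipative.yosida_form_le (H : MDissipative m c κ G) {l : ℝ} (hl' : 2 * κ < l)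
    (x : E) : m (H.yosida l x) x ≤ 4 * κ * m x x := by
  have hl : κ < l := by linarith [H.nonneg]
  have hl0 : 0 < l := by linarith [H.nonneg]
  have h1 := H.diss _ _ (H.yosida_mem hl x)
  have h2 := H.yosida_le hl' x
  have h3 := mul_nonneg (inv_pos.mpr hl0).le (H.isInner.nonneg (H.yosida l x))
  have h4 : m (H.yosida l x) (l • H.res l x)
      = m (H.yosida l x) x + l⁻¹ * m (H.yosida l x) (H.yosida l x) := by
    rw [H.eq_sub_yosida hl0 x, map_add, map_smul, smul_eq_mul]
  rw [h4] at h1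
  have h5 := mul_le_mul_of_nonneg_left h2 H.nonneg
  linarith

theorem MDissipative.yosida_of_mem (H : MDissipative m c κ G) {l : ℝ} (hl : κ < l) {y z : E}
    (h : (y, z) ∈ G) : H.yosida l y = l • H.res l z := by
  have h1 := (H.mem_iff hl).mp h
  rw [map_sub, map_smul, sub_eq_iff_eq_add] at h1
  change l • (l • H.res l y - y) = _
  rw [h1, add_sub_cancel_left]

/-- The regularized equation, with a bound on the regularized operator along the solution that
does not depend on the regularization: difference quotients in time satisfy the energy estimate,
and initially they are controlled since the initial value is in the domain. -/
theorem MDissipative.exists_approx (H : MDissipative m c κ G) {F : E → E} {k : NNReal}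
    (hF : LipschitzWith k F) {T : ℝ} (hT : 0 ≤ T) {y₀ z₀ : E} (h₀ : (y₀, z₀) ∈ G) :
    ∃ D, 0 ≤ D ∧ ∀ l, 2 * κ < l → ∃ y : ℝ → E, y 0 = y₀ ∧
      ∀ t ∈ Icc 0 T, HasDerivAt y (H.yosida l (y t) + F (y t)) t ∧ ‖H.yosida l (y t)‖ ≤ D := by
  set B : ℝ := ‖m‖ * k ^ 2 / c with hB
  have hc := H.isInner.pos
  have hB0 : 0 ≤ B := div_nonneg (by positivity) hc.le
  set K : ℝ := 8 * κ + 1 + B with hK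
  have hK0 : 0 ≤ K := by linarith [H.nonneg]
  set C₁ : ℝ := √(4 * ‖m‖ / c * ‖z₀‖ ^ 2) + ‖F y₀‖ with hC₁
  have hC₁0 : 0 ≤ C₁ := add_nonneg (Real.sqrt_nonneg _) (norm_nonneg _)
  set V : ℝ := √(Real.exp (K * T) * (‖m‖ * C₁ ^ 2) / c) with hV
  have hV0 : 0 ≤ V := Real.sqrt_nonneg _
  refine ⟨V + (‖F y₀‖ + k * (V * T)), by positivity, fun l hl => ?_⟩
  have hl' : κ < l := by linarith [H.nonneg]
  have hl0 : 0 < l := by linarith [H.nonneg]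
  set A := H.yosida l with hA
  have hAF : LipschitzWith (‖A‖₊ + k) fun x => A x + F x := A.lipschitz.add hF
  obtain ⟨y, hy0, hy⟩ := exists_ode hAF y₀ (show 0 ≤ T + 1 by linarith)
  -- The initial speed is bounded uniformly in `l`, since `A y₀` is a regularization of `z₀`.
  have hder0 : ‖A y₀ + F y₀‖ ≤ C₁ := by
    refine (norm_add_le _ _).trans (add_le_add ?_ le_rfl)
    rw [hA, H.yosida_of_mem hl' h₀]
    exact Real.le_sqrt_of_sq_le (H.norm_yosida_le hl z₀)
  have hshift : ∀ h ∈ Ioc (0 : ℝ) 1, ∀ t ∈ Icc 0 T,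
      m (y (t + h) - y t) (y (t + h) - y t) ≤
        Real.exp (K * T) * m (y (0 + h) - y 0) (y (0 + h) - y 0) := by
    intro h hh t ht
    have h1 := H.isInner.energy_le (w := fun t => y (t + h) - y t)
      (w' := fun t => (A (y (t + h)) + F (y (t + h))) - (A (y t) + F (y t))) (b := fun _ => 0)
      (T := T) hK0 (fun s hs => by
        refine HasDerivAt.sub ?_ (hy s ⟨hs.1, by linarith [hs.2]⟩)
        exact (hy (s + h) ⟨by linarith [hs.1, hh.1], by linarith [hs.2, hh.2]⟩).comp_add_const
          s h) continuous_const (fun _ => le_rfl) (fun s _ => by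
        set w := y (s + h) - y s with hw
        have e : (A (y (s + h)) + F (y (s + h))) - (A (y s) + F (y s))
            = A w + (F (y (s + h)) - F (y s)) := by
          rw [hw, map_sub]
          abel
        have h2 := H.yosida_form_le hl w
        have h3 := H.isInner.two_mul_le (F (y (s + h)) - F (y s)) w
        have h4 : m (F (y (s + h)) - F (y s)) (F (y (s + h)) - F (y s)) ≤ B * m w w := by
          have h5 := hF.norm_sub_le (y (s + h)) (y s)
          rw [← hw] at h5
          calc m (F (y (s + h)) - F (y s)) (F (y (s + h)) - F (y s))
              ≤ ‖m‖ * ‖F (y (s + h)) - F (y s)‖ ^ 2 := MDissipative.form_le m _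
            _ ≤ ‖m‖ * (k * ‖w‖) ^ 2 := mul_le_mul_of_nonneg_left
                (pow_le_pow_left₀ (norm_nonneg _) h5 2) (by positivity)
            _ = ‖m‖ * k ^ 2 * ‖w‖ ^ 2 := by ring
            _ ≤ ‖m‖ * k ^ 2 * (m w w / c) :=
                mul_le_mul_of_nonneg_left (H.norm_sq_le w) (by positivity)
            _ = B * m w w := by rw [hB]; ring
        rw [e, map_add, add_apply, hK]
        linarith) ht
    rw [intervalIntegral.integral_zero, add_zero] at h1
    refine h1.trans (mul_le_mul_of_nonneg_right ?_ (H.isInner.nonneg _))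
    exact Real.exp_le_exp.mpr (mul_le_mul_of_nonneg_left ht.2 hK0)
  have hspeed : ∀ t ∈ Icc 0 T, ‖A (y t) + F (y t)‖ ≤ V := by
    intro t ht
    have hq : ∀ t ∈ Icc 0 T, Tendsto (fun h : ℝ => m (h⁻¹ • (y (t + h) - y t))
        (h⁻¹ • (y (t + h) - y t))) (𝓝[>] 0) (𝓝 (m (A (y t) + F (y t)) (A (y t) + F (y t)))) := by
      intro t ht
      have h1 := (hasDerivAt_iff_tendsto_slope_zero.mp (hy t ⟨ht.1, by linarith [ht.2]⟩)).mono_left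
        (nhdsWithin_mono 0 fun x (hx : 0 < x) => hx.ne')
      exact ((continuous_self m continuous_id).tendsto _).comp h1
    have h2 : m (A (y t) + F (y t)) (A (y t) + F (y t)) ≤
        Real.exp (K * T) * m (A (y 0) + F (y 0)) (A (y 0) + F (y 0)) := by
      refine le_of_tendsto_of_tendsto (hq t ht) ((hq 0 ⟨le_rfl, hT⟩).const_mul _) ?_
      filter_upwards [Ioc_mem_nhdsGT one_pos] with h hh
      have h3 := mul_le_mul_of_nonneg_left (hshift h hh t ht) (sq_nonneg h⁻¹)
      simp only [map_smul, smul_apply, smul_eq_mul]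
      linarith
    rw [hy0] at h2
    refine Real.le_sqrt_of_sq_le ((H.norm_sq_le _).trans (div_le_div_of_nonneg_right
      (h2.trans (mul_le_mul_of_nonneg_left ?_ (Real.exp_pos _).le)) hc.le))
    exact (MDissipative.form_le m _).trans (mul_le_mul_of_nonneg_left
      (pow_le_pow_left₀ (norm_nonneg _) hder0 2) (by positivity))
  refine ⟨y, hy0, fun t ht => ⟨hy t ⟨ht.1, by linarith [ht.2]⟩, ?_⟩⟩
  have h1 : ‖y t - y₀‖ ≤ V * T := by
    have := (convex_Icc (0 : ℝ) T).norm_image_sub_le_of_norm_hasDerivWithin_le (f := y)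
      (fun s hs => (hy s ⟨hs.1, by linarith [hs.2]⟩).hasDerivWithinAt) hspeed
      (⟨le_rfl, hT⟩ : (0 : ℝ) ∈ Icc 0 T) ht
    rw [hy0, sub_zero, Real.norm_of_nonneg ht.1] at this
    exact this.trans (mul_le_mul_of_nonneg_left ht.2 hV0)
  have h2 : ‖F (y t)‖ ≤ ‖F y₀‖ + k * (V * T) := by
    have h3 := (hF.norm_sub_le (y t) y₀).trans (mul_le_mul_of_nonneg_left h1 k.2)
    have h4 := norm_sub_norm_le (F (y t)) (F y₀)
    linarith!
  have h3 := norm_sub_le (A (y t) + F (y t)) (F (y t))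
  rw [add_sub_cancel_right] at h3
  exact h3.trans (add_le_add (hspeed t ht) h2)

/-- The approximations form a Cauchy sequence. -/
theorem MDissipative.approx_sub_le (H : MDissipative m c κ G) {F : E → E} {k : NNReal}
    (hF : LipschitzWith k F) (T D : ℝ) (hD : 0 ≤ D) :
    ∃ C, 0 ≤ C ∧ ∀ a b : ℝ, 2 * κ < a → 2 * κ < b → 1 ≤ a → 1 ≤ b → ∀ y z : ℝ → E, y 0 = z 0 →
      (∀ t ∈ Icc 0 T, HasDerivAt y (H.yosida a (y t) + F (y t)) t ∧ ‖H.yosida a (y t)‖ ≤ D) →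
      (∀ t ∈ Icc 0 T, HasDerivAt z (H.yosida b (z t) + F (z t)) t ∧ ‖H.yosida b (z t)‖ ≤ D) →
      ∀ t ∈ Icc 0 T, ‖y t - z t‖ ^ 2 ≤ C * a⁻¹ + C * b⁻¹ := by
  set B : ℝ := ‖m‖ * k ^ 2 / c with hB
  have hc := H.isInner.pos
  have hB0 : 0 ≤ B := div_nonneg (by positivity) hc.le
  set K : ℝ := 4 * κ + 1 + B with hK
  have hK0 : 0 ≤ K := by linarith [H.nonneg]
  set M : ℝ := ‖m‖ * (4 * D ^ 2 + 8 * κ * D ^ 2) with hM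
  have hM0 : 0 ≤ M := by have := H.nonneg; positivity
  by_cases hT : 0 ≤ T
  swap
  · exact ⟨0, le_rfl, fun _ _ _ _ _ _ _ _ _ _ _ t ht => absurd (ht.1.trans ht.2) hT⟩
  refine ⟨Real.exp (K * T) * (T * M) / c, by positivity, ?_⟩
  intro a b ha hb ha1 hb1 y z h0 hy hz t ht
  have ha0 : 0 < a := by linarith
  have hb0 : 0 < b := by linarith
  have hai : a⁻¹ ≤ 1 := inv_le_one_of_one_le₀ ha1
  have hbi : b⁻¹ ≤ 1 := inv_le_one_of_one_le₀ hb1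
  have hap := inv_pos.mpr ha0
  have hbp := inv_pos.mpr hb0
  have h1 := H.isInner.energy_le (w := fun t => y t - z t)
    (w' := fun t => (H.yosida a (y t) + F (y t)) - (H.yosida b (z t) + F (z t)))
    (b := fun _ => M * (a⁻¹ + b⁻¹)) (T := T) hK0
    (fun s hs => (hy s hs).1.sub (hz s hs).1) continuous_const (fun _ => by positivity)
    (fun s hs => by
      set p := H.yosida a (y s) with hp
      set q := H.yosida b (z s) with hq
      set w := y s - z s with hw
      set e := a⁻¹ • p - b⁻¹ • q with he
      have hpD : ‖p‖ ≤ D := (hy s hs).2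
      have hqD : ‖q‖ ≤ D := (hz s hs).2
      -- The regularizations of `y` and `z` are in the domain, and their difference is `w + e`.
      have hmem : (w + e, p - q) ∈ G := by
        have := G.sub_mem (H.yosida_mem (show κ < a by linarith [H.nonneg]) (y s))
          (H.yosida_mem (show κ < b by linarith [H.nonneg]) (z s))
        rw [H.eq_sub_yosida ha0, H.eq_sub_yosida hb0, Prod.mk_sub_mk] at this
        convert this using 2
        rw [hw, he]
        abel
      have h2 := H.diss _ _ hmem
      have h3 : m (w + e) (w + e) ≤ 2 * m w w + 2 * m e e := by
        have := H.isInner.two_mul_le w e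
        have h4 := H.isInner.symm w e
        simp only [map_add, add_apply]
        linarith
      have hen : ‖e‖ ≤ D * (a⁻¹ + b⁻¹) := by
        refine (norm_sub_le _ _).trans ?_
        rw [norm_smul, norm_smul, Real.norm_of_nonneg hap.le, Real.norm_of_nonneg hbp.le]
        have := mul_le_mul_of_nonneg_left hpD hap.le
        have := mul_le_mul_of_nonneg_left hqD hbp.le
        linarith
      have h5 : m e e ≤ ‖m‖ * (2 * D ^ 2 * (a⁻¹ + b⁻¹)) := by
        refine (MDissipative.form_le m e).trans (mul_le_mul_of_nonneg_left ?_ (by positivity))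
        refine (pow_le_pow_left₀ (norm_nonneg _) hen 2).trans ?_
        have : (a⁻¹ + b⁻¹) ^ 2 ≤ 2 * (a⁻¹ + b⁻¹) := by nlinarith
        have := mul_le_mul_of_nonneg_left this (sq_nonneg D)
        linarith
      have h6 : -m (p - q) e ≤ ‖m‖ * (2 * D ^ 2 * (a⁻¹ + b⁻¹)) := by
        have h7 := IsInner.le_norm m (p - q) (-e)
        rw [map_neg, norm_neg] at h7
        have h8 : ‖p - q‖ ≤ 2 * D := (norm_sub_le _ _).trans (by linarith)
        have h9 := mul_le_mul h8 hen (norm_nonneg _) (by linarith)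
        rw [mul_assoc] at h7
        refine h7.trans (mul_le_mul_of_nonneg_left (h9.trans_eq (by ring)) (by positivity))
      have h7 := H.isInner.two_mul_le (F (y s) - F (z s)) w
      have h8 : m (F (y s) - F (z s)) (F (y s) - F (z s)) ≤ B * m w w := by
        have h9 := hF.norm_sub_le (y s) (z s)
        rw [← hw] at h9
        calc m (F (y s) - F (z s)) (F (y s) - F (z s))
            ≤ ‖m‖ * ‖F (y s) - F (z s)‖ ^ 2 := MDissipative.form_le m _
          _ ≤ ‖m‖ * (k * ‖w‖) ^ 2 := mul_le_mul_of_nonneg_left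
              (pow_le_pow_left₀ (norm_nonneg _) h9 2) (by positivity)
          _ = ‖m‖ * k ^ 2 * ‖w‖ ^ 2 := by ring
          _ ≤ ‖m‖ * k ^ 2 * (m w w / c) :=
              mul_le_mul_of_nonneg_left (H.norm_sq_le w) (by positivity)
          _ = B * m w w := by rw [hB]; ring
      have e1 : (p + F (y s)) - (q + F (z s)) = (p - q) + (F (y s) - F (z s)) := by abel
      have h10 := mul_le_mul_of_nonneg_left h3 H.nonneg
      have h11 := mul_le_mul_of_nonneg_left h5 H.nonneg
      rw [map_add] at h2
      rw [e1, map_add, add_apply, hK, hM]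
      linarith) ht
  rw [intervalIntegral.integral_const, sub_zero, smul_eq_mul, h0, sub_self, map_zero, zero_add]
    at h1
  have h2 : Real.exp (K * t) * (t * (M * (a⁻¹ + b⁻¹)))
      ≤ Real.exp (K * T) * (T * (M * (a⁻¹ + b⁻¹))) := by
    refine mul_le_mul (Real.exp_le_exp.mpr (mul_le_mul_of_nonneg_left ht.2 hK0))
      (mul_le_mul_of_nonneg_right ht.2 (by positivity))
      (mul_nonneg ht.1 (by positivity)) (Real.exp_pos _).le
  refine (H.norm_sq_le _).trans ((div_le_div_of_nonneg_right (h1.trans h2) hc.le).trans_eq ?_)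
  ring

theorem LocLip.of_lipschitzWith {F : E → E} {k : NNReal} (hF : LipschitzWith k F) : LocLip F :=
  fun _ _ => ⟨k + 1, by positivity, fun a b _ _ => (hF.norm_sub_le a b).trans
    (mul_le_mul_of_nonneg_right (by linarith) (norm_nonneg _))⟩

theorem MDissipative.exists_mild_of_mem (H : MDissipative m c κ G) {F : E → E} {k : NNReal}
    (hF : LipschitzWith k F) {T : ℝ} (hT : 0 ≤ T) {y₀ z₀ : E} (h₀ : (y₀, z₀) ∈ G) :
    ∃ y, IsMild G F T y ∧ y 0 = y₀ := by
  obtain ⟨D, hD, happ⟩ := H.exists_approx hF hT h₀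
  obtain ⟨C, hC, hcau⟩ := H.approx_sub_le hF T D hD
  let l : ℕ → ℝ := fun n => n + (2 * κ + 1)
  have hl : ∀ n, 2 * κ < l n := fun n => by
    have : (0 : ℝ) ≤ n := n.cast_nonneg
    simp only [l]
    linarith
  have hl1 : ∀ n, 1 ≤ l n := fun n => by
    have : (0 : ℝ) ≤ n := n.cast_nonneg
    have := H.nonneg
    simp only [l]
    linarith
  have hlt : Tendsto l atTop atTop :=
    tendsto_atTop_add_const_right _ _ tendsto_natCast_atTop_atTop
  have hinv : Tendsto (fun n => (l n)⁻¹) atTop (𝓝 0) := tendsto_inv_atTop_zero.comp hlt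
  choose y hy0 hy using fun n => happ (l n) (hl n)
  have hyc : ∀ n, ContinuousOn (y n) (Icc 0 T) := fun n t ht =>
    (hy n t ht).1.continuousAt.continuousWithinAt
  obtain ⟨g, hg⟩ := exists_uniform_limit (f := y) (s := Icc 0 T) (ε := fun n => C * (l n)⁻¹)
    (by simpa using hinv.const_mul C) (fun n j => hcau _ _ (hl n) (hl j) (hl1 n) (hl1 j) _ _
      ((hy0 n).trans (hy0 j).symm) (hy n) (hy j))
  have h0 : (0 : ℝ) ∈ Icc 0 T := ⟨le_rfl, hT⟩
  refine ⟨g, ?_, tendsto_nhds_unique (hg.tendsto_at h0) (by simp only [hy0, tendsto_const_nhds])⟩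
  refine H.isMild_of_tendsto (.of_lipschitzWith hF)
    (x := fun n t => l n • H.res (l n) (y n t)) (y := y)
    (fun n => ((H.res (l n)).continuous.comp_continuousOn (hyc n)).const_smul _) hyc
    (fun n t ht => ?_) ?_ hg
  · have i1 := intervalIntegrable_of_Icc (hyc n) ht
    have i2 : IntervalIntegrable (fun s => F (y n s)) volume 0 t :=
      intervalIntegrable_of_Icc (hF.continuous.comp_continuousOn (hyc n)) ht
    have i3 : IntervalIntegrable (fun s => H.yosida (l n) (y n s)) volume 0 t :=
      intervalIntegrable_of_Icc ((H.yosida (l n)).continuous.comp_continuousOn (hyc n)) ht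
    have h1 : y n t - y n 0 = ∫ s in (0 : ℝ)..t, (H.yosida (l n) (y n s) + F (y n s)) := by
      refine (intervalIntegral.integral_eq_sub_of_hasDerivAt (fun s hs => ?_) (i3.add i2)).symm
      rw [uIcc_of_le ht.1] at hs
      exact (hy n s ⟨hs.1, hs.2.trans ht.2⟩).1
    rw [h1, intervalIntegral.integral_add i3 i2, add_sub_cancel_right,
      intervalIntegral.integral_smul, ContinuousLinearMap.intervalIntegral_comp_comm _ i1,
      ContinuousLinearMap.intervalIntegral_comp_comm _ i1]
    exact H.yosida_mem (by linarith [hl n, H.nonneg]) _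
  · rw [Metric.tendstoUniformlyOn_iff] at hg ⊢
    intro ε hε
    have h1 : Tendsto (fun n => D * (l n)⁻¹) atTop (𝓝 0) := by simpa using hinv.const_mul D
    filter_upwards [hg (ε / 2) (by positivity),
      h1.eventually (gt_mem_nhds (show 0 < ε / 2 by positivity))] with n h2 h3 t ht
    have h4 := h2 t ht
    have hln : 0 < l n := by linarith [hl1 n]
    rw [dist_comm, dist_eq_norm] at h4 ⊢
    rw [H.eq_sub_yosida hln]
    have h5 : ‖(l n)⁻¹ • H.yosida (l n) (y n t)‖ ≤ D * (l n)⁻¹ := by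
      rw [norm_smul, Real.norm_of_nonneg (inv_pos.mpr hln).le, mul_comm]
      exact mul_le_mul_of_nonneg_right (hy n t ht).2 (inv_pos.mpr hln).le
    have h6 : y n t + (l n)⁻¹ • H.yosida (l n) (y n t) - g t
        = (y n t - g t) + (l n)⁻¹ • H.yosida (l n) (y n t) := by abel
    rw [h6]
    linarith [norm_add_le (y n t - g t) ((l n)⁻¹ • H.yosida (l n) (y n t))]

/-- Limits of mild solutions with convergent initial values. -/
theorem MDissipative.exists_mild_of_tendsto (H : MDissipative m c κ G) {F : E → E} (hF : LocLip F)
    {k T : ℝ} (hT : 0 ≤ T) {y : ℕ → ℝ → E} {y₀ : E}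
    (hy : ∀ n, IsMild G F T (y n)) (h₀ : Tendsto (fun n => y n 0) atTop (𝓝 y₀))
    (hL : ∀ n j, ∀ s ∈ Icc 0 T, ‖F (y n s) - F (y j s)‖ ≤ k * ‖y n s - y j s‖) :
    ∃ z, IsMild G F T z ∧ z 0 = y₀ ∧ TendstoUniformlyOn y z atTop (Icc 0 T) := by
  obtain ⟨C, hC, hs⟩ := H.exists_stability k T
  obtain ⟨z, hz⟩ := exists_uniform_limit (f := y) (s := Icc 0 T)
    (ε := fun n => C ^ 2 * (2 * ‖y n 0 - y₀‖ ^ 2))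
    (by
      have h1 := (((tendsto_iff_norm_sub_tendsto_zero.mp h₀).pow 2).const_mul 2).const_mul (C ^ 2)
      simpa using h1)
    (fun n j t ht => by
      have h1 := hs hF.continuous le_rfl (hy n) (hy j) (hL n j) t ht
      have h2 := norm_sub_le (y n 0 - y₀) (y j 0 - y₀)
      rw [sub_sub_sub_cancel_right] at h2
      have h3 := pow_le_pow_left₀ (norm_nonneg _) (h1.trans (mul_le_mul_of_nonneg_left h2 hC)) 2
      refine h3.trans ?_
      rw [mul_pow, ← mul_add]
      refine mul_le_mul_of_nonneg_left ?_ (sq_nonneg C)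
      nlinarith [sq_nonneg (‖y n 0 - y₀‖ - ‖y j 0 - y₀‖)])
  exact ⟨z, H.isMild_of_tendsto hF (fun n => (hy n).cont) (fun n => (hy n).cont)
    (fun n => (hy n).mem) hz hz, tendsto_nhds_unique (hz.tendsto_at ⟨le_rfl, hT⟩) h₀, hz⟩

/-- Global existence for Lipschitz nonlinearities. -/
theorem MDissipative.exists_mild (H : MDissipative m c κ G) {F : E → E} {k : NNReal}
    (hF : LipschitzWith k F) {T : ℝ} (hT : 0 ≤ T) (y₀ : E) :
    ∃ y, IsMild G F T y ∧ y 0 = y₀ := by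
  obtain ⟨x, z, hxz, hx⟩ := H.exists_seq y₀
  choose y hy hy0 using fun n => H.exists_mild_of_mem hF hT (hxz n)
  obtain ⟨z, hz, hz0, _⟩ := H.exists_mild_of_tendsto (.of_lipschitzWith hF) hT hy
    (by simpa only [hy0] using hx) fun n j s _ => hF.norm_sub_le _ _
  exact ⟨z, hz, hz0⟩

end Yosida

/-! ### Maximal solutions -/

section Maximal

variable {E : Type*} [NormedAddCommGroup E] [InnerProductSpace ℝ E] [CompleteSpace E]
variable {m : E →L[ℝ] E →L[ℝ] ℝ} {c κ : ℝ} {G : Submodule ℝ (E × E)}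

theorem IsMild.sub_mem {F : E → E} (hF : Continuous F) {T : ℝ} {y : ℝ → E} (h : IsMild G F T y)
    {a t : ℝ} (ha : a ∈ Icc 0 T) (ht : t ∈ Icc 0 T) :
    (∫ s in a..t, y s, y t - y a - ∫ s in a..t, F (y s)) ∈ G := by
  have h1 := G.sub_mem (h.mem t ht) (h.mem a ha)
  have hFy : ContinuousOn (fun s => F (y s)) (Icc 0 T) := hF.comp_continuousOn h.cont
  rw [Prod.mk_sub_mk, intervalIntegral.integral_interval_sub_left
    (intervalIntegrable_of_Icc h.cont ht) (intervalIntegrable_of_Icc h.cont ha)] at h1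
  rw [← intervalIntegral.integral_interval_sub_left
    (intervalIntegrable_of_Icc hFy ht) (intervalIntegrable_of_Icc hFy ha)]
  convert h1 using 2
  abel

theorem IsMild.shift {F : E → E} (hF : Continuous F) {T : ℝ} {y : ℝ → E} (h : IsMild G F T y)
    {a : ℝ} (ha : a ∈ Icc 0 T) : IsMild G F (T - a) fun t => y (t + a) := by
  refine ⟨h.cont.comp (by fun_prop) fun t ht => ⟨by linarith [ht.1, ha.1], by linarith [ht.2]⟩,
    fun t ht => ?_⟩
  have h1 := h.sub_mem hF ha (t := t + a) ⟨by linarith [ht.1, ha.1], by linarith [ht.2]⟩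
  rw [intervalIntegral.integral_comp_add_right, intervalIntegral.integral_comp_add_right
    (fun s => F (y s)), zero_add]
  exact h1

/-- Solutions can be continued by solutions that start at their end points. -/
theorem IsMild.concat {F : E → E} (hF : Continuous F) {a b : ℝ} (ha : 0 ≤ a) (hb : 0 ≤ b)
    {y z : ℝ → E} (hy : IsMild G F a y) (hz : IsMild G F b z) (h : z 0 = y a) :
    IsMild G F (a + b) fun t => if t ≤ a then y t else z (t - a) := by
  set w : ℝ → E := fun t => if t ≤ a then y t else z (t - a) with hw
  have e1 : ∀ t, t ≤ a → w t = y t := fun t ht => if_pos ht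
  have e2 : ∀ t, a ≤ t → w t = z (t - a) := fun t ht => by
    rcases ht.eq_or_lt with rfl | ht
    · rw [e1 _ le_rfl, sub_self, h]
    · exact if_neg (not_le.mpr ht)
  have hU : Icc 0 (a + b) = Icc 0 a ∪ Icc a (a + b) := (Icc_union_Icc_eq_Icc ha (by linarith)).symm
  have c1 : ContinuousOn w (Icc 0 a) := hy.cont.congr fun t ht => e1 t ht.2
  have c2 : ContinuousOn w (Icc a (a + b)) := by
    refine ContinuousOn.congr (f := fun t => z (t - a)) ?_ fun t ht => e2 t ht.1
    exact hz.cont.comp (by fun_prop) fun t ht => ⟨by linarith [ht.1], by linarith [ht.2]⟩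
  have cw : ContinuousOn w (Icc 0 (a + b)) := by
    rw [hU]
    exact c1.union_of_isClosed c2 isClosed_Icc isClosed_Icc
  have hw0 : w 0 = y 0 := e1 0 ha
  refine ⟨cw, fun t ht => ?_⟩
  rcases le_total t a with hta | hta
  · have ht' : t ∈ Icc 0 a := ⟨ht.1, hta⟩
    exact (hy.congr (fun _ _ => rfl) fun s hs => (e1 s hs.2).symm).mem t ht'
  · have ht' : t - a ∈ Icc 0 b := ⟨by linarith, by linarith [ht.2]⟩
    have haa : a ∈ Icc 0 a := ⟨ha, le_rfl⟩
    have key : ∀ {f : E → E}, Continuous f → ∫ s in (0 : ℝ)..t, f (w s)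
        = (∫ s in (0 : ℝ)..a, f (y s)) + ∫ s in (0 : ℝ)..(t - a), f (z s) := by
      intro f hf
      have cf : ContinuousOn (fun s => f (w s)) (Icc 0 (a + b)) := hf.comp_continuousOn cw
      have hab : a ∈ Icc 0 (a + b) := ⟨ha, by linarith⟩
      have i1 := intervalIntegrable_of_Icc cf hab
      have i2 := intervalIntegrable_of_Icc cf ht
      rw [← intervalIntegral.integral_add_adjacent_intervals i1 (i1.symm.trans i2)]
      congr 1
      · exact integral_congr_Icc (fun s hs => by rw [e1 s hs.2]) haa
      · have h1 : ∫ s in a..t, f (w s) = ∫ s in a..t, f (z (s - a)) := by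
          refine intervalIntegral.integral_congr fun s hs => ?_
          rw [uIcc_of_le hta] at hs
          simp only [e2 s hs.1]
        rw [h1, intervalIntegral.integral_comp_sub_right (fun s => f (z s)), sub_self]
    have k1 := key continuous_id
    simp only [id] at k1
    rw [k1, key hF, e2 t hta, hw0]
    have h2 := G.add_mem (hy.mem a haa) (hz.mem (t - a) ht')
    rw [Prod.mk_add_mk, h] at h2
    convert h2 using 2
    abel

theorem MDissipative.mild_unique (H : MDissipative m c κ G) {F : E → E} (hF : LocLip F) {T : ℝ}
    {y z : ℝ → E} (hy : IsMild G F T y) (hz : IsMild G F T z) (h : y 0 = z 0) :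
    ∀ t ∈ Icc 0 T, y t = z t := by
  obtain ⟨A, hA, hyA⟩ := exists_norm_le hy.cont
  obtain ⟨B, hB, hzB⟩ := exists_norm_le hz.cont
  obtain ⟨k, hk, hl⟩ := hF (max A B) (lt_max_of_lt_left hA)
  obtain ⟨C, hC, hs⟩ := H.exists_stability k T
  intro t ht
  have h1 := hs hF.continuous le_rfl hy hz (fun s hs => hl _ _ ((hyA s hs).trans (le_max_left _ _))
    ((hzB s hs).trans (le_max_right _ _))) t ht
  rw [h, sub_self, norm_zero, mul_zero] at h1
  exact sub_eq_zero.mp (norm_le_zero_iff.mp h1)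

theorem LocLip.comp_retract {F : E → E} (hF : LocLip F) {R : ℝ} (hR : 0 < R) :
    ∃ k : NNReal, LipschitzWith k fun x => F (retract R x) := by
  obtain ⟨k, hk, h⟩ := hF R hR
  refine ⟨(k * 2).toNNReal, LipschitzWith.of_dist_le_mul fun x y => ?_⟩
  rw [dist_eq_norm, dist_eq_norm, Real.coe_toNNReal _ (by positivity), mul_assoc]
  exact (h _ _ (norm_retract_le hR x) (norm_retract_le hR y)).trans
    (mul_le_mul_of_nonneg_left (norm_retract_sub_le hR x y) hk.le)

/-- Local existence, on a time interval whose length depends only on the size of the initial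
value. -/
theorem MDissipative.exists_local (H : MDissipative m c κ G) {F : E → E} (hF : LocLip F)
    (R : ℝ) :
    ∃ τ, 0 < τ ∧ ∀ y₀ : E, ‖y₀‖ ≤ R → ∃ y, IsMild G F τ y ∧ y 0 = y₀ := by
  have hc := H.isInner.pos
  -- `Q` bounds the solutions of the problem with `F` truncated outside of the ball of radius `Q`, up
  -- to a time `τ ≤ M⁻²` where the truncated nonlinearity, bounded by `M`, contributes at most `1`.
  set A : ℝ := 4 * Real.exp (2 * κ + 1) with hA
  set Q : ℝ := √(A * (‖m‖ * (R ^ 2 + 1)) / c) + 1 with hQ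
  have hQ0 : 0 < Q := by positivity
  obtain ⟨k, hk, hl⟩ := hF Q hQ0
  obtain ⟨K, hK⟩ := hF.comp_retract hQ0
  set M : ℝ := ‖F 0‖ + k * Q with hM
  have hM0 : 0 < M := by positivity
  have hFM : ∀ x, ‖F (retract Q x)‖ ≤ M := fun x => by
    have h1 := hl (retract Q x) 0 (norm_retract_le hQ0 x) (by simpa using hQ0.le)
    rw [sub_zero] at h1
    have h2 := norm_sub_norm_le (F (retract Q x)) (F 0)
    have h3 := mul_le_mul_of_nonneg_left (norm_retract_le hQ0 x) hk.le
    linarith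
  set τ : ℝ := min 1 (1 / M ^ 2) with hτ
  have hτ0 : 0 < τ := lt_min one_pos (by positivity)
  refine ⟨τ, hτ0, fun y₀ hy₀ => ?_⟩
  obtain ⟨y, hy, hy0⟩ := H.exists_mild hK hτ0.le y₀
  have hbound : ∀ t ∈ Icc 0 τ, ‖y t‖ ≤ Q := by
    intro t ht
    have hft : ContinuousOn (fun s => F (retract Q (y s))) (Icc 0 τ) :=
      hK.continuous.comp_continuousOn hy.cont
    have h1 := H.linear_le one_pos hy.cont hft hy.mem ht
    have h2 : ∫ s in (0 : ℝ)..t, m (F (retract Q (y s))) (F (retract Q (y s)))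
        ≤ ∫ s in (0 : ℝ)..t, ‖m‖ * M ^ 2 := by
      refine intervalIntegral.integral_mono_on ht.1 (intervalIntegrable_of_Icc
        ((continuous_self m continuous_id).comp_continuousOn hft) ht)
        (continuous_const.intervalIntegrable _ _) fun s _ => ?_
      exact (MDissipative.form_le m _).trans (mul_le_mul_of_nonneg_left
        (pow_le_pow_left₀ (norm_nonneg _) (hFM _) 2) (by positivity))
    rw [intervalIntegral.integral_const, sub_zero, smul_eq_mul] at h2
    have h3 : t * M ^ 2 ≤ 1 := by
      have := ht.2.trans (min_le_right _ _)
      rwa [le_div_iff₀ (by positivity)] at this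
    have h4 : m (y 0) (y 0) ≤ ‖m‖ * R ^ 2 := by
      rw [hy0]
      exact (MDissipative.form_le m _).trans (mul_le_mul_of_nonneg_left
        (pow_le_pow_left₀ (norm_nonneg _) hy₀ 2) (by positivity))
    have h5 : t * (‖m‖ * M ^ 2) ≤ ‖m‖ := by
      have := mul_le_mul_of_nonneg_left h3 (show 0 ≤ ‖m‖ by positivity)
      linarith
    have h6 : 4 * Real.exp ((2 * κ + 1⁻¹) * t) ≤ A := by
      rw [hA, inv_one]
      have : (2 * κ + 1) * t ≤ 2 * κ + 1 :=
        mul_le_of_le_one_right (by linarith [H.nonneg]) (ht.2.trans (min_le_left _ _))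
      linarith [Real.exp_le_exp.mpr this]
    have h7 : m (y t) (y t) ≤ A * (‖m‖ * (R ^ 2 + 1)) := by
      refine h1.trans (mul_le_mul h6 (by linarith) ?_ (by positivity))
      rw [one_mul]
      exact add_nonneg (H.isInner.nonneg _)
        (intervalIntegral.integral_nonneg ht.1 fun s _ => H.isInner.nonneg _)
    refine (Real.le_sqrt_of_sq_le ((H.norm_sq_le _).trans
      (div_le_div_of_nonneg_right h7 hc.le))).trans ?_
    linarith
  exact ⟨y, hy.congr (fun t ht => by rw [retract_of_le hQ0 (hbound t ht)]) fun _ _ => rfl, hy0⟩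

/-- The maximal mild solution and the blow-up alternative. -/
theorem MDissipative.exists_maximal (H : MDissipative m c κ G) {F : E → E} (hF : LocLip F)
    (y₀ : E) :
    ∃ (tmax : EReal) (y : ℝ → E), 0 < tmax ∧ y 0 = y₀ ∧
      (∀ T : ℝ, 0 < T → (T : EReal) < tmax → IsMild G F T y) ∧
      (∀ (T : ℝ) (z : ℝ → E), 0 < T → IsMild G F T z → z 0 = y₀ →
        (T : EReal) < tmax ∧ ∀ t ∈ Icc 0 T, z t = y t) ∧
      (∀ τ : ℝ, tmax = τ → Tendsto (fun t => ‖y t‖) (𝓝[<] τ) atTop) := by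
  classical
  -- The lengths of the time intervals on which a solution exists.
  set S : Set ℝ := {T | 0 < T ∧ ∃ y, IsMild G F T y ∧ y 0 = y₀} with hS
  have hext : ∀ (T : ℝ) (z : ℝ → E) (R : ℝ), 0 < T → IsMild G F T z → z 0 = y₀ →
      ∃ δ, 0 < δ ∧ ∀ t ∈ Icc 0 T, ‖z t‖ ≤ R → t + δ ∈ S := by
    intro T z R hT hz hz0
    obtain ⟨δ, hδ, h⟩ := H.exists_local hF R
    refine ⟨δ, hδ, fun t ht htR => ?_⟩
    obtain ⟨w, hw, hw0⟩ := h (z t) htR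
    refine ⟨by linarith [ht.1], _, (hz.mono ht.2).concat hF.continuous ht.1 hδ.le hw hw0, ?_⟩
    rw [if_pos ht.1, hz0]
  have hopen : ∀ T ∈ S, ∃ T' ∈ S, T < T' := by
    rintro T ⟨hT, z, hz, hz0⟩
    obtain ⟨δ, hδ, h⟩ := hext T z ‖z T‖ hT hz hz0
    exact ⟨T + δ, h T ⟨hT.le, le_rfl⟩ le_rfl, by linarith⟩
  obtain ⟨τ₀, hτ₀, hloc⟩ := H.exists_local hF ‖y₀‖
  have hne : τ₀ ∈ S := ⟨hτ₀, hloc y₀ le_rfl⟩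
  choose! sol hsol using fun (T : ℝ) (hT : T ∈ S) => hT.2
  set y : ℝ → E := fun t => if h : ∃ T ∈ S, t ≤ T then sol h.choose t else 0 with hy
  have hagree : ∀ (T : ℝ) (z : ℝ → E), IsMild G F T z → z 0 = y₀ → T ∈ S →
      ∀ t ∈ Icc 0 T, z t = y t := by
    intro T z hz hz0 hT t ht
    have hex : ∃ T ∈ S, t ≤ T := ⟨T, hT, ht.2⟩
    simp only [hy, dif_pos hex]
    obtain ⟨h1, h2⟩ := hex.choose_spec
    have h3 := hsol _ h1
    exact H.mild_unique hF (hz.mono ht.2) (h3.1.mono h2) (hz0.trans h3.2.symm) t ⟨ht.1, le_rfl⟩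
  set tmax : EReal := sSup ((fun T : ℝ => (T : EReal)) '' S) with htmax
  have hlt : ∀ T ∈ S, (T : EReal) < tmax := fun T hT => by
    obtain ⟨T', hT', h⟩ := hopen T hT
    exact lt_of_lt_of_le (EReal.coe_lt_coe_iff.mpr h) (le_sSup ⟨T', hT', rfl⟩)
  have hmild : ∀ T : ℝ, 0 < T → (T : EReal) < tmax → IsMild G F T y := by
    intro T hT h
    obtain ⟨_, ⟨T', hT', rfl⟩, h'⟩ := lt_sSup_iff.mp h
    have h1 := hsol T' hT'
    have h2 : T ≤ T' := (EReal.coe_lt_coe_iff.mp h').le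
    exact (h1.1.congr (fun _ _ => rfl) (hagree T' _ h1.1 h1.2 hT')).mono h2
  have hy0 : y 0 = y₀ := by
    have h1 := hsol τ₀ hne
    rw [← hagree τ₀ _ h1.1 h1.2 hne 0 ⟨le_rfl, hτ₀.le⟩, h1.2]
  refine ⟨tmax, y, (EReal.coe_pos.mpr hτ₀).trans (hlt _ hne), hy0, hmild,
    fun T z hT hz hz0 => ⟨hlt T ⟨hT, z, hz, hz0⟩, hagree T z hz hz0 ⟨hT, z, hz, hz0⟩⟩, ?_⟩
  intro τ hτ
  have hτpos : 0 < τ := by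
    have := (EReal.coe_pos.mpr hτ₀).trans (hlt _ hne)
    rw [hτ] at this
    exact EReal.coe_pos.mp this
  rw [tendsto_atTop]
  intro R
  obtain ⟨δ, hδ, hl⟩ := H.exists_local hF R
  filter_upwards [Ioo_mem_nhdsLT (show max 0 (τ - δ) < τ from max_lt hτpos (by linarith))]
    with t ht
  -- Otherwise the solution could be continued from `t` by the time `δ`, beyond `τ`.
  by_contra hR
  have ht0 : 0 < t := (le_max_left _ _).trans_lt ht.1
  have htm := hmild t ht0 (by rw [hτ]; exact EReal.coe_lt_coe_iff.mpr ht.2)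
  obtain ⟨w, hw, hw0⟩ := hl (y t) (not_le.mp hR).le
  have h1 : t + δ ∈ S := ⟨by linarith, _, htm.concat hF.continuous ht0.le hδ.le hw hw0, by
    rw [if_pos ht0.le, hy0]⟩
  have h2 := hlt _ h1
  rw [hτ, EReal.coe_lt_coe_iff] at h2
  linarith [(le_max_right _ _).trans_lt ht.1]

end Maximal

/-! ### Strong solutions -/

section Regularity

variable {E : Type*} [NormedAddCommGroup E] [InnerProductSpace ℝ E] [CompleteSpace E]
variable {m : E →L[ℝ] E →L[ℝ] ℝ} {c κ : ℝ} {G : Submodule ℝ (E × E)}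

/-- Near the initial time, a mild solution that starts in the domain differs from its initial
value by `O(h)`: the constant curve `y₀` is a mild solution with source `-z₀`. -/
theorem MDissipative.exists_initial_lipschitz (H : MDissipative m c κ G) {F : E → E}
    (hF : Continuous F) {T : ℝ} {y : ℝ → E} (hy : IsMild G F T y) {z₀ : E}
    (h₀ : (y 0, z₀) ∈ G) : ∃ C, 0 ≤ C ∧ ∀ h ∈ Ioc 0 T, ‖y h - y 0‖ ≤ C * h := by
  have hc := H.isInner.pos
  have hFy : ContinuousOn (fun s => F (y s) + z₀) (Icc 0 T) :=
    (hF.comp_continuousOn hy.cont).add continuousOn_const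
  obtain ⟨M, hM, hFM⟩ := exists_norm_le hFy
  set D : ℝ := 4 * Real.exp (2 * κ * T + 1) * (‖m‖ * M ^ 2) / c with hD
  have hD0 : 0 ≤ D := by positivity
  refine ⟨√D, Real.sqrt_nonneg _, fun h hh => ?_⟩
  have hh' : h ∈ Icc 0 T := ⟨hh.1.le, hh.2⟩
  -- The free parameter of the energy estimate is chosen to be `h`.
  have h1 := H.linear_le (w := fun s => y s - y 0) (f := fun s => F (y s) + z₀) hh.1
    (hy.cont.sub continuousOn_const) hFy (T := T) (fun t ht => by
      have h2 := G.sub_mem (hy.mem t ht) (G.smul_mem t h₀)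
      have i1 := intervalIntegrable_of_Icc hy.cont ht
      have i2 : IntervalIntegrable (fun s => F (y s)) volume 0 t :=
        intervalIntegrable_of_Icc (hF.comp_continuousOn hy.cont) ht
      rw [intervalIntegral.integral_sub i1 intervalIntegrable_const,
        intervalIntegral.integral_add i2 intervalIntegrable_const,
        intervalIntegral.integral_const, intervalIntegral.integral_const, sub_zero]
      rw [Prod.smul_mk, Prod.mk_sub_mk] at h2
      convert h2 using 2
      abel) hh'
  have h2 : ∫ s in (0 : ℝ)..h, m (F (y s) + z₀) (F (y s) + z₀) ≤ h * (‖m‖ * M ^ 2) := by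
    have h3 : ∫ s in (0 : ℝ)..h, m (F (y s) + z₀) (F (y s) + z₀)
        ≤ ∫ s in (0 : ℝ)..h, ‖m‖ * M ^ 2 := by
      refine intervalIntegral.integral_mono_on hh.1.le (intervalIntegrable_of_Icc
        ((continuous_self m continuous_id).comp_continuousOn hFy) hh')
        (continuous_const.intervalIntegrable _ _) fun s hs => ?_
      exact (MDissipative.form_le m _).trans (mul_le_mul_of_nonneg_left
        (pow_le_pow_left₀ (norm_nonneg _) (hFM s ⟨hs.1, hs.2.trans hh.2⟩) 2) (by positivity))
    rwa [intervalIntegral.integral_const, sub_zero, smul_eq_mul] at h3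
  have h3 : (2 * κ + h⁻¹) * h ≤ 2 * κ * T + 1 := by
    rw [add_mul, inv_mul_cancel₀ hh.1.ne']
    have := mul_le_mul_of_nonneg_left hh.2 (show 0 ≤ 2 * κ by linarith [H.nonneg])
    linarith
  have h4 : m (y h - y 0) (y h - y 0)
      ≤ 4 * Real.exp (2 * κ * T + 1) * (‖m‖ * M ^ 2) * h ^ 2 := by
    refine h1.trans ?_
    rw [sub_self, map_zero, zero_add]
    have h5 := mul_le_mul_of_nonneg_left h2 hh.1.le
    calc 4 * Real.exp ((2 * κ + h⁻¹) * h) *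
          (h * ∫ s in (0 : ℝ)..h, m (F (y s) + z₀) (F (y s) + z₀))
        ≤ 4 * Real.exp ((2 * κ + h⁻¹) * h) * (h * (h * (‖m‖ * M ^ 2))) :=
          mul_le_mul_of_nonneg_left h5 (by positivity)
      _ ≤ 4 * Real.exp (2 * κ * T + 1) * (h * (h * (‖m‖ * M ^ 2))) := by
          have := Real.exp_le_exp.mpr h3
          have := hh.1
          exact mul_le_mul_of_nonneg_right (by linarith) (by positivity)
      _ = _ := by ring
  refine le_of_sq_le_sq ?_ (mul_nonneg (Real.sqrt_nonneg _) hh.1.le)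
  rw [mul_pow, Real.sq_sqrt hD0, hD, div_mul_eq_mul_div]
  exact (H.norm_sq_le _).trans (div_le_div_of_nonneg_right h4 hc.le)

/-- A mild solution that starts in the domain stays in the domain, with bounded images. -/
theorem MDissipative.exists_image (H : MDissipative m c κ G) {F : E → E}
    (hF : LocLip F) {T : ℝ} (hT : 0 ≤ T) {y : ℝ → E} (hy : IsMild G F T y) {z₀ : E}
    (h₀ : (y 0, z₀) ∈ G) : ∃ C, ∀ t ∈ Ico 0 T, ∃ g, ‖g‖ ≤ C ∧ (y t, g) ∈ G := by
  have hFy : ContinuousOn (fun s => F (y s)) (Icc 0 T) := hF.continuous.comp_continuousOn hy.cont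
  obtain ⟨L, hL, hinit⟩ := H.exists_initial_lipschitz hF.continuous hy h₀
  obtain ⟨R, hR, hyR⟩ := exists_norm_le hy.cont
  obtain ⟨M, hM, hFM⟩ := exists_norm_le hFy
  obtain ⟨k, hk, hl⟩ := hF R hR
  obtain ⟨K, hK, hs⟩ := H.exists_stability k T
  -- The solution is Lipschitz in time, by comparison with its own shift.
  have hlip : ∀ t h : ℝ, 0 ≤ t → 0 < h → t + h ≤ T → ‖y (t + h) - y t‖ ≤ K * (L * h) := by
    intro t h ht hh hth
    have hhT : h ∈ Icc 0 T := ⟨hh.le, by linarith⟩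
    have h1 := hs hF.continuous (show T - h ≤ T by linarith) (hy.shift hF.continuous hhT)
      (hy.mono (by linarith)) (fun s hs => hl _ _
        (hyR _ ⟨by linarith [hs.1], by linarith [hs.2]⟩)
        (hyR _ ⟨by linarith [hs.1], by linarith [hs.2]⟩)) t ⟨ht, by linarith⟩
    rw [zero_add] at h1
    exact h1.trans (mul_le_mul_of_nonneg_left (hinit h ⟨hh, hhT.2⟩) hK)
  refine ⟨K * L + M, fun t ht => ?_⟩
  obtain ⟨h, -, hpos, hlim⟩ := exists_seq_strictAnti_tendsto' (show 0 < T - t by linarith [ht.2])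
  have htT : t ∈ Icc 0 T := ⟨ht.1, ht.2.le⟩
  have hth : ∀ n, t + h n ∈ Icc 0 T := fun n =>
    ⟨by linarith [ht.1, (hpos n).1], by linarith [(hpos n).2]⟩
  -- The mean of `y` over `[t, t + h]` is in the domain, with bounded image, and tends to `y t`.
  have hmem := fun n => G.smul_mem (h n)⁻¹ (hy.sub_mem hF.continuous htT (hth n))
  refine H.exists_of_bounded (y := fun n => (h n)⁻¹ • ∫ s in t..(t + h n), y s)
    (z := fun n => (h n)⁻¹ • (y (t + h n) - y t - ∫ s in t..(t + h n), F (y s))) hmem ?_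
    fun n => ?_
  · obtain ⟨x, hx, hxy⟩ := exists_continuous_extension hT hy.cont
    have h1 := (hx.integral_hasStrictDerivAt t t).hasDerivAt.tendsto_slope_zero_right
    rw [← hxy t htT] at h1
    have h2 : Tendsto h atTop (𝓝[>] 0) :=
      tendsto_nhdsWithin_iff.mpr ⟨hlim, Eventually.of_forall fun n => (hpos n).1⟩
    refine (h1.comp h2).congr fun n => ?_
    simp only [Function.comp_apply, intervalIntegral.integral_same, sub_zero]
    congr 1
    refine intervalIntegral.integral_congr fun s hs => ?_
    rw [uIcc_of_le (by linarith [(hpos n).1])] at hs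
    exact (hxy s ⟨ht.1.trans hs.1, hs.2.trans (hth n).2⟩).symm
  · have hn := (hpos n).1
    have h1 := hlip t (h n) ht.1 hn (hth n).2
    have h2 : ‖∫ s in t..(t + h n), F (y s)‖ ≤ M * |t + h n - t| := by
      refine intervalIntegral.norm_integral_le_of_norm_le_const fun s hs => ?_
      rw [uIoc_of_le (by linarith)] at hs
      exact hFM s ⟨ht.1.trans hs.1.le, hs.2.trans (hth n).2⟩
    rw [add_sub_cancel_left, abs_of_pos hn] at h2
    rw [norm_smul, norm_inv, Real.norm_of_nonneg hn.le, inv_mul_le_iff₀ hn]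
    have h3 := norm_sub_le (y (t + h n) - y t) (∫ s in t..(t + h n), F (y s))
    linarith

/-- A mild solution that starts in the domain is a strong solution. -/
theorem MDissipative.exists_strong (H : MDissipative m c κ G) {F : E → E}
    (hF : LocLip F) {T : ℝ} (hT : 0 ≤ T) {y : ℝ → E} (hy : IsMild G F T y) {z₀ : E}
    (h₀ : (y 0, z₀) ∈ G) : ∃ z : ℝ → E, (∀ t ∈ Ioo 0 T, (y t, z t) ∈ G) ∧
      ∀ a b : ℝ, 0 < a → a ≤ b → b < T →
        IntervalIntegrable (fun t => z t + F (y t)) volume a b ∧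
          y b - y a = ∫ t in a..b, (z t + F (y t)) := by
  obtain ⟨C, hC⟩ := H.exists_image hF hT hy h₀
  choose! z hzC hz using hC
  refine ⟨z, fun t ht => hz t ⟨ht.1.le, ht.2⟩, fun a b ha hab hb => ?_⟩
  have hsub : ∀ t ∈ Icc a b, t ∈ Ico 0 T := fun t ht =>
    ⟨ha.le.trans ht.1, ht.2.trans_lt hb⟩
  have hyc : ContinuousOn y (Icc a b) := hy.cont.mono fun t ht =>
    ⟨(hsub t ht).1, (hsub t ht).2.le⟩
  -- `z` is measurable, being a pointwise limit of Yosida approximations along `y`.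
  have hmeas : AEStronglyMeasurable z (volume.restrict (Ioc a b)) := by
    let l : ℕ → ℝ := fun n => n + (κ + 1)
    have hlt : Tendsto l atTop atTop :=
      tendsto_atTop_add_const_right _ _ tendsto_natCast_atTop_atTop
    refine aestronglyMeasurable_of_tendsto_ae atTop (f := fun n t => H.yosida (l n) (y t))
      (fun n => (((H.yosida (l n)).continuous.comp_continuousOn hyc).mono
        Ioc_subset_Icc_self).aestronglyMeasurable measurableSet_Ioc) ?_
    refine (ae_restrict_iff' measurableSet_Ioc).mpr (Eventually.of_forall fun t ht => ?_)
    refine ((H.tendsto_yosida (z t)).comp hlt).congr fun n => ?_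
    refine (H.yosida_of_mem ?_ (hz t (hsub t ⟨ht.1.le, ht.2⟩))).symm
    have : (0 : ℝ) ≤ n := n.cast_nonneg
    simp only [l]
    linarith
  have iz : IntervalIntegrable z volume a b := by
    rw [intervalIntegrable_iff_integrableOn_Ioc_of_le hab]
    exact Integrable.of_bound hmeas C ((ae_restrict_iff' measurableSet_Ioc).mpr
      (Eventually.of_forall fun t ht => hzC t (hsub t ⟨ht.1.le, ht.2⟩)))
  have iy : IntervalIntegrable y volume a b := hyc.intervalIntegrable_of_Icc hab
  have iF : IntervalIntegrable (fun t => F (y t)) volume a b :=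
    (hF.continuous.comp_continuousOn hyc).intervalIntegrable_of_Icc hab
  refine ⟨iz.add iF, ?_⟩
  have h1 := H.integral_mem hab iy iz fun t ht => hz t (hsub t ⟨ht.1.le, ht.2.le⟩)
  have h2 := hy.sub_mem hF.continuous (a := a) (t := b) ⟨ha.le, by linarith⟩ ⟨by linarith, hb.le⟩
  have h3 := G.sub_mem h2 h1
  rw [Prod.mk_sub_mk, sub_self] at h3
  have h4 := H.single _ h3
  rw [intervalIntegral.integral_add iz iF]
  rw [sub_sub, sub_eq_zero] at h4
  rw [h4, add_comm]

/-- Strong solutions are mild. -/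
theorem MDissipative.isMild_of_strong (H : MDissipative m c κ G) {F : E → E}
    (hF : Continuous F) {T : ℝ} (hT : 0 < T) {y z : ℝ → E} (hy : ContinuousOn y (Icc 0 T))
    (hz : ∀ t ∈ Ioo 0 T, (y t, z t) ∈ G)
    (h : ∀ a b : ℝ, 0 < a → a ≤ b → b < T →
      IntervalIntegrable (fun t => z t + F (y t)) volume a b ∧
        y b - y a = ∫ t in a..b, (z t + F (y t))) : IsMild G F T y := by
  have hl : κ < κ + 1 := by linarith
  have hFy : ContinuousOn (fun t => F (y t)) (Icc 0 T) := hF.comp_continuousOn hy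
  let φ : ℝ → E × E := fun t =>
    (∫ s in (0 : ℝ)..t, y s, y t - y 0 - ∫ s in (0 : ℝ)..t, F (y s))
  have hprim : ∀ {f : ℝ → E}, ContinuousOn f (Icc 0 T) →
      ContinuousOn (fun t => ∫ s in (0 : ℝ)..t, f s) (Icc 0 T) := fun {f} hf => by
    have := intervalIntegral.continuousOn_primitive_interval (f := f) (a := 0) (b := T)
      (μ := volume) (by rw [uIcc_of_le hT.le]; exact hf.integrableOn_Icc)
    rwa [uIcc_of_le hT.le] at this
  have hφ : ContinuousOn φ (Icc 0 T) :=
    (hprim hy).prodMk ((hy.sub continuousOn_const).sub (hprim hFy))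
  have hstep : ∀ a b, 0 < a → a ≤ b → b < T → φ b - φ a ∈ G := by
    intro a b ha hab hb
    have haT : a ∈ Icc 0 T := ⟨ha.le, by linarith⟩
    have hbT : b ∈ Icc 0 T := ⟨by linarith, hb.le⟩
    have hyc : ContinuousOn y (Icc a b) := hy.mono (Icc_subset_Icc ha.le hb.le)
    have iy : IntervalIntegrable y volume a b := hyc.intervalIntegrable_of_Icc hab
    have iF : IntervalIntegrable (fun t => F (y t)) volume a b :=
      (hF.comp_continuousOn hyc).intervalIntegrable_of_Icc hab
    obtain ⟨i1, e1⟩ := h a b ha hab hb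
    have iz : IntervalIntegrable z volume a b := by
      have := i1.sub iF
      refine this.congr fun t _ => ?_
      simp
    have h1 := H.integral_mem hab iy iz fun t ht => hz t ⟨ha.trans ht.1, ht.2.trans hb⟩
    rw [intervalIntegral.integral_add iz iF] at e1
    have h2 : φ b - φ a = (∫ t in a..b, y t, ∫ t in a..b, z t) := by
      simp only [φ, Prod.mk_sub_mk]
      rw [intervalIntegral.integral_interval_sub_left (intervalIntegrable_of_Icc hy hbT)
        (intervalIntegrable_of_Icc hy haT)]
      have e2 := intervalIntegral.integral_interval_sub_left (intervalIntegrable_of_Icc hFy hbT)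
        (intervalIntegrable_of_Icc hFy haT)
      congr 1
      have e3 : y b - y 0 - (∫ s in (0 : ℝ)..b, F (y s)) - (y a - y 0 - ∫ s in (0 : ℝ)..a, F (y s))
        = (y b - y a) - ((∫ s in (0 : ℝ)..b, F (y s)) - ∫ s in (0 : ℝ)..a, F (y s)) := by abel
      rw [e3, e2, e1, add_sub_cancel_right]
    rwa [h2]
  have hstep' : ∀ a ∈ Ioo 0 T, ∀ b ∈ Ioo 0 T, φ b - φ a ∈ G := by
    intro a ha b hb
    rcases le_total a b with hab | hab
    · exact hstep a b ha.1 hab hb.2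
    · rw [← neg_sub]
      exact G.neg_mem (hstep b a hb.1 hab ha.2)
  -- The end points are reached by continuity, as `G` is closed.
  have hclos : ∀ a ∈ Ioo 0 T, ∀ b ∈ Icc 0 T, φ b - φ a ∈ G := by
    intro a ha
    have h1 : MapsTo (fun b => φ b - φ a) (Ioo 0 T) (G : Set (E × E)) := hstep' a ha
    have h2 := h1.closure_of_continuousOn (by
      rw [closure_Ioo hT.ne]
      exact hφ.sub continuousOn_const)
    rw [closure_Ioo hT.ne, (H.isClosed hl).closure_eq] at h2
    exact h2
  refine ⟨hy, fun t ht => ?_⟩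
  have ha : T / 2 ∈ Ioo 0 T := ⟨by linarith, by linarith⟩
  have h1 := G.sub_mem (hclos _ ha t ht) (hclos _ ha 0 ⟨le_rfl, hT.le⟩)
  have h2 : φ 0 = 0 := by simp [φ]
  rw [sub_sub_sub_cancel_right, h2, sub_zero] at h1
  exact h1

/-- Mild solutions are uniform limits of mild solutions that start in the domain. -/
theorem MDissipative.exists_approx_mem (H : MDissipative m c κ G) {F : E → E}
    (hF : LocLip F) {T : ℝ} (hT : 0 ≤ T) {y : ℝ → E} (hy : IsMild G F T y) :
    ∃ x : ℕ → ℝ → E, (∀ n, IsMild G F T (x n) ∧ ∃ z, (x n 0, z) ∈ G) ∧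
      TendstoUniformlyOn x y atTop (Icc 0 T) := by
  obtain ⟨R, hR, hyR⟩ := exists_norm_le hy.cont
  have hR1 : 0 < R + 1 := by linarith
  obtain ⟨k, hk⟩ := hF.comp_retract hR1
  -- With `F` truncated, the approximations exist on all of `[0, T]`; they eventually stay in the ball
  -- where the truncation has no effect.
  have hy' : IsMild G (fun x => F (retract (R + 1) x)) T y :=
    hy.congr (fun t ht => by rw [retract_of_le hR1 (by linarith [hyR t ht])]) fun _ _ => rfl
  obtain ⟨y0, z0, hyz, hlim⟩ := H.exists_seq (y 0)
  choose x hx hx0 using fun n => H.exists_mild hk hT (y0 n)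
  obtain ⟨C, hC, hs⟩ := H.exists_stability k T
  have hunif : TendstoUniformlyOn x y atTop (Icc 0 T) := by
    rw [Metric.tendstoUniformlyOn_iff]
    intro ε hε
    have h1 := (tendsto_iff_norm_sub_tendsto_zero.mp hlim).const_mul C
    rw [mul_zero] at h1
    filter_upwards [h1.eventually (gt_mem_nhds hε)] with n hn t ht
    have h2 := hs hk.continuous le_rfl (hx n) hy' (fun s _ => hk.norm_sub_le _ _) t ht
    rw [hx0] at h2
    rw [dist_comm, dist_eq_norm]
    exact h2.trans_lt hn
  obtain ⟨N, hN⟩ := eventually_atTop.mp (Metric.tendstoUniformlyOn_iff.mp hunif 1 one_pos)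
  refine ⟨fun n => x (n + N), fun n => ⟨?_, z0 (n + N), ?_⟩, fun u hu =>
    (tendsto_add_atTop_nat N).eventually (hunif u hu)⟩
  · refine (hx (n + N)).congr (fun t ht => ?_) fun _ _ => rfl
    rw [retract_of_le hR1]
    have h1 := hN (n + N) (Nat.le_add_left N n) t ht
    rw [dist_comm, dist_eq_norm] at h1
    have := norm_sub_norm_le (x (n + N) t) (y t)
    linarith [hyR t ht]
  · have h1 := hyz (n + N)
    rwa [← hx0] at h1

end Regularity

/-! ### The concrete system -/

section Integrated

variable {E : Type*} [NormedAddCommGroup E] [InnerProductSpace ℝ E] [CompleteSpace E]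
variable {G : Submodule ℝ (E × E)} {Z : Type*} [NormedAddCommGroup Z] [NormedSpace ℝ Z]
  [CompleteSpace Z]

/-- If `A z = B y` for all `(y, z) ∈ G`, then along mild solutions the equation
`(A y)' = B y + A (F(y))` holds in integrated form. -/
theorem IsMild.map_sub_eq {F : E → E} (hF : Continuous F) {T : ℝ} {y : ℝ → E}
    (hy : IsMild G F T y) {A B : E →L[ℝ] Z} (hAB : ∀ x z, (x, z) ∈ G → A z = B x) {t : ℝ}
    (ht : t ∈ Icc 0 T) :
    A (y t) - A (y 0) = ∫ s in (0 : ℝ)..t, (B (y s) + A (F (y s))) := by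
  have i1 := intervalIntegrable_of_Icc hy.cont ht
  have i2 : IntervalIntegrable (fun s => F (y s)) volume 0 t :=
    intervalIntegrable_of_Icc (hF.comp_continuousOn hy.cont) ht
  have i3 : IntervalIntegrable (fun s => B (y s)) volume 0 t :=
    intervalIntegrable_of_Icc (B.continuous.comp_continuousOn hy.cont) ht
  have i4 : IntervalIntegrable (fun s => A (F (y s))) volume 0 t :=
    intervalIntegrable_of_Icc ((A.continuous.comp hF).comp_continuousOn hy.cont) ht
  have h1 := hAB _ _ (hy.mem t ht)
  rw [map_sub, map_sub, sub_eq_iff_eq_add] at h1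
  rw [h1, intervalIntegral.integral_add i3 i4, ContinuousLinearMap.intervalIntegral_comp_comm _ i1,
    ContinuousLinearMap.intervalIntegral_comp_comm _ i2]

theorem IsMild.hasDerivWithinAt {F : E → E} (hF : Continuous F) {T : ℝ} {y : ℝ → E}
    (hy : IsMild G F T y) {A B : E →L[ℝ] Z} (hAB : ∀ x z, (x, z) ∈ G → A z = B x)
    (hA : ∀ x, A (F x) = 0) {t : ℝ} (ht : t ∈ Icc 0 T) :
    HasDerivWithinAt (fun s => A (y s)) (B (y t)) (Icc 0 T) t := by
  obtain ⟨x, hx, hxy⟩ := exists_continuous_extension (ht.1.trans ht.2)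
    (f := fun s => B (y s)) (B.continuous.comp_continuousOn hy.cont)
  have h1 := ((hx.integral_hasStrictDerivAt 0 t).hasDerivAt.const_add
    (A (y 0))).hasDerivWithinAt (s := Icc 0 T)
  rw [← hxy t ht] at h1
  refine h1.congr_of_mem (fun s hs => ?_) ht
  have h2 := hy.map_sub_eq hF hAB hs
  simp only [hA, add_zero] at h2
  rw [sub_eq_iff_eq_add'] at h2
  rw [h2, integral_congr_Icc hxy hs]

end Integrated

/-- The functional `x ↦ ⟪x, w⟫`. -/
def innerRight {H : Type*} [NormedAddCommGroup H] [InnerProductSpace ℝ H] (w : H) : H →L[ℝ] ℝ :=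
  (bil (ContinuousLinearMap.id ℝ H) (ContinuousLinearMap.id ℝ H)).flip w

namespace System

variable {V L X K M : Type*}
    [NormedAddCommGroup V] [InnerProductSpace ℝ V] [NormedAddCommGroup L] [InnerProductSpace ℝ L]
    [NormedAddCommGroup X] [InnerProductSpace ℝ X] [NormedAddCommGroup K] [InnerProductSpace ℝ K]
    [NormedAddCommGroup M] [InnerProductSpace ℝ M] [CompleteSpace V] [CompleteSpace L]
    [CompleteSpace X] [CompleteSpace K] [CompleteSpace M] (S : System V L X K M)

/-- The generator is quasi-m-dissipative. -/
theorem exists_mDissipative {U μ : ℝ} (hU : 0 ≤ U) (hμ : 0 < μ) :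
    ∃ κ, MDissipative (S.energy μ (S.symWeight μ)) (min 1 μ / 2) κ (S.graph U μ) := by
  obtain ⟨κ, h0, h1, h2⟩ := S.exists_dissipative hU hμ
  exact ⟨κ, S.isInner_energy hμ, h0, h1, fun _ hl => S.fullRange_graph hU hμ hl h2,
    fun _ h => S.graph_zero h⟩

variable {S} {U μ T t : ℝ} {F : State V L K M → State V L K M} {y : ℝ → State V L K M}

theorem hasDeriv_val (hF : Continuous F) (hy : IsMild (S.graph U μ) F T y)
    (h0 : ∀ x, phiL V L K M (F x) = 0) (ht : t ∈ Icc 0 T) :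
    HasDerivWithinAt (fun s => S.val (phiL V L K M (y s)))
      (psiL V L K M (y t) - U • S.dx 0 (phiL V L K M (y t))) (Icc 0 T) t :=
  hy.hasDerivWithinAt hF (A := S.val.comp (phiL V L K M))
    (B := psiL V L K M - U • (S.dx 0).comp (phiL V L K M)) (fun _ _ h => h.eq_phi)
    (fun x => by rw [ContinuousLinearMap.comp_apply, h0, map_zero]) ht

theorem hasDeriv_pos (hF : Continuous F) (hy : IsMild (S.graph U μ) F T y)
    (h0 : ∀ x, uL V L K M (F x) = 0) (ht : t ∈ Icc 0 T) :
    HasDerivWithinAt (fun s => S.pos (uL V L K M (y s))) (vL V L K M (y t)) (Icc 0 T) t :=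
  hy.hasDerivWithinAt hF (A := S.pos.comp (uL V L K M)) (B := vL V L K M)
    (fun _ _ h => h.eq_u) (fun x => by rw [ContinuousLinearMap.comp_apply, h0, map_zero]) ht

theorem weak_flow (hF : Continuous F) (hy : IsMild (S.graph U μ) F T y) (w : V)
    (ht : t ∈ Icc 0 T) :
    inner ℝ (psiL V L K M (y t)) (S.val w) - inner ℝ (psiL V L K M (y 0)) (S.val w)
      = ∫ s in (0 : ℝ)..t, (U * inner ℝ (psiL V L K M (y s)) (S.dx 0 w)
        - S.form μ (phiL V L K M (y s)) w
        - inner ℝ (S.e (vL V L K M (y s) + U • S.ux (uL V L K M (y s)))) (S.tr w)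
        + inner ℝ (psiL V L K M (F (y s))) (S.val w)) := by
  let A : State V L K M →L[ℝ] ℝ := (innerRight (S.val w)).comp (psiL V L K M)
  let B : State V L K M →L[ℝ] ℝ := U • (innerRight (S.dx 0 w)).comp (psiL V L K M)
    - ((S.form μ).flip w).comp (phiL V L K M)
    - (innerRight (S.tr w)).comp (S.e.comp (vL V L K M + U • S.ux.comp (uL V L K M)))
  exact hy.map_sub_eq hF (A := A) (B := B) (fun _ _ h => (h.eq_psi w).symm) ht

theorem weak_plate (hF : Continuous F) (hy : IsMild (S.graph U μ) F T y)
    (h0 : ∀ x, phiL V L K M (F x) = 0) (w : K) (ht : t ∈ Icc 0 T) :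
    (inner ℝ (vL V L K M (y t)) (S.pos w) - inner ℝ (S.e (S.pos w)) (S.tr (phiL V L K M (y t))))
      - (inner ℝ (vL V L K M (y 0)) (S.pos w)
        - inner ℝ (S.e (S.pos w)) (S.tr (phiL V L K M (y 0))))
      = ∫ s in (0 : ℝ)..t, (-inner ℝ (S.lap (uL V L K M (y s))) (S.lap w)
        - U * inner ℝ (S.e (S.ux w)) (S.tr (phiL V L K M (y s)))
        + inner ℝ (vL V L K M (F (y s))) (S.pos w)) := by
  let A : State V L K M →L[ℝ] ℝ := (innerRight (S.pos w)).comp (vL V L K M)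
    - (bil (ContinuousLinearMap.id ℝ X) (ContinuousLinearMap.id ℝ X) (S.e (S.pos w))).comp (S.tr.comp (phiL V L K M))
  let B : State V L K M →L[ℝ] ℝ :=
    -(innerRight (S.lap w)).comp (S.lap.comp (uL V L K M))
    - U • (bil (ContinuousLinearMap.id ℝ X) (ContinuousLinearMap.id ℝ X) (S.e (S.ux w))).comp (S.tr.comp (phiL V L K M))
  have h1 := hy.map_sub_eq hF (A := A) (B := B) (fun x z h => by
    have := h.eq_v w
    change inner ℝ (vL V L K M z) (S.pos w) - inner ℝ (S.e (S.pos w)) (S.tr (phiL V L K M z))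
      = -inner ℝ (S.lap (uL V L K M x)) (S.lap w)
        - U * inner ℝ (S.e (S.ux w)) (S.tr (phiL V L K M x))
    linarith) ht
  have h2 : ∀ x, A (F x) = inner ℝ (vL V L K M (F x)) (S.pos w) := fun x => by
    change inner ℝ (vL V L K M (F x)) (S.pos w)
      - inner ℝ (S.e (S.pos w)) (S.tr (phiL V L K M (F x))) = _
    rw [h0, map_zero, inner_zero_right, sub_zero]
  simp only [h2] at h1
  exact h1

end System

section Concrete

variable {Ω : Set R2}

theorem hasWeakPartial_of_gen {i : Fin 2} {f g : L2 halfSpace} (h : (halfRep.flow i).Gen f g) :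
    HasWeakPartial halfSpace i.castSucc f g := by
  intro η hη
  have h1 := h.inner_skew (gen_d1 (testH1 hη.toUniv) i)
  rw [val1_test, d1_test, IsTest.inner_lp, IsTest.inner_lp] at h1
  linarith

theorem exists_H1 (f f₀ f₁ f' : L2 halfSpace) (h0 : (halfRep.flow 0).Gen f f₀)
    (h1 : (halfRep.flow 1).Gen f f₁)
    (h2 : ∀ w, traceL w = 0 → inner ℝ f (d1 2 w) = -inner ℝ f' (val1 w)) :
    ∃ W : H1 halfSpace, val1 W = f ∧ d1 0 W = f₀ ∧ d1 1 W = f₁ ∧ d1 2 W = f' := by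
  refine ⟨mkH1 f ![f₀, f₁, f'] fun i => ?_, rfl, rfl, rfl, rfl⟩
  fin_cases i
  · exact hasWeakPartial_of_gen h0
  · exact hasWeakPartial_of_gen h1
  · intro η hη
    have h3 := h2 (testH1 hη.toUniv) (traceL_test_half hη)
    rw [val1_test, d1_test, IsTest.inner_lp, IsTest.inner_lp] at h3
    exact h3

theorem norm_sq_half (φ : H1 halfSpace) : ‖φ‖ ^ 2 = ‖val1L halfSpace φ‖ ^ 2
    + ‖d1L halfSpace (Fin.castSucc 0) φ‖ ^ 2 + ‖d1L halfSpace (Fin.castSucc 1) φ‖ ^ 2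
    + ‖d1L halfSpace 2 φ‖ ^ 2 := by
  have key : ∀ (a : ℝ) (f : Fin 3 → ℝ), a + ∑ i, f i = a + f 0 + f 1 + f 2 := fun a f => by
    rw [Fin.sum_univ_three]
    ring
  exact (norm_sq_H1 φ).trans (key (‖val1 φ‖ ^ 2) fun i => ‖d1 i φ‖ ^ 2)

theorem formA_eq (μ : ℝ) (φ w : H1 halfSpace) : formA μ φ w =
    inner ℝ (d1L halfSpace (Fin.castSucc 0) φ) (d1L halfSpace (Fin.castSucc 0) w)
    + inner ℝ (d1L halfSpace (Fin.castSucc 1) φ) (d1L halfSpace (Fin.castSucc 1) w)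
    + inner ℝ (d1L halfSpace 2 φ) (d1L halfSpace 2 w)
    + μ * inner ℝ (val1L halfSpace φ) (val1L halfSpace w) := by
  have key : ∀ (a : ℝ) (f : Fin 3 → ℝ), (∑ i, f i) + a = f 0 + f 1 + f 2 + a := fun a f => by
    rw [Fin.sum_univ_three]
  exact key (μ * inner ℝ (val1 φ) (val1 w)) fun i => inner ℝ (d1 i φ) (d1 i w)

/-- The flow–plate interaction. -/
def flowSystem (hΩ : IsOpen Ω) :
    System (H1 halfSpace) (L2 halfSpace) (Lp ℝ 2 (volume : Measure R2)) (H20 Ω) (L2 Ω) where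
  ρV := solRep
  ρL := halfRep
  ρX := bdRep
  val := val1L halfSpace
  dx i := d1L halfSpace i.castSucc
  dz := d1L halfSpace 2
  tr := traceL
  e := ext Ω
  pos := val2L Ω
  ux := d2L Ω 0
  uxx i := ddL Ω i 0
  lap := lapL Ω
  int_val := intertwines_val1
  int_dx i := intertwines_d1 i.castSucc
  int_dz := intertwines_d1 2
  int_tr := intertwines_traceL
  norm_sq φ := norm_sq_half φ
  val_inj _ h := H1_ext_of_val isOpen_halfSpace h
  val_dense _ h := eq_zero_of_inner_val1 h
  gen_dx φ i := gen_d1 φ i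
  green φ w := green_H1 φ w
  tr_dense _ h := eq_zero_of_inner_traceL h
  exists_mk f f₀ f₁ f' h0 h1 h2 := exists_H1 f f₀ f₁ f' h0 h1 h2
  norm_sq_plate u := norm_sq_H20_le hΩ.measurableSet u
  norm_sq_ux u := norm_sq_d2_le hΩ.measurableSet u
  pos_inj _ h := val2_injective hΩ.measurableSet h
  pos_dense _ h := eq_zero_of_inner_val2 hΩ h
  gen_pos u := gen_val2 u 0
  gen_ux u i := gen_d2 u i 0

theorem form_flowSystem (hΩ : IsOpen Ω) (μ : ℝ) (φ w : H1 halfSpace) :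
    (flowSystem hΩ).form μ φ w = formA μ φ w :=
  (formA_eq μ φ w).symm

theorem isGenerator_iff (hΩ : IsOpen Ω) {U μ : ℝ} {φ h : H1 halfSpace} {ψ p : L2 halfSpace}
    {u q : H20 Ω} {v r : L2 Ω} : (flowSystem hΩ).IsGenerator U μ φ ψ u v h p q r ↔
      val1 h = ψ - U • d1 0 φ ∧
      (∀ w : H1 halfSpace, U * inner ℝ ψ (d1 0 w) - formA μ φ w
        - inner ℝ (ext Ω (v + U • d2 0 u)) (traceL w) = inner ℝ p (val1 w)) ∧
      val2 q = v ∧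
      ∀ w : H20 Ω, -inner ℝ (lapL Ω u) (lapL Ω w) - U * inner ℝ (ext Ω (d2 0 w)) (traceL φ)
        + inner ℝ (ext Ω (val2 w)) (traceL h) = inner ℝ r (val2 w) := by
  simp only [← form_flowSystem hΩ]
  exact ⟨fun H => ⟨H.eq_phi, H.eq_psi, H.eq_u, H.eq_v⟩, fun H => ⟨H.1, H.2.1, H.2.2.1, H.2.2.2⟩⟩

theorem sub_formA_neumann {μ : ℝ} (hμ : 0 < μ) (φ w : H1 halfSpace) (v : L2 Ω) (a : ℝ) :
    a - formA μ (φ + neumann μ v) w = a - formA μ φ w - inner ℝ (ext Ω v) (traceL w) := by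
  have h1 := formA_add_left μ φ (neumann μ v) w
  have h2 := formA_neumann hμ v w
  linarith

theorem plate_pairing (U : ℝ) (u w : H20 Ω) (φ h : H1 halfSpace) : -inner ℝ (lap u) (lap w)
      + (-U * bdryPair (d2 0 w) (trace φ) + bdryPair (val2 w) (trace h))
    = -inner ℝ (lapL Ω u) (lapL Ω w) - U * inner ℝ (ext Ω (d2 0 w)) (traceL φ)
      + inner ℝ (ext Ω (val2 w)) (traceL h) := by
  have key : ∀ a a' b b' c c' : ℝ, a = a' → b = b' → c = c' →
      -a + (-U * b + c) = -a' - U * b' + c' := by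
    rintro a _ b _ c _ rfl rfl rfl
    ring
  have hb : ∀ (f : L2 Ω) (φ : H1 halfSpace), bdryPair f (trace φ) = inner ℝ (ext Ω f) (traceL φ) :=
    fun f φ => by rw [trace_eq, bdryPair_eq]
  exact key _ _ _ _ _ _ (congrArg₂ (inner ℝ) (lapL_apply u).symm (lapL_apply w).symm)
    (hb _ _) (hb _ _)

theorem isGen_iff_isGenerator (hΩ : IsOpen Ω) {U μ : ℝ} (hμ : 0 < μ) {y z : Y Ω} :
    IsGen U μ y z ↔
      (flowSystem hΩ).IsGenerator U μ y.phi y.psi y.u y.v z.phi z.psi z.u z.v := by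
  refine Iff.trans ?_ (isGenerator_iff hΩ).symm
  constructor
  · intro H
    exact ⟨H.eq_phi, fun w => (sub_formA_neumann hμ _ _ _ _).symm.trans (H.eq_psi w), H.eq_u,
      fun w => (plate_pairing _ _ _ _ _).symm.trans (H.eq_v w)⟩
  · rintro ⟨h1, h2, h3, h4⟩
    exact ⟨h1, fun w => (sub_formA_neumann hμ _ _ _ _).trans (h2 w), h3,
      fun w => (plate_pairing _ _ _ _ _).trans (h4 w)⟩

theorem isGen_iff (hΩ : IsOpen Ω) {U μ : ℝ} (hμ : 0 < μ) {y z : Y Ω} :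
    IsGen U μ y z ↔ (y, z) ∈ (flowSystem hΩ).graph U μ :=
  isGen_iff_isGenerator hΩ hμ

end Concrete

/-! ### Solutions of the concrete system -/

namespace System

variable {V L K M : Type*}
    [NormedAddCommGroup V] [InnerProductSpace ℝ V] [NormedAddCommGroup L] [InnerProductSpace ℝ L]
    [NormedAddCommGroup K] [InnerProductSpace ℝ K] [NormedAddCommGroup M] [InnerProductSpace ℝ M]
    [CompleteSpace V] [CompleteSpace L] [CompleteSpace K] [CompleteSpace M]

theorem norm_phiL_le (y : State V L K M) : ‖phiL V L K M y‖ ≤ ‖y‖ := by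
  refine (abs_le_of_sq_le_sq' ?_ (norm_nonneg y)).2
  rw [norm_sq_state y]
  nlinarith [sq_nonneg ‖psiL V L K M y‖, sq_nonneg ‖uL V L K M y‖, sq_nonneg ‖vL V L K M y‖]

theorem norm_uL_le (y : State V L K M) : ‖uL V L K M y‖ ≤ ‖y‖ := by
  refine (abs_le_of_sq_le_sq' ?_ (norm_nonneg y)).2
  rw [norm_sq_state y]
  nlinarith [sq_nonneg ‖psiL V L K M y‖, sq_nonneg ‖phiL V L K M y‖, sq_nonneg ‖vL V L K M y‖]

theorem locLip_state {f : V → L} {g : K → M} (hf : LocLip f) (hg : LocLip g) :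
    LocLip fun y : State V L K M => (WithLp.toLp 2
      (WithLp.toLp 2 (0, f (phiL V L K M y)), WithLp.toLp 2 (0, g (uL V L K M y))) :
        State V L K M) := by
  intro R hR
  obtain ⟨k, hk, hk'⟩ := hf R hR
  obtain ⟨j, hj, hj'⟩ := hg R hR
  refine ⟨k + j, by positivity, fun a b ha hb => ?_⟩
  have h1 := hk' _ _ ((norm_phiL_le a).trans ha) ((norm_phiL_le b).trans hb)
  have h2 := hj' _ _ ((norm_uL_le a).trans ha) ((norm_uL_le b).trans hb)
  have h3 := norm_phiL_le (a - b)
  have h4 := norm_uL_le (a - b)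
  rw [map_sub] at h3 h4
  refine (abs_le_of_sq_le_sq' ?_ (by positivity)).2
  rw [norm_sq_state]
  simp only [map_sub]
  change ‖(0 : V) - 0‖ ^ 2 + ‖f (phiL V L K M a) - f (phiL V L K M b)‖ ^ 2 + ‖(0 : K) - 0‖ ^ 2
    + ‖g (uL V L K M a) - g (uL V L K M b)‖ ^ 2 ≤ _
  rw [sub_self, sub_self, norm_zero, norm_zero]
  have h6 := h1.trans (mul_le_mul_of_nonneg_left h3 hk.le)
  have h7 := h2.trans (mul_le_mul_of_nonneg_left h4 hj.le)
  have h8 := norm_nonneg (f (phiL V L K M a) - f (phiL V L K M b))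
  have h9 := norm_nonneg (g (uL V L K M a) - g (uL V L K M b))
  nlinarith

end System

section Solutions

variable {Ω : Set R2} {U μ T : ℝ} {F₁ : H1 halfSpace → L2 halfSpace} {F₂ : H20 Ω → L2 Ω}
  {y : ℝ → Y Ω}

theorem locLip_nonlin (h₁ : LocLip F₁) (h₂ : LocLip F₂) : LocLip (nonlin F₁ F₂) :=
  System.locLip_state h₁ h₂

theorem finiteEnergy_of_isMild (hΩ : IsOpen Ω) (hF : Continuous (nonlin F₁ F₂))
    (h : IsMild ((flowSystem hΩ).graph U μ) (nonlin F₁ F₂) T y) : FiniteEnergy U T y :=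
  ⟨h.cont, fun _ ht => System.hasDeriv_val hF h (fun _ => rfl) ht,
    fun _ ht => System.hasDeriv_pos hF h (fun _ => rfl) ht⟩

theorem isWeakSolution_of_isMild (hΩ : IsOpen Ω) (hF : Continuous (nonlin F₁ F₂))
    (h : IsMild ((flowSystem hΩ).graph U μ) (nonlin F₁ F₂) T y) :
    IsWeakSolution U μ F₁ F₂ T y := by
  have hb : ∀ (f : L2 Ω) (φ : H1 halfSpace), bdryPair f (trace φ) = inner ℝ (ext Ω f) (traceL φ) :=
    fun f φ => by rw [trace_eq, bdryPair_eq]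
  refine ⟨finiteEnergy_of_isMild hΩ hF h, fun w t ht => ?_, fun w t ht => ?_⟩
  · refine (System.weak_flow hF h w ht).trans (intervalIntegral.integral_congr fun s _ => ?_)
    have key : ∀ a b b' c c' d : ℝ, b = b' → c = c' → a - b - c + d = a - b' - c' + d := by
      rintro a b _ c _ d rfl rfl
      rfl
    exact key _ _ _ _ _ _ (form_flowSystem hΩ μ _ w) (hb _ _).symm
  · have e1 : ∀ s, inner ℝ (y s).v (val2 w) - bdryPair (val2 w) (trace (y s).phi)
        = inner ℝ (y s).v (val2 w) - inner ℝ (ext Ω (val2 w)) (traceL (y s).phi) :=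
      fun s => by rw [hb]
    rw [e1, e1]
    refine (System.weak_plate hF h (fun _ => rfl) w ht).trans
      (intervalIntegral.integral_congr fun s _ => ?_)
    have key : ∀ a a' b b' d : ℝ, a = a' → b = b' → -a - U * b + d = -a' - U * b' + d := by
      rintro a _ b _ d rfl rfl
      rfl
    exact key _ _ _ _ _ (congrArg₂ (inner ℝ) (lapL_apply _) (lapL_apply w)) (hb _ _).symm

variable {m : Y Ω →L[ℝ] Y Ω →L[ℝ] ℝ} {c κ : ℝ}

theorem isStrongSolution_of_isMild (hΩ : IsOpen Ω) (hμ : 0 < μ)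
    (H : MDissipative m c κ ((flowSystem hΩ).graph U μ)) (hF : LocLip (nonlin F₁ F₂))
    (hT : 0 ≤ T) (h : IsMild ((flowSystem hΩ).graph U μ) (nonlin F₁ F₂) T y)
    (h₀ : y 0 ∈ domGen U μ) : IsStrongSolution U μ F₁ F₂ T y := by
  obtain ⟨z₀, h₀⟩ := h₀
  obtain ⟨z, hz, hz'⟩ := H.exists_strong hF hT h ((isGen_iff hΩ hμ).mp h₀)
  exact ⟨finiteEnergy_of_isMild hΩ hF.continuous h, z,
    fun t ht => (isGen_iff hΩ hμ).mpr (hz t ht), hz'⟩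

theorem isMild_of_isStrongSolution (hΩ : IsOpen Ω) (hμ : 0 < μ)
    (H : MDissipative m c κ ((flowSystem hΩ).graph U μ)) (hF : LocLip (nonlin F₁ F₂))
    (hT : 0 < T) (h : IsStrongSolution U μ F₁ F₂ T y) :
    IsMild ((flowSystem hΩ).graph U μ) (nonlin F₁ F₂) T y := by
  obtain ⟨h1, z, hz, hz'⟩ := h
  exact H.isMild_of_strong hF.continuous hT h1.cont (fun t ht => (isGen_iff hΩ hμ).mp (hz t ht)) hz'

/-- Generalized solutions are the mild solutions. -/
theorem isGeneralizedSolution_iff (hΩ : IsOpen Ω) (hμ : 0 < μ)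
    (H : MDissipative m c κ ((flowSystem hΩ).graph U μ)) (hF : LocLip (nonlin F₁ F₂))
    (hT : 0 < T) : IsGeneralizedSolution U μ F₁ F₂ T y ↔
      IsMild ((flowSystem hΩ).graph U μ) (nonlin F₁ F₂) T y := by
  constructor
  · rintro ⟨-, x, hx, hlim⟩
    have hx' := fun n => isMild_of_isStrongSolution hΩ hμ H hF hT (hx n)
    exact H.isMild_of_tendsto hF (fun n => (hx' n).cont) (fun n => (hx' n).cont)
      (fun n => (hx' n).mem) hlim hlim
  · intro h
    obtain ⟨x, hx, hlim⟩ := H.exists_approx_mem hF hT.le h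
    exact ⟨finiteEnergy_of_isMild hΩ hF.continuous h, x, fun n =>
      isStrongSolution_of_isMild hΩ hμ H hF hT.le (hx n).1
        ((hx n).2.imp fun _ => (isGen_iff hΩ hμ).mpr), hlim⟩

end Solutions

end FlowPlate

end

theorem theorem3p8 (Ω : Set FlowPlate.R2) (hΩ : IsOpen Ω) (hΩb : Bornology.IsBounded Ω)
    (U μ : ℝ) (hU0 : 0 ≤ U) (hU1 : U ≠ 1) (hμ : 0 < μ)
    (F₁ : FlowPlate.H1 FlowPlate.halfSpace → FlowPlate.L2 FlowPlate.halfSpace)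
    (F₂ : FlowPlate.H20 Ω → FlowPlate.L2 Ω)
    (hF₁ : FlowPlate.LocLip F₁) (hF₂ : FlowPlate.LocLip F₂) (y₀ : FlowPlate.Y Ω) :
    ∃ (tmax : EReal) (y : ℝ → FlowPlate.Y Ω), 0 < tmax ∧ y 0 = y₀ ∧
      (∀ T : ℝ, 0 < T → (T : EReal) < tmax →
        FlowPlate.IsGeneralizedSolution U μ F₁ F₂ T y ∧
        FlowPlate.IsWeakSolution U μ F₁ F₂ T y) ∧
      (∀ (T : ℝ) (z : ℝ → FlowPlate.Y Ω), 0 < T →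
        FlowPlate.IsGeneralizedSolution U μ F₁ F₂ T z → z 0 = y₀ →
          (T : EReal) < tmax ∧ ∀ t ∈ Set.Icc 0 T, z t = y t) ∧
      (y₀ ∈ FlowPlate.domGen U μ → ∀ T : ℝ, 0 < T → (T : EReal) < tmax →
        FlowPlate.IsStrongSolution U μ F₁ F₂ T y) ∧
      (∀ τ : ℝ, tmax = τ →
        Filter.Tendsto (fun t => ‖y t‖) (nhdsWithin τ (Set.Iio τ)) Filter.atTop) := by
  have hF := FlowPlate.locLip_nonlin hF₁ hF₂
  obtain ⟨κ, H⟩ := (FlowPlate.flowSystem hΩ).exists_mDissipative hU0 hμ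
  obtain ⟨tmax, y, h0, hy0, hmild, huniq, hblow⟩ := H.exists_maximal hF y₀
  refine ⟨tmax, y, h0, hy0, fun T hT hlt => ?_, fun T z hT hz hz0 => ?_,
    fun hdom T hT hlt => ?_, hblow⟩
  · have h := hmild T hT hlt
    exact ⟨(FlowPlate.isGeneralizedSolution_iff hΩ hμ H hF hT).mpr h,
      FlowPlate.isWeakSolution_of_isMild hΩ hF.continuous h⟩
  · exact huniq T z hT ((FlowPlate.isGeneralizedSolution_iff hΩ hμ H hF hT).mp hz) hz0
  · exact FlowPlate.isStrongSolution_of_isMild hΩ hμ H hF hT.le (hmild T hT hlt)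
      (hy0.symm ▸ hdom)
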